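/- **Setting.** Let $(M,g,J)$ and $(\tilde M,\tilde g,\tilde J)$ be closed (compact, without boundary) Kähler–Einstein manifolds of real dimension $2n$ with the same scalar curvature, with Kähler forms $\omega=g(J\cdot,\cdot)$ and $\tilde\omega=\tilde g(\tilde J\cdot,\cdot)$. Let $f:M\to\tilde M$ be a diffeomorphism with $f^*\tilde\omega=\omega$. Put $G=g\oplus\tilde g$ and $\mathcal J(u,v)=(Ju,-\tilde Jv)$ on $M\times\tilde M$. Let $F_t:M\to M\times\tilde M$, $t\in[0,T)$, be a smooth family of immersions moving by mean curvature ($\partial_tF_t$ is the mean curvature vector of $F_t$) with $F_0(x)=(x,f(x))$, and let $\Sigma_t=F_t(M)$. Let $\Omega$ be the pull-back to $M\times\tilde M$ of the volume form $\omega^n/n!$ of $M$, and let $*\Omega=\Omega(e_1,\dots,e_{2n})$ for an oriented orthonormal basis $e_1,\dots,e_{2n}$ of the tangent space of $\Sigma_t$ (oriented by $M$ through $F_t$), regarded as a function of $(x,t)\in M\times[0,T)$. It is the Jacobian of the projection of $\Sigma_t$ to $M$. Let $\Delta$ be the Laplacian of the induced metric $F_t^*G$. For an index $1\le i\le 2n$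 put $i'=i+(-1)^{i+1}$; unrestricted sums run over $1,\dots,2n$. **Statement.** For every $t\in[0,T)$ the function $*\Omega$ is smooth on $M$. Let $x\in M$ be a point near which $\Sigma_t$ is locally a graph over $M$, i.e. $d(\pi_1\circ F_t)_x$ is invertible, where $\pi_1,\pi_2$ are the projections of $M\times\tilde M$ to its factors. Put $(p,\tilde p)=F_t(x)$ and $L=d(\pi_2\circ F_t)_x\circ d(\pi_1\circ F_t)_x^{-1}:T_pM\to T_{\tilde p}\tilde M$ (the differential at $p$ of the map whose graph is $\Sigma_t$ near $F_t(x)$). Then there are an orthonormal basis $a_1,\ a_2=Ja_1,\ \dots,\ a_{2n-1},\ a_{2n}=Ja_{2n-1}$ of $T_pM$ and numbers $\lambda_i>0$ with $L^*La_i=\lambda_i^2a_i$ and $\lambda_i\lambda_{i'}=1$. For every such basis and such numbers, let $\tilde a_i=\lambda_i^{-1}La_i$, let $$e_i=\frac{(a_i,La_i)}{\sqrt{1+\lambda_i^2}},\qquad h_{ijk}=G(\nabla^{M\times\tilde M}_{e_i}e_j,\mathcal Je_k)$$ (the coefficients of the second fundamental form of $\Sigma_t$), and let $R_{ikik}=R(a_i,a_k,a_i,a_k)$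 and $\tilde R_{ikik}=\tilde R(\tilde a_i,\tilde a_k,\tilde a_i,\tilde a_k)$ be curvature coefficients of $M$ and $\tilde M$, with the sign for which they are sectional curvatures when $i\ne k$. Then at $(x,t)$ $$\frac{d}{dt}{*\Omega}=\Delta{*\Omega}+{*\Omega}\Big\{Q(\lambda,h)+\sum_k\sum_{i\ne k}\frac{\lambda_i}{(1+\lambda_k^2)(\lambda_i+\lambda_{i'})}\big(R_{ikik}-\lambda_k^2\tilde R_{ikik}\big)\Big\},$$ where $$Q(\lambda,h)=\sum_{i,j,k}h_{ijk}^2-2\sum_k\sum_{i\text{ odd}}\big(h_{iik}h_{i'i'k}-h_{ii'k}^2\big)-2\sum_k\sum_{i<j,\ j\ne i'}(-1)^{i+j}\lambda_i\lambda_j\big(h_{i'ik}h_{j'jk}-h_{i'jk}h_{j'ik}\big).$$ Here $d/dt$ is the derivative at fixed $x$ (one-sided at $t=0$). If moreover $M$ and $\tilde M$ are both $\mathbb{CP}^n$ with the Fubini–Study metric, normalized to have holomorphic sectional curvature $1$, then at $(x,t)$ $$\frac{d}{dt}{*\Omega}=\Delta{*\Omega}+{*\Omega}\Big[Q(\lambda,h)+\sum_{k\text{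 odd}}\frac{(1-\lambda_k^2)^2}{(1+\lambda_k^2)^2}\Big].$$ -/

import Mathlib

open scoped Manifold ContDiff
open Set Bundle

noncomputable section

namespace GraphFlow

section Riemannian

/-! ### Riemannian geometry in charts

A manifold `M` is modelled on a finite-dimensional real space `E` through `I`. By Mathlib's
convention `TangentSpace I x` is `E`, identified through the preferred chart `extChartAt I x`, so a
tensor at `x` computed at the centre of that chart is already expressed in `TangentSpace I x`. -/

variable {E : Type*} [NormedAddCommGroup E] [NormedSpace ℝ E] [FiniteDimensional ℝ E]
  {H : Type*} [TopologicalSpace H] (I : ModelWithCorners ℝ E H)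
  {M : Type*} [TopologicalSpace M] [ChartedSpace H M]
  {E' : Type*} [NormedAddCommGroup E'] [NormedSpace ℝ E'] [FiniteDimensional ℝ E']
  {H' : Type*} [TopologicalSpace H'] (I' : ModelWithCorners ℝ E' H')
  {N : Type*} [TopologicalSpace N] [ChartedSpace H' N]

/-- A field of bilinear forms on the tangent spaces (the carrier of a metric tensor). -/
abbrev BilinField (M : Type*) [TopologicalSpace M] [ChartedSpace H M] : Type _ :=
  ∀ x : M, TangentSpace I x →L[ℝ] TangentSpace I x →L[ℝ] ℝ

/-- A field of endomorphisms of the tangent spaces. -/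
abbrev EndoField (M : Type*) [TopologicalSpace M] [ChartedSpace H M] : Type _ :=
  ∀ x : M, TangentSpace I x →L[ℝ] TangentSpace I x

/-- The coordinate expression `y ↦ g_y` of `g` in the chart at `x` (pull-back by the inverse
chart). -/
def chartMetric (g : BilinField I M) (x : M) (y : E) : E →L[ℝ] E →L[ℝ] ℝ :=
  let A : E →L[ℝ] E := mfderiv 𝓘(ℝ, E) I (extChartAt I x).symm y
  let B : E →L[ℝ] E →L[ℝ] ℝ := g ((extChartAt I x).symm y)
  B.bilinearComp A A

/-- The coordinate expression of a field of endomorphisms in the chart at `x`. -/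
def chartEndo (J : EndoField I M) (x : M) (y : E) : E →L[ℝ] E :=
  let A : E →L[ℝ] E := mfderiv 𝓘(ℝ, E) I (extChartAt I x).symm y
  let B : E →L[ℝ] E := J ((extChartAt I x).symm y)
  let D : E →L[ℝ] E := mfderiv I 𝓘(ℝ, E) (extChartAt I x) ((extChartAt I x).symm y)
  D ∘L B ∘L A

/-- The Christoffel symbol `Γ_y(u, v) = ∇_u v` (for constant `u`, `v`) of the Levi-Civita
connection of a metric `G` on an open subset of `E`, from the Koszul formula
`G(Γ(u, v), w) = (D_u G(v, w) + D_v G(u, w) - D_w G(u, v)) / 2`. The metric `G y` is read as a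
map `E → E*`, whose inverse raises the index. -/
def christoffel (G : E → E →L[ℝ] E →L[ℝ] ℝ) (y u v : E) : E :=
  (G y).inverse ((1 / 2 : ℝ) •
    (fderiv ℝ G y u v + fderiv ℝ G y v u - ((fderiv ℝ G y).flip u).flip v))

/-- The trace `∑ B^{ij} T(b_i, b_j)` of a bilinear map `T` with respect to an inner product `B`;
it equals `∑ T(e_i, e_i)` for every `B`-orthonormal basis `e`. -/
def metricTrace {W : Type*} [AddCommGroup W] [Module ℝ W]
    (B : E →L[ℝ] E →L[ℝ] ℝ) (T : E → E → W) : W :=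
  ∑ i, T (Module.finBasis ℝ E i)
    (B.inverse (LinearMap.toContinuousLinearMap ((Module.finBasis ℝ E).coord i)))

/-- The curvature `R(u, v) w = ∇_u ∇_v w - ∇_v ∇_u w - ∇_[u,v] w` at `x`. -/
def riemann (g : BilinField I M) (x : M) (u v w : TangentSpace I x) : TangentSpace I x :=
  let Γ : E → E → E → E := christoffel (chartMetric I g x)
  let y : E := extChartAt I x x
  let u : E := u
  let v : E := v
  let w : E := w
  let r : E := fderiv ℝ (fun z => Γ z v w) y u - fderiv ℝ (fun z => Γ z u w) y v
    + Γ y u (Γ y v w) - Γ y v (Γ y u w)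
  r

/-- The curvature tensor with the sign convention in which `R(a, b, a, b)` is the sectional
curvature of the plane spanned by orthonormal `a`, `b`. -/
def curvTensor (g : BilinField I M) (x : M) (a b c d : TangentSpace I x) : ℝ :=
  g x (riemann I g x a b d) c

/-- The Ricci curvature `Ric(u, v) = tr (w ↦ R(w, u) v)`. -/
def ricci (g : BilinField I M) (x : M) (u v : TangentSpace I x) : ℝ :=
  ∑ i, (Module.finBasis ℝ E).coord i (riemann I g x (Module.finBasis ℝ E i : E) u v)

/-- The scalar curvature. -/
def scal (g : BilinField I M) (x : M) : ℝ :=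
  metricTrace (E := E) (g x) (ricci I g x)

/-- `Ric = c g` for a constant `c`. -/
def IsEinstein (g : BilinField I M) : Prop :=
  ∃ c : ℝ, ∀ (x : M) (u v : TangentSpace I x), ricci I g x u v = c * g x u v

/-- `(g, J)` is a Kähler structure: `J` is a smooth almost complex structure, `g` is `J`-invariant,
and `J` is parallel for the Levi-Civita connection of `g`. -/
structure IsKahler [IsManifold I ∞ M] (g : BilinField I M) (J : EndoField I M) : Prop where
  smooth : ContMDiff I (I.prod 𝓘(ℝ, E →L[ℝ] E)) ∞
    (fun x : M => TotalSpace.mk' (E →L[ℝ] E)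
      (E := fun x : M => TangentSpace I x →L[ℝ] TangentSpace I x) x (J x))
  sq : ∀ (x : M) (v : TangentSpace I x), J x (J x v) = -v
  compat : ∀ (x : M) (u v : TangentSpace I x), g x (J x u) (J x v) = g x u v
  /-- `(∇_u J) v = D_u J v + Γ(u, J v) - J Γ(u, v) = 0` in the chart at `x`. -/
  parallel : ∀ (x : M) (u v : E),
    fderiv ℝ (fun z => chartEndo I J x z v) (extChartAt I x x) u
      + christoffel (chartMetric I g x) (extChartAt I x x) u
          (chartEndo I J x (extChartAt I x x) v)
      - chartEndo I J x (extChartAt I x x)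
          (christoffel (chartMetric I g x) (extChartAt I x x) u v) = 0

/-- The Laplace-Beltrami operator `Δ u = tr_g (D² u - Du ∘ Γ)`. -/
def laplacian (g : BilinField I M) (u : M → ℝ) (x : M) : ℝ :=
  let U : E → ℝ := u ∘ (extChartAt I x).symm
  let y : E := extChartAt I x x
  metricTrace (E := E) (g x) (fun v w =>
    fderiv ℝ (fun z => fderiv ℝ U z w) y v
      - fderiv ℝ U y (christoffel (chartMetric I g x) y v w))

/-- The metric `F^* G` induced on `M` by a map `F : M → N`. -/
def induced (G : BilinField I' N) (F : M → N) : BilinField I M := fun x =>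
  let A : E →L[ℝ] E' := mfderiv I I' F x
  let B : E' →L[ℝ] E' →L[ℝ] ℝ := G (F x)
  let r : E →L[ℝ] E →L[ℝ] ℝ := B.bilinearComp A A
  r

/-- The second fundamental form of an immersion `F : M → N` into `(N, G)`:
`∇dF(u, v) = D²F(u, v) + Γ^N(DF u, DF v) - DF(Γ^M(u, v))`, where `Γ^M` belongs to the induced
metric. It is the normal component of `∇^N_{dF u} dF v`. -/
def secondFund (G : BilinField I' N) (F : M → N) (x : M) (u v : TangentSpace I x) :
    TangentSpace I' (F x) :=
  let f : E → E' := writtenInExtChartAt I I' x F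
  let y : E := extChartAt I x x
  let u : E := u
  let v : E := v
  let r : E' := fderiv ℝ (fun z => fderiv ℝ f z v) y u
    + christoffel (chartMetric I' G (F x)) (extChartAt I' (F x) (F x))
        (fderiv ℝ f y u) (fderiv ℝ f y v)
    - fderiv ℝ f y (christoffel (chartMetric I (induced I I' G F) x) y u v)
  r

/-- The mean curvature vector, the trace of the second fundamental form. -/
def meanCurvature (G : BilinField I' N) (F : M → N) (x : M) : TangentSpace I' (F x) :=
  metricTrace (E := E) (induced I I' G F x) (secondFund I I' G F x)

/-- `F t`, `t ∈ [0, T)`, is a smooth family of immersions of `M` into `(N, G)` that moves by its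
mean curvature vector (at `t = 0` the time derivative is one-sided). -/
structure IsMeanCurvatureFlow (G : BilinField I' N) (T : ℝ) (F : ℝ → M → N) : Prop where
  smooth : ContMDiffOn (𝓘(ℝ, ℝ).prod I) I' ∞ (fun z : ℝ × M => F z.1 z.2) (Ico 0 T ×ˢ univ)
  immersion : ∀ t ∈ Ico 0 T, ∀ x, Function.Injective (mfderiv I I' (F t) x)
  velocity : ∀ t ∈ Ico 0 T, ∀ x,
    mfderivWithin 𝓘(ℝ, ℝ) I' (fun s => F s x) (Ico 0 T) t (1 : ℝ) = meanCurvature I I' G (F t) x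

/-- The product metric `g ⊕ g'` on `M × N`. -/
def prodMetric (g : BilinField I M) (g' : BilinField I' N) : BilinField (I.prod I') (M × N) :=
  fun q =>
    let B : E →L[ℝ] E →L[ℝ] ℝ := g q.1
    let B' : E' →L[ℝ] E' →L[ℝ] ℝ := g' q.2
    let r : E × E' →L[ℝ] E × E' →L[ℝ] ℝ :=
      B.bilinearComp (ContinuousLinearMap.fst ℝ E E') (ContinuousLinearMap.fst ℝ E E')
        + B'.bilinearComp (ContinuousLinearMap.snd ℝ E E') (ContinuousLinearMap.snd ℝ E E')
    r

/-- The almost complex structure `(u, v) ↦ (J u, -J' v)` on `M × N`. -/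
def prodJ (J : EndoField I M) (J' : EndoField I' N) : EndoField (I.prod I') (M × N) :=
  fun q =>
    let A : E →L[ℝ] E := J q.1
    let A' : E' →L[ℝ] E' := J' q.2
    let r : E × E' →L[ℝ] E × E' := A.prodMap (-A')
    r

end Riemannian

section Kahler

variable {n : ℕ}
  {M : Type*} [TopologicalSpace M] [ChartedSpace (EuclideanSpace ℝ (Fin (2 * n))) M]
  {M' : Type*} [TopologicalSpace M'] [ChartedSpace (EuclideanSpace ℝ (Fin (2 * n))) M']

/-- Smooth Riemannian metrics on a manifold of real dimension `2n`. -/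
abbrev Metric (n : ℕ) (M : Type*) [TopologicalSpace M]
    [ChartedSpace (EuclideanSpace ℝ (Fin (2 * n))) M] [IsManifold (𝓡 (2 * n)) ∞ M] : Type _ :=
  ContMDiffRiemannianMetric (𝓡 (2 * n)) ∞ (EuclideanSpace ℝ (Fin (2 * n)))
    (fun x : M => TangentSpace (𝓡 (2 * n)) x)

/-- The volume form `ω^n / n!` of a Kähler manifold, `ω(u, v) = g(J u, v)`; it takes the value `1`
on every orthonormal basis of the form `(b_1, J b_1, …, b_n, J b_n)`. -/
def volForm (g : BilinField (𝓡 (2 * n)) M) (J : EndoField (𝓡 (2 * n)) M) (p : M)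
    (v : Fin (2 * n) → TangentSpace (𝓡 (2 * n)) p) : ℝ :=
  (1 / ((2 : ℝ) ^ n * (n.factorial : ℝ))) *
    ∑ σ : Equiv.Perm (Fin (2 * n)), ((Equiv.Perm.sign σ : ℤ) : ℝ) *
      ∏ k : Fin n, g p (J p (v (σ ⟨2 * k, by omega⟩))) (v (σ ⟨2 * k + 1, by omega⟩))

/-- `*Ω` for an immersion `F : M → M × M'`, where `Ω` is the pull-back of the volume form of `M`
under the first projection: the value of `Ω` on `dF(e_1), …, dF(e_{2n})`, for `e` an oriented basis
of `T_x M` that is orthonormal for the metric induced by `F`. It is written here in an arbitrary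
basis `b` of `T_x M`, as `± Ω(dF(b_1), …, dF(b_{2n})) / √(det (F^*G)(b_i, b_j))`, with the sign of
`b` in the orientation of `M` by its complex structure. -/
def starOmega (g : BilinField (𝓡 (2 * n)) M) (J : EndoField (𝓡 (2 * n)) M)
    (g' : BilinField (𝓡 (2 * n)) M') (F : M → M × M') (x : M) : ℝ :=
  let b : Fin (2 * n) → TangentSpace (𝓡 (2 * n)) x :=
    fun i => (EuclideanSpace.single i (1 : ℝ) : EuclideanSpace ℝ (Fin (2 * n)))
  Real.sign (volForm g J x b) *
    volForm g J (F x).1 (fun i => mfderiv (𝓡 (2 * n)) (𝓡 (2 * n)) (fun y => (F y).1) x (b i)) /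
    Real.sqrt (Matrix.det (Matrix.of fun i j =>
      induced (𝓡 (2 * n)) ((𝓡 (2 * n)).prod (𝓡 (2 * n)))
        (prodMetric (𝓡 (2 * n)) (𝓡 (2 * n)) g g') F x (b i) (b j)))

/-- The Laplacian of `*Ω` in the metric induced on `M` by `F : M → M × M'`. -/
def laplacianStarOmega (g : BilinField (𝓡 (2 * n)) M) (J : EndoField (𝓡 (2 * n)) M)
    (g' : BilinField (𝓡 (2 * n)) M') (F : M → M × M') (x : M) : ℝ :=
  laplacian (𝓡 (2 * n))
    (induced (𝓡 (2 * n)) ((𝓡 (2 * n)).prod (𝓡 (2 * n)))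
      (prodMetric (𝓡 (2 * n)) (𝓡 (2 * n)) g g') F)
    (starOmega g J g' F) x

/-- `F` is locally a graph over `M` near `x`: the first projection restricted to the image of `F`
is a local diffeomorphism there. -/
def IsGraphAt (F : M → M × M') (x : M) : Prop :=
  Function.Injective (mfderiv (𝓡 (2 * n)) (𝓡 (2 * n)) (fun y => (F y).1) x)

/-- For `F = (F₁, F₂)` with `IsGraphAt F x`, the inverse of `d(F₁)_x`. -/
def invProj (F : M → M × M') (x : M) :
    TangentSpace (𝓡 (2 * n)) (F x).1 →L[ℝ] TangentSpace (𝓡 (2 * n)) x :=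
  (mfderiv (𝓡 (2 * n)) (𝓡 (2 * n)) (fun y => (F y).1) x).inverse

/-- The differential at `p = F₁(x)` of the map `M → M'` whose graph is locally the image of `F`:
`d(F₂)_x ∘ (d(F₁)_x)⁻¹`. -/
def graphDeriv (F : M → M × M') (x : M) :
    TangentSpace (𝓡 (2 * n)) (F x).1 →L[ℝ] TangentSpace (𝓡 (2 * n)) (F x).2 :=
  (mfderiv (𝓡 (2 * n)) (𝓡 (2 * n)) (fun y => (F y).2) x) ∘L (invProj F x)

/-- The involution `i ↦ i'` exchanging `1 ↔ 2`, `3 ↔ 4`, …. Indices here start at `0`, so the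
odd indices of a numbering from `1` are the even ones here. -/
def partner (i : Fin (2 * n)) : Fin (2 * n) :=
  if h : Even (i : ℕ) then ⟨i + 1, by have := i.2; obtain ⟨k, hk⟩ := h; omega⟩
  else ⟨i - 1, by have := i.2; omega⟩

/-- `a` is an orthonormal basis `(a_1, a_2 = J a_1, …, a_{2n-1}, a_{2n} = J a_{2n-1})` of `T_p M`
consisting of singular vectors of `L : T_p M → T_q M'` with singular values `lam`
(`L^* L a_i = lam_i² a_i`), paired so that `lam_i lam_{i'} = 1`. -/
structure IsAdaptedFrame (g : BilinField (𝓡 (2 * n)) M) (J : EndoField (𝓡 (2 * n)) M)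
    (g' : BilinField (𝓡 (2 * n)) M') {p : M} {q : M'}
    (L : TangentSpace (𝓡 (2 * n)) p →L[ℝ] TangentSpace (𝓡 (2 * n)) q)
    (a : Fin (2 * n) → TangentSpace (𝓡 (2 * n)) p) (lam : Fin (2 * n) → ℝ) : Prop where
  orthonormal : ∀ i j, g p (a i) (a j) = if i = j then 1 else 0
  complex : ∀ i : Fin (2 * n), Even (i : ℕ) → J p (a i) = a (partner i)
  pos : ∀ i, 0 < lam i
  singular : ∀ i v, g' q (L (a i)) (L v) = lam i ^ 2 * g p (a i) v
  paired : ∀ i, lam i * lam (partner i) = 1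

/-- The basis `ã_i = L(a_i) / lam_i` of `T_q M'`, that is `E(a_i)` for the isometry
`E = L (L^* L)^{-1/2}`. -/
def imageFrame {p : M} {q : M'}
    (L : TangentSpace (𝓡 (2 * n)) p →L[ℝ] TangentSpace (𝓡 (2 * n)) q)
    (a : Fin (2 * n) → TangentSpace (𝓡 (2 * n)) p) (lam : Fin (2 * n) → ℝ)
    (i : Fin (2 * n)) : TangentSpace (𝓡 (2 * n)) q :=
  (lam i)⁻¹ • L (a i)

/-- The vectors of `T_x M` that `dF` maps to the orthonormal basis
`e_i = (a_i, L a_i) / √(1 + lam_i²)` of the tangent space of the image of `F`. -/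
def tangentFrame (F : M → M × M') (x : M)
    (a : Fin (2 * n) → TangentSpace (𝓡 (2 * n)) (F x).1) (lam : Fin (2 * n) → ℝ)
    (i : Fin (2 * n)) : TangentSpace (𝓡 (2 * n)) x :=
  (Real.sqrt (1 + lam i ^ 2))⁻¹ • invProj F x (a i)

/-- The coefficients `h_{ijk} = G(∇_{e_i} e_j, 𝒥 e_k)` of the second fundamental form in the basis
`e_i = (a_i, L a_i) / √(1 + lam_i²)`, where `𝒥(u, v) = (J u, -J' v)`. -/
def hCoeff (g : BilinField (𝓡 (2 * n)) M) (J : EndoField (𝓡 (2 * n)) M)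
    (g' : BilinField (𝓡 (2 * n)) M') (J' : EndoField (𝓡 (2 * n)) M')
    (F : M → M × M') (x : M)
    (a : Fin (2 * n) → TangentSpace (𝓡 (2 * n)) (F x).1) (lam : Fin (2 * n) → ℝ)
    (i j k : Fin (2 * n)) : ℝ :=
  let G := prodMetric (𝓡 (2 * n)) (𝓡 (2 * n)) g g'
  G (F x)
    (secondFund (𝓡 (2 * n)) ((𝓡 (2 * n)).prod (𝓡 (2 * n))) G F x
      (tangentFrame F x a lam i) (tangentFrame F x a lam j))
    (prodJ (𝓡 (2 * n)) (𝓡 (2 * n)) J J' (F x)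
      (mfderiv (𝓡 (2 * n)) ((𝓡 (2 * n)).prod (𝓡 (2 * n))) F x (tangentFrame F x a lam k)))

/-- The quadratic form `Q(λ, h)`. -/
def quadForm (lam : Fin (2 * n) → ℝ) (h : Fin (2 * n) → Fin (2 * n) → Fin (2 * n) → ℝ) : ℝ :=
  (∑ i, ∑ j, ∑ k, h i j k ^ 2)
    - 2 * ∑ k, ∑ i : Fin (2 * n) with Even i.val,
        (h i i k * h (partner i) (partner i) k - h i (partner i) k ^ 2)
    - 2 * ∑ k, ∑ i, ∑ j with i < j ∧ j ≠ partner i,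
        (-1) ^ ((i : ℕ) + (j : ℕ)) * lam i * lam j *
          (h (partner i) i k * h (partner j) j k - h (partner i) j k * h (partner j) i k)

/-- The curvature term
`∑_k ∑_{i ≠ k} λ_i / ((1 + λ_k²) (λ_i + λ_{i'})) (R_{ikik} - λ_k² R̃_{ikik})`. -/
def curvTerm (g : BilinField (𝓡 (2 * n)) M) (g' : BilinField (𝓡 (2 * n)) M') {p : M} {q : M'}
    (L : TangentSpace (𝓡 (2 * n)) p →L[ℝ] TangentSpace (𝓡 (2 * n)) q)
    (a : Fin (2 * n) → TangentSpace (𝓡 (2 * n)) p) (lam : Fin (2 * n) → ℝ) : ℝ :=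
  ∑ k, ∑ i with i ≠ k,
    lam i / ((1 + lam k ^ 2) * (lam i + lam (partner i))) *
      (curvTensor (𝓡 (2 * n)) g p (a i) (a k) (a i) (a k)
        - lam k ^ 2 * curvTensor (𝓡 (2 * n)) g' q
            (imageFrame L a lam i) (imageFrame L a lam k)
            (imageFrame L a lam i) (imageFrame L a lam k))

/-- `(M, g, J)` is `ℂℙⁿ` with the Fubini-Study metric of holomorphic sectional curvature `1`:
`M` is identified with the set of complex lines in `ℂ^{n+1}` in such a way that the projection
`z ↦ [z]` is smooth and holomorphic on `ℂ^{n+1} \ {0}` and pulls `g` back to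
`4 Re (|z|² ⟨v, u⟩ - ⟨v, z⟩ ⟨z, u⟩) / |z|⁴`. -/
def IsFubiniStudy (g : BilinField (𝓡 (2 * n)) M) (J : EndoField (𝓡 (2 * n)) M) : Prop :=
  ∃ (φ : Projectivization ℂ (EuclideanSpace ℂ (Fin (n + 1))) ≃ M)
    (pr : EuclideanSpace ℂ (Fin (n + 1)) → M),
    (∀ z (hz : z ≠ 0), pr z = φ (Projectivization.mk ℂ z hz)) ∧
    ContMDiffOn 𝓘(ℝ, EuclideanSpace ℂ (Fin (n + 1))) (𝓡 (2 * n)) ∞ pr {0}ᶜ ∧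
    ∀ z : EuclideanSpace ℂ (Fin (n + 1)), z ≠ 0 →
      ∀ u v : EuclideanSpace ℂ (Fin (n + 1)),
        mfderiv 𝓘(ℝ, EuclideanSpace ℂ (Fin (n + 1))) (𝓡 (2 * n)) pr z (Complex.I • u)
          = J (pr z) (mfderiv 𝓘(ℝ, EuclideanSpace ℂ (Fin (n + 1))) (𝓡 (2 * n)) pr z u) ∧
        g (pr z) (mfderiv 𝓘(ℝ, EuclideanSpace ℂ (Fin (n + 1))) (𝓡 (2 * n)) pr z u)
            (mfderiv 𝓘(ℝ, EuclideanSpace ℂ (Fin (n + 1))) (𝓡 (2 * n)) pr z v)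
          = 4 * ((‖z‖ : ℂ) ^ 2 * inner ℂ v u - inner ℂ v z * inner ℂ z u).re / ‖z‖ ^ 4

end Kahler

end GraphFlow

end

open GraphFlow

/-!
The idea. The graph of the symplectomorphism `f` is a Lagrangian submanifold of
`(M × M', g ⊕ g', 𝒥)`, which is Kähler–Einstein because both factors have the same Einstein constant
(`exists_common_einstein_constant`). Mean curvature flow in a Kähler–Einstein manifold preserves the
Lagrangian condition, so that `𝒥` maps the tangent spaces of `Σ_t` to its normal spaces at all
times, and the evolution of `*Ω` can be read off in a frame adapted to `𝒥`.

*Coordinates.* All computations take place in charts: a Riemannian metric is a field of bilinear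
forms on an open subset of a vector space, with connection `chr` and curvature `curv`, and an
immersion has a second fundamental form `sff`. To compute a Laplacian at a point, second derivatives
are taken along the curves `geo`, which have vanishing covariant acceleration at that point, and
orthonormal frames are moved along by parallel transport (`FrameLift`). The Codazzi equation,
in the form of `ImmInto.cov_meanCurv_normal`, trades the derivative of the mean curvature vector,
which enters the time derivative, for the trace of second derivatives of the immersion, which enters
the Laplacian; the difference is a curvature term.

*Lagrangian submanifolds stay Lagrangian.* Let `u` be the squared norm of the Kähler form pulled
back to `Σ_t`. Its evolution is `evolution_normSq`. The terms that are not second derivatives of `u` are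
at most a multiple of `u`, by the linear algebra of `reaction_le`. This uses that the Einstein
condition turns the trace of the curvature into a multiple of the metric, and that the restrictions
of the Kähler form to a half-dimensional subspace and to its orthogonal complement have the same
norm. At a spatial maximum the second derivatives are not positive, so `u` grows at most
exponentially there (`LocalFlow.deriv_normSq_le`), and the maximum principle `eq_zero_of_deriv_le`
on the compact manifold `M` gives `u = 0` (`IsMeanCurvatureFlow.lagrangian`).

*The evolution of `*Ω`.* Since `Ω` is parallel, only the tangent vectors are differentiated, and
`evolution_jac` expresses the time derivative minus the Laplacian of `*Ω` as a `reactionTerm`: the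
squared norm of the second fundamental form times `*Ω`, the values of `Ω` with two tangent vectors
replaced by second fundamental forms, and the values with one tangent vector replaced by the normal
part of a curvature trace.

*Adapted frames.* The differential `L` is symplectic (`graphMap_symplectic`), so that the complex
structure exchanges the eigenspaces of `L*L` for the eigenvalues `λ²` and `λ⁻²`
(`singular_complex`), and splitting off one eigenvector after another gives the unitary basis
(`exists_singular_vectors`, `exists_isAdaptedFrame`). In the frame `e_i` the normal vectors `𝒥 e_k`
have first components proportional to those of the partner tangent vectors `e_{k'}`, so that `Ω`
with two vectors replaced is a `2 × 2` minor of `h`. The coefficients `h_{ijk}` are totally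
symmetric (`ImmInto.sff_kahler_symm`), and reordering the sum of the minors gives `Q(λ, h)`
(`quadForm_eq`, `reactionTerm_adapted`, `evolution_adapted`).

*Fubini–Study metrics.* At the origin of affine coordinates the curvature follows from the explicit
Christoffel symbols `fubiniChr`; the sectional curvatures of a unitary basis are `1` on complex
lines and `1 / 4` otherwise (`IsFubiniStudy.curvTensor_frame`). The curvature term then collapses by
pairing each index with its partner (`sum_fubiniStudy`).
-/

open scoped Manifold ContDiff
open Set Bundle
open GraphFlow
noncomputable section

set_option maxSynthPendingDepth 3
set_option linter.unusedSectionVars false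

namespace GraphFlow

open Filter Topology

/-! ### Metrics and their connections on open subsets of a vector space -/

theorem two_le_infty : (2 : ℕ∞ω) ≤ ∞ :=
  WithTop.coe_le_coe.2 le_top

section Coordinates

variable {E : Type*} [NormedAddCommGroup E] [NormedSpace ℝ E] [FiniteDimensional ℝ E]
  {W : Type*} [NormedAddCommGroup W] [NormedSpace ℝ W]

/-- A positive definite symmetric bilinear form. -/
structure IsInner (B : E →L[ℝ] E →L[ℝ] ℝ) : Prop where
  symm : ∀ u v, B u v = B v u
  pos : ∀ v, v ≠ 0 → 0 < B v v

theorem IsInner.eq_zero {B : E →L[ℝ] E →L[ℝ] ℝ} (hB : IsInner B) {u : E}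
    (h : ∀ w, B u w = 0) : u = 0 := by
  by_contra hu
  exact (hB.pos u hu).ne' (h u)

theorem IsInner.ext {B : E →L[ℝ] E →L[ℝ] ℝ} (hB : IsInner B) {u v : E}
    (h : ∀ w, B u w = B v w) : u = v := by
  rw [← sub_eq_zero]
  exact hB.eq_zero fun w => by simp [h w]

theorem IsInner.isInvertible {B : E →L[ℝ] E →L[ℝ] ℝ} (hB : IsInner B) : B.IsInvertible := by
  have hinj : Function.Injective (B : E →ₗ[ℝ] (E →L[ℝ] ℝ)) := by
    intro u v h
    exact hB.ext fun w => by
      have := congrArg (fun L : E →L[ℝ] ℝ => L w) h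
      simpa using this
  have hdim : Module.finrank ℝ E = Module.finrank ℝ (E →L[ℝ] ℝ) := by
    rw [← (LinearMap.toContinuousLinearMap : (E →ₗ[ℝ] ℝ) ≃ₗ[ℝ] (E →L[ℝ] ℝ)).finrank_eq]
    exact (Subspace.dual_finrank_eq (K := ℝ) (V := E)).symm
  let e := LinearEquiv.ofInjectiveOfFinrankEq (B : E →ₗ[ℝ] (E →L[ℝ] ℝ)) hinj hdim
  refine ⟨e.toContinuousLinearEquiv, ?_⟩
  ext u v
  exact congrArg (fun L : E →L[ℝ] ℝ => L v) (LinearMap.congr_fun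
    (LinearEquiv.coe_ofInjectiveOfFinrankEq (B : E →ₗ[ℝ] (E →L[ℝ] ℝ)) hinj hdim) u)

theorem IsInner.apply_inverse {B : E →L[ℝ] E →L[ℝ] ℝ} (hB : IsInner B) (ξ : E →L[ℝ] ℝ) (w : E) :
    B (B.inverse ξ) w = ξ w := by
  rw [hB.isInvertible.self_apply_inverse]

/-- A smooth Riemannian metric on an open subset of a vector space. -/
structure MetricOn (G : E → E →L[ℝ] E →L[ℝ] ℝ) (V : Set E) : Prop where
  isOpen : IsOpen V
  smooth : ContDiffOn ℝ ∞ G V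
  inner : ∀ y ∈ V, IsInner (G y)

variable {G : E → E →L[ℝ] E →L[ℝ] ℝ} {V : Set E}

theorem MetricOn.mono (hG : MetricOn G V) {V' : Set E} (h : V' ⊆ V) (ho : IsOpen V') :
    MetricOn G V' :=
  ⟨ho, hG.smooth.mono h, fun y hy => hG.inner y (h hy)⟩

theorem MetricOn.contDiffAt (hG : MetricOn G V) {y : E} (hy : y ∈ V) : ContDiffAt ℝ ∞ G y :=
  hG.smooth.contDiffAt (hG.isOpen.mem_nhds hy)

theorem MetricOn.differentiableAt (hG : MetricOn G V) {y : E} (hy : y ∈ V) :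
    DifferentiableAt ℝ G y :=
  (hG.contDiffAt hy).differentiableAt (by simp)

theorem fderiv_apply₂ {F F' F'' : Type*} [NormedAddCommGroup F] [NormedSpace ℝ F]
    [NormedAddCommGroup F'] [NormedSpace ℝ F'] [NormedAddCommGroup F''] [NormedSpace ℝ F'']
    {G : E → F →L[ℝ] F' →L[ℝ] F''} {y : E} (hG : DifferentiableAt ℝ G y) (w : E) (u : F) (v : F') :
    fderiv ℝ (fun z => G z u v) y w = fderiv ℝ G y w u v := by
  have h := ((hG.hasFDerivAt.clm_apply (hasFDerivAt_const u y)).clm_apply (hasFDerivAt_const v y))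
  rw [h.fderiv]
  simp

theorem fderiv_apply₁ {F F' : Type*} [NormedAddCommGroup F] [NormedSpace ℝ F]
    [NormedAddCommGroup F'] [NormedSpace ℝ F']
    {G : E → F →L[ℝ] F'} {y : E} (hG : DifferentiableAt ℝ G y) (w : E) (u : F) :
    fderiv ℝ (fun z => G z u) y w = fderiv ℝ G y w u := by
  have h := (hG.hasFDerivAt.clm_apply (hasFDerivAt_const u y))
  rw [h.fderiv]
  simp

theorem MetricOn.fderiv_symm (hG : MetricOn G V) {y : E} (hy : y ∈ V) (w u v : E) :
    fderiv ℝ G y w u v = fderiv ℝ G y w v u := by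
  rw [← fderiv_apply₂ (hG.differentiableAt hy), ← fderiv_apply₂ (hG.differentiableAt hy)]
  have : (fun z => G z u v) =ᶠ[𝓝 y] fun z => G z v u := by
    filter_upwards [hG.isOpen.mem_nhds hy] with z hz using (hG.inner z hz).symm u v
  rw [this.fderiv_eq]

/-- Koszul's formula. -/
theorem MetricOn.koszul (hG : MetricOn G V) {y : E} (hy : y ∈ V) (u v w : E) :
    G y (christoffel G y u v) w =
      1 / 2 * (fderiv ℝ G y u v w + fderiv ℝ G y v u w - fderiv ℝ G y w u v) := by
  rw [christoffel, (hG.inner y hy).apply_inverse]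
  simp

/-- The Christoffel symbols as a field of continuous bilinear maps. -/
def chr (G : E → E →L[ℝ] E →L[ℝ] ℝ) (y : E) : E →L[ℝ] E →L[ℝ] E :=
  (ContinuousLinearMap.compL ℝ E (E →L[ℝ] ℝ) E (G y).inverse) ∘L
    ((1 / 2 : ℝ) • (fderiv ℝ G y + (fderiv ℝ G y).flip -
      (((ContinuousLinearMap.flipₗᵢ ℝ E E ℝ).toContinuousLinearEquiv :
        (E →L[ℝ] E →L[ℝ] ℝ) ≃L[ℝ] (E →L[ℝ] E →L[ℝ] ℝ)) :
          (E →L[ℝ] E →L[ℝ] ℝ) →L[ℝ] (E →L[ℝ] E →L[ℝ] ℝ)) ∘L (fderiv ℝ G y).flip))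

theorem chr_apply (y u v : E) : chr G y u v = christoffel G y u v := by
  simp [chr, christoffel]

theorem MetricOn.chr_symm (hG : MetricOn G V) {y : E} (hy : y ∈ V) (u v : E) :
    chr G y u v = chr G y v u := by
  rw [chr_apply, chr_apply]
  refine (hG.inner y hy).ext fun w => ?_
  rw [hG.koszul hy, hG.koszul hy, hG.fderiv_symm hy w u v]
  ring

/-- The Levi-Civita connection is compatible with the metric. -/
theorem MetricOn.compat (hG : MetricOn G V) {y : E} (hy : y ∈ V) (w u v : E) :
    fderiv ℝ G y w u v = G y (chr G y w u) v + G y u (chr G y w v) := by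
  rw [(hG.inner y hy).symm u, chr_apply, chr_apply, hG.koszul hy, hG.koszul hy,
    hG.fderiv_symm hy w v u, hG.fderiv_symm hy u w v, hG.fderiv_symm hy v w u]
  ring

/-- The Christoffel symbols are determined by symmetry and compatibility: any symmetric solution
`C` of `D_w G (u, v) = C(w, u, v) + C(w, v, u)` is the Koszul expression. -/
theorem MetricOn.chr_unique (hG : MetricOn G V) {y : E} (hy : y ∈ V) {C : E → E → E → ℝ}
    (hs : ∀ u v w, C u v w = C v u w)
    (hc : ∀ w u v, fderiv ℝ G y w u v = C w u v + C w v u) (u v w : E) :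
    G y (chr G y u v) w = C u v w := by
  rw [chr_apply, hG.koszul hy, hc, hc, hc, hs v w u, hs w u v, hs v u w]
  ring

theorem MetricOn.contDiffOn_chr (hG : MetricOn G V) : ContDiffOn ℝ ∞ (chr G) V := by
  rw [contDiffOn_clm_apply]
  intro u
  rw [contDiffOn_clm_apply]
  intro v
  simp only [chr_apply, christoffel]
  have hD : ContDiffOn ℝ ∞ (fderiv ℝ G) V := by
    have := hG.smooth.fderiv_of_isOpen (m := ∞) hG.isOpen (by simp)
    exact this
  refine ContDiffOn.clm_apply ?_ ?_
  · intro y hy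
    obtain ⟨e, he⟩ := (hG.inner y hy).isInvertible
    have h1 : ContDiffAt ℝ ∞ ContinuousLinearMap.inverse (G y) := by
      rw [← he]; exact contDiffAt_map_inverse e
    exact (h1.comp y (hG.contDiffAt hy)).contDiffWithinAt
  · refine ContDiffOn.const_smul (1 / 2 : ℝ) (ContDiffOn.sub (ContDiffOn.add ?_ ?_) ?_)
    · exact (hD.clm_apply contDiffOn_const).clm_apply contDiffOn_const
    · exact (hD.clm_apply contDiffOn_const).clm_apply contDiffOn_const
    · rw [contDiffOn_clm_apply]
      intro w
      simp only [ContinuousLinearMap.flip_apply]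
      exact ((hD.clm_apply contDiffOn_const).clm_apply contDiffOn_const).clm_apply contDiffOn_const

theorem MetricOn.chr_differentiableAt (hG : MetricOn G V) {y : E} (hy : y ∈ V) :
    DifferentiableAt ℝ (chr G) y :=
  (hG.contDiffOn_chr.contDiffAt (hG.isOpen.mem_nhds hy)).differentiableAt (by simp)

/-- The curvature `R(u, v) w` of a connection `Γ` on an open subset of a vector space. -/
def curv (Γ : W → W →L[ℝ] W →L[ℝ] W) (q u v w : W) : W :=
  fderiv ℝ Γ q u v w - fderiv ℝ Γ q v u w + Γ q u (Γ q v w) - Γ q v (Γ q u w)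

theorem curv_antisymm (Γ : W → W →L[ℝ] W →L[ℝ] W) (q u v w : W) :
    curv Γ q u v w = - curv Γ q v u w := by
  simp only [curv]; abel

/-- The curvature as a trilinear map. -/
def curvL (Γ : W → W →L[ℝ] W →L[ℝ] W) (q : W) : W →ₗ[ℝ] W →ₗ[ℝ] W →ₗ[ℝ] W :=
  LinearMap.mk₂ ℝ (fun u v =>
    { toFun := fun w => curv Γ q u v w
      map_add' := fun a b => by simp only [curv, map_add]; abel
      map_smul' := fun c a => by
        simp only [curv, map_smul, smul_add, smul_sub, RingHom.id_apply] })
    (fun a b c => by ext; simp only [curv, map_add, add_apply, LinearMap.coe_mk, AddHom.coe_mk,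
      LinearMap.add_apply]; abel)
    (fun c a b => by ext; simp [curv, smul_add, smul_sub])
    (fun a b c => by ext; simp only [curv, map_add, add_apply, LinearMap.coe_mk, AddHom.coe_mk,
      LinearMap.add_apply]; abel)
    (fun c a b => by ext; simp [curv, smul_add, smul_sub])

theorem curvL_apply (Γ : W → W →L[ℝ] W →L[ℝ] W) (q u v w : W) :
    curvL Γ q u v w = curv Γ q u v w := rfl

/-- The covariant Hessian `∇_u (df v)`, for constant `u` and `v`, of a map `f` into a space with
connection `Γ`. -/
def hess (Γ : W → W →L[ℝ] W →L[ℝ] W) (f : E → W) (z : E) : E →L[ℝ] E →L[ℝ] W :=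
  fderiv ℝ (fderiv ℝ f) z + (Γ (f z)).bilinearComp (fderiv ℝ f z) (fderiv ℝ f z)

theorem hess_apply (Γ : W → W →L[ℝ] W →L[ℝ] W) (f : E → W) (z u v : E) :
    hess Γ f z u v = fderiv ℝ (fderiv ℝ f) z u v + Γ (f z) (fderiv ℝ f z u) (fderiv ℝ f z v) := rfl

/-- The covariant derivative `∇_w (∇_u (df v))`, for constant `u`, `v`, `w`. -/
def third (Γ : W → W →L[ℝ] W →L[ℝ] W) (f : E → W) (z w u v : E) : W :=
  fderiv ℝ (hess Γ f) z w u v + Γ (f z) (fderiv ℝ f z w) (hess Γ f z u v)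

/-- The data of a smooth map `f : U → V` between open sets and a smooth torsion-free connection
`Γ` on `V`. -/
structure MapInto (Γ : W → W →L[ℝ] W →L[ℝ] W) (f : E → W) (U : Set E) (V : Set W) : Prop where
  openU : IsOpen U
  openV : IsOpen V
  smooth : ContDiffOn ℝ ∞ f U
  mapsTo : MapsTo f U V
  smoothΓ : ContDiffOn ℝ ∞ Γ V
  symmΓ : ∀ q ∈ V, ∀ u v, Γ q u v = Γ q v u

variable {Γ : W → W →L[ℝ] W →L[ℝ] W} {f : E → W} {U : Set E} {V' : Set W}

namespace MapInto

theorem contDiffAt (h : MapInto Γ f U V') {z : E} (hz : z ∈ U) : ContDiffAt ℝ ∞ f z :=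
  h.smooth.contDiffAt (h.openU.mem_nhds hz)

theorem differentiableAt (h : MapInto Γ f U V') {z : E} (hz : z ∈ U) : DifferentiableAt ℝ f z :=
  (h.contDiffAt hz).differentiableAt (by simp)

theorem contDiffOn_fderiv (h : MapInto Γ f U V') : ContDiffOn ℝ ∞ (fderiv ℝ f) U :=
  h.smooth.fderiv_of_isOpen h.openU (by simp)

theorem contDiffOn_fderiv₂ (h : MapInto Γ f U V') : ContDiffOn ℝ ∞ (fderiv ℝ (fderiv ℝ f)) U :=
  h.contDiffOn_fderiv.fderiv_of_isOpen h.openU (by simp)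

theorem differentiableAt_fderiv (h : MapInto Γ f U V') {z : E} (hz : z ∈ U) :
    DifferentiableAt ℝ (fderiv ℝ f) z :=
  (h.contDiffOn_fderiv.contDiffAt (h.openU.mem_nhds hz)).differentiableAt (by simp)

theorem differentiableAt_fderiv₂ (h : MapInto Γ f U V') {z : E} (hz : z ∈ U) :
    DifferentiableAt ℝ (fderiv ℝ (fderiv ℝ f)) z :=
  (h.contDiffOn_fderiv₂.contDiffAt (h.openU.mem_nhds hz)).differentiableAt (by simp)

theorem differentiableAt_conn (h : MapInto Γ f U V') {q : W} (hq : q ∈ V') :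
    DifferentiableAt ℝ Γ q :=
  (h.smoothΓ.contDiffAt (h.openV.mem_nhds hq)).differentiableAt (by simp)

theorem fderiv₂_symm (h : MapInto Γ f U V') {z : E} (hz : z ∈ U) (u v : E) :
    fderiv ℝ (fderiv ℝ f) z u v = fderiv ℝ (fderiv ℝ f) z v u :=
  ((h.contDiffAt hz).isSymmSndFDerivAt (by simp [two_le_infty])).eq u v

theorem hess_symm (h : MapInto Γ f U V') {z : E} (hz : z ∈ U) (u v : E) :
    hess Γ f z u v = hess Γ f z v u := by
  rw [hess_apply, hess_apply, h.fderiv₂_symm hz u v, h.symmΓ _ (h.mapsTo hz)]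

theorem contDiffOn_hess (h : MapInto Γ f U V') : ContDiffOn ℝ ∞ (hess Γ f) U := by
  rw [contDiffOn_clm_apply]
  intro u
  rw [contDiffOn_clm_apply]
  intro v
  simp only [hess_apply]
  refine ContDiffOn.add ((h.contDiffOn_fderiv₂.clm_apply contDiffOn_const).clm_apply
    contDiffOn_const) ?_
  exact ((h.smoothΓ.comp h.smooth h.mapsTo).clm_apply
    (h.contDiffOn_fderiv.clm_apply contDiffOn_const)).clm_apply
    (h.contDiffOn_fderiv.clm_apply contDiffOn_const)

theorem differentiableAt_hess (h : MapInto Γ f U V') {z : E} (hz : z ∈ U) :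
    DifferentiableAt ℝ (hess Γ f) z :=
  (h.contDiffOn_hess.contDiffAt (h.openU.mem_nhds hz)).differentiableAt (by simp)

theorem fderiv_hess (h : MapInto Γ f U V') {z : E} (hz : z ∈ U) (w u v : E) :
    fderiv ℝ (hess Γ f) z w u v = fderiv ℝ (fderiv ℝ (fderiv ℝ f)) z w u v
      + fderiv ℝ Γ (f z) (fderiv ℝ f z w) (fderiv ℝ f z u) (fderiv ℝ f z v)
      + Γ (f z) (fderiv ℝ (fderiv ℝ f) z w u) (fderiv ℝ f z v)
      + Γ (f z) (fderiv ℝ f z u) (fderiv ℝ (fderiv ℝ f) z w v) := by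
  rw [← fderiv_apply₂ (h.differentiableAt_hess hz)]
  simp only [hess_apply]
  have h1 := ((h.differentiableAt_fderiv₂ hz).hasFDerivAt.clm_apply
    (hasFDerivAt_const u z)).clm_apply (hasFDerivAt_const v z)
  have h2 := ((h.differentiableAt_conn (h.mapsTo hz)).hasFDerivAt.comp z
    (h.differentiableAt hz).hasFDerivAt)
  have h3 := (h.differentiableAt_fderiv hz).hasFDerivAt.clm_apply (hasFDerivAt_const u z)
  have h4 := (h.differentiableAt_fderiv hz).hasFDerivAt.clm_apply (hasFDerivAt_const v z)
  refine (congrArg (fun L : E →L[ℝ] W => L w)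
    (h1.add ((h2.clm_apply h3).clm_apply h4)).fderiv).trans ?_
  simp
  abel

/-- The Ricci identity: covariant derivatives along `f` commute up to curvature. -/
theorem third_sub_third (h : MapInto Γ f U V') {z : E} (hz : z ∈ U) (w u v : E) :
    third Γ f z w u v - third Γ f z u w v
      = curv Γ (f z) (fderiv ℝ f z w) (fderiv ℝ f z u) (fderiv ℝ f z v) := by
  have h3 : fderiv ℝ (fderiv ℝ (fderiv ℝ f)) z w u = fderiv ℝ (fderiv ℝ (fderiv ℝ f)) z u w :=
    ((h.contDiffOn_fderiv.contDiffAt (h.openU.mem_nhds hz)).isSymmSndFDerivAt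
      (by simp [two_le_infty])).eq w u
  simp only [third, h.fderiv_hess hz, hess_apply, curv, h3, h.fderiv₂_symm hz w u, map_add]
  abel

theorem third_symm (h : MapInto Γ f U V') {z : E} (hz : z ∈ U) (w u v : E) :
    third Γ f z w u v = third Γ f z w v u := by
  have : (fun y => hess Γ f y u v) =ᶠ[𝓝 z] fun y => hess Γ f y v u := by
    filter_upwards [h.openU.mem_nhds hz] with y hy using h.hess_symm hy u v
  simp only [third]
  rw [← fderiv_apply₂ (h.differentiableAt_hess hz), ← fderiv_apply₂ (h.differentiableAt_hess hz),
    this.fderiv_eq, h.hess_symm hz]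

end MapInto

end Coordinates

/-! ### Parallel forms, immersions and the second fundamental form -/

section Parallel

variable {E : Type*} [NormedAddCommGroup E] [NormedSpace ℝ E] [FiniteDimensional ℝ E]
  {W : Type*} [NormedAddCommGroup W] [NormedSpace ℝ W] [FiniteDimensional ℝ W]

/-- `B` is a smooth field of bilinear forms on `V`, parallel for the connection `Γ`. -/
structure ParallelOn (Γ : W → W →L[ℝ] W →L[ℝ] W) (B : W → W →L[ℝ] W →L[ℝ] ℝ) (V : Set W) :
    Prop where
  openV : IsOpen V
  smooth : ContDiffOn ℝ ∞ B V
  smoothΓ : ContDiffOn ℝ ∞ Γ V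
  parallel : ∀ q ∈ V, ∀ w u v, fderiv ℝ B q w u v = B q (Γ q w u) v + B q u (Γ q w v)

/-- The section `s` along the curve `c` has covariant derivative `s'` at `r`, and `c` has velocity
`c'` there; derivatives are taken within `S`. -/
def CovAt (Γ : W → W →L[ℝ] W →L[ℝ] W) (c s : ℝ → W) (S : Set ℝ) (r : ℝ) (c' s' : W) : Prop :=
  HasDerivWithinAt c c' S r ∧ HasDerivWithinAt s (s' - Γ (c r) c' (s r)) S r

variable {Γ : W → W →L[ℝ] W →L[ℝ] W} {B : W → W →L[ℝ] W →L[ℝ] ℝ} {V : Set W}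

theorem MetricOn.parallelOn {G : W → W →L[ℝ] W →L[ℝ] ℝ}
    (hG : MetricOn G V) : ParallelOn (chr G) G V :=
  ⟨hG.isOpen, hG.smooth, hG.contDiffOn_chr, fun _ hq w u v => hG.compat hq w u v⟩

theorem ParallelOn.differentiableAt (h : ParallelOn Γ B V) {q : W} (hq : q ∈ V) :
    DifferentiableAt ℝ B q :=
  (h.smooth.contDiffAt (h.openV.mem_nhds hq)).differentiableAt (by simp)

theorem ParallelOn.differentiableAt_conn (h : ParallelOn Γ B V) {q : W} (hq : q ∈ V) :
    DifferentiableAt ℝ Γ q :=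
  (h.smoothΓ.contDiffAt (h.openV.mem_nhds hq)).differentiableAt (by simp)

theorem ParallelOn.hasDerivWithinAt (h : ParallelOn Γ B V) {c s t : ℝ → W} {S : Set ℝ} {r : ℝ}
    {c' s' t' : W} (hc : c r ∈ V) (hs : CovAt Γ c s S r c' s') (ht : CovAt Γ c t S r c' t') :
    HasDerivWithinAt (fun r => B (c r) (s r) (t r)) (B (c r) s' (t r) + B (c r) (s r) t') S r := by
  have h1 := (((h.differentiableAt hc).hasFDerivAt.comp_hasDerivWithinAt r hs.1).clm_apply
    hs.2).clm_apply ht.2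
  refine h1.congr_deriv ?_
  simp only [Function.comp_apply, h.parallel _ hc, map_sub, add_apply, sub_apply]
  ring

/-- The curvature acts trivially on a parallel bilinear form. -/
theorem ParallelOn.curv_add (h : ParallelOn Γ B V) {q : W} (hq : q ∈ V) (u v a b : W) :
    B q (curv Γ q u v a) b + B q a (curv Γ q u v b) = 0 := by
  have key : ∀ u v : W, fderiv ℝ (fderiv ℝ (fun z => B z a b)) q u v =
      B q (Γ q u (Γ q v a)) b + B q (Γ q v a) (Γ q u b) + B q (fderiv ℝ Γ q u v a) b
      + (B q (Γ q u a) (Γ q v b) + B q a (Γ q u (Γ q v b)) + B q a (fderiv ℝ Γ q u v b)) := by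
    intro u v
    have hsm : ContDiffAt ℝ ∞ (fun z => B z a b) q :=
      ((h.smooth.contDiffAt (h.openV.mem_nhds hq)).clm_apply contDiffAt_const).clm_apply
        contDiffAt_const
    have hd : DifferentiableAt ℝ (fderiv ℝ (fun z => B z a b)) q :=
      (hsm.fderiv_right (m := 1) (by exact two_le_infty)).differentiableAt (by simp)
    rw [← fderiv_apply₁ hd]
    have he : (fun z => fderiv ℝ (fun z => B z a b) z v) =ᶠ[𝓝 q]
        fun z => B z (Γ z v a) b + B z a (Γ z v b) := by
      filter_upwards [h.openV.mem_nhds hq] with z hz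
      rw [fderiv_apply₂ (h.differentiableAt hz), h.parallel z hz]
    rw [he.fderiv_eq]
    have hB := (h.differentiableAt hq).hasFDerivAt
    have hΓ := (h.differentiableAt_conn hq).hasFDerivAt
    have h1 : ∀ x : W, HasFDerivAt (fun z => Γ z v x) _ q := fun x =>
      (hΓ.clm_apply (hasFDerivAt_const v q)).clm_apply (hasFDerivAt_const x q)
    have h2 := ((hB.clm_apply (h1 a)).clm_apply (hasFDerivAt_const b q)).add
      ((hB.clm_apply (hasFDerivAt_const a q)).clm_apply (h1 b))
    refine (congrArg (fun L : W →L[ℝ] ℝ => L u) h2.fderiv).trans ?_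
    simp only [ContinuousLinearMap.comp_zero, zero_add, add_apply,
      ContinuousLinearMap.coe_comp, Function.comp_apply, ContinuousLinearMap.flip_apply,
      h.parallel q hq]
    ring
  have hsm : ContDiffAt ℝ ∞ (fun z => B z a b) q :=
    ((h.smooth.contDiffAt (h.openV.mem_nhds hq)).clm_apply contDiffAt_const).clm_apply
      contDiffAt_const
  have hsymm := (hsm.isSymmSndFDerivAt (by simp [two_le_infty])).eq u v
  rw [key, key] at hsymm
  simp only [curv, map_add, map_sub, add_apply, sub_apply]
  linarith

/-- The first Bianchi identity. -/
theorem MetricOn.bianchi {G : W → W →L[ℝ] W →L[ℝ] ℝ} (hG : MetricOn G V)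
    {q : W} (hq : q ∈ V) (u v w : W) :
    curv (chr G) q u v w + curv (chr G) q v w u + curv (chr G) q w u v = 0 := by
  have hs : ∀ x a b : W, fderiv ℝ (chr G) q x a b = fderiv ℝ (chr G) q x b a := by
    intro x a b
    rw [← fderiv_apply₂ (hG.chr_differentiableAt hq), ← fderiv_apply₂ (hG.chr_differentiableAt hq)]
    have : (fun z => chr G z a b) =ᶠ[𝓝 q] fun z => chr G z b a := by
      filter_upwards [hG.isOpen.mem_nhds hq] with z hz using hG.chr_symm hz a b
    rw [this.fderiv_eq]
  simp only [curv]
  rw [hs u v w, hs v w u, hs w u v, hG.chr_symm hq v w, hG.chr_symm hq u w, hG.chr_symm hq u v]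
  abel

theorem MetricOn.curv_skew {G : W → W →L[ℝ] W →L[ℝ] ℝ} (hG : MetricOn G V)
    {q : W} (hq : q ∈ V) (u v a b : W) :
    G q (curv (chr G) q u v a) b = - G q (curv (chr G) q u v b) a := by
  have := hG.parallelOn.curv_add hq u v a b
  rw [(hG.inner q hq).symm a] at this
  linarith

/-- Pair symmetry of the curvature. -/
theorem MetricOn.curv_pair {G : W → W →L[ℝ] W →L[ℝ] ℝ} (hG : MetricOn G V)
    {q : W} (hq : q ∈ V) (u v a b : W) :
    G q (curv (chr G) q u v a) b = G q (curv (chr G) q a b u) v := by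
  have bi : ∀ x y z w : W, G q (curv (chr G) q x y z) w + G q (curv (chr G) q y z x) w
      + G q (curv (chr G) q z x y) w = 0 := by
    intro x y z w
    rw [← add_apply, ← map_add, ← add_apply, ← map_add, hG.bianchi hq]
    simp
  have sk := hG.curv_skew hq
  have an : ∀ x y z w : W, G q (curv (chr G) q x y z) w = - G q (curv (chr G) q y x z) w := by
    intro x y z w
    rw [curv_antisymm]; simp
  have e1 := bi u v a b
  have e2 := bi v a b u
  have e3 := bi a b u v
  have e4 := bi b u v a
  have a1 := sk v a b u
  have a2 := sk a b v u
  have a3 := sk b v a u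
  have a4 := sk a b u v
  have a5 := sk b u a v
  have a6 := sk u a b v
  have a7 := sk b u v a
  have a8 := sk u v b a
  have a9 := sk v b u a
  have b1 := an v b a u
  have b2 := an u a v b
  have b3 := an a u v b
  have b4 := an v b u a
  have b5 := sk a u v b
  have b6 := sk v b a u
  linarith

end Parallel

section Induced

variable {E : Type*} [NormedAddCommGroup E] [NormedSpace ℝ E] [FiniteDimensional ℝ E]
  {W : Type*} [NormedAddCommGroup W] [NormedSpace ℝ W] [FiniteDimensional ℝ W]
  {W' : Type*} [NormedAddCommGroup W'] [NormedSpace ℝ W'] [FiniteDimensional ℝ W']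

/-- The pull-back of the metric `G` by `f`. -/
def pull (G : W → W →L[ℝ] W →L[ℝ] ℝ) (f : E → W) (z : E) : E →L[ℝ] E →L[ℝ] ℝ :=
  (G (f z)).bilinearComp (fderiv ℝ f z) (fderiv ℝ f z)

theorem pull_apply (G : W → W →L[ℝ] W →L[ℝ] ℝ) (f : E → W) (z u v : E) :
    pull G f z u v = G (f z) (fderiv ℝ f z u) (fderiv ℝ f z v) := rfl

theorem hess_congr {Γ : W → W →L[ℝ] W →L[ℝ] W} {f f₁ : E → W} {z : E} (h : f =ᶠ[𝓝 z] f₁) :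
    hess Γ f z = hess Γ f₁ z := by
  simp only [hess, h.fderiv.fderiv_eq, h.fderiv_eq, h.eq_of_nhds]

theorem hess_comp (Γ : W' → W' →L[ℝ] W' →L[ℝ] W') {p : W → W'} {q : E → W} {z : E}
    (hp : ContDiffAt ℝ ∞ p (q z)) (hq : ContDiffAt ℝ ∞ q z) (u v : E) :
    hess Γ (p ∘ q) z u v = hess Γ p (q z) (fderiv ℝ q z u) (fderiv ℝ q z v)
      + fderiv ℝ p (q z) (fderiv ℝ (fderiv ℝ q) z u v) := by
  have hne : (1 : ℕ∞ω) ≠ 0 := by simp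
  have hp' : ∀ᶠ y in 𝓝 z, DifferentiableAt ℝ p (q y) := by
    have := (hp.of_le (m := 1) (le_trans (by norm_num) two_le_infty)).eventually (by simp)
    filter_upwards [hq.continuousAt.eventually this] with y hy using hy.differentiableAt hne
  have hq' : ∀ᶠ y in 𝓝 z, DifferentiableAt ℝ q y := by
    have := (hq.of_le (m := 1) (le_trans (by norm_num) two_le_infty)).eventually (by simp)
    filter_upwards [this] with y hy using hy.differentiableAt hne
  have he : fderiv ℝ (p ∘ q) =ᶠ[𝓝 z] fun y => (fderiv ℝ p (q y)) ∘L fderiv ℝ q y := by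
    filter_upwards [hp', hq'] with y h1 h2 using fderiv_comp y h1 h2
  have d1 : HasFDerivAt (fderiv ℝ p) (fderiv ℝ (fderiv ℝ p) (q z)) (q z) :=
    ((hp.fderiv_right (m := 1) (by exact two_le_infty)).differentiableAt hne).hasFDerivAt
  have d2 : HasFDerivAt (fderiv ℝ q) (fderiv ℝ (fderiv ℝ q) z) z :=
    ((hq.fderiv_right (m := 1) (by exact two_le_infty)).differentiableAt hne).hasFDerivAt
  have d3 := (d1.comp z hq'.self_of_nhds.hasFDerivAt).clm_comp d2
  rw [hess_apply, he.fderiv_eq, he.eq_of_nhds, hess_apply]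
  refine (congrArg (fun L : W' => L + _) (congrArg (fun L : E →L[ℝ] E →L[ℝ] W' => L u v)
    d3.fderiv)).trans ?_
  simp
  abel

variable {G : W → W →L[ℝ] W →L[ℝ] ℝ} {f : E → W} {U : Set E} {V : Set W}

/-- `f : U → V` is a smooth immersion into the Riemannian manifold `(V, G)`. -/
structure ImmInto (G : W → W →L[ℝ] W →L[ℝ] ℝ) (f : E → W) (U : Set E) (V : Set W) : Prop where
  metric : MetricOn G V
  openU : IsOpen U
  smooth : ContDiffOn ℝ ∞ f U
  mapsTo : MapsTo f U V
  injective : ∀ z ∈ U, Function.Injective (fderiv ℝ f z)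

namespace ImmInto

theorem mapInto (h : ImmInto G f U V) : MapInto (chr G) f U V :=
  ⟨h.openU, h.metric.isOpen, h.smooth, h.mapsTo, h.metric.contDiffOn_chr,
    fun _ hq u v => h.metric.chr_symm hq u v⟩

theorem metricOn_pull (h : ImmInto G f U V) : MetricOn (pull G f) U where
  isOpen := h.openU
  smooth := by
    rw [contDiffOn_clm_apply]
    intro u
    rw [contDiffOn_clm_apply]
    intro v
    simp only [pull_apply]
    exact ((h.metric.smooth.comp h.smooth h.mapsTo).clm_apply
      (h.mapInto.contDiffOn_fderiv.clm_apply contDiffOn_const)).clm_apply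
      (h.mapInto.contDiffOn_fderiv.clm_apply contDiffOn_const)
  inner z hz := by
    refine ⟨fun u v => (h.metric.inner _ (h.mapsTo hz)).symm _ _, fun v hv => ?_⟩
    refine (h.metric.inner _ (h.mapsTo hz)).pos _ fun h0 => hv ?_
    exact h.injective z hz (h0.trans (map_zero _).symm)

theorem fderiv_pull (h : ImmInto G f U V) {z : E} (hz : z ∈ U)
    (w u v : E) : fderiv ℝ (pull G f) z w u v =
      G (f z) (hess (chr G) f z w u) (fderiv ℝ f z v)
        + G (f z) (hess (chr G) f z w v) (fderiv ℝ f z u) := by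
  rw [← fderiv_apply₂ (h.metricOn_pull.differentiableAt hz)]
  have h3 := fun u : E =>
    (h.mapInto.differentiableAt_fderiv hz).hasFDerivAt.clm_apply (hasFDerivAt_const u z)
  have h2 := (h.metric.differentiableAt (h.mapsTo hz)).hasFDerivAt.comp z
    (h.mapInto.differentiableAt hz).hasFDerivAt
  refine (congrArg (fun L : E →L[ℝ] ℝ => L w) ((h2.clm_apply (h3 u)).clm_apply (h3 v)).fderiv).trans
    ?_
  simp only [hess_apply, (h.metric.inner _ (h.mapsTo hz)).symm _ (fderiv ℝ f z u)]
  simp [h.metric.compat (h.mapsTo hz),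
    (h.metric.inner _ (h.mapsTo hz)).symm (fderiv ℝ f z u)]
  ring

/-- The tangential part of the covariant Hessian is the connection of the induced metric. -/
theorem pull_chr (h : ImmInto G f U V) {z : E} (hz : z ∈ U) (u v w : E) :
    G (f z) (fderiv ℝ f z (chr (pull G f) z u v)) (fderiv ℝ f z w)
      = G (f z) (hess (chr G) f z u v) (fderiv ℝ f z w) :=
  h.metricOn_pull.chr_unique hz
    (C := fun u v w => G (f z) (hess (chr G) f z u v) (fderiv ℝ f z w))
    (fun u v w => by simp only [h.mapInto.hess_symm hz u v])
    (fun w u v => h.fderiv_pull hz w u v) u v w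

end ImmInto

/-- The second fundamental form of the immersion `f`. -/
def sff (G : W → W →L[ℝ] W →L[ℝ] ℝ) (f : E → W) (z : E) :
    E →L[ℝ] E →L[ℝ] W :=
  hess (chr G) f z - (ContinuousLinearMap.compL ℝ E E W (fderiv ℝ f z)) ∘L (chr (pull G f) z)

theorem sff_apply (z u v : E) :
    sff G f z u v = hess (chr G) f z u v - fderiv ℝ f z (chr (pull G f) z u v) := rfl

namespace ImmInto

theorem sff_normal (h : ImmInto G f U V) {z : E} (hz : z ∈ U) (u v w : E) :
    G (f z) (sff G f z u v) (fderiv ℝ f z w) = 0 := by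
  rw [sff_apply, map_sub, sub_apply, h.pull_chr hz, sub_self]

theorem sff_symm (h : ImmInto G f U V) {z : E} (hz : z ∈ U) (u v : E) :
    sff G f z u v = sff G f z v u := by
  rw [sff_apply, sff_apply, h.mapInto.hess_symm hz, h.metricOn_pull.chr_symm hz]

/-- The second fundamental form is the normal part of the covariant Hessian. -/
theorem eq_sff (h : ImmInto G f U V) {z : E} (hz : z ∈ U) {u v : E} {a : W} {x : E}
    (ha : ∀ w, G (f z) a (fderiv ℝ f z w) = 0)
    (hx : hess (chr G) f z u v = a + fderiv ℝ f z x) : a = sff G f z u v := by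
  have h1 : a - sff G f z u v = fderiv ℝ f z (chr (pull G f) z u v - x) := by
    rw [sff_apply, hx, map_sub]; abel
  have h2 : G (f z) (a - sff G f z u v) (a - sff G f z u v) = 0 := by
    have h3 : ∀ w, G (f z) (a - sff G f z u v) (fderiv ℝ f z w) = 0 := fun w => by
      rw [map_sub, sub_apply, ha, h.sff_normal hz, sub_zero]
    exact (congrArg _ h1).trans (h3 _)
  by_contra hne
  exact ((h.metric.inner _ (h.mapsTo hz)).pos _ (sub_ne_zero.2 hne)).ne' h2

end ImmInto

/-- A local isometry between open sets is affine for the Levi-Civita connections. -/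
theorem hess_isometry {G' : W' → W' →L[ℝ] W' →L[ℝ] ℝ} {θ : W → W'}
    {V' : Set W'} (h : ImmInto G' θ V V') (hG : ∀ q ∈ V, G q = pull G' θ q)
    {q : W} (hq : q ∈ V) (hs : Function.Surjective (fderiv ℝ θ q)) (u v : W) :
    hess (chr G') θ q u v = fderiv ℝ θ q (chr G q u v) := by
  have e : G =ᶠ[𝓝 q] pull G' θ := by
    filter_upwards [h.openU.mem_nhds hq] with y hy using hG y hy
  have hc : chr G q = chr (pull G' θ) q := by
    simp only [chr, e.fderiv_eq, e.eq_of_nhds]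
  have h0 : sff G' θ q u v = 0 := by
    refine (h.metric.inner _ (h.mapsTo hq)).eq_zero fun w => ?_
    obtain ⟨w, rfl⟩ := hs w
    exact h.sff_normal hq u v w
  rw [sff_apply, sub_eq_zero] at h0
  rw [h0, hc]

/-- Naturality of the curvature under local isometries. -/
theorem curv_isometry {G' : W' → W' →L[ℝ] W' →L[ℝ] ℝ} {θ : W → W'}
    {V' : Set W'} (hGV : MetricOn G V) (h : ImmInto G' θ V V') (hG : ∀ q ∈ V, G q = pull G' θ q)
    (hs : ∀ q ∈ V, Function.Surjective (fderiv ℝ θ q)) {q : W} (hq : q ∈ V) (u v w : W) :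
    curv (chr G') (θ q) (fderiv ℝ θ q u) (fderiv ℝ θ q v) (fderiv ℝ θ q w)
      = fderiv ℝ θ q (curv (chr G) q u v w) := by
  rw [← h.mapInto.third_sub_third hq]
  have key : ∀ u v w : W, third (chr G') θ q u v w = fderiv ℝ θ q
      (fderiv ℝ (chr G) q u v w + chr G q u (chr G q v w)) := by
    intro u v w
    have he : (fun y => hess (chr G') θ y v w) =ᶠ[𝓝 q] fun y => fderiv ℝ θ y (chr G y v w) := by
      filter_upwards [h.openU.mem_nhds hq] with y hy using hess_isometry h hG hy (hs y hy) v w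
    have h1 := (h.mapInto.differentiableAt_fderiv hq).hasFDerivAt.clm_apply
      (((hGV.chr_differentiableAt hq).hasFDerivAt.clm_apply (hasFDerivAt_const v q)).clm_apply
        (hasFDerivAt_const w q))
    rw [third, ← fderiv_apply₂ (h.mapInto.differentiableAt_hess hq), he.fderiv_eq,
      hess_isometry h hG hq (hs q hq), map_add, ← hess_isometry h hG hq (hs q hq) u, hess_apply]
    refine (congrArg (fun L : W' => L + _) (congrArg (fun L : W →L[ℝ] W' => L u)
      h1.fderiv)).trans ?_
    simp
    abel
  rw [key, key, ← map_sub]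
  congr 1
  simp only [curv]
  abel

end Induced

/-! ### Orthonormal bases and metric traces -/

section LinearAlgebra

variable {E : Type*} [NormedAddCommGroup E] [NormedSpace ℝ E] [FiniteDimensional ℝ E]
  {B : E →L[ℝ] E →L[ℝ] ℝ} {ι κ : Type*} [DecidableEq ι] [Fintype ι] [DecidableEq κ] [Fintype κ]

/-- The family `e` is orthonormal for the bilinear form `B`. -/
def Ortho (B : E →L[ℝ] E →L[ℝ] ℝ) (e : ι → E) : Prop :=
  ∀ i j, B (e i) (e j) = if i = j then 1 else 0

theorem Ortho.apply_sum {e : ι → E} (he : Ortho B e) (c : ι → ℝ) (j : ι) :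
    B (∑ i, c i • e i) (e j) = c j := by
  simp [map_sum, sum_apply, he _ _]

theorem Ortho.linearIndependent {e : ι → E} (he : Ortho B e) : LinearIndependent ℝ e := by
  rw [Fintype.linearIndependent_iff]
  intro c hc j
  rw [← he.apply_sum c j, hc]
  simp

theorem Ortho.basis_exists {e : ι → E} (he : Ortho B e)
    (hcard : Fintype.card ι = Module.finrank ℝ E) :
    ∃ b : Module.Basis ι ℝ E, ⇑b = e := by
  rcases isEmpty_or_nonempty ι with h | h
  · have h0 : Module.finrank ℝ E = 0 := by rw [← hcard]; simp
    have : Subsingleton E := Module.finrank_zero_iff.1 h0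
    exact ⟨Module.Basis.empty E, by ext i; exact isEmptyElim i⟩
  · exact ⟨basisOfLinearIndependentOfCardEqFinrank he.linearIndependent hcard, by simp⟩

theorem Ortho.expand {e : ι → E} (he : Ortho B e) (hcard : Fintype.card ι = Module.finrank ℝ E)
    (x : E) : x = ∑ i, B x (e i) • e i := by
  obtain ⟨b, hb⟩ := he.basis_exists hcard
  have h := b.sum_repr x
  rw [hb] at h
  have h2 : ∀ i, B x (e i) = b.repr x i := fun i => by
    conv_lhs => rw [← h]
    exact he.apply_sum _ i
  simp only [h2, h]

theorem Ortho.trace_eq {e : ι → E} (he : Ortho B e) (hcard : Fintype.card ι = Module.finrank ℝ E)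
    (L : E →ₗ[ℝ] E) : LinearMap.trace ℝ E L = ∑ i, B (L (e i)) (e i) := by
  obtain ⟨b, hb⟩ := he.basis_exists hcard
  rw [LinearMap.trace_eq_matrix_trace ℝ b, Matrix.trace]
  refine Finset.sum_congr rfl fun i _ => ?_
  rw [Matrix.diag_apply, LinearMap.toMatrix_apply, hb]
  have h := b.sum_repr (L (e i))
  rw [hb] at h
  conv_rhs => rw [← h]
  exact (he.apply_sum _ i).symm

theorem exists_unit_orthogonal (hB : IsInner B) (e : ι → E)
    (h : Fintype.card ι < Module.finrank ℝ E) : ∃ v, B v v = 1 ∧ ∀ i, B (e i) v = 0 := by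
  let L : E →ₗ[ℝ] (ι → ℝ) := LinearMap.pi fun i => (B (e i) : E →ₗ[ℝ] ℝ)
  have hk : L.ker ≠ ⊥ := by
    apply LinearMap.ker_ne_bot_of_finrank_lt
    simpa using h
  obtain ⟨v, hv, hv0⟩ := L.ker.exists_mem_ne_zero_of_ne_bot hk
  have hp := hB.pos v hv0
  refine ⟨(Real.sqrt (B v v))⁻¹ • v, ?_, fun i => ?_⟩
  · have hs := Real.mul_self_sqrt hp.le
    have : Real.sqrt (B v v) ≠ 0 := (Real.sqrt_pos.2 hp).ne'
    simp only [map_smul, smul_apply, smul_eq_mul]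
    field_simp
    rw [sq, hs]
  · have : L v i = 0 := by rw [LinearMap.mem_ker.1 hv]; rfl
    have h1 : B (e i) v = 0 := this
    rw [map_smul, h1, smul_zero]

/-- An orthonormal family extends by any number of vectors that the dimension permits. -/
theorem exists_ortho_extend (hB : IsInner B) (e : ι → E) (k : ℕ)
    (h : Fintype.card ι + k ≤ Module.finrank ℝ E) :
    ∃ ν : Fin k → E, Ortho B ν ∧ ∀ i j, B (e i) (ν j) = 0 := by
  induction k with
  | zero => exact ⟨Fin.elim0, fun i => i.elim0, fun _ j => j.elim0⟩
  | succ k ih =>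
    obtain ⟨ν, h1, h2⟩ := ih (by omega)
    obtain ⟨v, hv, hv'⟩ := exists_unit_orthogonal hB (Sum.elim e ν)
      (by simp only [Fintype.card_sum, Fintype.card_fin]; omega)
    refine ⟨Fin.snoc ν v, fun i j => ?_, fun i j => ?_⟩
    · have h3 : ∀ j, B (ν j) v = 0 := fun j => hv' (Sum.inr j)
      refine Fin.lastCases ?_ (fun i => ?_) i <;> refine Fin.lastCases ?_ (fun j => ?_) j
      · simp [hv]
      · have : ¬ (Fin.last k = j.castSucc) := (Fin.castSucc_lt_last j).ne'
        simp [this, hB.symm v, h3]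
      · simp [h3, (Fin.castSucc_lt_last i).ne]
      · simp [h1 i j]
    · refine Fin.lastCases ?_ (fun j => ?_) j
      · simpa using hv' (Sum.inl i)
      · simp [h2]

theorem exists_ortho (hB : IsInner B) {k : ℕ} (h : k = Module.finrank ℝ E) :
    ∃ e : Fin k → E, Ortho B e := by
  obtain ⟨e, he, -⟩ := exists_ortho_extend (ι := Fin 0) hB Fin.elim0 k (by simp [h])
  exact ⟨e, he⟩

theorem Ortho.sum_elim (hB : IsInner B) {e : ι → E} {ν : κ → E} (he : Ortho B e)
    (hν : Ortho B ν) (h : ∀ i j, B (e i) (ν j) = 0) : Ortho B (Sum.elim e ν) := by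
  rintro (i | i) (j | j)
  · simp [he i j]
  · simp [h]
  · simp [hB.symm, h]
  · simp [hν i j]

theorem metricTrace_eq_dual {W : Type*} [AddCommGroup W] [Module ℝ W] {T : E → E → W}
    (h1 : ∀ v, IsLinearMap ℝ fun u => T u v) (h2 : ∀ u, IsLinearMap ℝ (T u)) {e : ι → E}
    {ξ : ι → E →L[ℝ] ℝ} (hξ : ∀ x, x = ∑ i, ξ i x • e i) :
    metricTrace B T = ∑ i, T (e i) (B.inverse (ξ i)) := by
  have s1 : ∀ {s : ι → E} (v : E), T (∑ i, s i) v = ∑ i, T (s i) v := fun {s} v =>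
    map_sum (h1 v).mk' s _
  set b := Module.finBasis ℝ E
  have h3 : ∀ i, ξ i = ∑ j, ξ i (b j) • LinearMap.toContinuousLinearMap (b.coord j) := by
    intro i
    ext x
    conv_lhs => rw [← b.sum_repr x, map_sum]
    simp [sum_apply, mul_comm]
  unfold metricTrace
  calc _ = ∑ j, ∑ i, ξ i (b j) • T (e i)
        (B.inverse (LinearMap.toContinuousLinearMap (b.coord j))) := by
        refine Finset.sum_congr rfl fun j _ => ?_
        conv_lhs => rw [hξ (b j)]
        rw [s1]
        exact Finset.sum_congr rfl fun i _ => (h1 _).map_smul _ _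
    _ = ∑ i, T (e i) (B.inverse (ξ i)) := by
        rw [Finset.sum_comm]
        refine Finset.sum_congr rfl fun i _ => ?_
        conv_rhs => rw [h3 i, map_sum]
        rw [show T (e i) (∑ j, B.inverse (ξ i (b j) • LinearMap.toContinuousLinearMap (b.coord j)))
          = ∑ j, T (e i) (B.inverse (ξ i (b j) • LinearMap.toContinuousLinearMap (b.coord j)))
          from map_sum (h2 (e i)).mk' _ _]
        exact Finset.sum_congr rfl fun j _ => by rw [map_smul, (h2 _).map_smul]

theorem metricTrace_eq_sum {W : Type*} [AddCommGroup W] [Module ℝ W] (hB : IsInner B)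
    {T : E → E → W} (h1 : ∀ v, IsLinearMap ℝ fun u => T u v) (h2 : ∀ u, IsLinearMap ℝ (T u))
    {e : ι → E} (he : Ortho B e) (hcard : Fintype.card ι = Module.finrank ℝ E) :
    metricTrace B T = ∑ i, T (e i) (e i) := by
  rw [metricTrace_eq_dual h1 h2 (e := e) (ξ := fun i => B (e i))]
  · simp [hB.isInvertible.inverse_apply_self]
  · intro x
    conv_lhs => rw [he.expand hcard x]
    simp [hB.symm x]

/-- Positive definiteness is uniform near a positive definite form. -/
theorem IsInner.eventually_bound (hB : IsInner B) :
    ∃ c > 0, ∀ᶠ B' in 𝓝 B, ∀ v, c * ‖v‖ ^ 2 ≤ B' v v := by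
  obtain ⟨m, hm, h⟩ : ∃ m > 0, ∀ v, m * ‖v‖ ^ 2 ≤ B v v := by
    have hc : IsCompact (Metric.sphere (0 : E) 1) := isCompact_sphere 0 1
    rcases (Metric.sphere (0 : E) 1).eq_empty_or_nonempty with h0 | hne
    · refine ⟨1, one_pos, fun v => ?_⟩
      by_cases hv : v = 0
      · simp [hv]
      · exfalso
        have : ‖v‖⁻¹ • v ∈ Metric.sphere (0 : E) 1 := by
          simp [norm_smul, hv]
        rw [h0] at this
        exact this
    · obtain ⟨v₀, hv₀, hmin⟩ := hc.exists_isMinOn hne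
        (f := fun v => B v v) (by fun_prop)
      have hv0 : v₀ ≠ 0 := by
        rintro rfl
        simp at hv₀
      refine ⟨B v₀ v₀, hB.pos _ hv0, fun v => ?_⟩
      by_cases hv : v = 0
      · simp [hv]
      · have hn : ‖v‖ ≠ 0 := norm_ne_zero_iff.2 hv
        have h1 : B v₀ v₀ ≤ B (‖v‖⁻¹ • v) (‖v‖⁻¹ • v) :=
          hmin (show ‖v‖⁻¹ • v ∈ Metric.sphere (0 : E) 1 by simp [norm_smul, hv])
        simp only [map_smul, smul_apply, smul_eq_mul] at h1
        calc B v₀ v₀ * ‖v‖ ^ 2 ≤ (‖v‖⁻¹ * (‖v‖⁻¹ * B v v)) * ‖v‖ ^ 2 := by gcongr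
          _ = B v v := by field_simp
  refine ⟨m / 2, half_pos hm, ?_⟩
  filter_upwards [Metric.ball_mem_nhds B (half_pos hm)] with B' hB' v
  have h1 : |(B' - B) v v| ≤ m / 2 * ‖v‖ ^ 2 := by
    calc |(B' - B) v v| ≤ ‖B' - B‖ * ‖v‖ * ‖v‖ := (B' - B).le_opNorm₂ v v
      _ ≤ m / 2 * ‖v‖ * ‖v‖ := by
        gcongr
        rw [← dist_eq_norm]; exact (Metric.mem_ball.1 hB').le
      _ = _ := by ring
  have h2 := (abs_le.1 h1).1
  have h3 := h v
  simp only [sub_apply] at h2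
  linarith

end LinearAlgebra

/-! ### Second derivatives along curves of vanishing covariant acceleration -/

section OneVariable

theorem eventually_const_of_deriv_zero {φ : ℝ → ℝ}
    (h : ∀ᶠ r in 𝓝 (0 : ℝ), HasDerivAt φ 0 r) : ∀ᶠ r in 𝓝 (0 : ℝ), φ r = φ 0 := by
  obtain ⟨ε, hε, hb⟩ := Metric.eventually_nhds_iff_ball.1 h
  filter_upwards [Metric.ball_mem_nhds (0 : ℝ) hε] with r hr
  refine IsOpen.is_const_of_fderiv_eq_zero (𝕜 := ℝ) Metric.isOpen_ball
    (convex_ball (0 : ℝ) ε).isPreconnected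
    (fun x hx => (hb x hx).differentiableAt.differentiableWithinAt) (fun x hx => ?_) hr
    (Metric.mem_ball_self hε)
  have := (hb x hx).hasFDerivAt.fderiv
  rw [this]; ext; simp

/-- `φ` is differentiable near `0` and has second derivative `d` at `0`. -/
def Has2DerivAt (φ : ℝ → ℝ) (d : ℝ) : Prop :=
  ∃ φ₁ : ℝ → ℝ, (∀ᶠ r in 𝓝 (0 : ℝ), HasDerivAt φ (φ₁ r) r) ∧ HasDerivAt φ₁ d 0

namespace Has2DerivAt

variable {φ ψ : ℝ → ℝ} {d e : ℝ}

theorem congr (h : Has2DerivAt φ d) (hφ : ψ =ᶠ[𝓝 0] φ) : Has2DerivAt ψ d := by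
  obtain ⟨φ₁, h1, h2⟩ := h
  refine ⟨φ₁, ?_, h2⟩
  filter_upwards [h1, hφ.eventually_nhds] with r hr he using hr.congr_of_eventuallyEq he

theorem unique (h : Has2DerivAt φ d) (h' : Has2DerivAt φ e) : d = e := by
  obtain ⟨φ₁, h1, h2⟩ := h
  obtain ⟨φ₂, h3, h4⟩ := h'
  have : φ₁ =ᶠ[𝓝 0] φ₂ := by
    filter_upwards [h1, h3] with r hr hr' using hr.unique hr'
  exact h2.unique (h4.congr_of_eventuallyEq this)

theorem sum {ι : Type*} {s : Finset ι} {φ : ι → ℝ → ℝ} {d : ι → ℝ}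
    (h : ∀ i ∈ s, Has2DerivAt (φ i) (d i)) :
    Has2DerivAt (fun r => ∑ i ∈ s, φ i r) (∑ i ∈ s, d i) := by
  choose! φ₁ h1 h2 using h
  refine ⟨fun r => ∑ i ∈ s, φ₁ i r, ?_, HasDerivAt.fun_sum h2⟩
  filter_upwards [(Filter.eventually_all_finset s).2 h1] with r hr using HasDerivAt.fun_sum hr

theorem const_mul (h : Has2DerivAt φ d) (c : ℝ) : Has2DerivAt (fun r => c * φ r) (c * d) := by
  obtain ⟨φ₁, h1, h2⟩ := h
  refine ⟨fun r => c * φ₁ r, ?_, h2.const_mul c⟩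
  filter_upwards [h1] with r hr using hr.const_mul c

theorem sq {φ φ₁ : ℝ → ℝ} {d : ℝ} (h1 : ∀ᶠ r in 𝓝 (0 : ℝ), HasDerivAt φ (φ₁ r) r)
    (h2 : HasDerivAt φ₁ d 0) :
    Has2DerivAt (fun r => φ r ^ 2) (2 * φ₁ 0 ^ 2 + 2 * φ 0 * d) := by
  refine ⟨fun r => 2 * φ r * φ₁ r, ?_, ?_⟩
  · filter_upwards [h1] with r hr
    exact (hr.pow 2).congr_deriv (by simp)
  · exact ((h1.self_of_nhds.const_mul 2).mul h2).congr_deriv (by ring)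

/-- The second derivative is nonpositive at a local maximum. -/
theorem nonpos_of_isLocalMax (h : Has2DerivAt φ d) (hm : IsLocalMax φ 0) : d ≤ 0 := by
  obtain ⟨φ₁, h1, h2⟩ := h
  by_contra hd
  push Not at hd
  have e1 : deriv φ =ᶠ[𝓝 0] φ₁ := by filter_upwards [h1] with r hr using hr.deriv
  have hdd : deriv (deriv φ) 0 = d := by rw [e1.deriv_eq, h2.deriv]
  have hmin := isLocalMin_of_deriv_deriv_pos (by rw [hdd]; exact hd) hm.deriv_eq_zero
    h1.self_of_nhds.continuousAt
  have hc : φ =ᶠ[𝓝 0] fun _ => φ 0 := by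
    filter_upwards [hm, hmin] with r ha hb using le_antisymm ha hb
  have : Has2DerivAt φ 0 := Has2DerivAt.congr ⟨fun _ => 0,
    Eventually.of_forall fun r => hasDerivAt_const r _, hasDerivAt_const _ _⟩ hc
  exact hd.ne' (Has2DerivAt.unique ⟨φ₁, h1, h2⟩ this)

end Has2DerivAt

end OneVariable

section Curves

variable {E : Type*} [NormedAddCommGroup E] [NormedSpace ℝ E] [FiniteDimensional ℝ E]
  {W : Type*} [NormedAddCommGroup W] [NormedSpace ℝ W] [FiniteDimensional ℝ W]

/-- Parallel transport along a curve exists for a short time. -/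
theorem exists_parallel {Γ : E → E →L[ℝ] E →L[ℝ] E} {U : Set E} (hU : IsOpen U)
    (hΓ : ContDiffOn ℝ ∞ Γ U) {γ γ' : ℝ → E} (hγ : ContDiff ℝ ∞ γ) (hγ' : ContDiff ℝ ∞ γ')
    (h0 : γ 0 ∈ U) (e : E) :
    ∃ X : ℝ → E, X 0 = e ∧ ∀ᶠ r in 𝓝 (0 : ℝ), HasDerivAt X (-Γ (γ r) (γ' r) (X r)) r := by
  have : CompleteSpace E := FiniteDimensional.complete ℝ E
  let F : ℝ × E → ℝ × E := fun p => (1, -Γ (γ p.1) (γ' p.1) p.2)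
  have hF : ContDiffAt ℝ 1 F (0, e) := by
    have h1 : ContDiffAt ℝ ∞ (fun p : ℝ × E => Γ (γ p.1)) (0, e) := by
      have h2 : ContDiffAt ℝ ∞ Γ (γ 0) := hΓ.contDiffAt (hU.mem_nhds h0)
      exact ContDiffAt.comp (g := Γ) (f := fun p : ℝ × E => γ p.1) (0, e) h2
        (hγ.comp contDiff_fst).contDiffAt
    refine ContDiffAt.of_le ?_ (le_trans (by norm_num) two_le_infty)
    refine contDiffAt_const.prodMk ((h1.clm_apply ?_).clm_apply contDiffAt_snd).neg
    exact (hγ'.comp contDiff_fst).contDiffAt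
  obtain ⟨α, hα0, ε, hε, hα⟩ :=
    hF.exists_forall_mem_closedBall_exists_eq_forall_mem_Ioo_hasDerivAt₀ 0
  have hmem : Ioo (0 - ε) (0 + ε) ∈ 𝓝 (0 : ℝ) := Ioo_mem_nhds (by linarith) (by linarith)
  have h1 : ∀ t ∈ Ioo (0 - ε) (0 + ε), HasDerivAt (fun t => (α t).1) 1 t := fun t ht =>
    ((hasFDerivAt_fst (𝕜 := ℝ) (p := α t)).comp_hasDerivAt t (hα t ht))
  have h2 : ∀ t ∈ Ioo (0 - ε) (0 + ε), HasDerivAt (fun t => (α t).2)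
      (-Γ (γ (α t).1) (γ' (α t).1) (α t).2) t := fun t ht =>
    ((hasFDerivAt_snd (𝕜 := ℝ) (p := α t)).comp_hasDerivAt t (hα t ht))
  have h3 : ∀ t ∈ Ioo (0 - ε) (0 + ε), (α t).1 = t := by
    intro t ht
    have hd : ∀ t ∈ Ioo (0 - ε) (0 + ε), HasDerivAt (fun t => (α t).1 - t) 0 t := fun t ht => by
      exact ((h1 t ht).sub (hasDerivAt_id t)).congr_deriv (by simp)
    have := IsOpen.is_const_of_fderiv_eq_zero (𝕜 := ℝ) isOpen_Ioo
      (convex_Ioo (0 - ε) (0 + ε)).isPreconnected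
      (fun x hx => (hd x hx).differentiableAt.differentiableWithinAt)
      (fun x hx => by rw [(hd x hx).hasFDerivAt.fderiv]; ext; simp) ht
      (show (0 : ℝ) ∈ _ from ⟨by linarith, by linarith⟩)
    rw [hα0] at this
    simpa [sub_eq_zero] using this
  refine ⟨fun t => (α t).2, by simp [hα0], ?_⟩
  filter_upwards [hmem] with t ht
  have := h2 t ht
  rwa [h3 t ht] at this

/-- A curve through `z` with velocity `v` and vanishing covariant acceleration at `z`. -/
def geo (g : E → E →L[ℝ] E →L[ℝ] ℝ) (z v : E) (r : ℝ) : E :=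
  z + r • v - (r ^ 2 / 2) • chr g z v v

/-- The velocity of `geo g z v`. -/
def geoVel (g : E → E →L[ℝ] E →L[ℝ] ℝ) (z v : E) (r : ℝ) : E :=
  v - r • chr g z v v

variable {g : E → E →L[ℝ] E →L[ℝ] ℝ} {z v : E}

@[simp] theorem geo_zero : geo g z v 0 = z := by simp [geo]
@[simp] theorem geoVel_zero : geoVel g z v 0 = v := by simp [geoVel]

theorem hasDerivAt_geo (r : ℝ) : HasDerivAt (geo g z v) (geoVel g z v r) r := by
  have h := (((hasDerivAt_id r).smul_const v).const_add z).sub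
    ((((hasDerivAt_id r).pow 2).div_const 2).smul_const (chr g z v v))
  refine h.congr_deriv ?_
  simp [geoVel]

theorem hasDerivAt_geoVel (r : ℝ) : HasDerivAt (geoVel g z v) (-chr g z v v) r := by
  have h := ((hasDerivAt_id r).smul_const (chr g z v v)).const_sub v
  refine h.congr_deriv ?_
  simp

theorem contDiff_geo : ContDiff ℝ ∞ (geo g z v) := by unfold geo; fun_prop
theorem contDiff_geoVel : ContDiff ℝ ∞ (geoVel g z v) := by unfold geoVel; fun_prop

theorem eventually_geo_mem {U : Set E} (hU : IsOpen U) (hz : z ∈ U) :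
    ∀ᶠ r in 𝓝 (0 : ℝ), geo g z v r ∈ U := by
  have h := (contDiff_geo (g := g) (z := z) (v := v)).continuous.continuousAt (x := 0)
  exact h.eventually (by rw [geo_zero]; exact hU.mem_nhds hz)

/-- The second derivative of a function along `geo` is its covariant Hessian. -/
theorem has2DerivAt_comp_geo {u : E → ℝ} (hu : ContDiffAt ℝ ∞ u z) :
    Has2DerivAt (fun r => u (geo g z v r))
      (fderiv ℝ (fderiv ℝ u) z v v - fderiv ℝ u z (chr g z v v)) := by
  have h1 : ∀ᶠ y in 𝓝 z, DifferentiableAt ℝ u y := by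
    have := (hu.of_le (m := 1) (le_trans (by norm_num) two_le_infty)).eventually (by simp)
    filter_upwards [this] with y hy using hy.differentiableAt (by simp)
  have h2 : HasFDerivAt (fderiv ℝ u) (fderiv ℝ (fderiv ℝ u) z) (geo g z v 0) := by
    rw [geo_zero]
    exact ((hu.fderiv_right (m := 1) two_le_infty).differentiableAt (by simp)).hasFDerivAt
  refine ⟨fun r => fderiv ℝ u (geo g z v r) (geoVel g z v r), ?_, ?_⟩
  · have h := (contDiff_geo (g := g) (z := z) (v := v)).continuous.continuousAt (x := 0)
    rw [ContinuousAt, geo_zero] at h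
    filter_upwards [h.eventually h1] with r hr
    exact hr.hasFDerivAt.comp_hasDerivAt r (hasDerivAt_geo r)
  · refine ((h2.comp_hasDerivAt (0 : ℝ) (hasDerivAt_geo 0)).clm_apply
      (hasDerivAt_geoVel 0)).congr_deriv ?_
    simp [sub_eq_add_neg]

variable {Γ : W → W →L[ℝ] W →L[ℝ] W} {f : E → W} {U : Set E} {V : Set W}

theorem MapInto.covAt_fderiv (h : MapInto Γ f U V) {γ : ℝ → E} {Y : ℝ → E} {r : ℝ} {γ' Y' : E}
    (hr : γ r ∈ U) (hγ : HasDerivAt γ γ' r) (hY : HasDerivAt Y Y' r) :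
    CovAt Γ (fun r => f (γ r)) (fun r => fderiv ℝ f (γ r) (Y r)) univ r (fderiv ℝ f (γ r) γ')
      (hess Γ f (γ r) γ' (Y r) + fderiv ℝ f (γ r) Y') := by
  refine ⟨((h.differentiableAt hr).hasFDerivAt.comp_hasDerivAt r hγ).hasDerivWithinAt, ?_⟩
  refine HasDerivAt.hasDerivWithinAt ?_
  refine (((h.differentiableAt_fderiv hr).hasFDerivAt.comp_hasDerivAt r hγ).clm_apply
    hY).congr_deriv ?_
  simp only [hess_apply, Function.comp_apply]
  abel

theorem MapInto.covAt_hess (h : MapInto Γ f U V) {γ : ℝ → E} {Y Z : ℝ → E} {r : ℝ}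
    {γ' Y' Z' : E} (hr : γ r ∈ U) (hγ : HasDerivAt γ γ' r) (hY : HasDerivAt Y Y' r)
    (hZ : HasDerivAt Z Z' r) :
    CovAt Γ (fun r => f (γ r)) (fun r => hess Γ f (γ r) (Y r) (Z r)) univ r (fderiv ℝ f (γ r) γ')
      (third Γ f (γ r) γ' (Y r) (Z r) + hess Γ f (γ r) Y' (Z r) + hess Γ f (γ r) (Y r) Z') := by
  refine ⟨((h.differentiableAt hr).hasFDerivAt.comp_hasDerivAt r hγ).hasDerivWithinAt, ?_⟩
  refine HasDerivAt.hasDerivWithinAt ?_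
  refine ((((h.differentiableAt_hess hr).hasFDerivAt.comp_hasDerivAt r hγ).clm_apply
    hY).clm_apply hZ).congr_deriv ?_
  simp only [third, Function.comp_apply, add_apply]
  abel

theorem CovAt.add {c s t : ℝ → W} {S : Set ℝ} {r : ℝ} {c' s' t' : W} (hs : CovAt Γ c s S r c' s')
    (ht : CovAt Γ c t S r c' t') : CovAt Γ c (fun r => s r + t r) S r c' (s' + t') :=
  ⟨hs.1, (hs.2.add ht.2).congr_deriv (by simp only [map_add]; abel)⟩

theorem CovAt.sub {c s t : ℝ → W} {S : Set ℝ} {r : ℝ} {c' s' t' : W} (hs : CovAt Γ c s S r c' s')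
    (ht : CovAt Γ c t S r c' t') : CovAt Γ c (fun r => s r - t r) S r c' (s' - t') :=
  ⟨hs.1, (hs.2.sub ht.2).congr_deriv (by simp only [map_sub]; abel)⟩

theorem CovAt.sum {ι : Type*} {A : Finset ι} {c : ℝ → W} {s : ι → ℝ → W} {S : Set ℝ} {r : ℝ}
    {c' : W} {s' : ι → W} (hc : HasDerivWithinAt c c' S r)
    (hs : ∀ i ∈ A, CovAt Γ c (s i) S r c' (s' i)) :
    CovAt Γ c (fun r => ∑ i ∈ A, s i r) S r c' (∑ i ∈ A, s' i) :=
  ⟨hc, (HasDerivWithinAt.fun_sum fun i hi => (hs i hi).2).congr_deriv (by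
    simp only [map_sum, Finset.sum_sub_distrib])⟩

theorem CovAt.congr {c s t : ℝ → W} {r : ℝ} {c' s' : W} (hs : CovAt Γ c s univ r c' s')
    (h : t =ᶠ[𝓝 r] s) : CovAt Γ c t univ r c' s' := by
  refine ⟨hs.1, ?_⟩
  rw [h.eq_of_nhds]
  exact hs.2.congr_of_eventuallyEq (by rwa [nhdsWithin_univ]) h.eq_of_nhds

theorem CovAt.unique {c s : ℝ → W} {r : ℝ} {c' s' s'' : W} (hs : CovAt Γ c s univ r c' s')
    (ht : CovAt Γ c s univ r c' s'') : s' = s'' := by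
  have := (hasDerivWithinAt_univ.1 hs.2).unique (hasDerivWithinAt_univ.1 ht.2)
  simpa using this

end Curves

/-! ### Frames along curves and derivatives of parallel forms -/

section Frames

variable {E : Type*} [NormedAddCommGroup E] [NormedSpace ℝ E] [FiniteDimensional ℝ E]
  {W : Type*} [NormedAddCommGroup W] [NormedSpace ℝ W] [FiniteDimensional ℝ W]
  {ι : Type*} [Fintype ι] [DecidableEq ι]

/-- `Θ` is a field of alternating forms on `V` that is parallel for the connection `Γ`: it obeys the
product rule for covariant derivatives of sections along curves. -/
def ParallelForm (Γ : W → W →L[ℝ] W →L[ℝ] W) (Θ : W → W [⋀^ι]→ₗ[ℝ] ℝ) (V : Set W) : Prop :=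
  ∀ (c : ℝ → W) (s : ι → ℝ → W) (S : Set ℝ) (r : ℝ) (c' : W) (s' : ι → W), c r ∈ V →
    (∀ i, CovAt Γ c (s i) S r c' (s' i)) →
    HasDerivWithinAt (fun r => Θ (c r) fun i => s i r)
      (∑ i, Θ (c r) (Function.update (fun j => s j r) i (s' i))) S r

variable {G : W → W →L[ℝ] W →L[ℝ] ℝ} {f : E → W} {U : Set E} {V : Set W}

/-- A frame `X` along `geo`, orthonormal for the induced metric, whose image under `df` has the
normal covariant derivatives `a` and second covariant derivatives `Y` at `0`. -/
structure FrameLift (G : W → W →L[ℝ] W →L[ℝ] ℝ) (f : E → W) (U : Set E) (z v : E) (e : ι → E)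
    (X : ι → ℝ → E) (a : ι → ℝ → W) (Y : ι → W) : Prop where
  init : ∀ i, X i 0 = e i
  mem : ∀ᶠ r in 𝓝 (0 : ℝ), geo (pull G f) z v r ∈ U
  ortho : ∀ᶠ r in 𝓝 (0 : ℝ), Ortho (pull G f (geo (pull G f) z v r)) fun i => X i r
  cov : ∀ᶠ r in 𝓝 (0 : ℝ), ∀ i, CovAt (chr G) (fun r => f (geo (pull G f) z v r))
    (fun r => fderiv ℝ f (geo (pull G f) z v r) (X i r)) univ r
    (fderiv ℝ f (geo (pull G f) z v r) (geoVel (pull G f) z v r)) (a i r)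
  init_a : ∀ i, a i 0 = sff G f z v (e i)
  cov_a : ∀ i, CovAt (chr G) (fun r => f (geo (pull G f) z v r)) (a i) univ 0 (fderiv ℝ f z v) (Y i)
  deriv_X : ∀ i, HasDerivAt (X i) (-chr (pull G f) z v (e i)) 0
  second : ∀ i, ∃ x, Y i = third (chr G) f z v v (e i)
    - hess (chr G) f z (chr (pull G f) z v v) (e i)
    - (2 : ℝ) • hess (chr G) f z v (chr (pull G f) z v (e i)) + fderiv ℝ f z x
  tangential : ∀ i p, G (f z) (Y i) (fderiv ℝ f z (e p))
    = - G (f z) (sff G f z v (e i)) (sff G f z v (e p))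

/-- Parallel transport of an orthonormal frame along `geo` for the induced metric. The covariant
derivative of the image frame in the ambient space is then the second fundamental form. -/
theorem ImmInto.exists_frameLift (h : ImmInto G f U V) {z : E} (hz : z ∈ U) (v : E) {e : ι → E}
    (he : Ortho (pull G f z) e) : ∃ X a Y, FrameLift G f U z v e X a Y := by
  set g := pull G f with hg
  have hgm : MetricOn g U := h.metricOn_pull
  choose X hX0 hX using fun i => exists_parallel h.openU hgm.contDiffOn_chr
    (contDiff_geo (g := g) (z := z) (v := v)) contDiff_geoVel (by rwa [geo_zero]) (e i)
  have hX' : ∀ᶠ r in 𝓝 (0 : ℝ), ∀ i, HasDerivAt (X i)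
      (-chr g (geo g z v r) (geoVel g z v r) (X i r)) r := Filter.eventually_all.2 hX
  have hmem := eventually_geo_mem (g := g) (v := v) h.openU hz
  have hmem0 : geo g z v 0 ∈ U := by rwa [geo_zero]
  have hd0 : ∀ i, HasDerivAt (X i) (-chr g z v (e i)) 0 := fun i => by
    have := (hX i).self_of_nhds
    rwa [geo_zero, geoVel_zero, hX0] at this
  let a : ι → ℝ → W := fun i r => hess (chr G) f (geo g z v r) (geoVel g z v r) (X i r)
    + fderiv ℝ f (geo g z v r) (-chr g (geo g z v r) (geoVel g z v r) (X i r))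
  have ha : ∀ i r, a i r = sff G f (geo g z v r) (geoVel g z v r) (X i r) := fun i r => by
    simp only [a, sff_apply, map_neg, ← sub_eq_add_neg, ← hg]
  have hort : ∀ᶠ r in 𝓝 (0 : ℝ), Ortho (g (geo g z v r)) fun i => X i r := by
    have : ∀ i j, ∀ᶠ r in 𝓝 (0 : ℝ), g (geo g z v r) (X i r) (X j r) = if i = j then 1 else 0 := by
      intro i j
      have hc : ∀ᶠ r in 𝓝 (0 : ℝ), HasDerivAt
          (fun r => g (geo g z v r) (X i r) (X j r)) 0 r := by
        filter_upwards [hX', hmem] with r hr hm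
        have h1 : ∀ i, CovAt (chr g) (geo g z v) (X i) univ r (geoVel g z v r) 0 := fun i =>
          ⟨(hasDerivAt_geo r).hasDerivWithinAt,
            ((hr i).congr_deriv (by simp)).hasDerivWithinAt⟩
        have := hgm.parallelOn.hasDerivWithinAt hm (h1 i) (h1 j)
        simpa using this
      filter_upwards [eventually_const_of_deriv_zero hc] with r hr
      rw [hr, geo_zero, hX0, hX0, he i j]
    filter_upwards [Filter.eventually_all.2 fun i => Filter.eventually_all.2 (this i)] with r hr
      using hr
  have hcov : ∀ᶠ r in 𝓝 (0 : ℝ), ∀ i, CovAt (chr G) (fun r => f (geo g z v r))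
      (fun r => fderiv ℝ f (geo g z v r) (X i r)) univ r
      (fderiv ℝ f (geo g z v r) (geoVel g z v r)) (a i r) := by
    filter_upwards [hX', hmem] with r hr hm i
    exact h.mapInto.covAt_fderiv hm (hasDerivAt_geo r) (hr i)
  -- the coefficient field of the tangential correction term is differentiable at `0`
  have hXd : ∀ i, ∃ x, HasDerivAt
      (fun r => -chr g (geo g z v r) (geoVel g z v r) (X i r)) x 0 := by
    intro i
    have h1 := (hgm.chr_differentiableAt hmem0).hasFDerivAt.comp_hasDerivAt (0 : ℝ)
      (hasDerivAt_geo 0)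
    exact ⟨_, ((h1.clm_apply (hasDerivAt_geoVel 0)).clm_apply (hd0 i)).neg⟩
  choose x hx using hXd
  have hcova : ∀ i, CovAt (chr G) (fun r => f (geo g z v r)) (a i) univ 0 (fderiv ℝ f z v)
      (third (chr G) f z v v (e i) - hess (chr G) f z (chr g z v v) (e i)
        - (2 : ℝ) • hess (chr G) f z v (chr g z v (e i)) + fderiv ℝ f z (x i)) := by
    intro i
    have h1 := h.mapInto.covAt_hess hmem0 (hasDerivAt_geo 0)
      (hasDerivAt_geoVel (g := g) (z := z) (v := v) 0) (hd0 i)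
    have h2 := h.mapInto.covAt_fderiv hmem0 (hasDerivAt_geo 0) (hx i)
    have h3 := h1.add h2
    simp only [geo_zero, geoVel_zero, hX0] at h3
    convert h3 using 1
    simp only [map_neg, neg_apply, two_smul]
    abel
  refine ⟨X, a, _, hX0, hmem, hort, hcov, fun i => by rw [ha, geo_zero, geoVel_zero, hX0], hcova,
    hd0, fun i => ⟨x i, rfl⟩, fun i p => ?_⟩
  -- differentiate `G (a i, df X p) = 0`
  have hzero : ∀ᶠ r in 𝓝 (0 : ℝ),
      G (f (geo g z v r)) (a i r) (fderiv ℝ f (geo g z v r) (X p r)) = 0 := by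
    filter_upwards [hmem] with r hm
    rw [ha, h.sff_normal hm]
  have hV : f (geo g z v 0) ∈ V := by rw [geo_zero]; exact h.mapsTo hz
  have h1 := hcova i
  have h2 := hcov.self_of_nhds p
  rw [geo_zero, geoVel_zero] at h2
  have h3 := hasDerivWithinAt_univ.1 (h.metric.parallelOn.hasDerivWithinAt hV h1 h2)
  have h4 := h3.unique ((hasDerivAt_const (0 : ℝ) (0 : ℝ)).congr_of_eventuallyEq hzero)
  simp only [geo_zero, hX0, ha, geoVel_zero] at h4
  linarith

namespace FrameLift

variable {z v : E} {e : ι → E} {X : ι → ℝ → E} {a : ι → ℝ → W} {Y : ι → W}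

/-- A parallel form on a transported frame: the second derivative has one term for each vector
that is differentiated twice, and one for each ordered pair of vectors differentiated once. -/
theorem has2DerivAt_form {Θ : W → W [⋀^ι]→ₗ[ℝ] ℝ} (hΘ : ParallelForm (chr G) Θ V)
    (h : ImmInto G f U V) (hz : z ∈ U) (hF : FrameLift G f U z v e X a Y) :
    Has2DerivAt (fun r => Θ (f (geo (pull G f) z v r))
        fun i => fderiv ℝ f (geo (pull G f) z v r) (X i r))
      (∑ i, Θ (f z) (Function.update (fun j => fderiv ℝ f z (e j)) i (Y i))
        + ∑ i, ∑ j with j ≠ i, Θ (f z) (Function.update (Function.update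
            (fun j => fderiv ℝ f z (e j)) i (sff G f z v (e i))) j (sff G f z v (e j)))) := by
  refine ⟨fun r => ∑ i, Θ (f (geo (pull G f) z v r)) (Function.update
    (fun j => fderiv ℝ f (geo (pull G f) z v r) (X j r)) i (a i r)), ?_, ?_⟩
  · filter_upwards [hF.mem, hF.cov] with r hr hc
    exact hasDerivWithinAt_univ.1 (hΘ _ _ _ _ _ _ (h.mapsTo hr) hc)
  · have hV : f (geo (pull G f) z v 0) ∈ V := by rw [geo_zero]; exact h.mapsTo hz
    have hc := hF.cov.self_of_nhds
    simp only [geo_zero, geoVel_zero] at hc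
    have key : ∀ i, HasDerivAt (fun r => Θ (f (geo (pull G f) z v r)) (Function.update
        (fun j => fderiv ℝ f (geo (pull G f) z v r) (X j r)) i (a i r)))
        (∑ j, Θ (f z) (Function.update (Function.update (fun j => fderiv ℝ f z (e j)) i
          (sff G f z v (e i))) j (if j = i then Y i else sff G f z v (e j)))) 0 := by
      intro i
      have h1 := hΘ (fun r => f (geo (pull G f) z v r))
        (fun j r => Function.update
          (fun j => fderiv ℝ f (geo (pull G f) z v r) (X j r)) i (a i r) j) univ 0
        (fderiv ℝ f z v) (fun j => if j = i then Y i else a j 0) hV ?_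
      · refine (hasDerivWithinAt_univ.1 h1).congr_deriv ?_
        simp only [geo_zero, hF.init_a, hF.init]
      · intro j
        by_cases hj : j = i
        · subst hj
          simpa using hF.cov_a j
        · simpa [hj] using hc j
    refine (HasDerivAt.fun_sum fun i _ => key i).congr_deriv ?_
    rw [← Finset.sum_add_distrib]
    refine Finset.sum_congr rfl fun i _ => ?_
    rw [← Finset.add_sum_erase _ _ (Finset.mem_univ i)]
    congr 1
    · simp
    · refine Finset.sum_congr ?_ fun j hj => ?_
      · ext j; simp
      · rw [if_neg (by simpa using hj)]

theorem hasDerivAt_bilin {η : W → W →L[ℝ] W →L[ℝ] ℝ} (hη : ParallelOn (chr G) η V)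
    (h : ImmInto G f U V) (hF : FrameLift G f U z v e X a Y) (i j : ι) :
    ∀ᶠ r in 𝓝 (0 : ℝ), HasDerivAt (fun r => η (f (geo (pull G f) z v r))
        (fderiv ℝ f (geo (pull G f) z v r) (X i r)) (fderiv ℝ f (geo (pull G f) z v r) (X j r)))
      (η (f (geo (pull G f) z v r)) (a i r) (fderiv ℝ f (geo (pull G f) z v r) (X j r))
        + η (f (geo (pull G f) z v r)) (fderiv ℝ f (geo (pull G f) z v r) (X i r)) (a j r)) r := by
  filter_upwards [hF.mem, hF.cov] with r hr hc
  exact hasDerivWithinAt_univ.1 (hη.hasDerivWithinAt (h.mapsTo hr) (hc i) (hc j))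

theorem hasDerivAt_bilin' {η : W → W →L[ℝ] W →L[ℝ] ℝ} (hη : ParallelOn (chr G) η V)
    (h : ImmInto G f U V) (hz : z ∈ U) (hF : FrameLift G f U z v e X a Y) (i j : ι) :
    HasDerivAt (fun r =>
        η (f (geo (pull G f) z v r)) (a i r) (fderiv ℝ f (geo (pull G f) z v r) (X j r))
        + η (f (geo (pull G f) z v r)) (fderiv ℝ f (geo (pull G f) z v r) (X i r)) (a j r))
      (η (f z) (Y i) (fderiv ℝ f z (e j)) + η (f z) (fderiv ℝ f z (e i)) (Y j)
        + 2 * η (f z) (sff G f z v (e i)) (sff G f z v (e j))) 0 := by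
  have hV : f (geo (pull G f) z v 0) ∈ V := by rw [geo_zero]; exact h.mapsTo hz
  have hc := hF.cov.self_of_nhds
  simp only [geo_zero, geoVel_zero] at hc
  have h1 := hη.hasDerivWithinAt hV (hF.cov_a i) (hc j)
  have h2 := hη.hasDerivWithinAt hV (hc i) (hF.cov_a j)
  refine (hasDerivWithinAt_univ.1 (h1.add h2)).congr_deriv ?_
  simp only [geo_zero, hF.init, hF.init_a]
  ring

end FrameLift

/-- The mean curvature vector field of the immersion `f`. -/
def meanCurv (G : W → W →L[ℝ] W →L[ℝ] ℝ) (f : E → W) (z : E) : W :=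
  metricTrace (pull G f z) fun u v => sff G f z u v

theorem ImmInto.meanCurv_eq (h : ImmInto G f U V) {z : E} (hz : z ∈ U) {e : ι → E}
    (he : Ortho (pull G f z) e) (hcard : Fintype.card ι = Module.finrank ℝ E) :
    meanCurv G f z = ∑ k, sff G f z (e k) (e k) :=
  metricTrace_eq_sum (h.metricOn_pull.inner z hz)
    (fun v => ⟨fun a b => by simp, fun c a => by simp⟩)
    (fun u => ⟨fun a b => by simp, fun c a => by simp⟩) he hcard

/-- The covariant derivative of the mean curvature vector, up to tangential terms. -/
theorem ImmInto.cov_meanCurv (h : ImmInto G f U V) {z : E} (hz : z ∈ U) {e : ι → E}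
    (he : Ortho (pull G f z) e) (hcard : Fintype.card ι = Module.finrank ℝ E)
    (hH : DifferentiableAt ℝ (meanCurv G f) z) (v : E) :
    ∃ x, fderiv ℝ (meanCurv G f) z v + chr G (f z) (fderiv ℝ f z v) (meanCurv G f z)
      = ∑ k, (third (chr G) f z v (e k) (e k)
          - (2 : ℝ) • hess (chr G) f z (e k) (chr (pull G f) z v (e k))
          - hess (chr G) f z v (chr (pull G f) z (e k) (e k))) + fderiv ℝ f z x := by
  obtain ⟨X, a, Y, hF⟩ := h.exists_frameLift hz v he
  set g := pull G f with hg
  have hgm : MetricOn g U := h.metricOn_pull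
  have hmem0 : geo g z v 0 ∈ U := by rwa [geo_zero]
  have hd : ∀ k, ∃ x, HasDerivAt (fun r => chr g (geo g z v r) (X k r) (X k r)) x 0 := by
    intro k
    have h1 := (hgm.chr_differentiableAt hmem0).hasFDerivAt.comp_hasDerivAt (0 : ℝ)
      (hasDerivAt_geo 0)
    exact ⟨_, (h1.clm_apply (hF.deriv_X k)).clm_apply (hF.deriv_X k)⟩
  choose x hx using hd
  have h1 : CovAt (chr G) (fun r => f (geo g z v r)) (fun r => ∑ k,
      (hess (chr G) f (geo g z v r) (X k r) (X k r)
        - fderiv ℝ f (geo g z v r) (chr g (geo g z v r) (X k r) (X k r)))) univ 0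
      (fderiv ℝ f (geo g z v 0) v) (∑ k, ((third (chr G) f (geo g z v 0) v (X k 0) (X k 0)
        + hess (chr G) f (geo g z v 0) (-chr g z v (e k)) (X k 0)
        + hess (chr G) f (geo g z v 0) (X k 0) (-chr g z v (e k)))
        - (hess (chr G) f (geo g z v 0) v (chr g (geo g z v 0) (X k 0) (X k 0))
          + fderiv ℝ f (geo g z v 0) (x k)))) := by
    have hgeo : HasDerivAt (geo g z v) v 0 := by
      simpa using hasDerivAt_geo (g := g) (z := z) (v := v) 0
    refine CovAt.sum (h.mapInto.covAt_fderiv hmem0 hgeo (hasDerivAt_const 0 v)).1 fun k _ => ?_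
    exact (h.mapInto.covAt_hess hmem0 hgeo (hF.deriv_X k) (hF.deriv_X k)).sub
      (h.mapInto.covAt_fderiv hmem0 hgeo (hx k))
  have h2 : (fun r => meanCurv G f (geo g z v r)) =ᶠ[𝓝 0] fun r => ∑ k,
      (hess (chr G) f (geo g z v r) (X k r) (X k r)
        - fderiv ℝ f (geo g z v r) (chr g (geo g z v r) (X k r) (X k r))) := by
    filter_upwards [hF.mem, hF.ortho] with r hm ho
    rw [h.meanCurv_eq hm ho hcard]
    rfl
  have h3 : CovAt (chr G) (fun r => f (geo g z v r)) (fun r => meanCurv G f (geo g z v r)) univ 0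
      (fderiv ℝ f (geo g z v 0) v)
      (fderiv ℝ (meanCurv G f) z v + chr G (f z) (fderiv ℝ f z v) (meanCurv G f z)) := by
    have hgeo : HasDerivAt (geo g z v) v 0 := by
      simpa using hasDerivAt_geo (g := g) (z := z) (v := v) 0
    refine ⟨(h.mapInto.covAt_fderiv hmem0 hgeo (hasDerivAt_const 0 v)).1, ?_⟩
    have hH' : HasFDerivAt (meanCurv G f) (fderiv ℝ (meanCurv G f) z) (geo g z v 0) := by
      rw [geo_zero]; exact hH.hasFDerivAt
    refine ((hH'.comp_hasDerivAt (0 : ℝ) hgeo).congr_deriv ?_).hasDerivWithinAt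
    simp
  have h4 := h3.unique (h1.congr h2)
  rw [h4]
  refine ⟨-∑ k, x k, ?_⟩
  simp only [geo_zero, hF.init, map_neg, neg_apply, map_sum, ← Finset.sum_neg_distrib,
    ← Finset.sum_add_distrib]
  refine Finset.sum_congr rfl fun k _ => ?_
  rw [h.mapInto.hess_symm hz (chr g z v (e k)) (e k), two_smul]
  abel

/-- The normal components of the covariant derivative of the mean curvature vector and of the rough
Laplacian of `df` differ by an ambient curvature term. -/
theorem ImmInto.cov_meanCurv_normal (h : ImmInto G f U V) {z : E} (hz : z ∈ U) {e : ι → E}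
    (he : Ortho (pull G f z) e) (hcard : Fintype.card ι = Module.finrank ℝ E)
    (hH : DifferentiableAt ℝ (meanCurv G f) z) {X : ι → ι → ℝ → E} {a : ι → ι → ℝ → W}
    {Y : ι → ι → W} (hF : ∀ k, FrameLift G f U z (e k) e (X k) (a k) (Y k)) (i : ι) {ν : W}
    (hν : ∀ x, G (f z) (fderiv ℝ f z x) ν = 0) :
    G (f z) (fderiv ℝ (meanCurv G f) z (e i)
        + chr G (f z) (fderiv ℝ f z (e i)) (meanCurv G f z)) ν
      = ∑ k, (G (f z) (Y k i) ν - G (f z) (curv (chr G) (f z) (fderiv ℝ f z (e k))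
          (fderiv ℝ f z (e i)) (fderiv ℝ f z (e k))) ν) := by
  obtain ⟨x, hx⟩ := h.cov_meanCurv hz he hcard hH (e i)
  rw [hx, map_add, add_apply, hν, add_zero, map_sum, sum_apply]
  refine Finset.sum_congr rfl fun k _ => ?_
  obtain ⟨y, hy⟩ := (hF k).second i
  have h1 := h.mapInto.third_sub_third hz (e k) (e i) (e k)
  rw [← h1, hy, h.mapInto.third_symm hz (e k) (e k) (e i),
    h.mapInto.hess_symm hz (chr (pull G f) z (e k) (e k)) (e i),
    h.metricOn_pull.chr_symm hz (e k) (e i)]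
  simp only [map_add, map_sub, add_apply, sub_apply, hν]
  ring

end Frames

/-! ### Gram determinants and the evolution of the Jacobian -/

section Determinants

variable {E : Type*} [NormedAddCommGroup E] [NormedSpace ℝ E] [FiniteDimensional ℝ E]
  {ι : Type*} [Fintype ι] [DecidableEq ι]

/-- The derivative of the determinant at the identity matrix is the trace. -/
theorem hasDerivWithinAt_det {P : ℝ → Matrix ι ι ℝ} {P' : Matrix ι ι ℝ} {S : Set ℝ} {t : ℝ}
    (hP : ∀ i j, HasDerivWithinAt (fun s => P s i j) (P' i j) S t) (h1 : P t = 1) :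
    HasDerivWithinAt (fun s => (P s).det) P'.trace S t := by
  let D : ContinuousMultilinearMap ℝ (fun _ : ι => ι → ℝ) ℝ :=
    { Matrix.detRowAlternating.toMultilinearMap with
      cont := (continuous_id (X := Matrix ι ι ℝ)).matrix_det }
  have hP' : HasDerivWithinAt (fun s => (P s : ι → ι → ℝ)) P' S t :=
    hasDerivWithinAt_pi.2 fun i => hasDerivWithinAt_pi.2 fun j => hP i j
  refine ((D.hasFDerivAt (P t : ι → ι → ℝ)).comp_hasDerivWithinAt t hP').congr_deriv ?_
  refine (D.linearDeriv_apply _ _).trans ?_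
  rw [Matrix.trace]
  refine Finset.sum_congr rfl fun i _ => ?_
  have : D (Function.update (P t : ι → ι → ℝ) i (P' i)) = ((P t).updateRow i (P' i)).det := rfl
  rw [this, ← Matrix.cramer_transpose_apply, h1, Matrix.transpose_one, Matrix.cramer_one]
  rfl

/-- The Gram matrix of a family. -/
def gram (B : E →L[ℝ] E →L[ℝ] ℝ) (b : ι → E) : Matrix ι ι ℝ := Matrix.of fun i j => B (b i) (b j)

/-- The value of an alternating form on the `B`-unit volume element spanned by `b`. -/
def unitValue (Θ : E [⋀^ι]→ₗ[ℝ] ℝ) (B : E →L[ℝ] E →L[ℝ] ℝ) (b : ι → E) : ℝ :=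
  Θ b / Real.sqrt (gram B b).det

theorem map_linear_combination (Θ : E [⋀^ι]→ₗ[ℝ] ℝ) (e : Module.Basis ι ℝ E) (C : Matrix ι ι ℝ) :
    Θ (fun i => ∑ j, C i j • e j) = C.det * Θ e := by
  have h := congrArg (fun L : E [⋀^ι]→ₗ[ℝ] ℝ => L (fun i => ∑ j, C i j • e j))
    (Θ.eq_smul_basis_det e)
  simp only [AlternatingMap.smul_apply, smul_eq_mul] at h
  rw [h, mul_comm, Module.Basis.det_apply]
  congr 1
  rw [← Matrix.det_transpose]
  congr 1
  ext i j
  rw [Matrix.transpose_apply, Module.Basis.toMatrix_apply, ← Module.Basis.equivFun_apply]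
  simp [Finsupp.single_apply, Finset.sum_apply]

theorem gram_linear_combination (B : E →L[ℝ] E →L[ℝ] ℝ) (e : ι → E) (C : Matrix ι ι ℝ) :
    gram B (fun i => ∑ j, C i j • e j) = C * gram B e * C.transpose := by
  ext i j
  simp only [gram, Matrix.of_apply, Matrix.mul_apply, Matrix.transpose_apply, map_sum, sum_apply,
    map_smul, smul_apply, smul_eq_mul, Finset.sum_mul, Finset.mul_sum]
  refine Finset.sum_congr rfl fun k _ => Finset.sum_congr rfl fun l _ => ?_
  ring

/-- The value on a unit volume element depends only on the orientation of the basis. -/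
theorem unitValue_linear_combination (Θ : E [⋀^ι]→ₗ[ℝ] ℝ) (B : E →L[ℝ] E →L[ℝ] ℝ)
    (e : Module.Basis ι ℝ E) (C : Matrix ι ι ℝ) :
    unitValue Θ B (fun i => ∑ j, C i j • e j) = Real.sign C.det * unitValue Θ B e := by
  rw [unitValue, unitValue, map_linear_combination, gram_linear_combination, Matrix.det_mul,
    Matrix.det_mul, Matrix.det_transpose,
    show C.det * (gram B e).det * C.det = C.det ^ 2 * (gram B e).det by ring,
    Real.sqrt_mul (sq_nonneg _), Real.sqrt_sq_eq_abs]
  rcases lt_trichotomy C.det 0 with h | h | h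
  · rw [Real.sign_of_neg h, abs_of_neg h, neg_mul, div_neg, mul_div_mul_left _ _ h.ne]
    ring
  · rw [h]; simp
  · rw [Real.sign_of_pos h, abs_of_pos h, mul_div_mul_left _ _ h.ne', one_mul]

theorem Ortho.gram_eq {B : E →L[ℝ] E →L[ℝ] ℝ} {e : ι → E} (he : Ortho B e) : gram B e = 1 := by
  ext i j
  simp [gram, he i j, Matrix.one_apply]

theorem Ortho.unitValue_eq {B : E →L[ℝ] E →L[ℝ] ℝ} {e : ι → E} (he : Ortho B e)
    (Θ : E [⋀^ι]→ₗ[ℝ] ℝ) : unitValue Θ B e = Θ e := by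
  simp [unitValue, he.gram_eq]

theorem Ortho.expand_family {B : E →L[ℝ] E →L[ℝ] ℝ} {e : ι → E} (he : Ortho B e)
    (hcard : Fintype.card ι = Module.finrank ℝ E) (b : ι → E) :
    b = fun i => ∑ j, (Matrix.of fun i j => B (b i) (e j)) i j • e j := by
  ext1 i
  exact he.expand hcard (b i)

theorem Ortho.unitValue_of_ortho {B B' : E →L[ℝ] E →L[ℝ] ℝ} {e : ι → E} (he : Ortho B e)
    (hcard : Fintype.card ι = Module.finrank ℝ E) (b : ι → E) (Θ : E [⋀^ι]→ₗ[ℝ] ℝ) :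
    unitValue Θ B' b
      = Real.sign (Matrix.det (Matrix.of fun i j => B (b i) (e j))) * unitValue Θ B' e := by
  obtain ⟨b', hb'⟩ := he.basis_exists hcard
  conv_lhs => rw [he.expand_family hcard b, ← hb']
  rw [unitValue_linear_combination, hb']

theorem Ortho.det_ne_zero {B : E →L[ℝ] E →L[ℝ] ℝ} {e b : ι → E} (he : Ortho B e)
    (hcard : Fintype.card ι = Module.finrank ℝ E) (hb : LinearIndependent ℝ b) :
    Matrix.det (Matrix.of fun i j => B (b i) (e j)) ≠ 0 := by
  obtain ⟨e', he'⟩ := he.basis_exists hcard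
  rcases isEmpty_or_nonempty ι with h0 | h0
  · simp
  obtain ⟨b', hb'⟩ : ∃ b' : Module.Basis ι ℝ E, ⇑b' = b :=
    ⟨basisOfLinearIndependentOfCardEqFinrank hb hcard, by simp⟩
  intro hdet
  have h := map_linear_combination b'.det e' (Matrix.of fun i j => B (b i) (e j))
  rw [he', ← he.expand_family hcard b, hdet, zero_mul, ← hb', b'.det_self] at h
  exact one_ne_zero h

end Determinants

section Jacobian

variable {E : Type*} [NormedAddCommGroup E] [NormedSpace ℝ E] [FiniteDimensional ℝ E]
  {W : Type*} [NormedAddCommGroup W] [NormedSpace ℝ W] [FiniteDimensional ℝ W]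
  {ι : Type*} [Fintype ι] [DecidableEq ι]

/-- The value of the form `Θ` on the unit volume element of the image of `f` that is oriented by
`b`. -/
def jac (Θ : W → W [⋀^ι]→ₗ[ℝ] ℝ) (G : W → W →L[ℝ] W →L[ℝ] ℝ) (b : ι → E) (f : E → W) (z : E) : ℝ :=
  unitValue ((Θ (f z)).compLinearMap (fderiv ℝ f z : E →ₗ[ℝ] W)) (pull G f z) b

variable {G : W → W →L[ℝ] W →L[ℝ] ℝ} {f : E → W} {U : Set E} {V : Set W}
  {Θ : W → W [⋀^ι]→ₗ[ℝ] ℝ}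

/-- The frame stays orthonormal along the curve, so that `jac` is, up to a constant sign, the
value of the parallel form on it. -/
theorem FrameLift.has2DerivAt_jac {z v : E} {e b : ι → E} {X : ι → ℝ → E} {a : ι → ℝ → W}
    {Y : ι → W} (hΘ : ParallelForm (chr G) Θ V)
    (h : ImmInto G f U V) (hz : z ∈ U) (hF : FrameLift G f U z v e X a Y)
    (hcard : Fintype.card ι = Module.finrank ℝ E) (hb : LinearIndependent ℝ b) :
    Has2DerivAt (fun r => jac Θ G b f (geo (pull G f) z v r))
      (Real.sign (Matrix.det (Matrix.of fun i j => pull G f z (b i) (e j))) *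
      (∑ i, Θ (f z) (Function.update (fun j => fderiv ℝ f z (e j)) i (Y i))
        + ∑ i, ∑ j with j ≠ i, Θ (f z) (Function.update (Function.update
            (fun j => fderiv ℝ f z (e j)) i (sff G f z v (e i))) j (sff G f z v (e j))))) := by
  refine ((hF.has2DerivAt_form hΘ h hz).const_mul _).congr ?_
  have hmem0 : geo (pull G f) z v 0 ∈ U := by rwa [geo_zero]
  have hc : ContinuousAt (fun r => Matrix.det
      (Matrix.of fun i j => pull G f (geo (pull G f) z v r) (b i) (X j r))) 0 := by
    refine ContinuousAt.comp (g := Matrix.det)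
      (f := fun r => Matrix.of fun i j => pull G f (geo (pull G f) z v r) (b i) (X j r))
      (continuous_id.matrix_det).continuousAt ?_
    refine continuousAt_pi.2 fun i => continuousAt_pi.2 fun j => ?_
    have h1 : ContinuousAt (fun r => pull G f (geo (pull G f) z v r)) 0 :=
      ContinuousAt.comp (g := pull G f) (h.metricOn_pull.differentiableAt hmem0).continuousAt
        contDiff_geo.continuous.continuousAt
    have h2 : ContinuousAt (fun r => pull G f (geo (pull G f) z v r) (b i)) 0 :=
      h1.clm_apply continuousAt_const
    exact h2.clm_apply (hF.deriv_X j).continuousAt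
  have h0 : Matrix.det
      (Matrix.of fun i j => pull G f (geo (pull G f) z v 0) (b i) (X j 0)) ≠ 0 := by
    have := hF.ortho.self_of_nhds.det_ne_zero hcard hb
    exact this
  have hs : ∀ᶠ r in 𝓝 (0 : ℝ), Real.sign (Matrix.det
      (Matrix.of fun i j => pull G f (geo (pull G f) z v r) (b i) (X j r))) = Real.sign
      (Matrix.det (Matrix.of fun i j => pull G f z (b i) (e j))) := by
    simp only [geo_zero, hF.init] at h0
    have hc' := hc.tendsto
    simp only [geo_zero, hF.init] at hc'
    rcases lt_or_gt_of_ne h0 with hn | hp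
    · filter_upwards [hc'.eventually (gt_mem_nhds hn)] with r hr
      rw [Real.sign_of_neg hn, Real.sign_of_neg hr]
    · filter_upwards [hc'.eventually (lt_mem_nhds hp)] with r hr
      rw [Real.sign_of_pos hp, Real.sign_of_pos hr]
  filter_upwards [hs, hF.ortho] with r hr ho
  rw [jac, ho.unitValue_of_ortho hcard b, hr, ho.unitValue_eq]
  rfl

/-- The time derivative of `jac` in terms of an orthonormal frame. -/
theorem hasDerivWithinAt_jac {F : ℝ → E → W} {t : ℝ} {S : Set ℝ} {z : E} {H : W} {DH : ι → W}
    (hG : MetricOn G V) (hΘ : ParallelForm (chr G) Θ V) (hV : F t z ∈ V) {e : ι → E}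
    (b : ι → E) (he : Ortho (pull G (F t) z) e) (hcard : Fintype.card ι = Module.finrank ℝ E)
    (hcov : ∀ i, CovAt (chr G) (fun s => F s z) (fun s => fderiv ℝ (F s) z (e i)) S t H (DH i)) :
    HasDerivWithinAt (fun s => jac Θ G b (F s) z)
      (Real.sign (Matrix.det (Matrix.of fun i j => pull G (F t) z (b i) (e j))) *
      (∑ i, Θ (F t z) (Function.update (fun j => fderiv ℝ (F t) z (e j)) i (DH i))
        - Θ (F t z) (fun j => fderiv ℝ (F t) z (e j)) *
          ∑ i, G (F t z) (DH i) (fderiv ℝ (F t) z (e i)))) S t := by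
  have hfun : (fun s => jac Θ G b (F s) z) = fun s =>
      Real.sign (Matrix.det (Matrix.of fun i j => pull G (F t) z (b i) (e j))) *
        jac Θ G e (F s) z := by
    ext s
    exact he.unitValue_of_ortho hcard b _
  rw [hfun]
  refine HasDerivWithinAt.const_mul _ ?_
  have h1 := hΘ _ _ S t H DH hV hcov
  have h2 := hasDerivWithinAt_det (P := fun s => gram (pull G (F s) z) e)
    (P' := Matrix.of fun i j => G (F t z) (DH i) (fderiv ℝ (F t) z (e j))
      + G (F t z) (fderiv ℝ (F t) z (e i)) (DH j)) (S := S) (t := t)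
    (fun i j => hG.parallelOn.hasDerivWithinAt hV (hcov i) (hcov j)) he.gram_eq
  have h3 : (gram (pull G (F t) z) e).det = 1 := by rw [he.gram_eq, Matrix.det_one]
  have h4 := h1.div (h2.sqrt (by rw [h3]; exact one_ne_zero))
    (by rw [h3]; simp)
  refine h4.congr_deriv ?_
  rw [h3]
  simp only [Real.sqrt_one, Matrix.trace, Matrix.diag_apply, Matrix.of_apply,
    fun i => (hG.inner _ hV).symm (fderiv ℝ (F t) z (e i)), ← two_mul, ← Finset.mul_sum]
  ring

/-- Replacing the argument `i` of an alternating form by a vector expanded in an adapted orthonormal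
basis. -/
theorem map_update_expand {B : W →L[ℝ] W →L[ℝ] ℝ} (hB : IsInner B) (Θ₀ : W [⋀^ι]→ₗ[ℝ] ℝ)
    {s ν : ι → W} (hs : Ortho B s) (hν : Ortho B ν) (hsν : ∀ i j, B (s i) (ν j) = 0)
    (hW : 2 * Fintype.card ι = Module.finrank ℝ W) (i : ι) (x : W) :
    Θ₀ (Function.update s i x) = B x (s i) * Θ₀ s
      + ∑ q, B x (ν q) * Θ₀ (Function.update s i (ν q)) := by
  have h := (hs.sum_elim hB hν hsν).expand (by simp [← hW, two_mul]) x
  rw [Fintype.sum_sum_type] at h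
  simp only [Sum.elim_inl, Sum.elim_inr] at h
  let L := Θ₀.toMultilinearMap.toLinearMap s i
  have hL : ∀ y, Θ₀ (Function.update s i y) = L y := fun y => rfl
  have h0 : ∀ p, p ≠ i → L (s p) = 0 := fun p hp => Θ₀.map_update_self s hp.symm
  have h1 : L (s i) = Θ₀ s := by rw [← hL, Function.update_eq_self]
  simp only [hL]
  conv_lhs => rw [h]
  rw [map_add, map_sum, map_sum, Finset.sum_eq_single i]
  · simp [h1]
  · intro p _ hp
    simp [h0 p hp]
  · simp

/-- The bookkeeping of `evolution_jac`: `d` stands for the tangential contributions, `y` and `R` for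
the normal components of second derivatives and of curvature, `A` for the inner products of second
fundamental forms and `T` for the terms with two vectors replaced. -/
theorem sum_rearrange (s : ℝ) (d T : ι → ℝ) (A th : ι → ι → ℝ) (y R : ι → ι → ι → ℝ) :
    ∑ i, (d i * s + ∑ q, (∑ k, (y k i q - R k i q)) * th i q) - s * ∑ i, d i
      = ∑ k, (∑ i, (-A k i * s + ∑ q, y k i q * th i q) + T k)
        + (s * ∑ k, ∑ i, A k i - ∑ k, T k - ∑ i, ∑ q, (∑ k, R k i q) * th i q) := by
  simp only [Finset.sum_add_distrib, Finset.sum_sub_distrib, sub_mul, neg_mul,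
    Finset.sum_neg_distrib, ← Finset.sum_mul]
  have e1 : ∑ i, ∑ q, (∑ k, y k i q) * th i q = ∑ k, ∑ i, ∑ q, y k i q * th i q := by
    refine (Finset.sum_congr rfl fun i _ => ?_).trans Finset.sum_comm
    exact (Finset.sum_congr rfl fun q _ => Finset.sum_mul _ _ _).trans Finset.sum_comm
  rw [e1]
  ring

/-- The evolution equation of `jac` along the mean curvature flow, for a parallel form `Θ` and an
orthonormal basis `s = df e`, `ν` adapted to the tangent and the normal space. -/
theorem evolution_jac {F : ℝ → E → W} {t : ℝ} {S : Set ℝ} {z : E}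
    (hΘ : ParallelForm (chr G) Θ V) (h : ImmInto G (F t) U V) (hz : z ∈ U)
    (hcard : Fintype.card ι = Module.finrank ℝ E)
    (hW : 2 * Fintype.card ι = Module.finrank ℝ W)
    (hH : DifferentiableAt ℝ (meanCurv G (F t)) z)
    (ht : HasDerivWithinAt (fun s => F s z) (meanCurv G (F t) z) S t)
    (ht' : ∀ v, HasDerivWithinAt (fun s => fderiv ℝ (F s) z v)
      (fderiv ℝ (meanCurv G (F t)) z v) S t)
    {e b : ι → E} {ν : ι → W} (he : Ortho (pull G (F t) z) e) (hb : LinearIndependent ℝ b)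
    (hν : Ortho (G (F t z)) ν) (hn : ∀ x q, G (F t z) (fderiv ℝ (F t) z x) (ν q) = 0) :
    ∃ (σ : ℝ) (d : ι → ℝ),
      jac Θ G b (F t) z = σ * Θ (F t z) (fun j => fderiv ℝ (F t) z (e j)) ∧
      (∀ k, Has2DerivAt (fun r => jac Θ G b (F t) (geo (pull G (F t)) z (e k) r)) (d k)) ∧
      HasDerivWithinAt (fun s => jac Θ G b (F s) z) (∑ k, d k + σ *
        (Θ (F t z) (fun j => fderiv ℝ (F t) z (e j)) *
            ∑ k, ∑ i, G (F t z) (sff G (F t) z (e k) (e i)) (sff G (F t) z (e k) (e i))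
          - ∑ k, ∑ i, ∑ j with j ≠ i, Θ (F t z) (Function.update (Function.update
              (fun j => fderiv ℝ (F t) z (e j)) i (sff G (F t) z (e k) (e i))) j
                (sff G (F t) z (e k) (e j)))
          - ∑ i, ∑ q, (∑ k, G (F t z) (curv (chr G) (F t z) (fderiv ℝ (F t) z (e k))
              (fderiv ℝ (F t) z (e i)) (fderiv ℝ (F t) z (e k))) (ν q))
              * Θ (F t z) (Function.update (fun j => fderiv ℝ (F t) z (e j)) i (ν q)))) S t := by
  choose X a Y hF using fun k => h.exists_frameLift hz (e k) he
  have hV := h.mapsTo hz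
  have hB := h.metric.inner _ hV
  have hcov : ∀ i, CovAt (chr G) (fun s => F s z) (fun s => fderiv ℝ (F s) z (e i)) S t
      (meanCurv G (F t) z) (fderiv ℝ (meanCurv G (F t)) z (e i)
        + chr G (F t z) (fderiv ℝ (F t) z (e i)) (meanCurv G (F t) z)) := fun i =>
    ⟨ht, (ht' (e i)).congr_deriv (by rw [h.metric.chr_symm hV (meanCurv G (F t) z)]; abel)⟩
  refine ⟨Real.sign (Matrix.det (Matrix.of fun i j => pull G (F t) z (b i) (e j))),
    fun k => Real.sign (Matrix.det (Matrix.of fun i j => pull G (F t) z (b i) (e j))) *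
      (∑ i, Θ (F t z) (Function.update (fun j => fderiv ℝ (F t) z (e j)) i (Y k i))
        + ∑ i, ∑ j with j ≠ i, Θ (F t z) (Function.update (Function.update
          (fun j => fderiv ℝ (F t) z (e j)) i (sff G (F t) z (e k) (e i))) j
            (sff G (F t) z (e k) (e j)))),
    ?_, fun k => (hF k).has2DerivAt_jac hΘ h hz hcard hb,
    (hasDerivWithinAt_jac h.metric hΘ hV b he hcard hcov).congr_deriv ?_⟩
  · rw [jac, he.unitValue_of_ortho hcard b, he.unitValue_eq]
    rfl
  · rw [← Finset.mul_sum, ← mul_add]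
    congr 1
    have hs : Ortho (G (F t z)) fun j => fderiv ℝ (F t) z (e j) := he
    have hx := fun i x => map_update_expand hB (Θ (F t z)) hs hν (fun i q => hn (e i) q) hW i x
    rw [Finset.sum_congr rfl fun i _ => hx i (fderiv ℝ (meanCurv G (F t)) z (e i)
        + chr G (F t z) (fderiv ℝ (F t) z (e i)) (meanCurv G (F t) z)),
      Finset.sum_congr rfl fun k _ => congrArg (fun c => c + _)
        (Finset.sum_congr rfl fun i _ => hx i (Y k i))]
    simp only [(hF _).tangential,
      fun i q => h.cov_meanCurv_normal hz he hcard hH hF i (fun x => hn x q)]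
    exact sum_rearrange _ _ _ _ _ _ _

end Jacobian

/-! ### The squared norm of a bilinear form -/

section NormSq

variable {E : Type*} [NormedAddCommGroup E] [NormedSpace ℝ E] [FiniteDimensional ℝ E]
  {ι : Type*} [Fintype ι] [DecidableEq ι]

/-- The squared norm of the bilinear form `α` with respect to the inner product `B`. -/
def normSq (B α : E →L[ℝ] E →L[ℝ] ℝ) : ℝ :=
  metricTrace B fun u w => metricTrace B fun v x => α u v * α w x

/-- The squared norm in a constant basis, with the dual basis expressed by the inverse metric; the
right side can be differentiated with the metric. -/
theorem normSq_eq_dual (B α : E →L[ℝ] E →L[ℝ] ℝ) {e : ι → E} {ξ : ι → E →L[ℝ] ℝ}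
    (hξ : ∀ x, x = ∑ i, ξ i x • e i) :
    normSq B α = ∑ i, ∑ j, α (e i) (e j) * α (B.inverse (ξ i)) (B.inverse (ξ j)) := by
  have h : ∀ u w, metricTrace B (fun v x => α u v * α w x)
      = ∑ j, α u (e j) * α w (B.inverse (ξ j)) := fun u w =>
    metricTrace_eq_dual (T := fun v x => α u v * α w x)
      (fun v => ⟨fun a b => by simp [add_mul], fun c a => by simp [mul_assoc]⟩)
      (fun v => ⟨fun a b => by simp [mul_add], fun c a => by simp; ring⟩) hξ
  unfold normSq
  simp only [h]
  exact metricTrace_eq_dual (T := fun u w => ∑ j, α u (e j) * α w (B.inverse (ξ j)))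
    (fun v => ⟨fun a b => by simp [add_mul, Finset.sum_add_distrib],
      fun c a => by simp [mul_assoc, Finset.mul_sum]⟩)
    (fun v => ⟨fun a b => by simp [mul_add, Finset.sum_add_distrib],
      fun c a => by simp [Finset.mul_sum, mul_left_comm]⟩) hξ

theorem Ortho.expand_dual {B : E →L[ℝ] E →L[ℝ] ℝ} (hB : IsInner B) {e : ι → E} (he : Ortho B e)
    (hcard : Fintype.card ι = Module.finrank ℝ E) (x : E) : x = ∑ i, B (e i) x • e i := by
  conv_lhs => rw [he.expand hcard x]
  simp only [hB.symm x]

theorem normSq_eq_sum {B : E →L[ℝ] E →L[ℝ] ℝ} (hB : IsInner B) (α : E →L[ℝ] E →L[ℝ] ℝ) {e : ι → E}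
    (he : Ortho B e) (hcard : Fintype.card ι = Module.finrank ℝ E) :
    normSq B α = ∑ i, ∑ j, α (e i) (e j) ^ 2 := by
  rw [normSq_eq_dual B α (ξ := fun i => B (e i)) (he.expand_dual hB hcard)]
  simp only [hB.isInvertible.inverse_apply_self, sq]

theorem hasDerivWithinAt_clm {W : Type*} [NormedAddCommGroup W] [NormedSpace ℝ W]
    {L : ℝ → E →L[ℝ] W} {L' : E →L[ℝ] W} {S : Set ℝ} {t : ℝ}
    (h : ∀ v, HasDerivWithinAt (fun s => L s v) (L' v) S t) : HasDerivWithinAt L L' S t := by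
  have key : ∀ M : E →L[ℝ] W, M = ∑ i, (LinearMap.toContinuousLinearMap
      ((Module.finBasis ℝ E).coord i)).smulRight (M (Module.finBasis ℝ E i)) := by
    intro M
    ext x
    conv_lhs => rw [← (Module.finBasis ℝ E).sum_repr x, map_sum]
    simp [sum_apply]
  rw [key L', funext fun s => key (L s)]
  refine HasDerivWithinAt.fun_sum fun i _ => ?_
  exact (ContinuousLinearMap.smulRightL ℝ E W (LinearMap.toContinuousLinearMap
      ((Module.finBasis ℝ E).coord i))).hasFDerivAt.comp_hasDerivWithinAt t (h _)

/-- The derivative of the squared norm of a skew form in a moving inner product. -/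
theorem hasDerivWithinAt_normSq {B α : ℝ → E →L[ℝ] E →L[ℝ] ℝ} {B' α' : E →L[ℝ] E →L[ℝ] ℝ}
    {S : Set ℝ} {t : ℝ} (hS : UniqueDiffWithinAt ℝ S t)
    (hB : ∀ u v, HasDerivWithinAt (fun s => B s u v) (B' u v) S t)
    (hα : ∀ u v, HasDerivWithinAt (fun s => α s u v) (α' u v) S t)
    (hBt : IsInner (B t)) (hskew : ∀ u v, α t u v = - α t v u) {e : ι → E} (he : Ortho (B t) e)
    (hcard : Fintype.card ι = Module.finrank ℝ E) :
    HasDerivWithinAt (fun s => normSq (B s) (α s))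
      (2 * ∑ i, ∑ j, α t (e i) (e j) * α' (e i) (e j)
        - 2 * ∑ i, ∑ j, ∑ p, B' (e i) (e p) * α t (e p) (e j) * α t (e i) (e j)) S t := by
  have hBd : HasDerivWithinAt B B' S t :=
    hasDerivWithinAt_clm fun u => hasDerivWithinAt_clm fun v => hB u v
  have hαd : HasDerivWithinAt α α' S t :=
    hasDerivWithinAt_clm fun u => hasDerivWithinAt_clm fun v => hα u v
  obtain ⟨E₀, hE₀⟩ := hBt.isInvertible
  have hinv : ∀ᶠ s in 𝓝[S] t, (B s).IsInvertible := by
    have : ∀ᶠ B' in 𝓝 (B t), ContinuousLinearMap.IsInvertible B' := by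
      rw [← hE₀]
      filter_upwards [ContinuousLinearEquiv.nhds E₀] with L hL
      obtain ⟨e, he⟩ := hL
      exact ⟨e, he⟩
    exact hBd.continuousWithinAt.eventually this
  let β : ι → ℝ → E := fun i s => (B s).inverse (B t (e i))
  have hβt : ∀ i, β i t = e i := fun i => hBt.isInvertible.inverse_apply_self _
  have hβ : ∀ i, HasDerivWithinAt (β i) (-∑ p, B' (e i) (e p) • e p) S t := by
    intro i
    have h1 : DifferentiableAt ℝ (ContinuousLinearMap.inverse (R := ℝ) (M := E)
        (M₂ := E →L[ℝ] ℝ)) (B t) := by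
      have := contDiffAt_map_inverse (𝕜 := ℝ) (n := 1) E₀
      rw [hE₀] at this
      exact this.differentiableAt (by simp)
    have h2 := (h1.hasFDerivAt.comp_hasDerivWithinAt t hBd).clm_apply
      (hasDerivWithinAt_const t S (B t (e i)))
    obtain ⟨x, hx⟩ : ∃ x, HasDerivWithinAt (β i) x S t := ⟨_, h2⟩
    have hm : HasDerivWithinAt (fun s => B s (β i s)) (B' (β i t) + B t x) S t :=
      hBd.clm_apply hx
    have hz : HasDerivWithinAt (fun s => B s (β i s)) 0 S t := by
      refine (hasDerivWithinAt_const t S (B t (e i))).congr_of_eventuallyEq ?_ ?_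
      · filter_upwards [hinv] with s hs using hs.self_apply_inverse _
      · exact hBt.isInvertible.self_apply_inverse _
    have h0 : B' (e i) + B t x = 0 := by
      have := hS.eq_deriv _ hm hz
      rwa [hβt] at this
    have hx' : x = -∑ p, B' (e i) (e p) • e p := by
      rw [he.expand hcard x, ← Finset.sum_neg_distrib]
      refine Finset.sum_congr rfl fun p _ => ?_
      have := congrArg (fun L : E →L[ℝ] ℝ => L (e p)) h0
      simp only [add_apply, zero_apply] at this
      rw [← neg_smul]
      congr 1
      linarith
    rwa [← hx']
  have hfun : ∀ s, normSq (B s) (α s) = ∑ i, ∑ j, α s (e i) (e j) * α s (β i s) (β j s) := fun s =>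
    normSq_eq_dual (B s) (α s) (ξ := fun i => B t (e i)) (he.expand_dual hBt hcard)
  rw [funext hfun]
  have hd := HasDerivWithinAt.fun_sum (u := Finset.univ) fun i (_ : i ∈ Finset.univ) =>
    HasDerivWithinAt.fun_sum (u := Finset.univ) fun j (_ : j ∈ Finset.univ) =>
    (hα (e i) (e j)).mul ((hαd.clm_apply (hβ i)).clm_apply (hβ j))
  refine hd.congr_deriv ?_
  simp only [hβt, map_neg, map_sum, map_smul, sum_apply, smul_apply, smul_eq_mul, neg_apply,
    add_apply]
  have e1 : ∀ i j, α' (e i) (e j) * α t (e i) (e j) + α t (e i) (e j) * (α' (e i) (e j)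
      + -∑ p, B' (e i) (e p) * α t (e p) (e j) + -∑ p, B' (e j) (e p) * α t (e i) (e p))
      = 2 * (α t (e i) (e j) * α' (e i) (e j))
        - ∑ p, B' (e i) (e p) * α t (e p) (e j) * α t (e i) (e j)
        - ∑ p, B' (e j) (e p) * α t (e p) (e i) * α t (e j) (e i) := by
    intro i j
    have : ∀ p, B' (e j) (e p) * α t (e p) (e i) * α t (e j) (e i)
        = B' (e j) (e p) * α t (e i) (e p) * α t (e i) (e j) := fun p => by
      rw [hskew (e p), hskew (e j)]; ring
    rw [Finset.sum_congr rfl fun p _ => this p]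
    simp only [← Finset.sum_mul]
    ring
  simp only [e1, Finset.sum_sub_distrib, ← Finset.mul_sum]
  rw [Finset.sum_comm (f := fun i j => ∑ p, B' (e j) (e p) * α t (e p) (e i) * α t (e j) (e i))]
  ring

end NormSq

/-! ### The evolution of the pulled-back Kähler form -/

section LagrangianEstimate

variable {W : Type*} [NormedAddCommGroup W] [NormedSpace ℝ W] [FiniteDimensional ℝ W]
  {ι : Type*} [Fintype ι] [DecidableEq ι]

theorem abs_sum_le_card_mul {f : ι → ℝ} {C : ℝ} (h : ∀ i, |f i| ≤ C) :
    |∑ i, f i| ≤ Fintype.card ι * C := by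
  refine (Finset.abs_sum_le_sum_abs _ _).trans ((Finset.sum_le_sum fun i _ => h i).trans ?_)
  simp

/-- Decomposition into the tangential part in the frame `s` and the normal part in the frame `ν`. -/
theorem expand_two {B : W →L[ℝ] W →L[ℝ] ℝ} (hB : IsInner B) {s ν : ι → W} (hs : Ortho B s)
    (hν : Ortho B ν) (hsν : ∀ i j, B (s i) (ν j) = 0)
    (hW : 2 * Fintype.card ι = Module.finrank ℝ W) (x : W) :
    x = ∑ p, B x (s p) • s p + ∑ q, B x (ν q) • ν q := by
  have h := (Ortho.sum_elim hB hs hν hsν).expand (by simp [← hW, two_mul]) x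
  simpa [Fintype.sum_sum_type] using h

theorem parseval_two {B : W →L[ℝ] W →L[ℝ] ℝ} (hB : IsInner B) {s ν : ι → W} (hs : Ortho B s)
    (hν : Ortho B ν) (hsν : ∀ i j, B (s i) (ν j) = 0)
    (hW : 2 * Fintype.card ι = Module.finrank ℝ W) (x y : W) :
    B x y = ∑ p, B x (s p) * B y (s p) + ∑ q, B x (ν q) * B y (ν q) := by
  conv_lhs => rw [expand_two hB hs hν hsν hW x]
  simp only [map_add, map_sum, map_smul, add_apply, sum_apply, smul_apply, smul_eq_mul,
    hB.symm y]

/-- The algebraic part of the maximum principle for the Lagrangian condition: on a frame `s` of a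
half-dimensional subspace with normal frame `ν`, the reaction terms in the evolution of the
restriction `α` of the Kähler form are bounded by a multiple of `|α|²`. -/
theorem reaction_le {B : W →L[ℝ] W →L[ℝ] ℝ} (hB : IsInner B) {J : W →L[ℝ] W}
    (hJ : ∀ x, J (J x) = -x) (hJB : ∀ x y, B (J x) (J y) = B x y)
    {R : W →ₗ[ℝ] W →ₗ[ℝ] W →ₗ[ℝ] W} (hRa : ∀ x y a, R x y a = - R y x a)
    (hRs : ∀ x y a b, B (R x y a) b = - B (R x y b) a)
    (hRp : ∀ x y a b, B (R x y a) b = B (R a b x) y)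
    (hRJ : ∀ x y a, R x y (J a) = J (R x y a)) {c : ℝ} {s ν : ι → W}
    (hE : ∀ x y, ∑ k, B (R (s k) x y) (s k) + ∑ q, B (R (ν q) x y) (ν q) = c * B x y)
    (hs : Ortho B s)
    (hν : Ortho B ν) (hsν : ∀ i j, B (s i) (ν j) = 0)
    (hW : 2 * Fintype.card ι = Module.finrank ℝ W) {A Y : ι → ι → W} {DH : ι → W}
    (hAn : ∀ k i p, B (A k i) (s p) = 0)
    (hY : ∀ k i p, B (Y k i) (s p) = - B (A k i) (A k p))
    (hDH : ∀ i q, B (DH i) (ν q) = ∑ k, (B (Y k i) (ν q) - B (R (s k) (s i) (s k)) (ν q)))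
    {K : ℝ} (hA : ∀ k i q, |B (A k i) (ν q)| ≤ K)
    (hR : ∀ x y z w, B x x = 1 → B y y = 1 → B z z = 1 → B w w = 1 → |B (R x y z) w| ≤ K) :
    4 * ∑ i, ∑ j, B (J (s i)) (s j) * ∑ q, B (DH i) (ν q) * B (J (ν q)) (s j)
      ≤ ∑ k, ∑ i, ∑ j, 2 * B (J (s i)) (s j) * (B (J (Y k i)) (s j) + B (J (s i)) (Y k j)
          + 2 * B (J (A k i)) (A k j))
        + (2 * |c| + (Fintype.card ι : ℝ) ^ 5 * (12 * K + 8 * K ^ 2)) *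
          ∑ i, ∑ j, B (J (s i)) (s j) ^ 2 := by
  classical
  by_cases hι : IsEmpty ι
  · simp
  rw [not_isEmpty_iff] at hι
  obtain ⟨i₀⟩ := hι
  have hm1 : (1 : ℝ) ≤ Fintype.card ι := by
    exact_mod_cast Fintype.card_pos_iff.2 ⟨i₀⟩
  have hK : 0 ≤ K := (abs_nonneg _).trans (hA i₀ i₀ i₀)
  have hsk : ∀ x y, B (J x) y = - B x (J y) := fun x y => by
    rw [← hJB x (J y), hJ, map_neg, neg_neg]
  have hsk' : ∀ x y, B (J x) y = - B (J y) x := fun x y => by rw [hsk, hB.symm]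
  set α : ι → ι → ℝ := fun i j => B (J (s i)) (s j) with hα
  set b : ι → ι → ℝ := fun k q => B (J (s k)) (ν q) with hb
  set γ : ι → ι → ℝ := fun q p => B (J (ν q)) (ν p) with hγ
  set N : ℝ := ∑ i, ∑ j, α i j ^ 2 with hN
  have hβ : ∀ q j, B (J (ν q)) (s j) = - b j q := fun q j => hsk' _ _
  have hpars := parseval_two hB hs hν hsν hW
  have hexp := expand_two hB hs hν hsν hW
  -- `I1` and `I2` are relations for the orthogonal matrix `(α, b; -bᵀ, γ)` of the isometry `J`
  have I1 : ∀ k, ∑ p, α k p ^ 2 + ∑ q, b k q ^ 2 = 1 := fun k => by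
    have := hpars (J (s k)) (J (s k))
    rw [hJB, hs k k, if_pos rfl] at this
    simp only [sq]; exact this.symm
  have I2 : ∀ q q', ∑ k, b k q * b k q' + ∑ p, γ q p * γ q' p = if q = q' then 1 else 0 := by
    intro q q'
    have := hpars (J (ν q)) (J (ν q'))
    rw [hJB, hν q q'] at this
    simp only [hβ, neg_mul_neg] at this
    exact this.symm
  -- the tangential and the normal block of an orthogonal matrix have the same norm
  have hNγ : ∑ q, ∑ p, γ q p ^ 2 = N := by
    have h1 : N + ∑ k, ∑ q, b k q ^ 2 = Fintype.card ι := by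
      rw [hN, ← Finset.sum_add_distrib, Finset.sum_congr rfl fun k _ => I1 k]; simp
    have h2 : ∑ q, ∑ k, b k q ^ 2 + ∑ q, ∑ p, γ q p ^ 2 = Fintype.card ι := by
      rw [← Finset.sum_add_distrib]
      have : ∀ q, ∑ k, b k q ^ 2 + ∑ p, γ q p ^ 2 = 1 := fun q => by
        have := I2 q q
        rw [if_pos rfl] at this
        simpa only [sq] using this
      rw [Finset.sum_congr rfl fun q _ => this q]; simp
    rw [Finset.sum_comm] at h2
    linarith
  have hN0 : 0 ≤ N := Finset.sum_nonneg fun i _ => Finset.sum_nonneg fun j _ => sq_nonneg _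
  obtain ⟨r, hr0, hrN⟩ : ∃ r : ℝ, 0 ≤ r ∧ r * r = N :=
    ⟨√N, Real.sqrt_nonneg _, Real.mul_self_sqrt hN0⟩
  have hαr : ∀ i j, |α i j| ≤ r := fun i j => by
    refine abs_le_of_sq_le_sq ?_ hr0
    rw [sq r, hrN]
    exact (Finset.single_le_sum (f := fun j => α i j ^ 2) (fun j _ => sq_nonneg _)
      (Finset.mem_univ j)).trans (Finset.single_le_sum (f := fun i => ∑ j, α i j ^ 2)
      (fun i _ => Finset.sum_nonneg fun j _ => sq_nonneg _) (Finset.mem_univ i))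
  have hγr : ∀ i j, |γ i j| ≤ r := fun i j => by
    refine abs_le_of_sq_le_sq ?_ hr0
    rw [sq r, hrN, ← hNγ]
    exact (Finset.single_le_sum (f := fun j => γ i j ^ 2) (fun j _ => sq_nonneg _)
      (Finset.mem_univ j)).trans (Finset.single_le_sum (f := fun i => ∑ j, γ i j ^ 2)
      (fun i _ => Finset.sum_nonneg fun j _ => sq_nonneg _) (Finset.mem_univ i))
  have hα1 : ∀ i j, |α i j| ≤ 1 := fun i j => by
    refine abs_le_of_sq_le_sq ?_ zero_le_one
    rw [one_pow, ← I1 i]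
    exact (Finset.single_le_sum (f := fun j => α i j ^ 2) (fun j _ => sq_nonneg _)
      (Finset.mem_univ j)).trans (le_add_of_nonneg_right
        (Finset.sum_nonneg fun j _ => sq_nonneg _))
  have hb1 : ∀ i j, |b i j| ≤ 1 := fun i j => by
    refine abs_le_of_sq_le_sq ?_ zero_le_one
    rw [one_pow, ← I1 i]
    exact (Finset.single_le_sum (f := fun j => b i j ^ 2) (fun j _ => sq_nonneg _)
      (Finset.mem_univ j)).trans (le_add_of_nonneg_left
        (Finset.sum_nonneg fun j _ => sq_nonneg _))
  have hγ1 : ∀ i j, |γ i j| ≤ 1 := fun i j => by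
    refine abs_le_of_sq_le_sq ?_ zero_le_one
    have := I2 i i
    rw [if_pos rfl] at this
    rw [one_pow, ← this]
    simp only [← sq]
    exact (Finset.single_le_sum (f := fun j => γ i j ^ 2) (fun j _ => sq_nonneg _)
      (Finset.mem_univ j)).trans (le_add_of_nonneg_left
        (Finset.sum_nonneg fun j _ => sq_nonneg _))
  have hss : ∀ i, B (s i) (s i) = 1 := fun i => by rw [hs i i, if_pos rfl]
  have hνν : ∀ i, B (ν i) (ν i) = 1 := fun i => by rw [hν i i, if_pos rfl]
  have hJs : ∀ i, B (J (s i)) (J (s i)) = 1 := fun i => by rw [hJB, hss]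
  -- the decomposition of `η(x, s_j)` into tangential and normal parts
  have hηx : ∀ x j, B (J x) (s j) = ∑ p, B x (s p) * α p j - ∑ q, B x (ν q) * b j q := by
    intro x j
    conv_lhs => rw [hexp x]
    simp only [map_add, map_sum, map_smul, add_apply, sum_apply, smul_apply, smul_eq_mul, hβ,
      mul_neg, Finset.sum_neg_distrib, hα]
    ring
  let P : ι → ι → ℝ := fun i j => ∑ k, B (J (R (s k) (s i) (s k))) (s j)
  let τ : ι → ι → W → W → ℝ := fun i j x y => B (R x (s i) (J (s j))) y
  let err : ι → ι → ℝ := fun i j => ∑ k, τ i j (J (s k)) (J (s k)) - ∑ q, τ i j (ν q) (ν q)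
  -- the two sums are traces of the curvature over the `s k` and over the `J (s k)`; if the
  -- `J (s k)` spanned the normal space they would add up to the Einstein trace, and `err` is the
  -- correction
  have hP : ∀ i j, P i j - P j i = - c * α i j + err i j := by
    intro i j
    have hRJJ : ∀ x y a, R (J x) (J y) a = R x y a := fun x y a => hB.ext fun w => by
      rw [hRp, hRJ, hJB, hRp]
    have hRJm : ∀ x y a, R x (J y) a = - R (J x) y a := fun x y a => by
      rw [← hRJJ (J x) y a, hJ, map_neg, LinearMap.neg_apply, LinearMap.neg_apply, neg_neg]
    have h1 : ∀ i j k, B (J (R (s k) (s i) (s k))) (s j) = B (R (s k) (s i) (J (s j))) (s k) := by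
      intro i j k
      rw [hsk, hRs, neg_neg]
    have h2 : ∀ k, B (R (s k) (s j) (J (s i))) (s k) = - τ i j (J (s k)) (J (s k)) := by
      intro k
      change _ = - B (R (J (s k)) (s i) (J (s j))) (J (s k))
      rw [hRs (J (s k)), neg_neg, hRJ (J (s k)), hJB, hRp (s k), hRa (J (s i)), hRJm, neg_neg]
    have h3 := hE (s i) (J (s j))
    have h4 : B (s i) (J (s j)) = - α i j := by rw [hα]; simp only [hsk, neg_neg]
    rw [h4] at h3
    simp only [P, h1, h2, Finset.sum_neg_distrib, err]
    change _ + ∑ q, τ i j (ν q) (ν q) = _ at h3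
    linarith
  -- every term of `err` has a factor `α` or `γ`
  have herr : ∀ i j, |err i j| ≤ (Fintype.card ι : ℝ) ^ 3 * (4 * K * r) := by
    intro i j
    have hτ : ∀ x y, B x x = 1 → B y y = 1 → |τ i j x y| ≤ K := fun x y hx hy =>
      hR _ _ _ _ hx (hss i) (hJs j) hy
    have e1 : ∀ k, τ i j (J (s k)) (J (s k))
        = ∑ p, ∑ p', α k p * α k p' * τ i j (s p) (s p')
          + ∑ p, ∑ q, α k p * b k q * (τ i j (s p) (ν q) + τ i j (ν q) (s p))
          + ∑ q, ∑ q', b k q * b k q' * τ i j (ν q) (ν q') := by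
      intro k
      have h0 : J (s k) = ∑ p, α k p • s p + ∑ q, b k q • ν q := hexp _
      have hl : ∀ y, τ i j (J (s k)) y = ∑ p, α k p * τ i j (s p) y
          + ∑ q, b k q * τ i j (ν q) y := fun y => by
        simp only [τ]
        rw [h0]
        simp only [map_add, map_sum, map_smul, add_apply, sum_apply, smul_apply, smul_eq_mul,
          LinearMap.add_apply, LinearMap.sum_apply, LinearMap.smul_apply]
      have hr : ∀ x, τ i j x (J (s k)) = ∑ p, α k p * τ i j x (s p)
          + ∑ q, b k q * τ i j x (ν q) := fun x => by
        simp only [τ]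
        conv_lhs => rw [h0]
        simp only [map_add, map_sum, map_smul, smul_eq_mul]
      rw [hl]
      simp only [hr, mul_add, Finset.mul_sum, Finset.sum_add_distrib, ← mul_assoc]
      rw [Finset.sum_comm (f := fun q p => b k q * α k p * τ i j (ν q) (s p))]
      simp only [mul_comm (b k _) (α k _)]
      ring
    have e2 : ∑ k, ∑ q, ∑ q', b k q * b k q' * τ i j (ν q) (ν q')
        = ∑ q, τ i j (ν q) (ν q) - ∑ q, ∑ q', ∑ p, γ q p * γ q' p * τ i j (ν q) (ν q') := by
      rw [Finset.sum_comm, ← Finset.sum_sub_distrib]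
      refine Finset.sum_congr rfl fun q _ => ?_
      rw [Finset.sum_comm]
      have : ∀ q', ∑ k, b k q * b k q' * τ i j (ν q) (ν q')
          = (if q = q' then 1 else 0) * τ i j (ν q) (ν q')
            - ∑ p, γ q p * γ q' p * τ i j (ν q) (ν q') := fun q' => by
        rw [← I2 q q', ← Finset.sum_mul, ← Finset.sum_mul]; ring
      simp only [this, Finset.sum_sub_distrib, ite_mul, one_mul, zero_mul, Finset.sum_ite_eq,
        Finset.mem_univ, if_true]
    have e3 : err i j = ∑ k, ∑ p, ∑ p', α k p * α k p' * τ i j (s p) (s p')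
        + ∑ k, ∑ p, ∑ q, α k p * b k q * (τ i j (s p) (ν q) + τ i j (ν q) (s p))
        - ∑ q, ∑ q', ∑ p, γ q p * γ q' p * τ i j (ν q) (ν q') := by
      simp only [err, e1, Finset.sum_add_distrib, e2]
      ring
    have prod : ∀ {x y z C : ℝ}, |x| ≤ r → |y| ≤ 1 → |z| ≤ C → |x * y * z| ≤ C * r := by
      intro x y z C hx hy hz
      rw [abs_mul, abs_mul, mul_comm C r]
      have h1 : |x| * |y| ≤ r := by
        have := mul_le_mul hx hy (abs_nonneg _) hr0
        linarith
      exact mul_le_mul h1 hz (abs_nonneg _) hr0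
    have b1 : |∑ k, ∑ p, ∑ p', α k p * α k p' * τ i j (s p) (s p')|
        ≤ Fintype.card ι * (Fintype.card ι * (Fintype.card ι * (K * r))) :=
      abs_sum_le_card_mul fun k => abs_sum_le_card_mul fun p => abs_sum_le_card_mul fun p' =>
        prod (hαr _ _) (hα1 _ _) (hτ _ _ (hss _) (hss _))
    have b2 : |∑ k, ∑ p, ∑ q, α k p * b k q * (τ i j (s p) (ν q) + τ i j (ν q) (s p))|
        ≤ Fintype.card ι * (Fintype.card ι * (Fintype.card ι * ((K + K) * r))) :=
      abs_sum_le_card_mul fun k => abs_sum_le_card_mul fun p => abs_sum_le_card_mul fun p' =>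
        prod (hαr _ _) (hb1 _ _) ((abs_add_le _ _).trans
          (add_le_add (hτ _ _ (hss _) (hνν _)) (hτ _ _ (hνν _) (hss _))))
    have b3 : |∑ q, ∑ q', ∑ p, γ q p * γ q' p * τ i j (ν q) (ν q')|
        ≤ Fintype.card ι * (Fintype.card ι * (Fintype.card ι * (K * r))) :=
      abs_sum_le_card_mul fun k => abs_sum_le_card_mul fun p => abs_sum_le_card_mul fun p' =>
        prod (hγr _ _) (hγ1 _ _) (hτ _ _ (hνν _) (hνν _))
    rw [e3]
    refine (abs_sub _ _).trans ((add_le_add ((abs_add_le _ _).trans (add_le_add b1 b2)) b3).trans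
      (le_of_eq ?_))
    ring
  have hαα : ∀ {i j p : ι} {x C : ℝ}, |x| ≤ C → |α i j * α p j * x| ≤ r * r * C := by
    intro i j p x C hx
    rw [abs_mul, abs_mul]
    exact mul_le_mul (mul_le_mul (hαr _ _) (hαr _ _) (abs_nonneg _) hr0) hx (abs_nonneg _)
      (mul_nonneg hr0 hr0)
  -- the four error terms in the evolution of `N = r²` have two factors of size at most `r`
  have hT1 : |∑ i, ∑ j, ∑ k, ∑ p, α i j * α p j * B (A k i) (A k p)|
      ≤ (Fintype.card ι : ℝ) ^ 5 * (K ^ 2 * N) := by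
    have h : ∀ k i p, |B (A k i) (A k p)| ≤ Fintype.card ι * (K * K) := fun k i p => by
      rw [hpars (A k i) (A k p)]
      simp only [hAn, mul_zero, Finset.sum_const_zero, zero_add]
      exact abs_sum_le_card_mul fun q => by
        rw [abs_mul]; exact mul_le_mul (hA _ _ _) (hA _ _ _) (abs_nonneg _) hK
    refine (abs_sum_le_card_mul fun i => abs_sum_le_card_mul fun j => abs_sum_le_card_mul fun k =>
      abs_sum_le_card_mul fun p => hαα (h k i p)).trans (le_of_eq ?_)
    rw [← hrN]
    ring
  have hT2 : |∑ i, ∑ j, ∑ k, α i j * B (J (A k i)) (A k j)|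
      ≤ (Fintype.card ι : ℝ) ^ 5 * (K ^ 2 * N) := by
    have h : ∀ k i j, |B (J (A k i)) (A k j)|
        ≤ Fintype.card ι * (Fintype.card ι * (K * K * r)) := fun k i j => by
      have h0 : A k i = ∑ q, B (A k i) (ν q) • ν q := by
        conv_lhs => rw [hexp (A k i)]
        simp [hAn]
      have h1 : B (J (A k i)) (A k j)
          = ∑ q, ∑ p, B (A k i) (ν q) * B (A k j) (ν p) * γ q p := by
        rw [hpars]
        simp only [hAn, mul_zero, Finset.sum_const_zero, zero_add]
        rw [Finset.sum_comm]
        refine Finset.sum_congr rfl fun p _ => ?_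
        conv_lhs => rw [h0]
        simp only [map_sum, map_smul, sum_apply, smul_apply, smul_eq_mul, Finset.sum_mul, hγ]
        exact Finset.sum_congr rfl fun q _ => by ring
      rw [h1]
      refine abs_sum_le_card_mul fun q => abs_sum_le_card_mul fun p => ?_
      rw [abs_mul, abs_mul]
      exact mul_le_mul (mul_le_mul (hA _ _ _) (hA _ _ _) (abs_nonneg _) hK) (hγr _ _)
        (abs_nonneg _) (by positivity)
    refine (abs_sum_le_card_mul fun i => abs_sum_le_card_mul fun j => abs_sum_le_card_mul fun k =>
      show |_| ≤ r * (Fintype.card ι * (Fintype.card ι * (K * K * r))) from ?_).trans (le_of_eq ?_)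
    · rw [abs_mul]
      exact mul_le_mul (hαr _ _) (h k i j) (abs_nonneg _) hr0
    · rw [← hrN]
      ring
  have hT3 : |∑ i, ∑ j, ∑ k, ∑ p, α i j * α p j * B (R (s k) (s i) (s k)) (s p)|
      ≤ (Fintype.card ι : ℝ) ^ 4 * (K * N) := by
    refine (abs_sum_le_card_mul fun i => abs_sum_le_card_mul fun j => abs_sum_le_card_mul fun k =>
      abs_sum_le_card_mul fun p => hαα (hR _ _ _ _ (hss k) (hss i) (hss k) (hss p))).trans
      (le_of_eq ?_)
    rw [← hrN]
    ring
  have hT4 : |∑ i, ∑ j, α i j * err i j| ≤ (Fintype.card ι : ℝ) ^ 5 * (4 * K * N) := by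
    refine (abs_sum_le_card_mul fun i => abs_sum_le_card_mul fun j =>
      show |_| ≤ r * ((Fintype.card ι : ℝ) ^ 3 * (4 * K * r)) from ?_).trans (le_of_eq ?_)
    · rw [abs_mul]
      exact mul_le_mul (hαr _ _) (herr i j) (abs_nonneg _) hr0
    · rw [← hrN]
      ring
  have hmain : 4 * ∑ i, ∑ j, α i j * ∑ q, B (DH i) (ν q) * B (J (ν q)) (s j)
      = ∑ k, ∑ i, ∑ j, 2 * α i j * (B (J (Y k i)) (s j) + B (J (s i)) (Y k j)
          + 2 * B (J (A k i)) (A k j))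
        + 4 * (∑ i, ∑ j, ∑ k, ∑ p, α i j * α p j * B (A k i) (A k p))
        - 4 * (∑ i, ∑ j, ∑ k, α i j * B (J (A k i)) (A k j))
        + 4 * (∑ i, ∑ j, ∑ k, ∑ p, α i j * α p j * B (R (s k) (s i) (s k)) (s p))
        + 2 * c * N - 2 * ∑ i, ∑ j, α i j * err i j := by
    have hαs : ∀ i j, α i j = - α j i := fun i j => hsk' _ _
    have swap : ∀ X : ι → ι → ℝ, ∑ i, ∑ j, α i j * X j i = - ∑ i, ∑ j, α i j * X i j := by
      intro X
      rw [Finset.sum_comm, ← Finset.sum_neg_distrib]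
      refine Finset.sum_congr rfl fun i _ => ?_
      rw [← Finset.sum_neg_distrib]
      exact Finset.sum_congr rfl fun j _ => by rw [hαs j i]; ring
    have e1 : ∀ i j, ∑ q, B (DH i) (ν q) * B (J (ν q)) (s j)
        = ∑ k, B (J (Y k i)) (s j) + ∑ k, ∑ p, α p j * B (A k i) (A k p) - P i j
          + ∑ k, ∑ p, α p j * B (R (s k) (s i) (s k)) (s p) := by
      intro i j
      simp only [hβ, hDH, Finset.sum_mul, P]
      rw [Finset.sum_comm, ← Finset.sum_add_distrib, ← Finset.sum_sub_distrib,
        ← Finset.sum_add_distrib]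
      refine Finset.sum_congr rfl fun k _ => ?_
      rw [hηx (Y k i) j, hηx (R (s k) (s i) (s k)) j]
      simp only [hY, sub_mul, Finset.sum_sub_distrib, mul_neg, neg_mul, Finset.sum_neg_distrib,
        mul_comm (α _ j)]
      ring
    have e2 : ∑ k, ∑ i, ∑ j, 2 * α i j * (B (J (Y k i)) (s j) + B (J (s i)) (Y k j)
          + 2 * B (J (A k i)) (A k j))
        = 4 * (∑ i, ∑ j, α i j * ∑ k, B (J (Y k i)) (s j))
          + 4 * ∑ i, ∑ j, ∑ k, α i j * B (J (A k i)) (A k j) := by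
      have h1 : ∀ k, ∑ i, ∑ j, 2 * α i j * (B (J (Y k i)) (s j) + B (J (s i)) (Y k j)
          + 2 * B (J (A k i)) (A k j))
          = 4 * (∑ i, ∑ j, α i j * B (J (Y k i)) (s j))
            + 4 * ∑ i, ∑ j, α i j * B (J (A k i)) (A k j) := by
        intro k
        have h2 := swap fun i j => B (J (Y k i)) (s j)
        have h3 : ∀ i j, B (J (s i)) (Y k j) = - B (J (Y k j)) (s i) := fun i j => hsk' _ _
        have h4 : ∀ i j, 2 * α i j * (B (J (Y k i)) (s j) + B (J (s i)) (Y k j)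
            + 2 * B (J (A k i)) (A k j)) = 2 * (α i j * B (J (Y k i)) (s j))
            - 2 * (α i j * B (J (Y k j)) (s i)) + 4 * (α i j * B (J (A k i)) (A k j)) :=
          fun i j => by rw [h3]; ring
        simp only [h4, Finset.sum_add_distrib, Finset.sum_sub_distrib, ← Finset.mul_sum]
        rw [h2]
        ring
      simp only [h1, Finset.sum_add_distrib, ← Finset.mul_sum]
      congr 2
      · rw [Finset.sum_comm]
        refine Finset.sum_congr rfl fun i _ => ?_
        rw [Finset.sum_comm]
        simp only [Finset.mul_sum]
      · rw [Finset.sum_comm]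
        refine Finset.sum_congr rfl fun i _ => ?_
        simp only [Finset.mul_sum]
        rw [Finset.sum_comm]
    have e3 : 2 * ∑ i, ∑ j, α i j * P i j = - c * N + ∑ i, ∑ j, α i j * err i j := by
      have h1 := swap P
      have h2 : ∑ i, ∑ j, α i j * (P i j - P j i)
          = - c * N + ∑ i, ∑ j, α i j * err i j := by
        rw [hN]
        simp only [Finset.mul_sum, ← Finset.sum_add_distrib]
        exact Finset.sum_congr rfl fun i _ => Finset.sum_congr rfl fun j _ => by
          rw [hP]; ring
      rw [← h2]
      simp only [mul_sub, Finset.sum_sub_distrib]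
      rw [h1]; ring
    rw [e2]
    simp only [e1, mul_add, mul_sub, Finset.sum_add_distrib, Finset.sum_sub_distrib]
    have e4 : ∀ X : ι → ι → ι → ι → ℝ, ∑ i, ∑ j, α i j * ∑ k, ∑ p, α p j * X i j k p
        = ∑ i, ∑ j, ∑ k, ∑ p, α i j * α p j * X i j k p := fun X => by
      simp only [Finset.mul_sum, mul_assoc]
    rw [e4 fun i j k p => B (A k i) (A k p), e4 fun i j k p => B (R (s k) (s i) (s k)) (s p)]
    linarith
  have hm45 : (Fintype.card ι : ℝ) ^ 4 ≤ (Fintype.card ι : ℝ) ^ 5 :=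
    pow_le_pow_right₀ hm1 (by norm_num)
  have h45 : (Fintype.card ι : ℝ) ^ 4 * (K * N) ≤ (Fintype.card ι : ℝ) ^ 5 * (K * N) :=
    mul_le_mul_of_nonneg_right hm45 (mul_nonneg hK hN0)
  have hc : c * N ≤ |c| * N := mul_le_mul_of_nonneg_right (le_abs_self c) hN0
  rw [hmain]
  have a1 := (abs_le.1 hT1).2
  have a2 := (abs_le.1 hT2).1
  have a3 := (abs_le.1 hT3).2
  have a4 := (abs_le.1 hT4).1
  nlinarith

end LagrangianEstimate

/-! ### Kähler structures on open subsets of a vector space -/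

section KahlerCoordinates

variable {E : Type*} [NormedAddCommGroup E] [NormedSpace ℝ E] [FiniteDimensional ℝ E]
  {W : Type*} [NormedAddCommGroup W] [NormedSpace ℝ W] [FiniteDimensional ℝ W]
  {ι : Type*} [Fintype ι] [DecidableEq ι]

/-- The Kähler form `(x, y) ↦ G(J x, y)`. -/
def kform (G : W → W →L[ℝ] W →L[ℝ] ℝ) (J : W → W →L[ℝ] W) (q : W) : W →L[ℝ] W →L[ℝ] ℝ :=
  (G q) ∘L (J q)

theorem kform_apply (G : W → W →L[ℝ] W →L[ℝ] ℝ) (J : W → W →L[ℝ] W) (q x y : W) :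
    kform G J q x y = G q (J q x) y := rfl

/-- A Kähler structure on an open subset of a vector space; that `J` is parallel is expressed
through the Kähler form. -/
structure KahlerOn (G : W → W →L[ℝ] W →L[ℝ] ℝ) (J : W → W →L[ℝ] W) (V : Set W) : Prop where
  metric : MetricOn G V
  sq : ∀ q ∈ V, ∀ x, J q (J q x) = -x
  compat : ∀ q ∈ V, ∀ x y, G q (J q x) (J q y) = G q x y
  parallel : ParallelOn (chr G) (kform G J) V

variable {G : W → W →L[ℝ] W →L[ℝ] ℝ} {J : W → W →L[ℝ] W} {f : E → W} {U : Set E} {V : Set W}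

namespace KahlerOn

theorem skew (h : KahlerOn G J V) {q : W} (hq : q ∈ V) (x y : W) :
    G q (J q x) y = - G q x (J q y) := by
  rw [← h.compat q hq x (J q y), h.sq q hq, map_neg, neg_neg]

theorem curv_comm (h : KahlerOn G J V) {q : W} (hq : q ∈ V) (u v a : W) :
    curv (chr G) q u v (J q a) = J q (curv (chr G) q u v a) := by
  refine (h.metric.inner q hq).ext fun b => ?_
  have := h.parallel.curv_add hq u v a b
  rw [kform_apply, kform_apply, (h.metric.inner q hq).symm (J q a),
    h.metric.curv_skew hq u v b (J q a)] at this
  linarith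

end KahlerOn

theorem hasDerivWithinAt_pull_bilin {F : ℝ → E → W} {t : ℝ} {S : Set ℝ} {z : E} {H : W} {DH : E → W}
    {Γ : W → W →L[ℝ] W →L[ℝ] W} {η : W → W →L[ℝ] W →L[ℝ] ℝ}
    (hη : ParallelOn Γ η V) (hV : F t z ∈ V)
    (hcov : ∀ v, CovAt Γ (fun s => F s z) (fun s => fderiv ℝ (F s) z v) S t H (DH v)) (u v : E) :
    HasDerivWithinAt (fun s => pull η (F s) z u v)
      (η (F t z) (DH u) (fderiv ℝ (F t) z v) + η (F t z) (fderiv ℝ (F t) z u) (DH v)) S t :=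
  hη.hasDerivWithinAt hV (hcov u) (hcov v)

theorem normSq_deriv_eq {B : W →L[ℝ] W →L[ℝ] ℝ} (hB : IsInner B) {J : W →L[ℝ] W}
    (hsk : ∀ x y, B (J x) y = - B (J y) x) {s ν : ι → W} (hs : Ortho B s)
    (hν : Ortho B ν) (hsν : ∀ i j, B (s i) (ν j) = 0)
    (hW : 2 * Fintype.card ι = Module.finrank ℝ W) {DH : ι → W} {α' B' : ι → ι → ℝ}
    (hα' : ∀ i j, α' i j = B (J (DH i)) (s j) + B (J (s i)) (DH j))
    (hB' : ∀ i j, B' i j = B (DH i) (s j) + B (s i) (DH j)) :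
    2 * ∑ i, ∑ j, B (J (s i)) (s j) * α' i j
        - 2 * ∑ i, ∑ j, ∑ p, B' i p * B (J (s p)) (s j) * B (J (s i)) (s j)
      = 4 * ∑ i, ∑ j, B (J (s i)) (s j) * ∑ q, B (DH i) (ν q) * B (J (ν q)) (s j) := by
  have h1 : ∑ i, ∑ j, B (J (s i)) (s j) * B (J (s i)) (DH j)
      = ∑ i, ∑ j, B (J (s i)) (s j) * B (J (DH i)) (s j) := by
    rw [Finset.sum_comm]
    refine Finset.sum_congr rfl fun i _ => Finset.sum_congr rfl fun j _ => ?_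
    rw [hsk (s j) (s i), hsk (s j) (DH i)]
    ring
  have h2 : ∑ i, ∑ j, ∑ p, B (s i) (DH p) * B (J (s p)) (s j) * B (J (s i)) (s j)
      = ∑ i, ∑ j, ∑ p, B (DH i) (s p) * B (J (s p)) (s j) * B (J (s i)) (s j) := by
    rw [Finset.sum_comm, Finset.sum_comm (f := fun i j => ∑ p, B (DH i) (s p) *
      B (J (s p)) (s j) * B (J (s i)) (s j))]
    refine Finset.sum_congr rfl fun j _ => ?_
    rw [Finset.sum_comm]
    refine Finset.sum_congr rfl fun i _ => Finset.sum_congr rfl fun p _ => ?_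
    rw [hB.symm (s p)]
    ring
  have h3 : ∀ i j, B (J (DH i)) (s j) = ∑ p, B (DH i) (s p) * B (J (s p)) (s j)
      + ∑ q, B (DH i) (ν q) * B (J (ν q)) (s j) := by
    intro i j
    conv_lhs => rw [expand_two hB hs hν hsν hW (DH i)]
    simp only [map_add, map_sum, map_smul, add_apply, sum_apply, smul_apply, smul_eq_mul]
  have h4 : ∑ i, ∑ j, B (J (s i)) (s j) * B (J (DH i)) (s j)
      = ∑ i, ∑ j, ∑ p, B (DH i) (s p) * B (J (s p)) (s j) * B (J (s i)) (s j)
        + ∑ i, ∑ j, B (J (s i)) (s j) * ∑ q, B (DH i) (ν q) * B (J (ν q)) (s j) := by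
    simp only [← Finset.sum_add_distrib]
    refine Finset.sum_congr rfl fun i _ => Finset.sum_congr rfl fun j _ => ?_
    rw [h3, ← Finset.sum_mul]
    ring
  simp only [hα', hB', mul_add, add_mul, Finset.sum_add_distrib]
  rw [h1, h2, h4]
  ring

/-- The squared norm of the pulled-back Kähler form is a subsolution of a linear heat equation
along the mean curvature flow in a Kähler-Einstein manifold. -/
theorem evolution_normSq {F : ℝ → E → W} {t : ℝ} {S : Set ℝ} (hS : UniqueDiffWithinAt ℝ S t)
    {z : E} (hJ : KahlerOn G J V) (h : ImmInto G (F t) U V) (hz : z ∈ U)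
    (hcard : Fintype.card ι = Module.finrank ℝ E)
    (hW : 2 * Fintype.card ι = Module.finrank ℝ W)
    (hH : DifferentiableAt ℝ (meanCurv G (F t)) z)
    (ht : HasDerivWithinAt (fun s => F s z) (meanCurv G (F t) z) S t)
    (ht' : ∀ v, HasDerivWithinAt (fun s => fderiv ℝ (F s) z v)
      (fderiv ℝ (meanCurv G (F t)) z v) S t)
    {e : ι → E} {ν : ι → W} (he : Ortho (pull G (F t) z) e)
    (hν : Ortho (G (F t z)) ν) (hn : ∀ x q, G (F t z) (fderiv ℝ (F t) z x) (ν q) = 0)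
    {c : ℝ} (hE : ∀ x y, LinearMap.trace ℝ W (((curvL (chr G) (F t z)).flip x).flip y)
      = c * G (F t z) x y)
    {K : ℝ} (hA : ∀ k i q, |G (F t z) (sff G (F t) z (e k) (e i)) (ν q)| ≤ K)
    (hR : ∀ x y u w, G (F t z) x x = 1 → G (F t z) y y = 1 → G (F t z) u u = 1 →
      G (F t z) w w = 1 → |G (F t z) (curv (chr G) (F t z) x y u) w| ≤ K) :
    ∃ (D : ℝ) (d : ι → ℝ),
      HasDerivWithinAt (fun s => normSq (pull G (F s) z) (pull (kform G J) (F s) z)) D S t ∧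
      (∀ k, Has2DerivAt (fun r => normSq (pull G (F t) (geo (pull G (F t)) z (e k) r))
        (pull (kform G J) (F t) (geo (pull G (F t)) z (e k) r))) (d k)) ∧
      D ≤ ∑ k, d k + (2 * |c| + (Fintype.card ι : ℝ) ^ 5 * (12 * K + 8 * K ^ 2)) *
        normSq (pull G (F t) z) (pull (kform G J) (F t) z) := by
  choose X a Y hF using fun k => h.exists_frameLift hz (e k) he
  have hV := h.mapsTo hz
  have hB := h.metric.inner _ hV
  have hin := h.metricOn_pull.inner
  have hcov : ∀ v, CovAt (chr G) (fun s => F s z) (fun s => fderiv ℝ (F s) z v) S t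
      (meanCurv G (F t) z) (fderiv ℝ (meanCurv G (F t)) z v
        + chr G (F t z) (fderiv ℝ (F t) z v) (meanCurv G (F t) z)) := fun v =>
    ⟨ht, (ht' v).congr_deriv (by rw [h.metric.chr_symm hV (meanCurv G (F t) z)]; abel)⟩
  have hsk : ∀ x y, kform G J (F t z) x y = - kform G J (F t z) y x := fun x y => by
    rw [kform_apply, kform_apply, hJ.skew hV, hB.symm]
  set DH : E → W := fun v => fderiv ℝ (meanCurv G (F t)) z v
        + chr G (F t z) (fderiv ℝ (F t) z v) (meanCurv G (F t) z) with hDH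
  have hDHl : ∃ L : E →L[ℝ] W, ∀ v, L v = DH v :=
    ⟨fderiv ℝ (meanCurv G (F t)) z + ((chr G (F t z)).flip (meanCurv G (F t) z)) ∘L
      fderiv ℝ (F t) z, fun v => rfl⟩
  obtain ⟨L, hL⟩ := hDHl
  have hD := hasDerivWithinAt_normSq hS (B := fun s => pull G (F s) z)
    (α := fun s => pull (kform G J) (F s) z)
    (B' := (G (F t z)).bilinearComp L (fderiv ℝ (F t) z)
      + (G (F t z)).bilinearComp (fderiv ℝ (F t) z) L)
    (α' := (kform G J (F t z)).bilinearComp L (fderiv ℝ (F t) z)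
      + (kform G J (F t z)).bilinearComp (fderiv ℝ (F t) z) L)
    (fun u v => (hasDerivWithinAt_pull_bilin h.metric.parallelOn hV hcov u v).congr_deriv
      (by simp only [add_apply, ContinuousLinearMap.bilinearComp_apply, hL]; rfl))
    (fun u v => (hasDerivWithinAt_pull_bilin hJ.parallel hV hcov u v).congr_deriv
      (by simp only [add_apply, ContinuousLinearMap.bilinearComp_apply, hL]; rfl))
    (hin z hz) (fun u v => hsk _ _) he hcard
  set s : ι → W := fun i => fderiv ℝ (F t) z (e i) with hsdef
  have hs : Ortho (G (F t z)) s := he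
  refine ⟨_, fun k => ∑ i, ∑ j, (2 * (kform G J (F t z) (sff G (F t) z (e k) (e i)) (s j)
      + kform G J (F t z) (s i) (sff G (F t) z (e k) (e j))) ^ 2
      + 2 * kform G J (F t z) (s i) (s j) * (kform G J (F t z) (Y k i) (s j)
        + kform G J (F t z) (s i) (Y k j) + 2 * kform G J (F t z) (sff G (F t) z (e k) (e i))
          (sff G (F t) z (e k) (e j)))), hD, ?_, ?_⟩
  · intro k
    have h1 : Has2DerivAt (fun r => ∑ i, ∑ j,
        (kform G J (F t (geo (pull G (F t)) z (e k) r))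
        (fderiv ℝ (F t) (geo (pull G (F t)) z (e k) r) (X k i r))
        (fderiv ℝ (F t) (geo (pull G (F t)) z (e k) r) (X k j r))) ^ 2) _ :=
      Has2DerivAt.sum fun i _ => Has2DerivAt.sum fun j _ =>
        Has2DerivAt.sq ((hF k).hasDerivAt_bilin hJ.parallel h i j)
          ((hF k).hasDerivAt_bilin' hJ.parallel h hz i j)
    have g0 : geo (pull G (F t)) z (e k) 0 = z := by simp [geo]
    have h2 := h1.congr (ψ := fun r => normSq (pull G (F t) (geo (pull G (F t)) z (e k) r))
        (pull (kform G J) (F t) (geo (pull G (F t)) z (e k) r))) (by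
      filter_upwards [(hF k).ortho, (hF k).mem] with r hr hm
      exact normSq_eq_sum (hin _ hm) _ hr hcard)
    convert h2 using 1
    simp only [g0, (hF k).init, (hF k).init_a, hsdef]
  · have hYt : ∀ k i p, G (F t z) (Y k i) (s p) = - G (F t z) (sff G (F t) z (e k) (e i))
        (sff G (F t) z (e k) (e p)) := fun k => (hF k).tangential
    have hreact := reaction_le hB (hJ.sq _ hV) (hJ.compat _ hV) (R := curvL (chr G) (F t z))
      (fun x y a => curv_antisymm _ _ _ _ _) (fun x y a b => h.metric.curv_skew hV x y a b)
      (fun x y a b => h.metric.curv_pair hV x y a b) (fun x y a => hJ.curv_comm hV x y a)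
      (c := c) (s := s) (ν := ν) (by
        intro x y
        rw [← hE x y, (Ortho.sum_elim hB hs hν fun i j => hn _ _).trace_eq
          (by simp [← hW, two_mul]),
          Fintype.sum_sum_type]
        rfl) hs hν (fun i j => hn _ _) hW (A := fun k i => sff G (F t) z (e k) (e i)) (Y := Y)
      (DH := fun i => DH (e i)) (fun k i p => h.sff_normal hz _ _ _) hYt
      (fun i q => h.cov_meanCurv_normal hz he hcard hH hF i (fun x => hn x q)) hA
      hR
    rw [normSq_eq_sum (hin z hz) _ he hcard]
    have e1 : 2 * ∑ i, ∑ j, pull (kform G J) (F t) z (e i) (e j) *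
        ((kform G J (F t z)).bilinearComp L (fderiv ℝ (F t) z)
          + (kform G J (F t z)).bilinearComp (fderiv ℝ (F t) z) L) (e i) (e j)
        - 2 * ∑ i, ∑ j, ∑ p, ((G (F t z)).bilinearComp L (fderiv ℝ (F t) z)
          + (G (F t z)).bilinearComp (fderiv ℝ (F t) z) L) (e i) (e p)
          * pull (kform G J) (F t) z (e p) (e j) * pull (kform G J) (F t) z (e i) (e j)
        = 4 * ∑ i, ∑ j, G (F t z) (J (F t z) (s i)) (s j) * ∑ q, G (F t z) (DH (e i)) (ν q) *
          G (F t z) (J (F t z) (ν q)) (s j) := by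
      exact normSq_deriv_eq hB (fun x y => hsk x y) hs hν (fun i j => hn _ _) hW
        (DH := fun i => DH (e i)) (by
          intro i j
          simp only [add_apply, ContinuousLinearMap.bilinearComp_apply, hL]
          rfl) (by
          intro i j
          simp only [add_apply, ContinuousLinearMap.bilinearComp_apply, hL]
          rfl)
    rw [e1]
    refine hreact.trans (add_le_add ?_ le_rfl)
    refine Finset.sum_le_sum fun k _ => Finset.sum_le_sum fun i _ => Finset.sum_le_sum fun j _ => ?_
    simp only [kform_apply]
    exact le_add_of_nonneg_left (by positivity)

end KahlerCoordinates

/-! ### Products -/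

section Product

variable {E : Type*} [NormedAddCommGroup E] [NormedSpace ℝ E] [FiniteDimensional ℝ E]
  {E' : Type*} [NormedAddCommGroup E'] [NormedSpace ℝ E'] [FiniteDimensional ℝ E']

/-- The pull-back of a field of bilinear forms under the first projection. -/
def liftFst (B : E → E →L[ℝ] E →L[ℝ] ℝ) (q : E × E') : E × E' →L[ℝ] E × E' →L[ℝ] ℝ :=
  (B q.1).bilinearComp (ContinuousLinearMap.fst ℝ E E') (ContinuousLinearMap.fst ℝ E E')

/-- The pull-back of a field of bilinear forms under the second projection. -/
def liftSnd (B : E' → E' →L[ℝ] E' →L[ℝ] ℝ) (q : E × E') : E × E' →L[ℝ] E × E' →L[ℝ] ℝ :=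
  (B q.2).bilinearComp (ContinuousLinearMap.snd ℝ E E') (ContinuousLinearMap.snd ℝ E E')

/-- The product of two metrics in coordinates. -/
def prodG (g : E → E →L[ℝ] E →L[ℝ] ℝ) (g' : E' → E' →L[ℝ] E' →L[ℝ] ℝ) (q : E × E') :
    E × E' →L[ℝ] E × E' →L[ℝ] ℝ := liftFst g q + liftSnd g' q

variable {B g : E → E →L[ℝ] E →L[ℝ] ℝ} {B' g' : E' → E' →L[ℝ] E' →L[ℝ] ℝ} {V : Set E} {V' : Set E'}

theorem liftFst_apply (q u v : E × E') : liftFst B q u v = B q.1 u.1 v.1 := rfl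

theorem liftSnd_apply (q u v : E × E') : liftSnd B' q u v = B' q.2 u.2 v.2 := rfl

theorem prodG_apply (q u v : E × E') :
    prodG g g' q u v = g q.1 u.1 v.1 + g' q.2 u.2 v.2 := rfl

theorem contDiffOn_liftFst (hB : ContDiffOn ℝ ∞ B V) :
    ContDiffOn ℝ ∞ (liftFst B : E × E' → _) (V ×ˢ V') := by
  rw [contDiffOn_clm_apply]
  intro u
  rw [contDiffOn_clm_apply]
  intro v
  exact ((hB.comp contDiffOn_fst fun q hq => hq.1).clm_apply contDiffOn_const).clm_apply
    contDiffOn_const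

theorem contDiffOn_liftSnd (hB : ContDiffOn ℝ ∞ B' V') :
    ContDiffOn ℝ ∞ (liftSnd B' : E × E' → _) (V ×ˢ V') := by
  rw [contDiffOn_clm_apply]
  intro u
  rw [contDiffOn_clm_apply]
  intro v
  exact ((hB.comp contDiffOn_snd fun q hq => hq.2).clm_apply contDiffOn_const).clm_apply
    contDiffOn_const

theorem hasFDerivAt_liftFst {q : E × E'} (hB : DifferentiableAt ℝ B q.1) (u v : E × E') :
    HasFDerivAt (fun q => liftFst B q u v)
      ((((fderiv ℝ B q.1).flip u.1).flip v.1) ∘L ContinuousLinearMap.fst ℝ E E') q := by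
  have h := ((hB.hasFDerivAt.comp q hasFDerivAt_fst).clm_apply
    (hasFDerivAt_const u.1 q)).clm_apply (hasFDerivAt_const v.1 q)
  refine h.congr_fderiv ?_
  ext <;> simp

theorem hasFDerivAt_liftSnd {q : E × E'} (hB : DifferentiableAt ℝ B' q.2) (u v : E × E') :
    HasFDerivAt (fun q => liftSnd B' q u v)
      ((((fderiv ℝ B' q.2).flip u.2).flip v.2) ∘L ContinuousLinearMap.snd ℝ E E') q := by
  have h := ((hB.hasFDerivAt.comp q hasFDerivAt_snd).clm_apply
    (hasFDerivAt_const u.2 q)).clm_apply (hasFDerivAt_const v.2 q)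
  refine h.congr_fderiv ?_
  ext <;> simp

theorem MetricOn.prod (h : MetricOn g V) (h' : MetricOn g' V') :
    MetricOn (prodG g g') (V ×ˢ V') where
  isOpen := h.isOpen.prod h'.isOpen
  smooth := (contDiffOn_liftFst h.smooth).add (contDiffOn_liftSnd h'.smooth)
  inner q hq := by
    refine ⟨fun u v => ?_, fun v hv => ?_⟩
    · rw [prodG_apply, prodG_apply, (h.inner _ hq.1).symm, (h'.inner _ hq.2).symm]
    · rw [prodG_apply]
      have h1 : 0 ≤ g q.1 v.1 v.1 := by
        rcases eq_or_ne v.1 0 with h0 | h0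
        · simp [h0]
        · exact ((h.inner _ hq.1).pos _ h0).le
      have h2 : 0 ≤ g' q.2 v.2 v.2 := by
        rcases eq_or_ne v.2 0 with h0 | h0
        · simp [h0]
        · exact ((h'.inner _ hq.2).pos _ h0).le
      rcases eq_or_ne v.1 0 with h0 | h0
      · have h3 : v.2 ≠ 0 := fun h3 => hv (Prod.ext h0 h3)
        have := (h'.inner _ hq.2).pos _ h3
        linarith
      · have := (h.inner _ hq.1).pos _ h0
        linarith

theorem fderiv_liftFst (hB : ContDiffOn ℝ ∞ B V) (hV : IsOpen V)
    {q : E × E'} (hq : q.1 ∈ V) (w u v : E × E') :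
    fderiv ℝ (liftFst B) q w u v = fderiv ℝ B q.1 w.1 u.1 v.1 := by
  have hd : DifferentiableAt ℝ B q.1 :=
    (hB.contDiffAt (hV.mem_nhds hq)).differentiableAt (by simp)
  have hd' : DifferentiableAt ℝ (liftFst B : E × E' → _) q :=
    ((contDiffOn_liftFst (V' := univ) hB).contDiffAt
      ((hV.prod isOpen_univ).mem_nhds ⟨hq, trivial⟩)).differentiableAt (by simp)
  rw [← fderiv_apply₂ hd', (hasFDerivAt_liftFst hd u v).fderiv]
  simp

theorem fderiv_liftSnd (hB : ContDiffOn ℝ ∞ B' V') (hV : IsOpen V')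
    {q : E × E'} (hq : q.2 ∈ V') (w u v : E × E') :
    fderiv ℝ (liftSnd B') q w u v = fderiv ℝ B' q.2 w.2 u.2 v.2 := by
  have hd : DifferentiableAt ℝ B' q.2 :=
    (hB.contDiffAt (hV.mem_nhds hq)).differentiableAt (by simp)
  have hd' : DifferentiableAt ℝ (liftSnd B' : E × E' → _) q :=
    ((contDiffOn_liftSnd (V := univ) hB).contDiffAt
      ((isOpen_univ.prod hV).mem_nhds ⟨trivial, hq⟩)).differentiableAt (by simp)
  rw [← fderiv_apply₂ hd', (hasFDerivAt_liftSnd hd u v).fderiv]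
  simp

/-- The Levi-Civita connection of a product metric is the product connection. -/
theorem chr_prod (h : MetricOn g V) (h' : MetricOn g' V') {q : E × E'} (hq : q ∈ V ×ˢ V')
    (u v : E × E') :
    chr (prodG g g') q u v = (chr g q.1 u.1 v.1, chr g' q.2 u.2 v.2) := by
  refine ((h.prod h').inner q hq).ext fun w => ?_
  rw [(h.prod h').chr_unique hq
    (C := fun u v w => g q.1 (chr g q.1 u.1 v.1) w.1 + g' q.2 (chr g' q.2 u.2 v.2) w.2)]
  · rfl
  · intro u v w
    simp only [h.chr_symm hq.1 u.1 v.1, h'.chr_symm hq.2 u.2 v.2]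
  · intro w u v
    have d1 : DifferentiableAt ℝ (liftFst g : E × E' → _) q :=
      ((contDiffOn_liftFst h.smooth).contDiffAt
        ((h.prod h').isOpen.mem_nhds hq)).differentiableAt (by simp)
    have d2 : DifferentiableAt ℝ (liftSnd g' : E × E' → _) q :=
      ((contDiffOn_liftSnd h'.smooth).contDiffAt
        ((h.prod h').isOpen.mem_nhds hq)).differentiableAt (by simp)
    have e : fderiv ℝ (prodG g g') q = fderiv ℝ (liftFst g) q + fderiv ℝ (liftSnd g') q :=
      (d1.hasFDerivAt.add d2.hasFDerivAt).fderiv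
    rw [e, add_apply, add_apply, add_apply, fderiv_liftFst h.smooth h.isOpen hq.1,
      fderiv_liftSnd h'.smooth h'.isOpen hq.2, h.compat hq.1, h'.compat hq.2,
      (h.inner _ hq.1).symm u.1, (h'.inner _ hq.2).symm u.2]
    ring

theorem ParallelOn.liftFst (h : MetricOn g V) (h' : MetricOn g' V')
    (hB : ParallelOn (chr g) B V) : ParallelOn (chr (prodG g g')) (liftFst B) (V ×ˢ V') where
  openV := (h.prod h').isOpen
  smooth := contDiffOn_liftFst hB.smooth
  smoothΓ := (h.prod h').contDiffOn_chr
  parallel q hq w u v := by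
    rw [fderiv_liftFst hB.smooth h.isOpen hq.1, hB.parallel _ hq.1, liftFst_apply, liftFst_apply,
      chr_prod h h' hq, chr_prod h h' hq]

theorem ParallelOn.liftSnd (h : MetricOn g V) (h' : MetricOn g' V')
    (hB : ParallelOn (chr g') B' V') : ParallelOn (chr (prodG g g')) (liftSnd B') (V ×ˢ V') where
  openV := (h.prod h').isOpen
  smooth := contDiffOn_liftSnd hB.smooth
  smoothΓ := (h.prod h').contDiffOn_chr
  parallel q hq w u v := by
    rw [fderiv_liftSnd hB.smooth h'.isOpen hq.2, hB.parallel _ hq.2, liftSnd_apply, liftSnd_apply,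
      chr_prod h h' hq, chr_prod h h' hq]

theorem ParallelOn.sub {Γ : E → E →L[ℝ] E →L[ℝ] E} {B C : E → E →L[ℝ] E →L[ℝ] ℝ}
    (hB : ParallelOn Γ B V) (hC : ParallelOn Γ C V) : ParallelOn Γ (fun q => B q - C q) V where
  openV := hB.openV
  smooth := hB.smooth.sub hC.smooth
  smoothΓ := hB.smoothΓ
  parallel q hq w u v := by
    have e : fderiv ℝ (fun q => B q - C q) q = fderiv ℝ B q - fderiv ℝ C q :=
      ((hB.differentiableAt hq).hasFDerivAt.sub (hC.differentiableAt hq).hasFDerivAt).fderiv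
    rw [e]
    simp only [sub_apply, hB.parallel q hq, hC.parallel q hq]
    ring

theorem curv_prod (h : MetricOn g V) (h' : MetricOn g' V') {q : E × E'} (hq : q ∈ V ×ˢ V')
    (u v w : E × E') : curv (chr (prodG g g')) q u v w
      = (curv (chr g) q.1 u.1 v.1 w.1, curv (chr g') q.2 u.2 v.2 w.2) := by
  have key : ∀ u v w : E × E', fderiv ℝ (chr (prodG g g')) q u v w
      = (fderiv ℝ (chr g) q.1 u.1 v.1 w.1, fderiv ℝ (chr g') q.2 u.2 v.2 w.2) := by
    intro u v w
    rw [← fderiv_apply₂ ((h.prod h').chr_differentiableAt hq)]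
    have he : (fun z => chr (prodG g g') z v w) =ᶠ[𝓝 q]
        fun z => (chr g z.1 v.1 w.1, chr g' z.2 v.2 w.2) := by
      filter_upwards [(h.prod h').isOpen.mem_nhds hq] with z hz using chr_prod h h' hz v w
    have h1 := (((h.chr_differentiableAt hq.1).hasFDerivAt.comp q hasFDerivAt_fst).clm_apply
      (hasFDerivAt_const v.1 q)).clm_apply (hasFDerivAt_const w.1 q)
    have h2 := (((h'.chr_differentiableAt hq.2).hasFDerivAt.comp q hasFDerivAt_snd).clm_apply
      (hasFDerivAt_const v.2 q)).clm_apply (hasFDerivAt_const w.2 q)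
    rw [he.fderiv_eq]
    refine (congrArg (fun L : E × E' →L[ℝ] E × E' => L u) (h1.prodMk h2).fderiv).trans ?_
    simp
  simp only [curv, key, chr_prod h h' hq]
  rfl

variable {J : E → E →L[ℝ] E} {J' : E' → E' →L[ℝ] E'}

/-- `(u, v) ↦ (J u, -J' v)` in coordinates. -/
def prodEndo (J : E → E →L[ℝ] E) (J' : E' → E' →L[ℝ] E') (q : E × E') : E × E' →L[ℝ] E × E' :=
  (J q.1).prodMap (-J' q.2)

theorem prodEndo_apply (q u : E × E') : prodEndo J J' q u = (J q.1 u.1, -J' q.2 u.2) := rfl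

/-- The product of a Kähler structure and the conjugate of another one is Kähler. -/
theorem KahlerOn.prod (h : KahlerOn g J V) (h' : KahlerOn g' J' V') :
    KahlerOn (prodG g g') (prodEndo J J') (V ×ˢ V') where
  metric := h.metric.prod h'.metric
  sq q hq x := by
    simp [prodEndo_apply, h.sq _ hq.1, h'.sq _ hq.2, Prod.ext_iff]
  compat q hq x y := by
    simp only [prodEndo_apply, prodG_apply, map_neg, neg_apply, neg_neg, h.compat _ hq.1,
      h'.compat _ hq.2]
  parallel := by
    have e : kform (prodG g g') (prodEndo J J')
        = fun q => liftFst (kform g J) q - liftSnd (kform g' J') q := by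
      funext q
      ext u
      all_goals simp [kform_apply, prodG_apply, prodEndo_apply, liftFst_apply, liftSnd_apply]
    rw [e]
    exact (h.parallel.liftFst h.metric h'.metric).sub (h'.parallel.liftSnd h.metric h'.metric)

theorem trace_curv_prod (h : MetricOn g V) (h' : MetricOn g' V') {q : E × E'} (hq : q ∈ V ×ˢ V')
    (x y : E × E') :
    LinearMap.trace ℝ (E × E') (((curvL (chr (prodG g g')) q).flip x).flip y)
      = LinearMap.trace ℝ E (((curvL (chr g) q.1).flip x.1).flip y.1)
        + LinearMap.trace ℝ E' (((curvL (chr g') q.2).flip x.2).flip y.2) := by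
  rw [← LinearMap.trace_prodMap']
  congr 1
  exact LinearMap.ext fun u => curv_prod h h' hq u x y

end Product

/-! ### The volume form of a Kähler structure -/

section KahlerVolume

variable {W : Type*} [NormedAddCommGroup W] [NormedSpace ℝ W]
  {n : ℕ}

/-- The even index `2k`. -/
def evenIdx (k : Fin n) : Fin (2 * n) := ⟨2 * k, by omega⟩

/-- The odd index `2k + 1`. -/
def oddIdx (k : Fin n) : Fin (2 * n) := ⟨2 * k + 1, by omega⟩

theorem evenIdx_or_oddIdx (i : Fin (2 * n)) : ∃ k : Fin n, i = evenIdx k ∨ i = oddIdx k := by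
  refine ⟨⟨i / 2, by omega⟩, ?_⟩
  rcases Nat.even_or_odd' (i : ℕ) with ⟨c, hc | hc⟩
  · left; ext; simp [evenIdx]; omega
  · right; ext; simp [oddIdx]; omega

theorem evenIdx_injective : Function.Injective (evenIdx : Fin n → Fin (2 * n)) := by
  intro a b h
  have := congrArg Fin.val h
  simp only [evenIdx] at this
  ext; omega

theorem oddIdx_injective : Function.Injective (oddIdx : Fin n → Fin (2 * n)) := by
  intro a b h
  have := congrArg Fin.val h
  simp only [oddIdx] at this
  ext; omega

theorem evenIdx_ne_oddIdx (a b : Fin n) : evenIdx a ≠ oddIdx b := by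
  intro h
  have := congrArg Fin.val h
  simp only [evenIdx, oddIdx] at this
  omega

theorem sum_evenIdx_oddIdx {A : Type*} [AddCommMonoid A] (f : Fin (2 * n) → A) :
    ∑ i, f i = ∑ k : Fin n, (f (evenIdx k) + f (oddIdx k)) := by
  have hb : Function.Bijective (Sum.elim evenIdx oddIdx : Fin n ⊕ Fin n → Fin (2 * n)) := by
    refine ⟨evenIdx_injective.sumElim oddIdx_injective evenIdx_ne_oddIdx, fun i => ?_⟩
    obtain ⟨k, rfl | rfl⟩ := evenIdx_or_oddIdx i
    · exact ⟨Sum.inl k, rfl⟩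
    · exact ⟨Sum.inr k, rfl⟩
  rw [← (Equiv.ofBijective _ hb).sum_comp, Fintype.sum_sum_type, Finset.sum_add_distrib]
  rfl

theorem prod_update_evenIdx (η : W →L[ℝ] W →L[ℝ] ℝ) (v : Fin (2 * n) → W) (k : Fin n) (x : W) :
    ∏ j, η (Function.update v (evenIdx k) x (evenIdx j))
        (Function.update v (evenIdx k) x (oddIdx j))
      = η x (v (oddIdx k)) * ∏ j ∈ Finset.univ.erase k, η (v (evenIdx j)) (v (oddIdx j)) := by
  rw [← Finset.mul_prod_erase _ _ (Finset.mem_univ k)]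
  congr 1
  · rw [Function.update_self, Function.update_of_ne (evenIdx_ne_oddIdx _ _).symm]
  · refine Finset.prod_congr rfl fun j hj => ?_
    rw [Function.update_of_ne (evenIdx_ne_oddIdx _ _).symm,
      Function.update_of_ne (evenIdx_injective.ne (Finset.ne_of_mem_erase hj))]

theorem prod_update_oddIdx (η : W →L[ℝ] W →L[ℝ] ℝ) (v : Fin (2 * n) → W) (k : Fin n) (x : W) :
    ∏ j, η (Function.update v (oddIdx k) x (evenIdx j)) (Function.update v (oddIdx k) x (oddIdx j))
      = η (v (evenIdx k)) x * ∏ j ∈ Finset.univ.erase k, η (v (evenIdx j)) (v (oddIdx j)) := by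
  rw [← Finset.mul_prod_erase _ _ (Finset.mem_univ k)]
  congr 1
  · rw [Function.update_self, Function.update_of_ne (evenIdx_ne_oddIdx _ _)]
  · refine Finset.prod_congr rfl fun j hj => ?_
    rw [Function.update_of_ne (evenIdx_ne_oddIdx _ _),
      Function.update_of_ne (oddIdx_injective.ne (Finset.ne_of_mem_erase hj))]

/-- The multilinear map `v ↦ ∏ η(v_{2k}, v_{2k+1})`. -/
def pairProd (η : W →L[ℝ] W →L[ℝ] ℝ) : MultilinearMap ℝ (fun _ : Fin (2 * n) => W) ℝ where
  toFun v := ∏ k, η (v (evenIdx k)) (v (oddIdx k))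
  map_update_add' := by
    intro inst v i x y
    obtain rfl : inst = instDecidableEqFin _ := Subsingleton.elim _ _
    obtain ⟨k, rfl | rfl⟩ := evenIdx_or_oddIdx i
    · simp only [prod_update_evenIdx, map_add, add_apply, add_mul]
    · simp only [prod_update_oddIdx, map_add, add_mul]
  map_update_smul' := by
    intro inst v i c x
    obtain rfl : inst = instDecidableEqFin _ := Subsingleton.elim _ _
    obtain ⟨k, rfl | rfl⟩ := evenIdx_or_oddIdx i
    · simp only [prod_update_evenIdx, map_smul, smul_apply, smul_eq_mul, mul_assoc]
    · simp only [prod_update_oddIdx, map_smul, smul_eq_mul, mul_assoc]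

/-- The top exterior power `η^n / n!` of a `2`-form `η`, as an alternating form. -/
def topForm (n : ℕ) (η : W →L[ℝ] W →L[ℝ] ℝ) : W [⋀^Fin (2 * n)]→ₗ[ℝ] ℝ :=
  (1 / ((2 : ℝ) ^ n * (n.factorial : ℝ))) • MultilinearMap.alternatization (pairProd η)

theorem topForm_apply (η : W →L[ℝ] W →L[ℝ] ℝ) (v : Fin (2 * n) → W) :
    topForm n η v = (1 / ((2 : ℝ) ^ n * (n.factorial : ℝ))) *
      ∑ σ : Equiv.Perm (Fin (2 * n)), ((Equiv.Perm.sign σ : ℤ) : ℝ) *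
        ∏ k : Fin n, η (v (σ (evenIdx k))) (v (σ (oddIdx k))) := by
  rw [topForm, AlternatingMap.smul_apply, MultilinearMap.alternatization_apply, smul_eq_mul]
  congr 1
  refine Finset.sum_congr rfl fun σ _ => ?_
  rw [Units.smul_def, zsmul_eq_mul]
  rfl

variable [FiniteDimensional ℝ W]

/-- The powers of a parallel `2`-form are parallel. -/
theorem ParallelOn.topForm {Γ : W → W →L[ℝ] W →L[ℝ] W} {η : W → W →L[ℝ] W →L[ℝ] ℝ} {V : Set W}
    (h : ParallelOn Γ η V) : ParallelForm Γ (fun q => topForm n (η q)) V := by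
  intro c s S r c' s' hc hs
  have key : ∀ σ : Equiv.Perm (Fin (2 * n)), HasDerivWithinAt
      (fun r => ∏ k : Fin n, η (c r) (s (σ (evenIdx k)) r) (s (σ (oddIdx k)) r))
      (∑ i, ∏ k : Fin n, η (c r) (Function.update (fun j => s j r) i (s' i) (σ (evenIdx k)))
        (Function.update (fun j => s j r) i (s' i) (σ (oddIdx k)))) S r := by
    intro σ
    have h1 := HasDerivWithinAt.fun_finsetProd (u := Finset.univ) fun k (_ : k ∈ Finset.univ) =>
      h.hasDerivWithinAt hc (hs (σ (evenIdx k))) (hs (σ (oddIdx k)))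
    refine h1.congr_deriv ?_
    have h2 : ∀ i, (fun j => Function.update (fun j => s j r) (σ i) (s' (σ i)) (σ j))
        = Function.update (fun j => s (σ j) r) i (s' (σ i)) := fun i =>
      Function.update_comp_eq_of_injective (fun j => s j r) σ.injective i (s' (σ i))
    have h3 : ∀ i k, η (c r) (Function.update (fun j => s j r) (σ i) (s' (σ i)) (σ (evenIdx k)))
        (Function.update (fun j => s j r) (σ i) (s' (σ i)) (σ (oddIdx k)))
        = η (c r) (Function.update (fun j => s (σ j) r) i (s' (σ i)) (evenIdx k))
          (Function.update (fun j => s (σ j) r) i (s' (σ i)) (oddIdx k)) := fun i k => by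
      rw [← h2]
    rw [← Equiv.sum_comp σ, sum_evenIdx_oddIdx]
    refine Finset.sum_congr rfl fun k _ => ?_
    simp only [h3, prod_update_evenIdx, prod_update_oddIdx, smul_eq_mul]
    ring
  simp only [topForm_apply]
  have h4 := (HasDerivWithinAt.fun_sum (u := Finset.univ) fun σ (_ : σ ∈ Finset.univ) =>
    (key σ).const_mul ((Equiv.Perm.sign σ : ℤ) : ℝ)).const_mul
      (1 / ((2 : ℝ) ^ n * (n.factorial : ℝ)))
  refine h4.congr_deriv ?_
  rw [← Finset.mul_sum]
  congr 1
  rw [Finset.sum_comm]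
  simp only [Finset.mul_sum]

end KahlerVolume

/-! ### Mean curvature flow in coordinates -/

section Families

variable {E : Type*} [NormedAddCommGroup E] [NormedSpace ℝ E]
  {W : Type*} [NormedAddCommGroup W] [NormedSpace ℝ W] {f : ℝ → E → W} {S : Set ℝ} {U : Set E}

/-- A derivative in time and space along `S ×ˢ U` restricts to a full derivative in space, although
`S` need not be open. -/
theorem hasFDerivAt_of_prod (hU : IsOpen U) {A : ℝ × E →L[ℝ] W} {t : ℝ} {z : E} (ht : t ∈ S)
    (hz : z ∈ U)
    (hd : HasFDerivWithinAt (fun p : ℝ × E => f p.1 p.2) A (S ×ˢ U) (t, z)) :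
    HasFDerivAt (f t) (A ∘L ContinuousLinearMap.inr ℝ ℝ E) z := by
  have h1 : HasFDerivWithinAt (fun y : E => (t, y)) (ContinuousLinearMap.inr ℝ ℝ E) U z :=
    (hasFDerivAt_prodMk_right t z).hasFDerivWithinAt
  have h2 : HasFDerivWithinAt (f t) (A ∘L ContinuousLinearMap.inr ℝ ℝ E) U z :=
    hd.comp z h1 fun y hy => ⟨ht, hy⟩
  exact h2.hasFDerivAt (hU.mem_nhds hz)

theorem hasDerivWithinAt_of_prod {A : ℝ × E →L[ℝ] W} {t : ℝ} {z : E} (hz : z ∈ U)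
    (hd : HasFDerivWithinAt (fun p : ℝ × E => f p.1 p.2) A (S ×ˢ U) (t, z)) :
    HasDerivWithinAt (fun s => f s z) (A (1, 0)) S t := by
  have h1 : HasDerivWithinAt (fun s : ℝ => (s, z)) ((1 : ℝ), (0 : E)) S t :=
    ((hasDerivAt_id t).prodMk (hasDerivAt_const t z)).hasDerivWithinAt
  have hm : MapsTo (fun s : ℝ => (s, z)) S (S ×ˢ U) := fun s hs => ⟨hs, hz⟩
  exact hd.comp_hasDerivWithinAt t h1 hm

theorem fderiv_eq_fderivWithin_prod (hU : IsOpen U)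
    (hf : ContDiffOn ℝ ∞ (fun p : ℝ × E => f p.1 p.2) (S ×ˢ U)) {p : ℝ × E} (hp : p ∈ S ×ˢ U) :
    fderiv ℝ (f p.1) p.2
      = (fderivWithin ℝ (fun p : ℝ × E => f p.1 p.2) (S ×ˢ U) p) ∘L
        ContinuousLinearMap.inr ℝ ℝ E :=
  (hasFDerivAt_of_prod hU hp.1 hp.2
    ((hf.differentiableOn (by simp)) p hp).hasFDerivWithinAt).fderiv

/-- The spatial derivative of a smooth family of maps is a smooth family. -/
theorem contDiffOn_fderiv_family (hS : UniqueDiffOn ℝ S) (hU : IsOpen U)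
    (hf : ContDiffOn ℝ ∞ (fun p : ℝ × E => f p.1 p.2) (S ×ˢ U)) :
    ContDiffOn ℝ ∞ (fun p : ℝ × E => fderiv ℝ (f p.1) p.2) (S ×ˢ U) := by
  have h1 := hf.fderivWithin (m := ∞) (hS.prod hU.uniqueDiffOn) (by simp)
  have h2 := h1.clm_comp (contDiffOn_const (c := ContinuousLinearMap.inr ℝ ℝ E))
  exact h2.congr fun p hp => fderiv_eq_fderivWithin_prod hU hf hp

/-- Time and space derivatives of a smooth family commute. -/
theorem hasDerivWithinAt_fderiv_family (hS : UniqueDiffOn ℝ S) (hSi : S ⊆ closure (interior S))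
    (hU : IsOpen U) (hf : ContDiffOn ℝ ∞ (fun p : ℝ × E => f p.1 p.2) (S ×ˢ U)) {t : ℝ} {z : E}
    (ht : t ∈ S) (hz : z ∈ U) {H : E → W}
    (hH : ∀ y ∈ U, HasDerivWithinAt (fun s => f s y) (H y) S t) (v : E) :
    DifferentiableAt ℝ H z ∧
      HasDerivWithinAt (fun s => fderiv ℝ (f s) z v) (fderiv ℝ H z v) S t := by
  set A := S ×ˢ U with hA
  set g : ℝ × E → W := fun p => f p.1 p.2 with hg
  have hAu : UniqueDiffOn ℝ A := hS.prod hU.uniqueDiffOn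
  have hp : (t, z) ∈ A := ⟨ht, hz⟩
  have hD := hf.fderivWithin (m := ∞) hAu (by simp)
  have hD1 : ∀ p ∈ A, HasFDerivWithinAt g (fderivWithin ℝ g A p) A p := fun p hp =>
    ((hf.differentiableOn (by simp)) p hp).hasFDerivWithinAt
  have hD2 : HasFDerivWithinAt (fun p : ℝ × E => fderivWithin ℝ g A (p.1, p.2))
      (fderivWithin ℝ (fderivWithin ℝ g A) A (t, z)) A (t, z) :=
    ((hD.differentiableOn (by simp)) _ hp).hasFDerivWithinAt
  have hsymm : IsSymmSndFDerivWithinAt ℝ g A (t, z) := by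
    refine (hf _ hp).isSymmSndFDerivWithinAt (by simp [two_le_infty]) hAu ?_ hp
    rw [hA, interior_prod_eq, closure_prod_eq, hU.interior_eq]
    exact ⟨hSi ht, subset_closure hz⟩
  have hHe : H =ᶠ[𝓝 z] fun y => fderivWithin ℝ g A (t, y) (1, 0) := by
    filter_upwards [hU.mem_nhds hz] with y hy
    exact (hS t ht).eq_deriv _ (hH y hy) (hasDerivWithinAt_of_prod hy (hD1 (t, y) ⟨ht, hy⟩))
  have hHd := ((hasFDerivAt_of_prod (f := fun s y => fderivWithin ℝ g A (s, y)) hU ht hz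
    hD2).clm_apply (hasFDerivAt_const ((1 : ℝ), (0 : E)) z)).congr_of_eventuallyEq hHe
  refine ⟨hHd.differentiableAt, ?_⟩
  have h1 := (hasDerivWithinAt_of_prod (f := fun s y => fderivWithin ℝ g A (s, y)) hz
    hD2).clm_apply (hasDerivWithinAt_const t S ((0 : ℝ), v))
  have h2 : HasDerivWithinAt (fun s => fderiv ℝ (f s) z v) _ S t :=
    h1.congr (fun s hs => by
      rw [fderiv_eq_fderivWithin_prod (p := (s, z)) hU hf ⟨hs, hz⟩]; rfl)
      (by rw [fderiv_eq_fderivWithin_prod (p := (t, z)) hU hf ⟨ht, hz⟩]; rfl)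
  refine h2.congr_deriv ?_
  rw [hHd.fderiv]
  simp only [map_zero, add_zero, ContinuousLinearMap.comp_zero, zero_add,
    ContinuousLinearMap.flip_apply, ContinuousLinearMap.coe_comp, Function.comp_apply,
    ContinuousLinearMap.inr_apply]
  exact hsymm.eq _ _

end Families

section LocalFlow

variable {E : Type*} [NormedAddCommGroup E] [NormedSpace ℝ E] [FiniteDimensional ℝ E]
  {W : Type*} [NormedAddCommGroup W] [NormedSpace ℝ W] [FiniteDimensional ℝ W]
  {G : W → W →L[ℝ] W →L[ℝ] ℝ} {f : ℝ → E → W} {S : Set ℝ} {U : Set E} {V : Set W}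

/-- A mean curvature flow of immersions `f s : U → V`, `s ∈ S`, in coordinates. -/
structure LocalFlow (G : W → W →L[ℝ] W →L[ℝ] ℝ) (f : ℝ → E → W) (S : Set ℝ) (U : Set E)
    (V : Set W) : Prop where
  uniqueDiff : UniqueDiffOn ℝ S
  subset_closure : S ⊆ closure (interior S)
  metric : MetricOn G V
  openU : IsOpen U
  smooth : ContDiffOn ℝ ∞ (fun p : ℝ × E => f p.1 p.2) (S ×ˢ U)
  mapsTo : ∀ s ∈ S, MapsTo (f s) U V
  injective : ∀ s ∈ S, ∀ z ∈ U, Function.Injective (fderiv ℝ (f s) z)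
  velocity : ∀ s ∈ S, ∀ z ∈ U, HasDerivWithinAt (fun s => f s z) (meanCurv G (f s) z) S s

namespace LocalFlow

theorem immInto (h : LocalFlow G f S U V) {s : ℝ} (hs : s ∈ S) : ImmInto G (f s) U V where
  metric := h.metric
  openU := h.openU
  smooth := h.smooth.comp (contDiffOn_const.prodMk contDiffOn_id) fun _ hz => ⟨hs, hz⟩
  mapsTo := h.mapsTo s hs
  injective := h.injective s hs

theorem deriv_fderiv (h : LocalFlow G f S U V) {s : ℝ} (hs : s ∈ S) {z : E} (hz : z ∈ U) (v : E) :
    DifferentiableAt ℝ (meanCurv G (f s)) z ∧ HasDerivWithinAt (fun s => fderiv ℝ (f s) z v)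
      (fderiv ℝ (meanCurv G (f s)) z v) S s :=
  hasDerivWithinAt_fderiv_family h.uniqueDiff h.subset_closure h.openU h.smooth hs hz
    (fun y hy => h.velocity s hs y hy) v

theorem contDiffOn_fderiv (h : LocalFlow G f S U V) :
    ContDiffOn ℝ ∞ (fun p : ℝ × E => fderiv ℝ (f p.1) p.2) (S ×ˢ U) :=
  contDiffOn_fderiv_family h.uniqueDiff h.openU h.smooth

theorem contDiffOn_fderiv₂ (h : LocalFlow G f S U V) :
    ContDiffOn ℝ ∞ (fun p : ℝ × E => fderiv ℝ (fderiv ℝ (f p.1)) p.2) (S ×ˢ U) :=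
  contDiffOn_fderiv_family (f := fun s y => fderiv ℝ (f s) y) h.uniqueDiff h.openU
    h.contDiffOn_fderiv

theorem mapsTo_prod (h : LocalFlow G f S U V) :
    MapsTo (fun p : ℝ × E => f p.1 p.2) (S ×ˢ U) V := fun p hp => h.mapsTo p.1 hp.1 hp.2

theorem contDiffOn_pull (h : LocalFlow G f S U V) {B : W → W →L[ℝ] W →L[ℝ] ℝ}
    (hB : ContDiffOn ℝ ∞ B V) :
    ContDiffOn ℝ ∞ (fun p : ℝ × E => pull B (f p.1) p.2) (S ×ˢ U) := by
  rw [contDiffOn_clm_apply]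
  intro u
  rw [contDiffOn_clm_apply]
  intro v
  simp only [pull_apply]
  exact ((hB.comp h.smooth h.mapsTo_prod).clm_apply
    (h.contDiffOn_fderiv.clm_apply contDiffOn_const)).clm_apply
    (h.contDiffOn_fderiv.clm_apply contDiffOn_const)

theorem contDiffOn_hess (h : LocalFlow G f S U V) :
    ContDiffOn ℝ ∞ (fun p : ℝ × E => hess (chr G) (f p.1) p.2) (S ×ˢ U) := by
  rw [contDiffOn_clm_apply]
  intro u
  rw [contDiffOn_clm_apply]
  intro v
  simp only [hess_apply]
  refine ((h.contDiffOn_fderiv₂.clm_apply contDiffOn_const).clm_apply contDiffOn_const).add ?_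
  exact ((h.metric.contDiffOn_chr.comp h.smooth h.mapsTo_prod).clm_apply
    (h.contDiffOn_fderiv.clm_apply contDiffOn_const)).clm_apply
    (h.contDiffOn_fderiv.clm_apply contDiffOn_const)

end LocalFlow

theorem ContinuousWithinAt.eventually_norm_le {X F : Type*} [TopologicalSpace X]
    [NormedAddCommGroup F] {g : X → F} {A : Set X} {x : X} (h : ContinuousWithinAt g A x) :
    ∃ C ≥ 0, ∀ᶠ y in 𝓝[A] x, ‖g y‖ ≤ C := by
  refine ⟨‖g x‖ + 1, by positivity, ?_⟩
  have := h.norm.eventually (gt_mem_nhds (lt_add_one ‖g x‖))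
  filter_upwards [this] with y hy using hy.le

theorem unit_norm_le {B : W →L[ℝ] W →L[ℝ] ℝ} {c : ℝ} (hc : 0 < c)
    (h : ∀ v, c * ‖v‖ ^ 2 ≤ B v v) {v : W} (hv : B v v = 1) : ‖v‖ ≤ 1 + 1 / c := by
  have h1 := h v
  rw [hv] at h1
  have h2 : ‖v‖ ^ 2 ≤ 1 / c := by rw [le_div_iff₀ hc]; linarith
  nlinarith [sq_nonneg (‖v‖ - 1), norm_nonneg v, sq_nonneg (‖v‖)]

theorem norm_apply₂_le (B : W →L[ℝ] W →L[ℝ] E) {b r r' : ℝ} (hB : ‖B‖ ≤ b) (hb : 0 ≤ b)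
    (hr : 0 ≤ r) {x y : W} (hx : ‖x‖ ≤ r) (hy : ‖y‖ ≤ r') : ‖B x y‖ ≤ b * r * r' := by
  refine (B.le_opNorm₂ x y).trans ?_
  gcongr

/-- Local bounds for the second fundamental form and the ambient curvature along a flow. -/
theorem LocalFlow.exists_bound (h : LocalFlow G f S U V) {p : ℝ × E} (hp : p ∈ S ×ˢ U) :
    ∃ K ≥ 0, ∀ᶠ p in 𝓝[S ×ˢ U] p,
      (∀ x y ν, pull G (f p.1) p.2 x x = 1 → pull G (f p.1) p.2 y y = 1 →
        G (f p.1 p.2) ν ν = 1 → (∀ w, G (f p.1 p.2) (fderiv ℝ (f p.1) p.2 w) ν = 0) →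
        |G (f p.1 p.2) (sff G (f p.1) p.2 x y) ν| ≤ K) ∧
      ∀ x y u w, G (f p.1 p.2) x x = 1 → G (f p.1 p.2) y y = 1 → G (f p.1 p.2) u u = 1 →
        G (f p.1 p.2) w w = 1 → |G (f p.1 p.2) (curv (chr G) (f p.1 p.2) x y u) w| ≤ K := by
  have hf := h.smooth.continuousOn
  have hV : ∀ p ∈ S ×ˢ U, f p.1 p.2 ∈ V := h.mapsTo_prod
  have cG : ContinuousWithinAt (fun p : ℝ × E => G (f p.1 p.2)) (S ×ˢ U) p :=
    (h.metric.smooth.comp h.smooth h.mapsTo_prod).continuousOn p hp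
  have cΓ : ContinuousWithinAt (fun p : ℝ × E => chr G (f p.1 p.2)) (S ×ˢ U) p :=
    (h.metric.contDiffOn_chr.comp h.smooth h.mapsTo_prod).continuousOn p hp
  have cD : ContinuousWithinAt (fun p : ℝ × E => fderiv ℝ (chr G) (f p.1 p.2)) (S ×ˢ U) p :=
    ((h.metric.contDiffOn_chr.fderiv_of_isOpen (m := ∞) h.metric.isOpen (by simp)).comp h.smooth
      h.mapsTo_prod).continuousOn p hp
  have cH := h.contDiffOn_hess.continuousOn p hp
  have cP := (h.contDiffOn_pull h.metric.smooth).continuousOn p hp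
  obtain ⟨c₁, hc₁, e₁⟩ := (h.metric.inner _ (hV p hp)).eventually_bound
  obtain ⟨c₂, hc₂, e₂⟩ := ((h.immInto hp.1).metricOn_pull.inner p.2 hp.2).eventually_bound
  obtain ⟨g, hg, eg⟩ := ContinuousWithinAt.eventually_norm_le cG
  obtain ⟨γ, hγ, eγ⟩ := ContinuousWithinAt.eventually_norm_le cΓ
  obtain ⟨δ, hδ, eδ⟩ := ContinuousWithinAt.eventually_norm_le cD
  obtain ⟨η, hη, eη⟩ := ContinuousWithinAt.eventually_norm_le cH
  set r := 1 + 1 / c₁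
  set r' := 1 + 1 / c₂
  have hr : 0 ≤ r := by positivity
  have hr' : 0 ≤ r' := by positivity
  refine ⟨g * (η * r' * r') * r
    + g * (δ * r * r * r + δ * r * r * r + γ * r * (γ * r * r) + γ * r * (γ * r * r)) * r,
    by positivity, ?_⟩
  filter_upwards [eg, eγ, eδ, eη, cG.eventually e₁, cP.eventually e₂, self_mem_nhdsWithin] with
    q q1 q2 q3 q4 q5 q6 hq
  constructor
  · intro x y ν hx hy hν hn
    have e : G (f q.1 q.2) (sff G (f q.1) q.2 x y) ν
        = G (f q.1 q.2) (hess (chr G) (f q.1) q.2 x y) ν := by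
      rw [sff_apply, map_sub, sub_apply, hn, sub_zero]
    rw [e, ← Real.norm_eq_abs]
    refine (norm_apply₂_le _ q1 hg (by positivity) (norm_apply₂_le _ q4 hη hr'
      (unit_norm_le hc₂ q6 hx) (unit_norm_le hc₂ q6 hy)) (unit_norm_le hc₁ q5 hν)).trans ?_
    refine le_add_of_nonneg_right ?_
    positivity
  · intro x y u w hx hy hu hw
    have nx := unit_norm_le hc₁ q5 hx
    have ny := unit_norm_le hc₁ q5 hy
    have nu := unit_norm_le hc₁ q5 hu
    have nw := unit_norm_le hc₁ q5 hw
    have hD : ∀ x y u : W, ‖x‖ ≤ r → ‖y‖ ≤ r → ‖u‖ ≤ r →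
        ‖fderiv ℝ (chr G) (f q.1 q.2) x y u‖ ≤ δ * r * r * r := fun x y u hx hy hu =>
      norm_apply₂_le _ (((fderiv ℝ (chr G) (f q.1 q.2)).le_opNorm x).trans
        (mul_le_mul q3 hx (norm_nonneg _) hδ)) (by positivity) hr hy hu
    have hΓ : ∀ x y u : W, ‖x‖ ≤ r → ‖y‖ ≤ r → ‖u‖ ≤ r →
        ‖chr G (f q.1 q.2) x (chr G (f q.1 q.2) y u)‖ ≤ γ * r * (γ * r * r) :=
      fun x y u hx hy hu =>
      norm_apply₂_le _ q2 hγ hr hx (norm_apply₂_le _ q2 hγ hr hy hu)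
    have hc : ‖curv (chr G) (f q.1 q.2) x y u‖
        ≤ δ * r * r * r + δ * r * r * r + γ * r * (γ * r * r) + γ * r * (γ * r * r) := by
      rw [curv]
      exact norm_sub_le_of_le (norm_add_le_of_le (norm_sub_le_of_le (hD _ _ _ nx ny nu)
        (hD _ _ _ ny nx nu)) (hΓ _ _ _ nx ny nu)) (hΓ _ _ _ ny nx nu)
    rw [← Real.norm_eq_abs]
    refine (norm_apply₂_le _ q1 hg (by positivity) hc nw).trans ?_
    refine le_add_of_nonneg_left ?_
    positivity

end LocalFlow

/-! ### The parabolic inequality for the pulled-back Kähler form -/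

section LocalInequality

variable {E : Type*} [NormedAddCommGroup E] [NormedSpace ℝ E] [FiniteDimensional ℝ E]
  {W : Type*} [NormedAddCommGroup W] [NormedSpace ℝ W] [FiniteDimensional ℝ W]
  {G : W → W →L[ℝ] W →L[ℝ] ℝ} {J : W → W →L[ℝ] W} {f : ℝ → E → W} {S : Set ℝ} {U : Set E}
  {V : Set W}

theorem ContinuousWithinAt.normSq {X : Type*} [TopologicalSpace X] {B α : X → E →L[ℝ] E →L[ℝ] ℝ}
    {A : Set X} {x : X} (hB : ContinuousWithinAt B A x) (hα : ContinuousWithinAt α A x)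
    (hx : IsInner (B x)) : ContinuousWithinAt (fun y => GraphFlow.normSq (B y) (α y)) A x := by
  obtain ⟨e, he⟩ := hx.isInvertible
  have h1 : ContinuousAt (ContinuousLinearMap.inverse (R := ℝ) (M := E) (M₂ := E →L[ℝ] ℝ))
      (B x) := by
    have := contDiffAt_map_inverse (𝕜 := ℝ) (n := 1) e
    rw [he] at this
    exact this.continuousAt
  have h2 : ContinuousWithinAt (fun y => (B y).inverse) A x := h1.comp_continuousWithinAt hB
  unfold GraphFlow.normSq metricTrace
  refine tendsto_finsetSum _ fun i _ => tendsto_finsetSum _ fun j _ => ?_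
  exact ((hα.clm_apply continuousWithinAt_const).clm_apply continuousWithinAt_const).mul
    ((hα.clm_apply (h2.clm_apply continuousWithinAt_const)).clm_apply
      (h2.clm_apply continuousWithinAt_const))

theorem LocalFlow.continuousWithinAt_normSq (h : LocalFlow G f S U V)
    {B : W → W →L[ℝ] W →L[ℝ] ℝ} (hB : ContDiffOn ℝ ∞ B V) {p : ℝ × E} (hp : p ∈ S ×ˢ U) :
    ContinuousWithinAt (fun p : ℝ × E => GraphFlow.normSq (pull G (f p.1) p.2)
      (pull B (f p.1) p.2)) (S ×ˢ U) p :=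
  ContinuousWithinAt.normSq ((h.contDiffOn_pull h.metric.smooth).continuousOn p hp)
    ((h.contDiffOn_pull hB).continuousOn p hp) ((h.immInto hp.1).metricOn_pull.inner _ hp.2)

/-- At a spatial maximum, the squared norm of the pulled-back Kähler form of a mean curvature flow
grows at most exponentially. -/
theorem LocalFlow.deriv_normSq_le (h : LocalFlow G f S U V) (hJ : KahlerOn G J V)
    (hW : 2 * Module.finrank ℝ E = Module.finrank ℝ W) {c : ℝ}
    (hE : ∀ q ∈ V, ∀ x y, LinearMap.trace ℝ W (((curvL (chr G) q).flip x).flip y) = c * G q x y)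
    {p : ℝ × E} (hp : p ∈ S ×ˢ U) :
    ∃ C, ∀ᶠ p in 𝓝[S ×ˢ U] p,
      IsLocalMax (fun z => normSq (pull G (f p.1) z) (pull (kform G J) (f p.1) z)) p.2 →
      ∃ D, HasDerivWithinAt
        (fun s => normSq (pull G (f s) p.2) (pull (kform G J) (f s) p.2)) D S p.1 ∧
        D ≤ C * normSq (pull G (f p.1) p.2) (pull (kform G J) (f p.1) p.2) := by
  obtain ⟨K, hK, hb⟩ := h.exists_bound hp
  refine ⟨2 * |c| + (Fintype.card (Fin (Module.finrank ℝ E)) : ℝ) ^ 5 * (12 * K + 8 * K ^ 2), ?_⟩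
  filter_upwards [hb, self_mem_nhdsWithin] with q hq hqm hmax
  have hi := h.immInto hqm.1
  have hV := h.mapsTo q.1 hqm.1 hqm.2
  obtain ⟨e, he⟩ := exists_ortho (hi.metricOn_pull.inner _ hqm.2) rfl
  obtain ⟨ν, hν, hsν⟩ := exists_ortho_extend (h.metric.inner _ hV)
    (fun i => fderiv ℝ (f q.1) q.2 (e i)) (Module.finrank ℝ E) (by simp [← hW, two_mul])
  have hn : ∀ x j, G (f q.1 q.2) (fderiv ℝ (f q.1) q.2 x) (ν j) = 0 := by
    intro x j
    rw [he.expand (by simp) x]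
    simp [hsν]
  obtain ⟨D, d, hD, hd, hle⟩ := evolution_normSq (h.uniqueDiff q.1 hqm.1) hJ hi hqm.2 (by simp)
    (by simp [hW]) ((h.deriv_fderiv hqm.1 hqm.2 0).1) (h.velocity q.1 hqm.1 q.2 hqm.2)
    (fun v => (h.deriv_fderiv hqm.1 hqm.2 v).2) he hν hn (hE _ hV)
    (fun k i j => hq.1 _ _ _ ((he k k).trans (if_pos rfl)) ((he i i).trans (if_pos rfl))
      ((hν j j).trans (if_pos rfl)) fun w => hn w j) hq.2
  refine ⟨D, hD, hle.trans (add_le_of_nonpos_left (Finset.sum_nonpos fun k _ => ?_))⟩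
  refine (hd k).nonpos_of_isLocalMax ?_
  have g0 : geo (pull G (f q.1)) q.2 (e k) 0 = q.2 := by simp [geo]
  have hc : Tendsto (geo (pull G (f q.1)) q.2 (e k)) (𝓝 0) (𝓝 q.2) := by
    have := (contDiff_geo (g := pull G (f q.1)) (z := q.2) (v := e k)).continuous.tendsto 0
    rwa [g0] at this
  have := hc.eventually hmax
  filter_upwards [this] with r hr
  rw [g0]
  exact hr

end LocalInequality

/-! ### Tensor fields in charts -/

section Charts

variable {E : Type*} [NormedAddCommGroup E] [NormedSpace ℝ E]
  {H : Type*} [TopologicalSpace H] (I : ModelWithCorners ℝ E H) [I.Boundaryless]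
  {M : Type*} [TopologicalSpace M] [ChartedSpace H M] [IsManifold I ∞ M]

/-- The derivative of the inverse of the chart at `x`, as an endomorphism of the model space. -/
def dsymm (x : M) (y : E) : E →L[ℝ] E := mfderiv 𝓘(ℝ, E) I (extChartAt I x).symm y

/-- The derivative of the chart at `x`, as an endomorphism of the model space. -/
def dchart (x q : M) : E →L[ℝ] E := mfderiv I 𝓘(ℝ, E) (extChartAt I x) q

/-- The change of charts from the chart at `x` to the chart at `p`. -/
def transition (x p : M) : E → E := extChartAt I p ∘ (extChartAt I x).symm

/-- The domain of the change of charts from the chart at `x` to the chart at `p`. -/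
def overlap (x p : M) : Set E :=
  (extChartAt I x).target ∩ (extChartAt I x).symm ⁻¹' (extChartAt I p).source

variable {I}

theorem isOpen_overlap (x p : M) : IsOpen (overlap I x p) :=
  (continuousOn_extChartAt_symm x).isOpen_inter_preimage (isOpen_extChartAt_target x)
    (isOpen_extChartAt_source p)

theorem isManifold_one : IsManifold I 1 M :=
  IsManifold.of_le (n := ∞) (by exact_mod_cast (le_top : (1 : ℕ∞) ≤ ⊤))

theorem contMDiffAt_symm {x : M} {y : E} (hy : y ∈ (extChartAt I x).target) :
    ContMDiffAt 𝓘(ℝ, E) I ∞ (extChartAt I x).symm y :=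
  (contMDiffOn_extChartAt_symm (I := I) (n := ∞) x).contMDiffAt
    ((isOpen_extChartAt_target x).mem_nhds hy)

theorem mdifferentiableAt_symm {x : M} {y : E} (hy : y ∈ (extChartAt I x).target) :
    MDifferentiableAt 𝓘(ℝ, E) I (extChartAt I x).symm y :=
  (contMDiffAt_symm hy).mdifferentiableAt (by simp)

theorem contMDiffAt_chart {x q : M} (hq : q ∈ (extChartAt I x).source) :
    ContMDiffAt I 𝓘(ℝ, E) ∞ (extChartAt I x) q :=
  contMDiffAt_extChartAt' (by rwa [extChartAt_source] at hq)

theorem mdifferentiableAt_chart {x q : M} (hq : q ∈ (extChartAt I x).source) :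
    MDifferentiableAt I 𝓘(ℝ, E) (extChartAt I x) q :=
  (contMDiffAt_chart hq).mdifferentiableAt (by simp)

theorem dchart_dsymm {x : M} {y : E} (hy : y ∈ (extChartAt I x).target) (v : E) :
    dchart I x ((extChartAt I x).symm y) (dsymm I x y v) = v := by
  have : IsManifold I 1 M := isManifold_one
  have h := mfderiv_extChartAt_comp_mfderivWithin_extChartAt_symm (I := I) hy
  rw [I.range_eq_univ, mfderivWithin_univ] at h
  exact congrArg (fun L : E →L[ℝ] E => L v) h

theorem dsymm_dchart {x : M} {y : E} (hy : y ∈ (extChartAt I x).target) (v : E) :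
    dsymm I x y (dchart I x ((extChartAt I x).symm y) v) = v := by
  have : IsManifold I 1 M := isManifold_one
  have h := mfderivWithin_extChartAt_symm_comp_mfderiv_extChartAt (I := I) hy
  rw [I.range_eq_univ, mfderivWithin_univ] at h
  exact congrArg (fun L : E →L[ℝ] E => L v) h

theorem dsymm_dchart' {x q : M} (hq : q ∈ (extChartAt I x).source) (v : E) :
    dsymm I x (extChartAt I x q) (dchart I x q v) = v := by
  have h := dsymm_dchart ((extChartAt I x).map_source hq) v
  rwa [(extChartAt I x).left_inv hq] at h

theorem dchart_self (x : M) : dchart I x x = ContinuousLinearMap.id ℝ E := by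
  have : IsManifold I 1 M := isManifold_one
  exact mfderiv_extChartAt_self (I := I) (x := x)

theorem dsymm_self (x : M) : dsymm I x (extChartAt I x x) = ContinuousLinearMap.id ℝ E := by
  ext v
  have h := dsymm_dchart' (I := I) (mem_extChartAt_source (I := I) x) v
  rwa [dchart_self] at h

theorem contDiffOn_transition (x p : M) : ContDiffOn ℝ ∞ (transition I x p) (overlap I x p) := by
  rw [← contMDiffOn_iff_contDiffOn]
  intro y hy
  exact ((contMDiffAt_chart hy.2).comp y (contMDiffAt_symm hy.1)).contMDiffWithinAt

theorem fderiv_transition {x p : M} {y : E} (hy : y ∈ overlap I x p) (v : E) :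
    fderiv ℝ (transition I x p) y v
      = dchart I p ((extChartAt I x).symm y) (dsymm I x y v) := by
  have h := mfderiv_comp y (mdifferentiableAt_chart (I := I) hy.2) (mdifferentiableAt_symm hy.1)
  rw [mfderiv_eq_fderiv] at h
  exact congrArg (fun L : E →L[ℝ] E => L v) h

theorem transition_mem {x p : M} {y : E} (hy : y ∈ overlap I x p) :
    transition I x p y ∈ (extChartAt I p).target := (extChartAt I p).map_source hy.2

theorem symm_transition {x p : M} {y : E} (hy : y ∈ overlap I x p) :
    (extChartAt I p).symm (transition I x p y) = (extChartAt I x).symm y :=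
  (extChartAt I p).left_inv hy.2

theorem dsymm_fderiv_transition {x p : M} {y : E} (hy : y ∈ overlap I x p) (v : E) :
    dsymm I p (transition I x p y) (fderiv ℝ (transition I x p) y v) = dsymm I x y v := by
  rw [fderiv_transition hy]
  exact dsymm_dchart' hy.2 _

theorem injective_fderiv_transition {x p : M} {y : E} (hy : y ∈ overlap I x p) :
    Function.Injective (fderiv ℝ (transition I x p) y) := by
  intro u v h
  have := congrArg (dsymm I p (transition I x p y)) h
  rw [dsymm_fderiv_transition hy, dsymm_fderiv_transition hy] at this
  rw [← dchart_dsymm hy.1 u, ← dchart_dsymm hy.1 v, this]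

theorem surjective_fderiv_transition [FiniteDimensional ℝ E] {x p : M} {y : E}
    (hy : y ∈ overlap I x p) : Function.Surjective (fderiv ℝ (transition I x p) y) :=
  LinearMap.surjective_of_injective (f := (fderiv ℝ (transition I x p) y : E →ₗ[ℝ] E))
    (injective_fderiv_transition hy)

/-- The coordinate vector fields are smooth sections of the tangent bundle. -/
theorem contMDiffOn_dsymm (x : M) (v : E) :
    ContMDiffOn 𝓘(ℝ, E) I.tangent ∞
      (fun y => (⟨(extChartAt I x).symm y, dsymm I x y v⟩ : TangentBundle I M))
      (extChartAt I x).target := by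
  have h1 := (contMDiffOn_extChartAt_symm (I := I) (n := ∞) x).contMDiffOn_tangentMapWithin
    (m := ∞) (by simp) (isOpen_extChartAt_target x).uniqueMDiffOn
  have h2 : ContMDiff 𝓘(ℝ, E) 𝓘(ℝ, E).tangent ∞
      (fun y : E => (⟨y, v⟩ : TangentBundle 𝓘(ℝ, E) E)) :=
    contMDiff_vectorSpace_iff_contDiff.2 contDiff_const
  have h3 := h1.comp h2.contMDiffOn (s := (extChartAt I x).target) fun y hy => hy
  refine h3.congr fun y hy => ?_
  simp only [Function.comp_apply, tangentMapWithin,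
    mfderivWithin_of_isOpen (isOpen_extChartAt_target x) hy]
  rfl

theorem chartMetric_apply (g : BilinField I M) (x : M) (y u v : E) :
    chartMetric I g x y u v = g ((extChartAt I x).symm y) (dsymm I x y u) (dsymm I x y v) := rfl

theorem chartEndo_apply (J : EndoField I M) (x : M) (y u : E) :
    chartEndo I J x y u = dchart I x ((extChartAt I x).symm y)
      (J ((extChartAt I x).symm y) (dsymm I x y u)) := rfl

/-- Smoothness of a field of bilinear forms. -/
def SmoothBilin (g : BilinField I M) : Prop :=
  ContMDiff I (I.prod 𝓘(ℝ, E →L[ℝ] E →L[ℝ] ℝ)) ∞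
    (fun x : M => TotalSpace.mk' (E →L[ℝ] E →L[ℝ] ℝ)
      (E := fun x : M => TangentSpace I x →L[ℝ] TangentSpace I x →L[ℝ] ℝ) x (g x))

/-- A smooth field of bilinear forms applied to smooth vector fields is a smooth function. -/
theorem SmoothBilin.contDiffOn_apply {g : BilinField I M} (hg : SmoothBilin g) {x : M} {V : Set E}
    (hV : V ⊆ (extChartAt I x).target) {u v : E → E}
    (hu : ContMDiffOn 𝓘(ℝ, E) I.tangent ∞
      (fun y => (⟨(extChartAt I x).symm y, u y⟩ : TangentBundle I M)) V)
    (hv : ContMDiffOn 𝓘(ℝ, E) I.tangent ∞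
      (fun y => (⟨(extChartAt I x).symm y, v y⟩ : TangentBundle I M)) V) :
    ContDiffOn ℝ ∞ (fun y => g ((extChartAt I x).symm y) (u y) (v y)) V := by
  rw [← contMDiffOn_iff_contDiffOn]
  intro y hy
  have h1 : ContMDiffWithinAt 𝓘(ℝ, E) (I.prod 𝓘(ℝ)) ∞
      (fun m ↦ TotalSpace.mk' ℝ (E := Bundle.Trivial M ℝ) ((extChartAt I x).symm m)
        (g ((extChartAt I x).symm m) (u m) (v m))) V y := by
    apply ContMDiffWithinAt.clm_bundle_apply₂ (F₁ := E) (F₂ := E)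
    · exact ContMDiffAt.comp_contMDiffWithinAt y hg.contMDiffAt
        (contMDiffAt_symm (hV hy)).contMDiffWithinAt
    · exact hu y hy
    · exact hv y hy
  simp only [contMDiffWithinAt_totalSpace] at h1
  exact h1.2

variable [FiniteDimensional ℝ E]

theorem SmoothBilin.contDiffOn_chartMetric {g : BilinField I M} (hg : SmoothBilin g) (x : M) :
    ContDiffOn ℝ ∞ (chartMetric I g x) (extChartAt I x).target := by
  rw [contDiffOn_clm_apply]
  intro u
  rw [contDiffOn_clm_apply]
  intro v
  exact hg.contDiffOn_apply subset_rfl (contMDiffOn_dsymm x u) (contMDiffOn_dsymm x v)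

/-- A smooth Riemannian metric. -/
structure IsMetric (g : BilinField I M) : Prop where
  smooth : SmoothBilin g
  symm : ∀ (x : M) (u v : TangentSpace I x), g x u v = g x v u
  pos : ∀ (x : M) (v : TangentSpace I x), v ≠ 0 → 0 < g x v v

theorem injective_dsymm {x : M} {y : E} (hy : y ∈ (extChartAt I x).target) :
    Function.Injective (dsymm I x y) := fun u v h => by
  rw [← dchart_dsymm hy u, ← dchart_dsymm hy v, h]

/-- The coordinate expressions of `g` are smooth Riemannian metrics. -/
def MetricField (g : BilinField I M) : Prop :=
  ∀ x : M, MetricOn (chartMetric I g x) (extChartAt I x).target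

theorem IsMetric.metricField {g : BilinField I M} (hg : IsMetric g) : MetricField g := by
  intro x
  refine ⟨isOpen_extChartAt_target x, hg.smooth.contDiffOn_chartMetric x, fun y hy =>
    ⟨fun u v => ?_, fun v hv => ?_⟩⟩
  · rw [chartMetric_apply, chartMetric_apply]
    exact hg.symm _ (dsymm I x y u) (dsymm I x y v)
  · rw [chartMetric_apply]
    refine hg.pos _ (dsymm I x y v) fun h => hv (injective_dsymm hy ?_)
    rw [map_zero]
    exact h

theorem chartMetric_eq_pull (g : BilinField I M) {x p : M} {y : E} (hy : y ∈ overlap I x p) :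
    chartMetric I g x y = pull (chartMetric I g p) (transition I x p) y := by
  ext u v
  rw [pull_apply, chartMetric_apply, chartMetric_apply, dsymm_fderiv_transition hy,
    dsymm_fderiv_transition hy, symm_transition hy]

theorem MetricField.immInto_transition {g : BilinField I M} (hg : MetricField g) (x p : M) :
    ImmInto (chartMetric I g p) (transition I x p) (overlap I x p) (extChartAt I p).target where
  metric := hg p
  openU := isOpen_overlap x p
  smooth := contDiffOn_transition x p
  mapsTo _ hy := transition_mem hy
  injective _ hy := injective_fderiv_transition hy

/-- Naturality of the curvature under changes of charts. -/
theorem MetricField.curv_transition {g : BilinField I M} (hg : MetricField g) {x p : M} {y : E}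
    (hy : y ∈ overlap I x p) (u v w : E) :
    curv (chr (chartMetric I g p)) (transition I x p y) (fderiv ℝ (transition I x p) y u)
      (fderiv ℝ (transition I x p) y v) (fderiv ℝ (transition I x p) y w)
      = fderiv ℝ (transition I x p) y (curv (chr (chartMetric I g x)) y u v w) :=
  curv_isometry ((hg x).mono inter_subset_left (isOpen_overlap x p))
    (hg.immInto_transition x p) (fun _ hq => chartMetric_eq_pull g hq)
    (fun _ hq => surjective_fderiv_transition hq) hy u v w

theorem mem_overlap_self {x : M} {y : E} (hy : y ∈ (extChartAt I x).target) :
    y ∈ overlap I x ((extChartAt I x).symm y) := ⟨hy, mem_extChartAt_source _⟩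

theorem transition_self {x : M} (y : E) :
    transition I x ((extChartAt I x).symm y) y
      = extChartAt I ((extChartAt I x).symm y) ((extChartAt I x).symm y) := rfl

/-- The curvature at the centre of a chart. -/
theorem MetricField.riemann_eq {g : BilinField I M} (hg : MetricField g) (x : M) (u v w : E) :
    riemann I g x u v w = curv (chr (chartMetric I g x)) (extChartAt I x x) u v w := by
  have hd := (hg x).chr_differentiableAt (mem_extChartAt_target x)
  rw [curv, ← fderiv_apply₂ hd, ← fderiv_apply₂ hd]
  simp only [chr_apply]
  rfl

theorem MetricField.ricci_eq {g : BilinField I M} (hg : MetricField g) (x : M) (u v : E) :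
    ricci I g x u v = LinearMap.trace ℝ E
      (((curvL (chr (chartMetric I g x)) (extChartAt I x x)).flip u).flip v) := by
  rw [LinearMap.trace_eq_matrix_trace ℝ (Module.finBasis ℝ E), Matrix.trace]
  unfold ricci
  refine Finset.sum_congr rfl fun i _ => ?_
  rw [Matrix.diag_apply, LinearMap.toMatrix_apply]
  exact congrArg (fun w : E => (Module.finBasis ℝ E).coord i w) (hg.riemann_eq x _ u v)

/-- The Einstein condition at all points of a chart. -/
theorem MetricField.trace_curv {g : BilinField I M} (hg : MetricField g) {c : ℝ}
    (hc : ∀ (x : M) (u v : TangentSpace I x), ricci I g x u v = c * g x u v) (x : M) {y : E}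
    (hy : y ∈ (extChartAt I x).target) (u v : E) :
    LinearMap.trace ℝ E (((curvL (chr (chartMetric I g x)) y).flip u).flip v)
      = c * chartMetric I g x y u v := by
  have hm := mem_overlap_self (I := I) hy
  set p := (extChartAt I x).symm y with hp
  set D := fderiv ℝ (transition I x p) y with hD
  let Le : E ≃ₗ[ℝ] E := LinearEquiv.ofBijective (D : E →ₗ[ℝ] E)
    ⟨injective_fderiv_transition hm, surjective_fderiv_transition hm⟩
  have h1 : Le.conj (((curvL (chr (chartMetric I g x)) y).flip u).flip v)
      = (((curvL (chr (chartMetric I g p)) (transition I x p y)).flip (D u)).flip (D v)) := by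
    refine LinearMap.ext fun w => ?_
    obtain ⟨w, rfl⟩ := Le.surjective w
    rw [LinearEquiv.conj_apply_apply, LinearEquiv.symm_apply_apply]
    exact (hg.curv_transition hm w u v).symm
  rw [← LinearMap.trace_conj' _ Le, h1, transition_self, ← hg.ricci_eq]
  have h2 : ∀ u, D u = dsymm I x y u := fun u => by
    rw [hD, fderiv_transition hm, dchart_self]; rfl
  rw [h2, h2, chartMetric_apply]
  exact hc p (dsymm I x y u) (dsymm I x y v)

end Charts

/-! ### Kähler structures in charts -/

section KahlerCharts

variable {E : Type*} [NormedAddCommGroup E] [NormedSpace ℝ E] [FiniteDimensional ℝ E]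
  {H : Type*} [TopologicalSpace H] {I : ModelWithCorners ℝ E H} [I.Boundaryless]
  {M : Type*} [TopologicalSpace M] [ChartedSpace H M] [IsManifold I ∞ M]
  {g : BilinField I M} {J : EndoField I M}

theorem kform_chart_apply {x : M} {y : E} (hy : y ∈ (extChartAt I x).target) (u v : E) :
    kform (chartMetric I g x) (chartEndo I J x) y u v
      = g ((extChartAt I x).symm y) (J ((extChartAt I x).symm y) (dsymm I x y u))
          (dsymm I x y v) := by
  rw [kform_apply, chartMetric_apply, chartEndo_apply]
  exact congrArg (fun w : E => g ((extChartAt I x).symm y) w (dsymm I x y v)) (dsymm_dchart hy _)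

theorem IsKahler.contDiffOn_kform (hK : IsKahler I g J) (hg : IsMetric g) (x : M) :
    ContDiffOn ℝ ∞ (kform (chartMetric I g x) (chartEndo I J x)) (extChartAt I x).target := by
  rw [contDiffOn_clm_apply]
  intro u
  rw [contDiffOn_clm_apply]
  intro v
  have h1 : ContMDiffOn 𝓘(ℝ, E) I.tangent ∞
      (fun y => (⟨(extChartAt I x).symm y, J ((extChartAt I x).symm y) (dsymm I x y u)⟩ :
        TangentBundle I M)) (extChartAt I x).target := by
    refine ContMDiffOn.clm_bundle_apply (F₁ := E) (F₂ := E)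
      (E₁ := fun x : M => TangentSpace I x) (E₂ := fun x : M => TangentSpace I x) ?_
      (contMDiffOn_dsymm x u)
    exact hK.smooth.comp_contMDiffOn (contMDiffOn_extChartAt_symm x)
  exact (hg.smooth.contDiffOn_apply subset_rfl h1 (contMDiffOn_dsymm x v)).congr
    fun y hy => kform_chart_apply hy u v

theorem kform_chart_eq_pull {x p : M} {y : E} (hy : y ∈ overlap I x p) :
    kform (chartMetric I g x) (chartEndo I J x) y
      = pull (kform (chartMetric I g p) (chartEndo I J p)) (transition I x p) y := by
  ext u v
  rw [pull_apply, kform_chart_apply hy.1, kform_chart_apply (transition_mem hy),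
    dsymm_fderiv_transition hy, dsymm_fderiv_transition hy, symm_transition hy]

theorem IsKahler.parallel_center (hK : IsKahler I g J) (hg : IsMetric g) (p : M) (w u v : E) :
    fderiv ℝ (kform (chartMetric I g p) (chartEndo I J p)) (extChartAt I p p) w u v
      = kform (chartMetric I g p) (chartEndo I J p) (extChartAt I p p)
          (chr (chartMetric I g p) (extChartAt I p p) w u) v
        + kform (chartMetric I g p) (chartEndo I J p) (extChartAt I p p) u
          (chr (chartMetric I g p) (extChartAt I p p) w v) := by
  have hm := hg.metricField p
  have hy := mem_extChartAt_target (I := I) p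
  have hsk := (hK.contDiffOn_kform hg p).contDiffAt (hm.isOpen.mem_nhds hy)
  have hd : DifferentiableAt ℝ (fun z => chartEndo I J p z u) (extChartAt I p p) := by
    have h1 : (fun z => chartEndo I J p z u) =ᶠ[𝓝 (extChartAt I p p)] fun z =>
        (chartMetric I g p z).inverse (kform (chartMetric I g p) (chartEndo I J p) z u) := by
      filter_upwards [hm.isOpen.mem_nhds hy] with z hz
      exact ((hm.inner z hz).isInvertible.inverse_apply_self _).symm
    refine DifferentiableAt.congr_of_eventuallyEq ?_ h1
    obtain ⟨e, he⟩ := (hm.inner _ hy).isInvertible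
    have h2 : ContDiffAt ℝ ∞ ContinuousLinearMap.inverse
        (chartMetric I g p (extChartAt I p p)) := by
      rw [← he]; exact contDiffAt_map_inverse e
    exact ((h2.comp _ (hm.contDiffAt hy)).clm_apply
      (hsk.clm_apply contDiffAt_const)).differentiableAt
      (by simp)
  rw [← fderiv_apply₂ (hsk.differentiableAt (by simp))]
  have h3 := ((hm.differentiableAt hy).hasFDerivAt.clm_apply hd.hasFDerivAt).clm_apply
    (hasFDerivAt_const v _)
  have h4 := hK.parallel p w u
  refine (congrArg (fun L : E →L[ℝ] ℝ => L w) h3.fderiv).trans ?_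
  simp only [← chr_apply] at h4
  have h5 : fderiv ℝ (fun z => chartEndo I J p z u) (extChartAt I p p) w
      = chartEndo I J p (extChartAt I p p) (chr (chartMetric I g p) (extChartAt I p p) w u)
        - chr (chartMetric I g p) (extChartAt I p p) w
          (chartEndo I J p (extChartAt I p p) u) := by
    rw [eq_sub_iff_add_eq, ← sub_eq_zero]
    exact h4
  simp only [ContinuousLinearMap.comp_zero, zero_add, add_apply, ContinuousLinearMap.coe_comp,
    Function.comp_apply, ContinuousLinearMap.flip_apply, hm.compat hy, h5, map_sub, sub_apply,
    kform_apply]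
  ring

theorem IsKahler.kahlerOn (hK : IsKahler I g J) (hg : IsMetric g) (x : M) :
    KahlerOn (chartMetric I g x) (chartEndo I J x) (extChartAt I x).target where
  metric := hg.metricField x
  sq y hy u := by
    rw [chartEndo_apply, chartEndo_apply]
    have h1 : dsymm I x y (dchart I x ((extChartAt I x).symm y)
        (J ((extChartAt I x).symm y) (dsymm I x y u)))
        = J ((extChartAt I x).symm y) (dsymm I x y u) := dsymm_dchart hy _
    rw [h1]
    refine (congrArg (dchart I x ((extChartAt I x).symm y))
      (hK.sq ((extChartAt I x).symm y) (dsymm I x y u))).trans ?_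
    exact (map_neg (dchart I x ((extChartAt I x).symm y)) (dsymm I x y u)).trans
      (congrArg Neg.neg (dchart_dsymm hy u))
  compat y hy u v := by
    have h0 : chartMetric I g x y (chartEndo I J x y u) (chartEndo I J x y v)
        = kform (chartMetric I g x) (chartEndo I J x) y u (chartEndo I J x y v) := rfl
    rw [h0, kform_chart_apply hy, chartEndo_apply, chartMetric_apply]
    have h1 : dsymm I x y (dchart I x ((extChartAt I x).symm y)
        (J ((extChartAt I x).symm y) (dsymm I x y v)))
        = J ((extChartAt I x).symm y) (dsymm I x y v) := dsymm_dchart hy _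
    rw [h1]
    exact hK.compat ((extChartAt I x).symm y) (dsymm I x y u) (dsymm I x y v)
  parallel :=
    { openV := isOpen_extChartAt_target x
      smooth := hK.contDiffOn_kform hg x
      smoothΓ := (hg.metricField x).contDiffOn_chr
      parallel := by
        intro y hy w u v
        have hm := mem_overlap_self (I := I) hy
        set p := (extChartAt I x).symm y with hp
        set η := kform (chartMetric I g p) (chartEndo I J p) with hη
        have hy' : transition I x p y ∈ (extChartAt I p).target := transition_mem hm
        have hd : DifferentiableAt ℝ η (transition I x p y) :=
          ((hK.contDiffOn_kform hg p).contDiffAt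
            ((isOpen_extChartAt_target p).mem_nhds hy')).differentiableAt (by simp)
        have hi := hg.metricField.immInto_transition x p
        have he : (kform (chartMetric I g x) (chartEndo I J x)) =ᶠ[𝓝 y]
            pull η (transition I x p) := by
          filter_upwards [(isOpen_overlap x p).mem_nhds hm] with z hz using kform_chart_eq_pull hz
        have hds : DifferentiableAt ℝ (kform (chartMetric I g x) (chartEndo I J x)) y :=
          ((hK.contDiffOn_kform hg x).contDiffAt
            ((isOpen_extChartAt_target x).mem_nhds hy)).differentiableAt (by simp)
        rw [he.eq_of_nhds, ← fderiv_apply₂ hds]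
        have he' : (fun z => kform (chartMetric I g x) (chartEndo I J x) z u v) =ᶠ[𝓝 y]
            fun z => pull η (transition I x p) z u v := by
          filter_upwards [he] with z hz using by rw [hz]
        rw [he'.fderiv_eq]
        have h3 := fun u : E =>
          (hi.mapInto.differentiableAt_fderiv hm).hasFDerivAt.clm_apply (hasFDerivAt_const u y)
        have h2 := hd.hasFDerivAt.comp y (hi.mapInto.differentiableAt hm).hasFDerivAt
        refine (congrArg (fun L : E →L[ℝ] ℝ => L w)
          ((h2.clm_apply (h3 u)).clm_apply (h3 v)).fderiv).trans ?_
        have h4 := fun a b : E => hess_isometry hi (fun q hq => chartMetric_eq_pull g hq) hm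
          (surjective_fderiv_transition hm) a b
        rw [pull_apply, pull_apply, ← h4, ← h4, hess_apply, hess_apply]
        have h5 := hK.parallel_center hg p (fderiv ℝ (transition I x p) y w)
          (fderiv ℝ (transition I x p) y u) (fderiv ℝ (transition I x p) y v)
        rw [← hη, ← transition_self] at h5
        simp only [Function.comp_apply, map_add, add_apply, ContinuousLinearMap.coe_comp,
          ContinuousLinearMap.flip_apply, ContinuousLinearMap.comp_zero, zero_add]
        rw [h5]
        ring }

end KahlerCharts

/-! ### Maps written in charts -/

section Congruence

variable {E : Type*} [NormedAddCommGroup E] [NormedSpace ℝ E] [FiniteDimensional ℝ E]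
  {W : Type*} [NormedAddCommGroup W] [NormedSpace ℝ W] [FiniteDimensional ℝ W]
  {W' : Type*} [NormedAddCommGroup W'] [NormedSpace ℝ W'] [FiniteDimensional ℝ W']

theorem chr_congr {G G' : W → W →L[ℝ] W →L[ℝ] ℝ} {q : W} (h : G =ᶠ[𝓝 q] G') :
    chr G q = chr G' q := by
  simp only [chr, h.fderiv_eq, h.eq_of_nhds]

variable {G : W → W →L[ℝ] W →L[ℝ] ℝ} {G' : W' → W' →L[ℝ] W' →L[ℝ] ℝ} {f : E → W} {f' : E → W'}
  {U U' O : Set E} {V O' : Set W} {V' : Set W'} {θ : W → W'} {κ : E → E}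

/-- Naturality of the second fundamental form under local isometries `θ` of the ambient space and
reparametrizations `κ`. -/
theorem sff_natural (h : ImmInto G f U V) (h' : ImmInto G' f' U' V') (hθ : ImmInto G' θ O' V')
    (hGθ : ∀ q ∈ O', G q = pull G' θ q) {z : E} (hz : z ∈ U') (hκ : ContDiffAt ℝ ∞ κ z)
    (hκz : κ z ∈ U) (hκs : Function.Surjective (fderiv ℝ κ z)) (hfz : f (κ z) ∈ O')
    (hθs : Function.Surjective (fderiv ℝ θ (f (κ z))))
    (hf : f' =ᶠ[𝓝 z] θ ∘ f ∘ κ) (u v : E) :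
    sff G' f' z u v
      = fderiv ℝ θ (f (κ z)) (sff G f (κ z) (fderiv ℝ κ z u) (fderiv ℝ κ z v)) := by
  have hfc := h.mapInto.contDiffAt hκz
  have hθc : ContDiffAt ℝ ∞ θ (f (κ z)) := hθ.mapInto.contDiffAt hfz
  have hfκ : ContDiffAt ℝ ∞ (f ∘ κ) z := hfc.comp z hκ
  have d1 : fderiv ℝ f' z = (fderiv ℝ θ (f (κ z))) ∘L ((fderiv ℝ f (κ z)) ∘L fderiv ℝ κ z) := by
    have dκ := (hκ.differentiableAt (by simp)).hasFDerivAt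
    have df := (hfc.differentiableAt (by simp)).hasFDerivAt
    have dθ := (hθc.differentiableAt (by simp)).hasFDerivAt
    rw [hf.fderiv_eq]
    exact (dθ.comp z (df.comp z dκ)).fderiv
  have d2 : fderiv ℝ (f ∘ κ) z = (fderiv ℝ f (κ z)) ∘L fderiv ℝ κ z :=
    ((hfc.differentiableAt (by simp)).hasFDerivAt.comp z
      (hκ.differentiableAt (by simp)).hasFDerivAt).fderiv
  have hf0 : f' z = θ (f (κ z)) := hf.eq_of_nhds
  have e1 : hess (chr G') f' z u v = fderiv ℝ θ (f (κ z)) (hess (chr G) (f ∘ κ) z u v) := by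
    rw [hess_congr hf, hess_comp (chr G') (p := θ) (q := f ∘ κ) hθc hfκ]
    have := hess_isometry hθ hGθ hfz hθs (fderiv ℝ (f ∘ κ) z u) (fderiv ℝ (f ∘ κ) z v)
    rw [Function.comp_apply, this, ← map_add, hess_apply, add_comm]
    rfl
  obtain ⟨x, hx⟩ := hκs (chr (pull G f) (κ z) (fderiv ℝ κ z u) (fderiv ℝ κ z v)
    + fderiv ℝ (fderiv ℝ κ) z u v)
  symm
  refine h'.eq_sff hz (x := x) (fun w => ?_) ?_
  · have h2 : ∀ a b, G' (f' z) (fderiv ℝ θ (f (κ z)) a) (fderiv ℝ θ (f (κ z)) b)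
        = G (f (κ z)) a b := fun a b => by rw [hf0, hGθ _ hfz, pull_apply]
    rw [d1, ContinuousLinearMap.coe_comp, Function.comp_apply, h2]
    exact h.sff_normal hκz _ _ _
  · have h3 : hess (chr G) (f ∘ κ) z u v = sff G f (κ z) (fderiv ℝ κ z u) (fderiv ℝ κ z v)
        + fderiv ℝ f (κ z) (fderiv ℝ κ z x) := by
      rw [hess_comp (chr G) hfc hκ, sff_apply, hx, map_add]
      abel
    rw [e1, h3, map_add, d1]
    rfl

/-- Naturality of the mean curvature vector. -/
theorem meanCurv_natural (h : ImmInto G f U V) (h' : ImmInto G' f' U' V') (hθ : ImmInto G' θ O' V')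
    (hGθ : ∀ q ∈ O', G q = pull G' θ q) {z : E} (hz : z ∈ U') (hκ : ContDiffAt ℝ ∞ κ z)
    (hκz : κ z ∈ U) (hκs : Function.Surjective (fderiv ℝ κ z)) (hfz : f (κ z) ∈ O')
    (hθs : Function.Surjective (fderiv ℝ θ (f (κ z))))
    (hf : f' =ᶠ[𝓝 z] θ ∘ f ∘ κ) :
    meanCurv G' f' z = fderiv ℝ θ (f (κ z)) (meanCurv G f (κ z)) := by
  obtain ⟨e, he⟩ := exists_ortho (h'.metricOn_pull.inner z hz) rfl
  have hfc := h.mapInto.contDiffAt hκz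
  have hθc : ContDiffAt ℝ ∞ θ (f (κ z)) := hθ.mapInto.contDiffAt hfz
  have d1 : fderiv ℝ f' z = (fderiv ℝ θ (f (κ z))) ∘L ((fderiv ℝ f (κ z)) ∘L fderiv ℝ κ z) := by
    rw [hf.fderiv_eq]
    exact ((hθc.differentiableAt (by simp)).hasFDerivAt.comp z
      ((hfc.differentiableAt (by simp)).hasFDerivAt.comp z
        (hκ.differentiableAt (by simp)).hasFDerivAt)).fderiv
  have hf0 : f' z = θ (f (κ z)) := hf.eq_of_nhds
  have he' : Ortho (pull G f (κ z)) fun i => fderiv ℝ κ z (e i) := by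
    intro i j
    rw [← he i j, pull_apply, pull_apply, d1, hf0, hGθ _ hfz, pull_apply]
    rfl
  rw [h'.meanCurv_eq hz he (by simp), h.meanCurv_eq hκz he' (by simp), map_sum]
  exact Finset.sum_congr rfl fun k _ =>
    sff_natural h h' hθ hGθ hz hκ hκz hκs hfz hθs hf (e k) (e k)

end Congruence

section Written

variable {E : Type*} [NormedAddCommGroup E] [NormedSpace ℝ E] [FiniteDimensional ℝ E]
  {H : Type*} [TopologicalSpace H] (I : ModelWithCorners ℝ E H) [I.Boundaryless]
  {M : Type*} [TopologicalSpace M] [ChartedSpace H M] [IsManifold I ∞ M]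
  {E' : Type*} [NormedAddCommGroup E'] [NormedSpace ℝ E'] [FiniteDimensional ℝ E']
  {H' : Type*} [TopologicalSpace H'] (I' : ModelWithCorners ℝ E' H') [I'.Boundaryless]
  {N : Type*} [TopologicalSpace N] [ChartedSpace H' N] [IsManifold I' ∞ N]

theorem chartMetric_self (g : BilinField I M) (x : M) :
    chartMetric I g x (extChartAt I x x) = (g x : E →L[ℝ] E →L[ℝ] ℝ) := by
  refine ContinuousLinearMap.ext fun u => ContinuousLinearMap.ext fun v => ?_
  rw [chartMetric_apply, extChartAt_to_inv, dsymm_self]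
  rfl

theorem chartEndo_self (J : EndoField I M) (x : M) :
    chartEndo I J x (extChartAt I x x) = (J x : E →L[ℝ] E) := by
  refine ContinuousLinearMap.ext fun u => ?_
  rw [chartEndo_apply, extChartAt_to_inv, dsymm_self, dchart_self]
  rfl

/-- The map `F` in the charts at `x` and at `p`. -/
def written (x : M) (p : N) (F : M → N) : E → E' := extChartAt I' p ∘ F ∘ (extChartAt I x).symm

/-- The domain of `written`. -/
def writtenDom (x : M) (p : N) (F : M → N) : Set E :=
  (extChartAt I x).target ∩ (extChartAt I x).symm ⁻¹' (F ⁻¹' (extChartAt I' p).source)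

variable {I I'} {F : M → N}

theorem isOpen_writtenDom (hF : Continuous F) (x : M) (p : N) :
    IsOpen (writtenDom I I' x p F) :=
  (continuousOn_extChartAt_symm x).isOpen_inter_preimage (isOpen_extChartAt_target x)
    ((isOpen_extChartAt_source p).preimage hF)

theorem contDiffOn_written (hF : ContMDiff I I' ∞ F) (x : M) (p : N) :
    ContDiffOn ℝ ∞ (written I I' x p F) (writtenDom I I' x p F) := by
  rw [← contMDiffOn_iff_contDiffOn]
  intro y hy
  exact ((contMDiffAt_chart hy.2).comp y
    ((hF _).comp y (contMDiffAt_symm hy.1))).contMDiffWithinAt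

/-- The differential of `F` at `q`, as a linear map of the model spaces. -/
def dmap (I : ModelWithCorners ℝ E H) (I' : ModelWithCorners ℝ E' H') (F : M → N) (q : M) :
    E →L[ℝ] E' := mfderiv I I' F q

theorem fderiv_written (hF : ContMDiff I I' ∞ F) {x : M} {p : N} {z : E}
    (hz : z ∈ writtenDom I I' x p F) (v : E) :
    fderiv ℝ (written I I' x p F) z v
      = dchart I' p (F ((extChartAt I x).symm z))
          (dmap I I' F ((extChartAt I x).symm z) (dsymm I x z v)) := by
  have h0 := (hF ((extChartAt I x).symm z)).mdifferentiableAt (by simp)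
  have h1 := mfderiv_comp z h0 (mdifferentiableAt_symm hz.1)
  have h := mfderiv_comp z (mdifferentiableAt_chart (I := I') hz.2)
    (h0.comp z (mdifferentiableAt_symm hz.1))
  rw [mfderiv_eq_fderiv, h1] at h
  exact congrArg (fun L : E →L[ℝ] E' => L v) h

theorem injective_dchart {p q : N} (hq : q ∈ (extChartAt I' p).source) :
    Function.Injective (dchart I' p q) := fun u v h => by
  rw [← dsymm_dchart' hq u, ← dsymm_dchart' hq v, h]

theorem immInto_written {G : BilinField I' N} (hG : MetricField G) (hF : ContMDiff I I' ∞ F)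
    (hi : ∀ q, Function.Injective (mfderiv I I' F q)) (x : M) (p : N) :
    ImmInto (chartMetric I' G p) (written I I' x p F) (writtenDom I I' x p F)
      (extChartAt I' p).target where
  metric := hG p
  openU := isOpen_writtenDom hF.continuous x p
  smooth := contDiffOn_written hF x p
  mapsTo _ hz := (extChartAt I' p).map_source hz.2
  injective z hz u v h := by
    rw [fderiv_written hF hz, fderiv_written hF hz] at h
    exact injective_dsymm hz.1 (hi _ (injective_dchart hz.2 h))

theorem pull_written {G : BilinField I' N} (hF : ContMDiff I I' ∞ F) {x : M} {p : N}
    {z : E} (hz : z ∈ writtenDom I I' x p F) :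
    pull (chartMetric I' G p) (written I I' x p F) z
      = chartMetric I (induced I I' G F) x z := by
  ext u v
  have h1 : ∀ w, dsymm I' p (written I I' x p F z) (fderiv ℝ (written I I' x p F) z w)
      = dmap I I' F ((extChartAt I x).symm z) (dsymm I x z w) := fun w => by
    rw [fderiv_written hF hz]
    exact dsymm_dchart' hz.2 _
  have h2 : (extChartAt I' p).symm (written I I' x p F z) = F ((extChartAt I x).symm z) :=
    (extChartAt I' p).left_inv hz.2
  rw [pull_apply, chartMetric_apply, h1, h1, h2]
  rfl

theorem mem_writtenDom_self (x : M) : extChartAt I x x ∈ writtenDom I I' x (F x) F :=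
  ⟨mem_extChartAt_target x, by
    change F ((extChartAt I x).symm (extChartAt I x x)) ∈ (extChartAt I' (F x)).source
    rw [extChartAt_to_inv]; exact mem_extChartAt_source _⟩

theorem written_self (x : M) :
    written I I' x (F x) F (extChartAt I x x) = extChartAt I' (F x) (F x) := by
  change extChartAt I' (F x) (F ((extChartAt I x).symm (extChartAt I x x))) = _
  rw [extChartAt_to_inv]

/-- The differential in the centred charts. -/
theorem fderiv_written_self (hF : ContMDiff I I' ∞ F) (x : M) :
    fderiv ℝ (written I I' x (F x) F) (extChartAt I x x) = dmap I I' F x := by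
  ext v
  rw [fderiv_written hF (mem_writtenDom_self x), extChartAt_to_inv, dchart_self, dsymm_self]
  rfl

theorem secondFund_eq {G : BilinField I' N} (hG : MetricField G) (hF : ContMDiff I I' ∞ F)
    (hi : ∀ q, Function.Injective (mfderiv I I' F q)) (x : M) (u v : E) :
    secondFund I I' G F x u v
      = sff (chartMetric I' G (F x)) (written I I' x (F x) F) (extChartAt I x x) u v := by
  have hI := immInto_written hG hF hi x (F x)
  have hz := mem_writtenDom_self (I := I) (I' := I') (F := F) x
  have hp : pull (chartMetric I' G (F x)) (written I I' x (F x) F) =ᶠ[𝓝 (extChartAt I x x)]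
      chartMetric I (induced I I' G F) x := by
    filter_upwards [hI.openU.mem_nhds hz] with z hz using pull_written hF hz
  rw [sff_apply, hess_apply, chr_congr hp, written_self, chr_apply, chr_apply,
    ← fderiv_apply₁ (hI.mapInto.differentiableAt_fderiv hz)]
  rfl

theorem induced_eq {G : BilinField I' N} (hF : ContMDiff I I' ∞ F) (x : M) :
    (induced I I' G F x : E →L[ℝ] E →L[ℝ] ℝ)
      = pull (chartMetric I' G (F x)) (written I I' x (F x) F) (extChartAt I x x) := by
  rw [pull_written hF (mem_writtenDom_self x), chartMetric_self]

theorem meanCurvature_eq {G : BilinField I' N} (hG : MetricField G) (hF : ContMDiff I I' ∞ F)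
    (hi : ∀ q, Function.Injective (mfderiv I I' F q)) (x : M) :
    meanCurvature I I' G F x
      = meanCurv (chartMetric I' G (F x)) (written I I' x (F x) F) (extChartAt I x x) := by
  have h1 : (fun u v : E => (secondFund I I' G F x u v : E')) = fun u v =>
      sff (chartMetric I' G (F x)) (written I I' x (F x) F) (extChartAt I x x) u v := by
    funext u v
    exact secondFund_eq hG hF hi x u v
  rw [meanCurv, ← h1, ← induced_eq hF]
  rfl

/-- The mean curvature vector in arbitrary charts. -/
theorem meanCurv_written {G : BilinField I' N} (hG : MetricField G) (hF : ContMDiff I I' ∞ F)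
    (hi : ∀ q, Function.Injective (mfderiv I I' F q)) {x : M} {p : N} {z : E}
    (hz : z ∈ writtenDom I I' x p F) :
    meanCurv (chartMetric I' G p) (written I I' x p F) z
      = dchart I' p (F ((extChartAt I x).symm z))
          (meanCurvature I I' G F ((extChartAt I x).symm z)) := by
  set y := (extChartAt I x).symm z with hy
  have hzo : z ∈ overlap I x y := mem_overlap_self hz.1
  have hyd := mem_writtenDom_self (I := I) (I' := I') (F := F) y
  have ht : transition I x y z = extChartAt I y y := transition_self z
  have hyo : written I I' y (F y) F (transition I x y z) ∈ overlap I' (F y) p := by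
    rw [ht, written_self]
    refine ⟨mem_extChartAt_target _, ?_⟩
    change (extChartAt I' (F y)).symm _ ∈ (extChartAt I' p).source
    rw [extChartAt_to_inv]
    exact hz.2
  have hF' : written I I' x p F =ᶠ[𝓝 z]
      transition I' (F y) p ∘ written I I' y (F y) F ∘ transition I x y := by
    have h1 : ∀ᶠ w in 𝓝 z, (extChartAt I x).symm w ∈ (extChartAt I y).source ∧
        F ((extChartAt I x).symm w) ∈ (extChartAt I' (F y)).source := by
      have hc : ContinuousAt (extChartAt I x).symm z := (contMDiffAt_symm hz.1).continuousAt
      have a1 : ∀ᶠ w in 𝓝 y, w ∈ (extChartAt I y).source := extChartAt_source_mem_nhds y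
      have a2 : ∀ᶠ w in 𝓝 y, F w ∈ (extChartAt I' (F y)).source :=
        (hF.continuous.tendsto y).eventually (extChartAt_source_mem_nhds (I := I') (F y))
      exact hc.eventually (a1.and a2)
    filter_upwards [h1] with w hw
    simp only [written, transition, Function.comp_apply]
    rw [(extChartAt I y).left_inv hw.1, (extChartAt I' (F y)).left_inv hw.2]
  rw [meanCurv_natural (immInto_written hG hF hi y (F y)) (immInto_written hG hF hi x p)
    (hG.immInto_transition (F y) p) (fun q hq => chartMetric_eq_pull G hq) hz
    ((contDiffOn_transition x y).contDiffAt ((isOpen_overlap x y).mem_nhds hzo))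
    (by rw [ht]; exact hyd) (surjective_fderiv_transition hzo) hyo
    (surjective_fderiv_transition hyo) hF', fderiv_transition hyo, ht, written_self,
    extChartAt_to_inv, dsymm_self, ← meanCurvature_eq hG hF hi]
  rfl

end Written

/-! ### Mean curvature flow in charts -/

section Flow

variable {E : Type*} [NormedAddCommGroup E] [NormedSpace ℝ E] [FiniteDimensional ℝ E]
  {H : Type*} [TopologicalSpace H] {I : ModelWithCorners ℝ E H} [I.Boundaryless]
  {M : Type*} [TopologicalSpace M] [ChartedSpace H M] [IsManifold I ∞ M]
  {E' : Type*} [NormedAddCommGroup E'] [NormedSpace ℝ E'] [FiniteDimensional ℝ E']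
  {H' : Type*} [TopologicalSpace H'] {I' : ModelWithCorners ℝ E' H'} [I'.Boundaryless]
  {N : Type*} [TopologicalSpace N] [ChartedSpace H' N] [IsManifold I' ∞ N]
  {G : BilinField I' N} {T : ℝ} {F : ℝ → M → N}

theorem IsMeanCurvatureFlow.contMDiff (h : IsMeanCurvatureFlow I I' G T F) {t : ℝ}
    (ht : t ∈ Ico 0 T) : ContMDiff I I' ∞ (F t) := by
  rw [← contMDiffOn_univ]
  have h1 : ContMDiffOn I (𝓘(ℝ, ℝ).prod I) ∞ (fun x : M => (t, x)) univ :=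
    (contMDiff_const.prodMk contMDiff_id).contMDiffOn
  exact h.smooth.comp h1 fun x _ => ⟨ht, trivial⟩

/-- The intervals on which the flow is studied in charts; they may contain the left end point `0`,
where derivatives are one-sided. -/
theorem exists_interval_nhds {t T δ : ℝ} (ht : t ∈ Ico 0 T) (hδ : 0 < δ) :
    UniqueDiffOn ℝ (Ico 0 T ∩ Metric.ball t δ) ∧
      Ico 0 T ∩ Metric.ball t δ ⊆ closure (interior (Ico 0 T ∩ Metric.ball t δ)) := by
  have hc : Convex ℝ (Ico 0 T ∩ Metric.ball t δ) := (convex_Ico 0 T).inter (convex_ball t δ)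
  have hn : (interior (Ico 0 T ∩ Metric.ball t δ)).Nonempty := by
    obtain ⟨s, hs1, hs2⟩ := exists_between (lt_min ht.2 (lt_add_of_pos_right t hδ))
    rw [lt_min_iff] at hs2
    refine ⟨s, mem_interior.2 ⟨Ioo t (min T (t + δ)), ?_, isOpen_Ioo,
      ⟨hs1, lt_min hs2.1 hs2.2⟩⟩⟩
    intro r hr
    have h2 := lt_min_iff.1 hr.2
    refine ⟨⟨ht.1.trans hr.1.le, h2.1⟩, ?_⟩
    rw [Metric.mem_ball, Real.dist_eq, abs_lt]
    constructor <;> linarith [hr.1, h2.2]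
  exact ⟨uniqueDiffOn_convex hc hn, by
    rw [hc.closure_interior_eq_closure_of_nonempty_interior hn]; exact subset_closure⟩

/-- A mean curvature flow between manifolds, read in charts near a point of space-time. -/
theorem IsMeanCurvatureFlow.exists_localFlow (h : IsMeanCurvatureFlow I I' G T F)
    (hG : MetricField G) {t : ℝ} (ht : t ∈ Ico 0 T) (x : M) :
    ∃ S U, t ∈ S ∧ S ⊆ Ico 0 T ∧ S ∈ 𝓝[Ico 0 T] t ∧ extChartAt I x x ∈ U ∧ Convex ℝ U ∧
      (∀ s ∈ S, U ⊆ writtenDom I I' x (F t x) (F s)) ∧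
      LocalFlow (chartMetric I' G (F t x)) (fun s => written I I' x (F t x) (F s)) S U
        (extChartAt I' (F t x)).target := by
  set p := F t x with hp
  set y := extChartAt I x x with hy
  have hyt : y ∈ (extChartAt I x).target := mem_extChartAt_target x
  have hc : ContinuousWithinAt (fun z : ℝ × E => F z.1 ((extChartAt I x).symm z.2))
      (Ico 0 T ×ˢ (extChartAt I x).target) (t, y) := by
    have h1 : ContinuousWithinAt (fun z : ℝ × M => F z.1 z.2) (Ico 0 T ×ˢ univ)
        (t, (extChartAt I x).symm y) := h.smooth.continuousOn _ ⟨ht, trivial⟩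
    have h2 : ContinuousWithinAt (fun z : ℝ × E => (z.1, (extChartAt I x).symm z.2))
        (Ico 0 T ×ˢ (extChartAt I x).target) (t, y) :=
      continuousWithinAt_fst.prodMk (((contMDiffAt_symm hyt).continuousAt.comp
        (x := ((t, y) : ℝ × E)) (f := Prod.snd) continuousAt_snd).continuousWithinAt)
    exact ContinuousWithinAt.comp (x := ((t, y) : ℝ × E))
      (f := fun z : ℝ × E => (z.1, (extChartAt I x).symm z.2)) h1 h2 fun z hz => ⟨hz.1, trivial⟩
  have hs : (extChartAt I' p).source ∈ 𝓝 (F t ((extChartAt I x).symm y)) := by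
    rw [hy, extChartAt_to_inv]; exact extChartAt_source_mem_nhds p
  have h3 : {z : ℝ × E | F z.1 ((extChartAt I x).symm z.2) ∈ (extChartAt I' p).source} ∈
      𝓝[Ico 0 T] t ×ˢ 𝓝[(extChartAt I x).target] y := by
    rw [← nhdsWithin_prod_eq]; exact hc hs
  obtain ⟨A, hA, B, hB, hAB⟩ := mem_prod_iff.1 h3
  rw [nhdsWithin_eq_nhds.2 ((isOpen_extChartAt_target x).mem_nhds hyt)] at hB
  obtain ⟨δ, hδ, hA'⟩ := Metric.mem_nhdsWithin_iff.1 hA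
  obtain ⟨r, hr, hB'⟩ := Metric.mem_nhds_iff.1
    (inter_mem hB ((isOpen_extChartAt_target x).mem_nhds hyt))
  set S := Ico 0 T ∩ Metric.ball t δ with hSdef
  set U := Metric.ball y r with hU
  have hdom : ∀ s ∈ S, U ⊆ writtenDom I I' x p (F s) := fun s hs z hz =>
    ⟨(hB' hz).2, hAB (show (s, z) ∈ A ×ˢ B from ⟨hA' ⟨hs.2, hs.1⟩, (hB' hz).1⟩)⟩
  obtain ⟨hu, hcl⟩ := exists_interval_nhds ht hδ
  refine ⟨S, U, ⟨ht, Metric.mem_ball_self hδ⟩, inter_subset_left,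
    inter_mem self_mem_nhdsWithin (mem_nhdsWithin_of_mem_nhds (Metric.ball_mem_nhds t hδ)),
    Metric.mem_ball_self hr, convex_ball y r, hdom, ?_⟩
  refine ⟨hu, hcl, hG p, Metric.isOpen_ball, ?_, ?_, ?_, ?_⟩
  · rw [← contMDiffOn_iff_contDiffOn]
    have h4 : ContMDiffOn 𝓘(ℝ, ℝ × E) (𝓘(ℝ, ℝ).prod I) ∞
        (fun z : ℝ × E => (z.1, (extChartAt I x).symm z.2)) (S ×ˢ U) := by
      refine ContMDiffOn.prodMk ?_ ?_
      · exact contDiff_fst.contMDiff.contMDiffOn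
      · have h6 : ContMDiffOn 𝓘(ℝ, ℝ × E) 𝓘(ℝ, E) ∞ (fun z : ℝ × E => z.2) (S ×ˢ U) :=
          contDiff_snd.contMDiff.contMDiffOn
        exact (contMDiffOn_extChartAt_symm (I := I) (n := ∞) x).comp h6 fun z hz => (hB' hz.2).2
    have h5 := h.smooth.comp h4 fun z hz => ⟨hz.1.1, trivial⟩
    refine ContMDiffOn.comp (t := (extChartAt I' p).source) (I' := I')
      (g := extChartAt I' p) ?_ h5 fun z hz => (hdom z.1 hz.1 hz.2).2
    exact fun q hq => (contMDiffAt_chart hq).contMDiffWithinAt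
  · intro s hs z hz
    exact (extChartAt I' p).map_source (hdom s hs hz).2
  · intro s hs z hz
    exact (immInto_written hG (h.contMDiff hs.1) (h.immersion s hs.1) x p).injective z
      (hdom s hs hz)
  · intro s hs z hz
    rw [meanCurv_written hG (h.contMDiff hs.1) (h.immersion s hs.1) (hdom s hs hz)]
    set w := (extChartAt I x).symm z
    have h4 : MDifferentiableWithinAt 𝓘(ℝ, ℝ) I' (fun r => F r w) (Ico 0 T) s := by
      have h5 : ContMDiffOn 𝓘(ℝ, ℝ) (𝓘(ℝ, ℝ).prod I) ∞ (fun r : ℝ => (r, w)) (Ico 0 T) :=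
        (contMDiff_id.prodMk contMDiff_const).contMDiffOn
      exact ((h.smooth.comp h5 fun r hr => ⟨hr, trivial⟩) s hs.1).mdifferentiableWithinAt
        (by simp)
    have h5 := (mdifferentiableAt_chart (I := I') (hdom s hs hz).2).hasMFDerivAt
    have h6 := (h5.comp_hasMFDerivWithinAt s (h4.hasMFDerivWithinAt.mono
      (inter_subset_left : S ⊆ Ico 0 T)))
    have h7 : HasDerivWithinAt (fun s => written I I' x p (F s) z) _ S s :=
      HasFDerivWithinAt.hasDerivWithinAt (F := E')
        (hasMFDerivWithinAt_iff_hasFDerivWithinAt.1 h6)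
    refine h7.congr_deriv ?_
    exact congrArg (fun v : E' => dchart I' p (F s w) v) (h.velocity s hs.1 w)

end Flow

/-! ### The maximum principle and preservation of the Lagrangian condition -/

section MaximumPrinciple

variable {M : Type*} [TopologicalSpace M] [CompactSpace M]

/-- The maximum principle: a nonnegative function on `[0, T) × M` that vanishes at time `0` and
grows at most exponentially, at locally bounded rates, at its spatial maxima vanishes. -/
theorem eq_zero_of_deriv_le {u : ℝ → M → ℝ} {T : ℝ}
    (hc : ContinuousOn (fun p : ℝ × M => u p.1 p.2) (Ico 0 T ×ˢ univ))
    (h0 : ∀ x, u 0 x = 0) (hpos : ∀ t ∈ Ico 0 T, ∀ x, 0 ≤ u t x)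
    (hd : ∀ t ∈ Ico 0 T, ∀ x, ∃ C, ∀ᶠ p in 𝓝[Ico 0 T ×ˢ univ] (t, x), IsLocalMax (u p.1) p.2 →
      ∃ D, HasDerivWithinAt (fun s => u s p.2) D (Ico 0 T) p.1 ∧ D ≤ C * u p.1 p.2)
    {t : ℝ} (ht : t ∈ Ico 0 T) (x : M) : u t x = 0 := by
  have hsub : Icc 0 t ⊆ Ico 0 T := fun s hs => ⟨hs.1, hs.2.trans_lt ht.2⟩
  set K : Set (ℝ × M) := Icc 0 t ×ˢ univ with hK
  have hKs : K ⊆ Ico 0 T ×ˢ univ := prod_mono hsub subset_rfl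
  have hKc : IsCompact K := isCompact_Icc.prod isCompact_univ
  obtain ⟨C, hC⟩ : ∃ C, ∀ p ∈ K, IsLocalMax (u p.1) p.2 →
      ∃ D, HasDerivWithinAt (fun s => u s p.2) D (Ico 0 T) p.1 ∧ D ≤ C * u p.1 p.2 := by
    have hmono : ∀ {C C' : ℝ} {p : ℝ × M}, p ∈ K → C ≤ C' → (∃ D, HasDerivWithinAt
        (fun s => u s p.2) D (Ico 0 T) p.1 ∧ D ≤ C * u p.1 p.2) → ∃ D, HasDerivWithinAt
        (fun s => u s p.2) D (Ico 0 T) p.1 ∧ D ≤ C' * u p.1 p.2 := by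
      rintro C C' p hp hCC ⟨D, hD, hle⟩
      exact ⟨D, hD, hle.trans (mul_le_mul_of_nonneg_right hCC (hpos _ (hKs hp).1 _))⟩
    have := hKc.induction_on (p := fun A => ∃ C, ∀ p ∈ A ∩ K, IsLocalMax (u p.1) p.2 →
      ∃ D, HasDerivWithinAt (fun s => u s p.2) D (Ico 0 T) p.1 ∧ D ≤ C * u p.1 p.2)
      ⟨0, fun p hp => absurd hp.1 (notMem_empty p)⟩
      (fun A B hAB ⟨C, hC⟩ => ⟨C, fun p hp => hC p ⟨hAB hp.1, hp.2⟩⟩)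
      (fun A B ⟨C, hC⟩ ⟨C', hC'⟩ => ⟨max C C', fun p hp hm => hp.1.elim
        (fun h => hmono hp.2 (le_max_left _ _) (hC p ⟨h, hp.2⟩ hm))
        (fun h => hmono hp.2 (le_max_right _ _) (hC' p ⟨h, hp.2⟩ hm))⟩)
      (fun p hp => by
        obtain ⟨C, hC⟩ := hd p.1 (hKs hp).1 p.2
        refine ⟨_, nhdsWithin_mono _ hKs hC, C, fun q hq => hq.1⟩)
    obtain ⟨C, hC⟩ := this
    exact ⟨C, fun p hp => hC p ⟨hp, hp⟩⟩
  -- with the factor `exp (-(C + 1) t)`, a positive maximum of `φ` on `[0, t] × M` would have a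
  -- negative left derivative in time
  set φ : ℝ × M → ℝ := fun p => Real.exp (-(C + 1) * p.1) * u p.1 p.2 with hφ
  have hφc : ContinuousOn φ K := by
    refine ContinuousOn.mul ?_ (hc.mono hKs)
    exact (Real.continuous_exp.comp (continuous_const.mul continuous_fst)).continuousOn
  obtain ⟨p, hp, hmax⟩ := hKc.exists_isMaxOn ⟨(t, x), ⟨ht.1, le_rfl⟩, trivial⟩ hφc
  have hle : φ p ≤ 0 := by
    by_contra! hlt
    have hup : 0 < u p.1 p.2 := pos_of_mul_pos_right hlt (Real.exp_pos _).le
    have hp0 : 0 < p.1 := by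
      refine lt_of_le_of_ne hp.1.1 fun h => hup.ne' ?_
      rw [← h, h0]
    have hm : IsLocalMax (u p.1) p.2 := Eventually.of_forall fun y => by
      have h1 : φ (p.1, y) ≤ φ p := hmax (show (p.1, y) ∈ K from ⟨hp.1, trivial⟩)
      exact le_of_mul_le_mul_left h1 (Real.exp_pos _)
    obtain ⟨D, hD, hDle⟩ := hC p hp hm
    have hpI : Icc 0 p.1 ⊆ Icc 0 t := Icc_subset_Icc_right hp.1.2
    have h1 : HasDerivWithinAt (fun s => φ (s, p.2))
        (Real.exp (-(C + 1) * p.1) * (-(C + 1)) * u p.1 p.2 + Real.exp (-(C + 1) * p.1) * D)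
        (Icc 0 p.1) p.1 := by
      refine HasDerivWithinAt.mul ?_ (hD.mono (hpI.trans hsub))
      simpa using (((hasDerivAt_id p.1).const_mul (-(C + 1))).exp).hasDerivWithinAt
    have h2 : IsLocalMaxOn (fun s => φ (s, p.2)) (Icc 0 p.1) p.1 := by
      refine IsMaxOn.localize fun s hs => ?_
      exact hmax (show (s, p.2) ∈ K from ⟨hpI hs, trivial⟩)
    have h3 := h2.hasFDerivWithinAt_nonpos h1.hasFDerivWithinAt (y := -p.1)
      (mem_posTangentConeAt_of_segment_subset (by
        rw [add_neg_cancel, segment_symm, segment_eq_Icc hp0.le]))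
    simp only [ContinuousLinearMap.toSpanSingleton_apply, smul_eq_mul] at h3
    have h4 : Real.exp (-(C + 1) * p.1) * (-(C + 1)) * u p.1 p.2 + Real.exp (-(C + 1) * p.1) * D
        = -(Real.exp (-(C + 1) * p.1) * ((C * u p.1 p.2 - D) + u p.1 p.2)) := by ring
    rw [h4] at h3
    have h5 : 0 < p.1 * (Real.exp (-(C + 1) * p.1) * ((C * u p.1 p.2 - D) + u p.1 p.2)) :=
      mul_pos hp0 (mul_pos (Real.exp_pos _) (by linarith))
    linarith
  have h1 : φ (t, x) ≤ φ p := hmax (show (t, x) ∈ K from ⟨⟨ht.1, le_rfl⟩, trivial⟩)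
  refine le_antisymm ?_ (hpos t ht x)
  exact nonpos_of_mul_nonpos_right (h1.trans hle) (Real.exp_pos _)

end MaximumPrinciple

section Lagrangian

variable {E : Type*} [NormedAddCommGroup E] [NormedSpace ℝ E] [FiniteDimensional ℝ E]

theorem normSq_nonneg {B : E →L[ℝ] E →L[ℝ] ℝ} (hB : IsInner B) (α : E →L[ℝ] E →L[ℝ] ℝ) :
    0 ≤ normSq B α := by
  obtain ⟨e, he⟩ := exists_ortho hB rfl
  rw [normSq_eq_sum hB α he (by simp)]
  positivity

theorem normSq_eq_zero_iff {B : E →L[ℝ] E →L[ℝ] ℝ} (hB : IsInner B) (α : E →L[ℝ] E →L[ℝ] ℝ) :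
    normSq B α = 0 ↔ α = 0 := by
  obtain ⟨e, he⟩ := exists_ortho hB rfl
  rw [normSq_eq_sum hB α he (by simp)]
  constructor
  · intro h
    rw [Finset.sum_eq_zero_iff_of_nonneg fun i _ => by positivity] at h
    have h1 : ∀ i j, α (e i) (e j) = 0 := fun i j => by
      have := h i (Finset.mem_univ i)
      rw [Finset.sum_eq_zero_iff_of_nonneg fun i _ => by positivity] at this
      exact pow_eq_zero_iff (two_ne_zero) |>.1 (this j (Finset.mem_univ j))
    ext u v
    rw [he.expand (by simp) u, he.expand (by simp) v]
    simp [h1, sum_apply]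
  · rintro rfl
    simp

theorem normSq_comp {B : E →L[ℝ] E →L[ℝ] ℝ} (hB : IsInner B) (α : E →L[ℝ] E →L[ℝ] ℝ)
    {A : E →L[ℝ] E} (hA : Function.Injective A) :
    normSq (B.bilinearComp A A) (α.bilinearComp A A) = normSq B α := by
  have hB' : IsInner (B.bilinearComp A A) := ⟨fun u v => hB.symm _ _, fun v hv =>
    hB.pos _ fun h => hv (hA (h.trans (map_zero A).symm))⟩
  obtain ⟨e, he⟩ := exists_ortho hB' rfl
  rw [normSq_eq_sum hB' _ he (by simp), normSq_eq_sum hB α (e := fun i => A (e i))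
    (fun i j => he i j) (by simp)]
  rfl

variable {H : Type*} [TopologicalSpace H] {I : ModelWithCorners ℝ E H} [I.Boundaryless]
  {M : Type*} [TopologicalSpace M] [ChartedSpace H M] [IsManifold I ∞ M]
  {E' : Type*} [NormedAddCommGroup E'] [NormedSpace ℝ E'] [FiniteDimensional ℝ E']
  {H' : Type*} [TopologicalSpace H'] {I' : ModelWithCorners ℝ E' H'} [I'.Boundaryless]
  {N : Type*} [TopologicalSpace N] [ChartedSpace H' N] [IsManifold I' ∞ N]
  {G : BilinField I' N} {J : EndoField I' N} {T : ℝ} {F : ℝ → M → N}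

/-- The Kähler form `(u, v) ↦ G(J u, v)`. -/
def kahlerField (G : BilinField I' N) (J : EndoField I' N) : BilinField I' N := fun p =>
  let B : E' →L[ℝ] E' →L[ℝ] ℝ := G p
  let A : E' →L[ℝ] E' := J p
  let r : E' →L[ℝ] E' →L[ℝ] ℝ := B ∘L A
  r

theorem kform_chart_eq {p : N} {q : E'} (hq : q ∈ (extChartAt I' p).target) :
    kform (chartMetric I' G p) (chartEndo I' J p) q = chartMetric I' (kahlerField G J) p q := by
  ext u v
  exact kform_chart_apply hq u v

/-- The squared norm of the pulled-back Kähler form, which vanishes exactly for Lagrangian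
immersions. -/
def lagDefect (I : ModelWithCorners ℝ E H) (I' : ModelWithCorners ℝ E' H') (G : BilinField I' N)
    (J : EndoField I' N) (F : M → N) (x : M) : ℝ :=
  normSq (E := E) (induced I I' G F x) (induced I I' (kahlerField G J) F x)

theorem isInner_induced (hG : MetricField G) {F : M → N}
    (hi : ∀ q, Function.Injective (mfderiv I I' F q)) (x : M) :
    IsInner (E := E) (induced I I' G F x) := by
  have h1 := (hG (F x)).inner _ (mem_extChartAt_target (F x))
  rw [chartMetric_self] at h1
  refine ⟨fun u v => h1.symm _ _, fun v hv => h1.pos _ fun h => hv (hi x ?_)⟩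
  exact h.trans (map_zero (dmap I I' F x)).symm

/-- The Lagrangian defect does not depend on the charts. -/
theorem lagDefect_eq (hG : MetricField G) {F : M → N} (hF : ContMDiff I I' ∞ F)
    (hi : ∀ q, Function.Injective (mfderiv I I' F q)) {x : M} {p : N} {z : E}
    (hz : z ∈ writtenDom I I' x p F) :
    normSq (pull (chartMetric I' G p) (written I I' x p F) z)
      (pull (kform (chartMetric I' G p) (chartEndo I' J p)) (written I I' x p F) z)
      = lagDefect I I' G J F ((extChartAt I x).symm z) := by
  have h1 : pull (kform (chartMetric I' G p) (chartEndo I' J p)) (written I I' x p F) z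
      = pull (chartMetric I' (kahlerField G J) p) (written I I' x p F) z := by
    have hw : written I I' x p F z ∈ (extChartAt I' p).target :=
      (extChartAt I' p).map_source hz.2
    rw [pull, pull, kform_chart_eq hw]
  rw [h1, pull_written hF hz, pull_written hF hz]
  exact normSq_comp (isInner_induced hG hi _) _ (injective_dsymm hz.1)

/-- Mean curvature flow in a Kähler–Einstein manifold preserves Lagrangian immersions. -/
theorem IsMeanCurvatureFlow.lagrangian [CompactSpace M] (h : IsMeanCurvatureFlow I I' G T F)
    (hG : MetricField G)
    (hJ : ∀ p, KahlerOn (chartMetric I' G p) (chartEndo I' J p) (extChartAt I' p).target)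
    (hW : 2 * Module.finrank ℝ E = Module.finrank ℝ E') {c : ℝ}
    (hE : ∀ p, ∀ q ∈ (extChartAt I' p).target, ∀ x y, LinearMap.trace ℝ E'
      (((curvL (chr (chartMetric I' G p)) q).flip x).flip y) = c * chartMetric I' G p q x y)
    (h0 : ∀ x (u v : E), induced I I' (kahlerField G J) (F 0) x u v = 0)
    {t : ℝ} (ht : t ∈ Ico 0 T) (x : M) (u v : E) :
    induced I I' (kahlerField G J) (F t) x u v = 0 := by
  have key := eq_zero_of_deriv_le (u := fun s x => lagDefect I I' G J (F s) x) (T := T)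
    ?_ ?_ ?_ ?_ ht x
  · exact congrArg (fun B : E →L[ℝ] E →L[ℝ] ℝ => B u v)
      ((normSq_eq_zero_iff (isInner_induced hG (h.immersion t ht) x) _).1 key)
  · rintro ⟨s, y⟩ ⟨hs, -⟩
    obtain ⟨S, U, hsS, hST, hSn, hyU, -, hdom, hL⟩ := h.exists_localFlow hG hs y
    have hUn := hL.openU.mem_nhds hyU
    have h1 := hL.continuousWithinAt_normSq (hJ (F s y)).parallel.smooth
      (p := (s, extChartAt I y y)) ⟨hsS, hyU⟩
    have h2 : ContinuousAt (fun p : ℝ × M => (p.1, extChartAt I y p.2)) (s, y) :=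
      continuousAt_fst.prodMk ((continuousAt_extChartAt y).comp (x := ((s, y) : ℝ × M))
        (f := Prod.snd) continuousAt_snd)
    have hev : ∀ᶠ p in 𝓝[Ico 0 T ×ˢ univ] (s, y), p.1 ∈ S ∧ extChartAt I y p.2 ∈ U ∧
        p.2 ∈ (extChartAt I y).source := by
      rw [nhdsWithin_prod_eq, nhdsWithin_univ]
      have a1 : ∀ᶠ w in 𝓝 y, extChartAt I y w ∈ U ∧ w ∈ (extChartAt I y).source :=
        ((continuousAt_extChartAt y).eventually hUn).and (extChartAt_source_mem_nhds y)
      have a2 : ∀ᶠ r in 𝓝[Ico 0 T] s, r ∈ S := hSn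
      exact a2.prod_mk a1
    have h3 : Tendsto (fun p : ℝ × M => (p.1, extChartAt I y p.2)) (𝓝[Ico 0 T ×ˢ univ] (s, y))
        (𝓝[S ×ˢ U] (s, extChartAt I y y)) := by
      refine tendsto_nhdsWithin_iff.2 ⟨h2.tendsto.mono_left nhdsWithin_le_nhds, ?_⟩
      filter_upwards [hev] with p hp using ⟨hp.1, hp.2.1⟩
    have h4 := h1.tendsto.comp h3
    have he : ∀ p : ℝ × M, p.1 ∈ S ∧ extChartAt I y p.2 ∈ U ∧ p.2 ∈ (extChartAt I y).source →
        normSq (pull (chartMetric I' G (F s y)) (written I I' y (F s y) (F p.1))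
          (extChartAt I y p.2)) (pull (kform (chartMetric I' G (F s y)) (chartEndo I' J (F s y)))
          (written I I' y (F s y) (F p.1)) (extChartAt I y p.2))
        = lagDefect I I' G J (F p.1) p.2 := fun p hp => by
      rw [lagDefect_eq hG (h.contMDiff (hST hp.1)) (h.immersion _ (hST hp.1)) (hdom _ hp.1 hp.2.1),
        (extChartAt I y).left_inv hp.2.2]
    have h5 := he (s, y) ⟨hsS, hyU, mem_extChartAt_source y⟩
    change Tendsto _ _ (𝓝 (lagDefect I I' G J (F s) y))
    rw [← h5]
    refine h4.congr' ?_
    filter_upwards [hev] with p hp using he p hp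
  · intro y
    refine (normSq_eq_zero_iff (isInner_induced hG (h.immersion 0 ⟨le_rfl,
      ht.1.trans_lt ht.2⟩) y) _).2 ?_
    exact ContinuousLinearMap.ext fun u => ContinuousLinearMap.ext fun v => h0 y u v
  · exact fun s hs y => normSq_nonneg (isInner_induced hG (h.immersion s hs) y) _
  · intro s hs y
    obtain ⟨S, U, hsS, hST, hSn, hyU, -, hdom, hL⟩ := h.exists_localFlow hG hs y
    have hUn := hL.openU.mem_nhds hyU
    obtain ⟨C, hC⟩ := hL.deriv_normSq_le (hJ (F s y)) hW (hE (F s y))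
      (p := (s, extChartAt I y y)) ⟨hsS, hyU⟩
    have h2 : ContinuousAt (fun p : ℝ × M => (p.1, extChartAt I y p.2)) (s, y) :=
      continuousAt_fst.prodMk ((continuousAt_extChartAt y).comp (x := ((s, y) : ℝ × M))
        (f := Prod.snd) continuousAt_snd)
    have hev : ∀ᶠ p in 𝓝[Ico 0 T ×ˢ univ] (s, y), (p.1 ∈ S ∧ S ∈ 𝓝[Ico 0 T] p.1) ∧
        extChartAt I y p.2 ∈ U ∧ p.2 ∈ (extChartAt I y).source := by
      rw [nhdsWithin_prod_eq, nhdsWithin_univ]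
      have a1 : ∀ᶠ w in 𝓝 y, extChartAt I y w ∈ U ∧ w ∈ (extChartAt I y).source :=
        ((continuousAt_extChartAt y).eventually hUn).and (extChartAt_source_mem_nhds y)
      have a2 : ∀ᶠ r in 𝓝[Ico 0 T] s, r ∈ S ∧ S ∈ 𝓝[Ico 0 T] r :=
        eventually_and.2 ⟨hSn, eventually_eventually_nhdsWithin.2 hSn⟩
      exact a2.prod_mk a1
    have h3 : Tendsto (fun p : ℝ × M => (p.1, extChartAt I y p.2)) (𝓝[Ico 0 T ×ˢ univ] (s, y))
        (𝓝[S ×ˢ U] (s, extChartAt I y y)) := by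
      refine tendsto_nhdsWithin_iff.2 ⟨h2.tendsto.mono_left nhdsWithin_le_nhds, ?_⟩
      filter_upwards [hev] with p hp using ⟨hp.1.1, hp.2.1⟩
    have he : ∀ p : ℝ × M, p.1 ∈ S ∧ extChartAt I y p.2 ∈ U ∧ p.2 ∈ (extChartAt I y).source →
        normSq (pull (chartMetric I' G (F s y)) (written I I' y (F s y) (F p.1))
          (extChartAt I y p.2)) (pull (kform (chartMetric I' G (F s y)) (chartEndo I' J (F s y)))
          (written I I' y (F s y) (F p.1)) (extChartAt I y p.2))
        = lagDefect I I' G J (F p.1) p.2 := fun p hp => by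
      rw [lagDefect_eq hG (h.contMDiff (hST hp.1)) (h.immersion _ (hST hp.1)) (hdom _ hp.1 hp.2.1),
        (extChartAt I y).left_inv hp.2.2]
    refine ⟨C, ?_⟩
    filter_upwards [hev, h3.eventually hC] with p hp hCp hmax
    have hsy : (extChartAt I y).symm (extChartAt I y p.2) = p.2 := (extChartAt I y).left_inv hp.2.2
    have hm : IsLocalMax (fun z => normSq (pull (chartMetric I' G (F s y))
        (written I I' y (F s y) (F p.1)) z) (pull (kform (chartMetric I' G (F s y))
        (chartEndo I' J (F s y))) (written I I' y (F s y) (F p.1)) z)) (extChartAt I y p.2) := by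
      have hcs : ContinuousAt (extChartAt I y).symm (extChartAt I y p.2) :=
        (contMDiffAt_symm ((extChartAt I y).map_source hp.2.2)).continuousAt
      have a1 : ∀ᶠ w in 𝓝 ((extChartAt I y).symm (extChartAt I y p.2)),
          lagDefect I I' G J (F p.1) w ≤ lagDefect I I' G J (F p.1) p.2 := by
        rw [hsy]; exact hmax
      filter_upwards [hcs.eventually a1, hL.openU.mem_nhds hp.2.1] with z hz hzU
      rw [he p ⟨hp.1.1, hp.2⟩, lagDefect_eq hG (h.contMDiff (hST hp.1.1))
        (h.immersion _ (hST hp.1.1)) (hdom _ hp.1.1 hzU)]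
      exact hz
    obtain ⟨D, hD, hle⟩ := hCp hm
    have hle' : D ≤ C * normSq (pull (chartMetric I' G (F s y)) (written I I' y (F s y) (F p.1))
          (extChartAt I y p.2)) (pull (kform (chartMetric I' G (F s y)) (chartEndo I' J (F s y)))
          (written I I' y (F s y) (F p.1)) (extChartAt I y p.2)) := hle
    rw [he p ⟨hp.1.1, hp.2⟩] at hle'
    refine ⟨D, ?_, hle'⟩
    have hD' : HasDerivWithinAt (fun r => lagDefect I I' G J (F r) p.2) D S p.1 :=
      hD.congr (fun r hr => (he (r, p.2) ⟨hr, hp.2⟩).symm) (he p ⟨hp.1.1, hp.2⟩).symm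
    exact hD'.mono_of_mem_nhdsWithin hp.1.2

end Lagrangian

/-! ### Charts of a product -/

section ProductCharts

variable {E : Type*} [NormedAddCommGroup E] [NormedSpace ℝ E] [FiniteDimensional ℝ E]
  {H : Type*} [TopologicalSpace H] {I : ModelWithCorners ℝ E H} [I.Boundaryless]
  {M : Type*} [TopologicalSpace M] [ChartedSpace H M] [IsManifold I ∞ M]
  {E' : Type*} [NormedAddCommGroup E'] [NormedSpace ℝ E'] [FiniteDimensional ℝ E']
  {H' : Type*} [TopologicalSpace H'] {I' : ModelWithCorners ℝ E' H'} [I'.Boundaryless]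
  {N : Type*} [TopologicalSpace N] [ChartedSpace H' N] [IsManifold I' ∞ N]

theorem target_prod (p : M × N) : (extChartAt (I.prod I') p).target
    = (extChartAt I p.1).target ×ˢ (extChartAt I' p.2).target := by
  rw [extChartAt_prod]; rfl

theorem chart_prod (p q : M × N) : extChartAt (I.prod I') p q
    = (extChartAt I p.1 q.1, extChartAt I' p.2 q.2) := by
  rw [extChartAt_prod]; rfl

theorem symm_prod (p : M × N) (q : E × E') : (extChartAt (I.prod I') p).symm q
    = ((extChartAt I p.1).symm q.1, (extChartAt I' p.2).symm q.2) := by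
  rw [extChartAt_prod]; rfl

theorem dsymm_prod {p : M × N} {q : E × E'} (hq : q ∈ (extChartAt (I.prod I') p).target)
    (u : E × E') : dsymm (I.prod I') p q u = (dsymm I p.1 q.1 u.1, dsymm I' p.2 q.2 u.2) := by
  rw [target_prod] at hq
  have hf : HasMFDerivAt 𝓘(ℝ, E × E') 𝓘(ℝ, E) (Prod.fst : E × E' → E) q
      (ContinuousLinearMap.fst ℝ E E') := hasFDerivAt_fst.hasMFDerivAt
  have hs : HasMFDerivAt 𝓘(ℝ, E × E') 𝓘(ℝ, E') (Prod.snd : E × E' → E') q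
      (ContinuousLinearMap.snd ℝ E E') := hasFDerivAt_snd.hasMFDerivAt
  have h1 := (mdifferentiableAt_symm (I := I) hq.1).hasMFDerivAt.comp q hf
  have h2 := (mdifferentiableAt_symm (I := I') hq.2).hasMFDerivAt.comp q hs
  have h3 := (h1.prodMk h2).mfderiv
  have e : ((extChartAt (I.prod I') p).symm : E × E' → M × N) = fun q =>
      (((extChartAt I p.1).symm ∘ Prod.fst) q, ((extChartAt I' p.2).symm ∘ Prod.snd) q) :=
    funext fun q => symm_prod p q
  rw [← e] at h3
  exact congrArg (fun L : E × E' →L[ℝ] E × E' => L u) h3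

theorem dchart_prod {p q : M × N} (hq : q ∈ (extChartAt (I.prod I') p).source)
    (u : E × E') : dchart (I.prod I') p q u = (dchart I p.1 q.1 u.1, dchart I' p.2 q.2 u.2) := by
  have hq' := hq
  rw [extChartAt_prod] at hq'
  have h := dsymm_dchart' hq u
  rw [dsymm_prod ((extChartAt (I.prod I') p).map_source hq), chart_prod] at h
  conv_rhs => rw [← h]
  have e1 := dchart_dsymm (I := I) ((extChartAt I p.1).map_source hq'.1)
    (dchart (I.prod I') p q u).1
  have e2 := dchart_dsymm (I := I') ((extChartAt I' p.2).map_source hq'.2)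
    (dchart (I.prod I') p q u).2
  rw [(extChartAt I p.1).left_inv hq'.1] at e1
  rw [(extChartAt I' p.2).left_inv hq'.2] at e2
  exact (Prod.ext e1 e2).symm

variable {g : BilinField I M} {g' : BilinField I' N} {J : EndoField I M} {J' : EndoField I' N}

theorem chartMetric_prod {p : M × N} {q : E × E'}
    (hq : q ∈ (extChartAt (I.prod I') p).target) :
    chartMetric (I.prod I') (prodMetric I I' g g') p q
      = prodG (chartMetric I g p.1) (chartMetric I' g' p.2) q := by
  refine ContinuousLinearMap.ext fun u => ContinuousLinearMap.ext fun v => ?_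
  rw [chartMetric_apply, prodG_apply, chartMetric_apply, chartMetric_apply, dsymm_prod hq,
    dsymm_prod hq, symm_prod]
  rfl

theorem chartEndo_prod {p : M × N} {q : E × E'}
    (hq : q ∈ (extChartAt (I.prod I') p).target) :
    chartEndo (I.prod I') (prodJ I I' J J') p q
      = prodEndo (chartEndo I J p.1) (chartEndo I' J' p.2) q := by
  refine ContinuousLinearMap.ext fun u => ?_
  rw [chartEndo_apply, prodEndo_apply, chartEndo_apply, chartEndo_apply, dsymm_prod hq]
  refine (dchart_prod ((extChartAt (I.prod I') p).map_target hq) _).trans ?_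
  rw [symm_prod]
  refine Prod.ext rfl ?_
  exact map_neg (dchart I' p.2 ((extChartAt I' p.2).symm q.2)) _

theorem MetricOn.congr {W : Type*} [NormedAddCommGroup W] [NormedSpace ℝ W]
    {G G' : W → W →L[ℝ] W →L[ℝ] ℝ} {V : Set W} (h : MetricOn G V) (he : EqOn G' G V) :
    MetricOn G' V where
  isOpen := h.isOpen
  smooth := h.smooth.congr he
  inner q hq := by rw [he hq]; exact h.inner q hq

theorem MetricField.prod (hg : MetricField g) (hg' : MetricField g') :
    MetricField (prodMetric I I' g g') := by
  intro p
  have h := (hg p.1).prod (hg' p.2)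
  rw [← target_prod (I := I) (I' := I')] at h
  exact h.congr fun q hq => chartMetric_prod hq

theorem chr_chartMetric_prod {p : M × N} {q : E × E'}
    (hq : q ∈ (extChartAt (I.prod I') p).target) :
    chr (chartMetric (I.prod I') (prodMetric I I' g g') p) q
      = chr (prodG (chartMetric I g p.1) (chartMetric I' g' p.2)) q :=
  chr_congr (by
    filter_upwards [(isOpen_extChartAt_target p).mem_nhds hq] with z hz
    exact chartMetric_prod hz)

theorem ParallelOn.congr {W : Type*} [NormedAddCommGroup W] [NormedSpace ℝ W]
    {Γ Γ' : W → W →L[ℝ] W →L[ℝ] W} {B B' : W → W →L[ℝ] W →L[ℝ] ℝ} {V : Set W}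
    (h : ParallelOn Γ B V) (hΓ : EqOn Γ' Γ V) (hB : EqOn B' B V) : ParallelOn Γ' B' V where
  openV := h.openV
  smooth := h.smooth.congr hB
  smoothΓ := h.smoothΓ.congr hΓ
  parallel q hq w u v := by
    rw [(hB.eventuallyEq_of_mem (h.openV.mem_nhds hq)).fderiv_eq, h.parallel q hq, hΓ hq, hB hq]

theorem kahlerOn_prod (hg : IsMetric g) (hg' : IsMetric g') (hK : IsKahler I g J)
    (hK' : IsKahler I' g' J') (p : M × N) :
    KahlerOn (chartMetric (I.prod I') (prodMetric I I' g g') p)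
      (chartEndo (I.prod I') (prodJ I I' J J') p) (extChartAt (I.prod I') p).target := by
  have h := (hK.kahlerOn hg p.1).prod (hK'.kahlerOn hg' p.2)
  rw [← target_prod (I := I) (I' := I')] at h
  refine ⟨(hg.metricField.prod hg'.metricField) p, fun q hq u => ?_, fun q hq u v => ?_, ?_⟩
  · rw [chartEndo_prod hq]; exact h.sq q hq u
  · rw [chartEndo_prod hq, chartMetric_prod hq]; exact h.compat q hq u v
  · refine h.parallel.congr (fun q hq => chr_chartMetric_prod hq) fun q hq => ?_
    rw [kform, kform, chartEndo_prod hq, chartMetric_prod hq]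

theorem trace_curv_chart_prod (hg : MetricField g) (hg' : MetricField g') {c : ℝ}
    (hc : ∀ (x : M) (u v : TangentSpace I x), ricci I g x u v = c * g x u v)
    (hc' : ∀ (x : N) (u v : TangentSpace I' x), ricci I' g' x u v = c * g' x u v)
    (p : M × N) {q : E × E'} (hq : q ∈ (extChartAt (I.prod I') p).target) (x y : E × E') :
    LinearMap.trace ℝ (E × E')
      (((curvL (chr (chartMetric (I.prod I') (prodMetric I I' g g') p)) q).flip x).flip y)
      = c * chartMetric (I.prod I') (prodMetric I I' g g') p q x y := by
  have hq' := hq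
  rw [target_prod] at hq'
  have h1 : curvL (chr (chartMetric (I.prod I') (prodMetric I I' g g') p)) q
      = curvL (chr (prodG (chartMetric I g p.1) (chartMetric I' g' p.2))) q := by
    have he : chr (chartMetric (I.prod I') (prodMetric I I' g g') p) =ᶠ[𝓝 q]
        chr (prodG (chartMetric I g p.1) (chartMetric I' g' p.2)) := by
      filter_upwards [(isOpen_extChartAt_target p).mem_nhds hq] with z hz
      exact chr_chartMetric_prod hz
    refine LinearMap.ext fun u => LinearMap.ext fun v => LinearMap.ext fun w => ?_
    change curv _ _ _ _ _ = curv _ _ _ _ _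
    rw [curv, curv, he.fderiv_eq, he.eq_of_nhds]
  rw [h1, trace_curv_prod (hg p.1) (hg' p.2) hq', hg.trace_curv hc p.1 hq'.1,
    hg'.trace_curv hc' p.2 hq'.2, chartMetric_prod hq, prodG_apply]
  ring

end ProductCharts

/-! ### Signs and orientations -/

section Sign

variable {W : Type*} [NormedAddCommGroup W] [NormedSpace ℝ W] [FiniteDimensional ℝ W]
  {ι : Type*} [Fintype ι] [DecidableEq ι]

theorem map_update_basis (Θ₀ : W [⋀^ι]→ₗ[ℝ] ℝ) (b : Module.Basis ι ℝ W) (i : ι) (x : W) :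
    Θ₀ (Function.update b i x) = b.coord i x * Θ₀ b := by
  let L := Θ₀.toMultilinearMap.toLinearMap b i
  have hL : ∀ y, Θ₀ (Function.update b i y) = L y := fun y => rfl
  have h0 : ∀ p, p ≠ i → L (b p) = 0 := fun p hp => Θ₀.map_update_self b hp.symm
  have h1 : L (b i) = Θ₀ b := by rw [← hL, Function.update_eq_self]
  rw [hL]
  conv_lhs => rw [← b.sum_repr x, map_sum, Finset.sum_eq_single i
    (fun p _ hp => by simp [h0 p hp]) (by simp)]
  simp [h1]

/-- Along a curve, the value of a parallel top form on a constant basis satisfies a linear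
differential equation; hence it vanishes everywhere if it vanishes somewhere. -/
theorem ParallelForm.eq_zero_of_convex {Γ : W → W →L[ℝ] W →L[ℝ] W} {Θ : W → W [⋀^ι]→ₗ[ℝ] ℝ}
    {U V : Set W} (hΘ : ParallelForm Γ Θ V) (hΓ : ContinuousOn Γ V) (hUV : U ⊆ V)
    (hU : Convex ℝ U) (b : Module.Basis ι ℝ W) {z z' : W} (hz : z ∈ U) (hz' : z' ∈ U)
    (h0 : Θ z b = 0) : Θ z' b = 0 := by
  set c : ℝ → W := fun r => z + r • (z' - z) with hc
  have hcU : ∀ r ∈ Icc (0 : ℝ) 1, c r ∈ U := fun r hr => hU.add_smul_sub_mem hz hz' hr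
  have hcd : ∀ r, HasDerivAt c (z' - z) r := fun r => by
    simpa only [id, one_smul] using ((hasDerivAt_id r).smul_const (z' - z)).const_add z
  set a : ℝ → ℝ := fun r => ∑ i, b.coord i (Γ (c r) (z' - z) (b i)) with ha
  have hd : ∀ r ∈ Icc (0 : ℝ) 1, HasDerivAt (fun r => Θ (c r) b) (a r * Θ (c r) b) r := by
    intro r hr
    have h1 := hΘ c (fun i _ => b i) univ r (z' - z) (fun i => Γ (c r) (z' - z) (b i))
      (hUV (hcU r hr)) (fun i => ⟨(hcd r).hasDerivWithinAt, by
        rw [sub_self]; exact hasDerivWithinAt_const _ _ _⟩)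
    rw [hasDerivWithinAt_univ] at h1
    refine h1.congr_deriv ?_
    rw [ha, Finset.sum_mul]
    exact Finset.sum_congr rfl fun i _ => map_update_basis _ b i _
  have hac : ContinuousOn a (Icc 0 1) := by
    have h1 : ContinuousOn (fun r => Γ (c r)) (Icc 0 1) :=
      hΓ.comp (fun r _ => (hcd r).continuousAt.continuousWithinAt) fun r hr => hUV (hcU r hr)
    refine continuousOn_finsetSum _ fun i _ => ?_
    have h2 : Continuous (b.coord i) := LinearMap.continuous_of_finiteDimensional _
    exact h2.comp_continuousOn ((h1.clm_apply continuousOn_const).clm_apply continuousOn_const)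
  obtain ⟨K, hK⟩ := isCompact_Icc.exists_bound_of_continuousOn hac
  have key := eq_zero_of_abs_deriv_le_mul_abs_self_of_eq_zero_right (f := fun r => Θ (c r) b)
    (f' := fun r => a r * Θ (c r) b) (K := K) (a := 0) (b := 1)
    (fun r hr => (hd r hr).continuousAt.continuousWithinAt)
    (fun r hr => (hd r ⟨hr.1, hr.2.le⟩).hasDerivWithinAt) (by simpa [hc] using h0)
    (fun r hr => by
      rw [norm_mul]
      exact mul_le_mul_of_nonneg_right (hK r ⟨hr.1, hr.2.le⟩) (norm_nonneg _)) 1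
    ⟨zero_le_one, le_rfl⟩
  simpa [hc] using key

/-- On a convex set a parallel top form vanishes everywhere or nowhere, by uniqueness for linear
differential equations along segments; hence its sign is constant. -/
theorem ParallelForm.exists_sign {Γ : W → W →L[ℝ] W →L[ℝ] W} {Θ : W → W [⋀^ι]→ₗ[ℝ] ℝ}
    {U V : Set W} (hΘ : ParallelForm Γ Θ V) (hΓ : ContinuousOn Γ V) (hUV : U ⊆ V)
    (hU : Convex ℝ U) (b : Module.Basis ι ℝ W) (hc : ContinuousOn (fun z => Θ z b) U) :
    ∃ σ, ∀ z ∈ U, Real.sign (Θ z b) = σ := by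
  rcases U.eq_empty_or_nonempty with rfl | ⟨z₀, hz₀⟩
  · exact ⟨0, fun z hz => absurd hz (notMem_empty z)⟩
  refine ⟨Real.sign (Θ z₀ b), fun z hz => ?_⟩
  by_cases h0 : ∃ y ∈ U, Θ y b = 0
  · obtain ⟨y, hy, h0⟩ := h0
    rw [hΘ.eq_zero_of_convex hΓ hUV hU b hy hz h0, hΘ.eq_zero_of_convex hΓ hUV hU b hy hz₀ h0]
  · push Not at h0
    have hp := hU.isPreconnected
    rcases lt_or_gt_of_ne (h0 z hz) with h1 | h1 <;> rcases lt_or_gt_of_ne (h0 z₀ hz₀) with h2 | h2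
    · rw [Real.sign_of_neg h1, Real.sign_of_neg h2]
    · obtain ⟨y, hy, hy0⟩ := hp.intermediate_value hz hz₀ hc ⟨h1.le, h2.le⟩
      exact absurd hy0 (h0 y hy)
    · obtain ⟨y, hy, hy0⟩ := hp.intermediate_value hz₀ hz hc ⟨h2.le, h1.le⟩
      exact absurd hy0 (h0 y hy)
    · rw [Real.sign_of_pos h1, Real.sign_of_pos h2]

theorem contDiffOn_topForm {E : Type*} [NormedAddCommGroup E] [NormedSpace ℝ E] {n : ℕ}
    {η : E → W →L[ℝ] W →L[ℝ] ℝ} {v : Fin (2 * n) → E → W} {A : Set E}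
    (hη : ContDiffOn ℝ ∞ η A) (hv : ∀ i, ContDiffOn ℝ ∞ (v i) A) :
    ContDiffOn ℝ ∞ (fun z => topForm n (η z) fun i => v i z) A := by
  simp only [topForm_apply]
  refine contDiffOn_const.mul (ContDiffOn.sum fun σ _ => contDiffOn_const.mul ?_)
  exact contDiffOn_prod fun k _ => (hη.clm_apply (hv _)).clm_apply (hv _)

theorem linearIndependent_gram_pos {B : W →L[ℝ] W →L[ℝ] ℝ} (hB : IsInner B) {b : ι → W}
    (hb : LinearIndependent ℝ b) (hcard : Fintype.card ι = Module.finrank ℝ W) :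
    0 < (gram B b).det := by
  obtain ⟨e, he⟩ : ∃ e : ι → W, Ortho B e := by
    obtain ⟨e, he⟩ := exists_ortho hB hcard
    exact ⟨fun i => e (Fintype.equivFin ι i), fun i j => by rw [he]; simp⟩
  have h := he.det_ne_zero hcard hb
  rw [he.expand_family hcard b, gram_linear_combination, Matrix.det_mul, Matrix.det_mul,
    Matrix.det_transpose, he.gram_eq, Matrix.det_one, mul_one]
  exact mul_self_pos.2 h

theorem sign_mul_real (x y : ℝ) : Real.sign (x * y) = Real.sign x * Real.sign y := by
  rcases lt_trichotomy x 0 with hx | rfl | hx <;> rcases lt_trichotomy y 0 with hy | rfl | hy <;>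
    simp [Real.sign_of_neg, Real.sign_of_pos, *, mul_pos_of_neg_of_neg, mul_neg_of_neg_of_pos,
      mul_neg_of_pos_of_neg]

/-- A top form evaluated on oriented unit volume elements does not depend on the basis. -/
theorem sign_mul_unitValue (Θ₁ Θ₂ : W [⋀^ι]→ₗ[ℝ] ℝ) (B : W →L[ℝ] W →L[ℝ] ℝ) (b : Module.Basis ι ℝ W)
    {b' : ι → W} (hb' : LinearIndependent ℝ b') :
    Real.sign (Θ₁ b') * unitValue Θ₂ B b' = Real.sign (Θ₁ b) * unitValue Θ₂ B b := by
  obtain ⟨C, hC⟩ : ∃ C : Matrix ι ι ℝ, b' = fun i => ∑ j, C i j • b j :=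
    ⟨Matrix.of fun i j => b.coord j (b' i), by
      ext1 i; exact (b.sum_repr (b' i)).symm⟩
  have hcard : Fintype.card ι = Module.finrank ℝ W := (Module.finrank_eq_card_basis b).symm
  have hdet : C.det ≠ 0 := by
    intro h0
    have h := map_linear_combination
      (basisOfLinearIndependentOfCardEqFinrank' b' hb' hcard).det b C
    have h1 := (basisOfLinearIndependentOfCardEqFinrank' b' hb' hcard).det_self
    rw [coe_basisOfLinearIndependentOfCardEqFinrank'] at h1
    rw [← hC, h0, zero_mul, h1] at h
    exact one_ne_zero h
  rw [hC, map_linear_combination, unitValue_linear_combination, sign_mul_real]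
  have : Real.sign C.det * Real.sign C.det = 1 := by
    rcases lt_or_gt_of_ne hdet with h | h
    · rw [Real.sign_of_neg h]; norm_num
    · rw [Real.sign_of_pos h]; norm_num
  linear_combination (Real.sign (Θ₁ b) * unitValue Θ₂ B b) * this

end Sign

/-! ### The function `*Ω` in charts -/

section FormAt

variable {E : Type*} [NormedAddCommGroup E] [NormedSpace ℝ E]
  {H : Type*} [TopologicalSpace H] {I : ModelWithCorners ℝ E H}
  {M : Type*} [TopologicalSpace M] [ChartedSpace H M]

/-- The value of a field of bilinear forms at `x`, as a bilinear form on the model space. -/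
def formAt (B : BilinField I M) (x : M) : E →L[ℝ] E →L[ℝ] ℝ := B x

/-- The value of a field of endomorphisms at `x`, as an endomorphism of the model space. -/
def endoAt (J : EndoField I M) (x : M) : E →L[ℝ] E := J x

end FormAt

section StarOmega

variable {n : ℕ}
  {M : Type*} [TopologicalSpace M] [ChartedSpace (EuclideanSpace ℝ (Fin (2 * n))) M]
  [IsManifold (𝓡 (2 * n)) ∞ M]
  {M' : Type*} [TopologicalSpace M'] [ChartedSpace (EuclideanSpace ℝ (Fin (2 * n))) M']
  [IsManifold (𝓡 (2 * n)) ∞ M']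
  {g : BilinField (𝓡 (2 * n)) M} {J : EndoField (𝓡 (2 * n)) M}
  {g' : BilinField (𝓡 (2 * n)) M'} {J' : EndoField (𝓡 (2 * n)) M'}

/-- The standard basis of the model space. -/
def stdBasis (n : ℕ) : Module.Basis (Fin (2 * n)) ℝ (EuclideanSpace ℝ (Fin (2 * n))) :=
  (EuclideanSpace.basisFun (Fin (2 * n)) ℝ).toBasis

theorem stdBasis_apply (i : Fin (2 * n)) :
    stdBasis n i = (EuclideanSpace.single i (1 : ℝ) : EuclideanSpace ℝ (Fin (2 * n))) := by
  simp [stdBasis]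

theorem topForm_bilinearComp {W W' : Type*} [NormedAddCommGroup W] [NormedSpace ℝ W]
    [NormedAddCommGroup W'] [NormedSpace ℝ W'] (η : W →L[ℝ] W →L[ℝ] ℝ) (A : W' →L[ℝ] W)
    (v : Fin (2 * n) → W') :
    topForm n (η.bilinearComp A A) v = topForm n η fun i => A (v i) := by
  simp only [topForm_apply]
  rfl

theorem volForm_eq (p : M) (v : Fin (2 * n) → EuclideanSpace ℝ (Fin (2 * n))) :
    volForm g J p v = topForm n (formAt (kahlerField g J) p) v := by
  exact (topForm_apply (formAt (kahlerField g J) p) v).symm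

theorem dmap_fst {F : M → M × M'}
    (hF : ContMDiff (𝓡 (2 * n)) ((𝓡 (2 * n)).prod (𝓡 (2 * n))) ∞ F) (x : M)
    (v : EuclideanSpace ℝ (Fin (2 * n))) :
    dmap (𝓡 (2 * n)) (𝓡 (2 * n)) (fun y => (F y).1) x v
      = (dmap (𝓡 (2 * n)) ((𝓡 (2 * n)).prod (𝓡 (2 * n))) F x v).1 := by
  have h := (hasMFDerivAt_fst (I := 𝓡 (2 * n)) (I' := 𝓡 (2 * n)) (F x)).comp x
    ((hF x).mdifferentiableAt (by simp)).hasMFDerivAt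
  exact congrArg (fun L : EuclideanSpace ℝ (Fin (2 * n)) →L[ℝ] EuclideanSpace ℝ (Fin (2 * n)) =>
    L v) h.mfderiv

theorem dmap_snd {F : M → M × M'}
    (hF : ContMDiff (𝓡 (2 * n)) ((𝓡 (2 * n)).prod (𝓡 (2 * n))) ∞ F) (x : M)
    (v : EuclideanSpace ℝ (Fin (2 * n))) :
    dmap (𝓡 (2 * n)) (𝓡 (2 * n)) (fun y => (F y).2) x v
      = (dmap (𝓡 (2 * n)) ((𝓡 (2 * n)).prod (𝓡 (2 * n))) F x v).2 := by
  have h := (hasMFDerivAt_snd (I := 𝓡 (2 * n)) (I' := 𝓡 (2 * n)) (F x)).comp x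
    ((hF x).mdifferentiableAt (by simp)).hasMFDerivAt
  exact congrArg (fun L : EuclideanSpace ℝ (Fin (2 * n)) →L[ℝ] EuclideanSpace ℝ (Fin (2 * n)) =>
    L v) h.mfderiv

/-- The pull-back of the volume form under the first projection, at a point where the Kähler form
of the first factor is `κ`. -/
def volFst (n : ℕ) {W W' : Type*} [NormedAddCommGroup W] [NormedSpace ℝ W]
    [NormedAddCommGroup W'] [NormedSpace ℝ W'] (κ : W →L[ℝ] W →L[ℝ] ℝ) :
    (W × W') [⋀^Fin (2 * n)]→ₗ[ℝ] ℝ :=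
  topForm n (κ.bilinearComp (ContinuousLinearMap.fst ℝ W W') (ContinuousLinearMap.fst ℝ W W'))

theorem volFst_apply {W W' : Type*} [NormedAddCommGroup W] [NormedSpace ℝ W]
    [NormedAddCommGroup W'] [NormedSpace ℝ W'] (κ : W →L[ℝ] W →L[ℝ] ℝ)
    (v : Fin (2 * n) → W × W') : volFst n κ v = topForm n κ fun i => (v i).1 :=
  topForm_bilinearComp κ _ v

theorem starOmega_eq {F : M → M × M'}
    (hF : ContMDiff (𝓡 (2 * n)) ((𝓡 (2 * n)).prod (𝓡 (2 * n))) ∞ F) (x : M) :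
    starOmega g J g' F x
      = Real.sign (topForm n (formAt (kahlerField g J) x) (stdBasis n))
        * unitValue
          ((volFst n (formAt (kahlerField g J) (F x).1)).compLinearMap
            (dmap (𝓡 (2 * n)) ((𝓡 (2 * n)).prod (𝓡 (2 * n))) F x).toLinearMap)
          (formAt (induced (𝓡 (2 * n)) ((𝓡 (2 * n)).prod (𝓡 (2 * n)))
            (prodMetric (𝓡 (2 * n)) (𝓡 (2 * n)) g g') F) x) (stdBasis n) := by
  have hb : (stdBasis n : Fin (2 * n) → EuclideanSpace ℝ (Fin (2 * n)))
      = fun i => EuclideanSpace.single i (1 : ℝ) := funext stdBasis_apply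
  have h1 : ∀ i : Fin (2 * n), mfderiv (𝓡 (2 * n)) (𝓡 (2 * n)) (fun y => (F y).1) x
      (EuclideanSpace.single i (1 : ℝ) : EuclideanSpace ℝ (Fin (2 * n)))
      = (dmap (𝓡 (2 * n)) ((𝓡 (2 * n)).prod (𝓡 (2 * n))) F x (EuclideanSpace.single i (1 : ℝ))).1 :=
    fun i => dmap_fst hF x _
  have h2 := funext h1
  have h3 : volForm g J (F x).1 (fun i => mfderiv (𝓡 (2 * n)) (𝓡 (2 * n)) (fun y => (F y).1) x
      (EuclideanSpace.single i (1 : ℝ) : EuclideanSpace ℝ (Fin (2 * n))))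
      = volFst n (formAt (kahlerField g J) (F x).1) fun i =>
        dmap (𝓡 (2 * n)) ((𝓡 (2 * n)).prod (𝓡 (2 * n))) F x (EuclideanSpace.single i (1 : ℝ)) := by
    rw [volFst_apply]
    exact (congrArg (volForm g J (F x).1) h2).trans (volForm_eq (F x).1 _)
  rw [unitValue, hb, ← mul_div_assoc]
  exact congrArg₂ (fun a b : ℝ => Real.sign a * b / _) (volForm_eq x _) h3

/-- `*Ω` in arbitrary charts. -/
theorem starOmega_chart {F : M → M × M'}
    (hF : ContMDiff (𝓡 (2 * n)) ((𝓡 (2 * n)).prod (𝓡 (2 * n))) ∞ F) {x : M} {p : M × M'}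
    {z : EuclideanSpace ℝ (Fin (2 * n))}
    (hz : z ∈ writtenDom (𝓡 (2 * n)) ((𝓡 (2 * n)).prod (𝓡 (2 * n))) x p F) :
    starOmega g J g' F ((extChartAt (𝓡 (2 * n)) x).symm z)
      = Real.sign (topForm n (chartMetric (𝓡 (2 * n)) (kahlerField g J) x z) (stdBasis n))
        * jac (fun q => volFst n (chartMetric (𝓡 (2 * n)) (kahlerField g J) p.1 q.1))
          (chartMetric ((𝓡 (2 * n)).prod (𝓡 (2 * n)))
            (prodMetric (𝓡 (2 * n)) (𝓡 (2 * n)) g g') p) (stdBasis n)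
          (written (𝓡 (2 * n)) ((𝓡 (2 * n)).prod (𝓡 (2 * n))) x p F) z := by
  set y := (extChartAt (𝓡 (2 * n)) x).symm z with hy
  set f := written (𝓡 (2 * n)) ((𝓡 (2 * n)).prod (𝓡 (2 * n))) x p F with hf
  have hli : LinearIndependent ℝ (fun i => dsymm (𝓡 (2 * n)) x z (stdBasis n i)) :=
    (stdBasis n).linearIndependent.map' (dsymm (𝓡 (2 * n)) x z).toLinearMap
      (LinearMap.ker_eq_bot.2 (injective_dsymm hz.1))
  rw [starOmega_eq hF, ← sign_mul_unitValue _ _ _ (stdBasis n) hli, jac, unitValue, unitValue,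
    pull_written hF hz]
  have h1 : topForm n (chartMetric (𝓡 (2 * n)) (kahlerField g J) x z) (stdBasis n)
      = topForm n (formAt (kahlerField g J) y)
        fun i => dsymm (𝓡 (2 * n)) x z (stdBasis n i) :=
    topForm_bilinearComp (formAt (kahlerField g J) y) _ _
  have hft : f z ∈ (extChartAt ((𝓡 (2 * n)).prod (𝓡 (2 * n))) p).target :=
    (extChartAt ((𝓡 (2 * n)).prod (𝓡 (2 * n))) p).map_source hz.2
  have hfs : (extChartAt (𝓡 (2 * n)) p.1).symm (f z).1 = (F y).1 := by
    have h3 : (extChartAt ((𝓡 (2 * n)).prod (𝓡 (2 * n))) p).symm (f z) = F y :=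
      (extChartAt ((𝓡 (2 * n)).prod (𝓡 (2 * n))) p).left_inv hz.2
    rw [symm_prod] at h3
    exact congrArg Prod.fst h3
  have h2 : ∀ v, dsymm (𝓡 (2 * n)) p.1 (f z).1 (fderiv ℝ f z v).1
      = (dmap (𝓡 (2 * n)) ((𝓡 (2 * n)).prod (𝓡 (2 * n))) F y (dsymm (𝓡 (2 * n)) x z v)).1 := by
    intro v
    have h3 := dsymm_dchart' hz.2
      (dmap (𝓡 (2 * n)) ((𝓡 (2 * n)).prod (𝓡 (2 * n))) F y (dsymm (𝓡 (2 * n)) x z v))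
    rw [← fderiv_written hF hz] at h3
    exact (congrArg Prod.fst (dsymm_prod hft _)).symm.trans (congrArg Prod.fst h3)
  have h3 : (volFst n (chartMetric (𝓡 (2 * n)) (kahlerField g J) p.1 (f z).1)).compLinearMap
        (fderiv ℝ f z).toLinearMap (stdBasis n)
      = (volFst n (formAt (kahlerField g J) (F y).1)).compLinearMap
            (dmap (𝓡 (2 * n)) ((𝓡 (2 * n)).prod (𝓡 (2 * n))) F y).toLinearMap
          fun i => dsymm (𝓡 (2 * n)) x z (stdBasis n i) := by
    rw [AlternatingMap.compLinearMap_apply, AlternatingMap.compLinearMap_apply]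
    refine (volFst_apply _ _).trans (Eq.trans ?_ (volFst_apply _ _).symm)
    refine (topForm_bilinearComp
      (formAt (kahlerField g J) ((extChartAt (𝓡 (2 * n)) p.1).symm (f z).1)) _ _).trans ?_
    rw [hfs]
    exact congrArg (fun v : Fin (2 * n) → EuclideanSpace ℝ (Fin (2 * n)) =>
      topForm n (formAt (kahlerField g J) (F y).1) v)
      (funext fun i => h2 (stdBasis n i))
  rw [h1]
  refine congrArg₂ (fun a b : ℝ => _ * (a / b)) h3.symm ?_
  rfl

end StarOmega

/-! ### The evolution of `*Ω` in an orthonormal frame -/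

section LaplacianCoordinates

variable {E : Type*} [NormedAddCommGroup E] [NormedSpace ℝ E] [FiniteDimensional ℝ E]
  {H : Type*} [TopologicalSpace H] {I : ModelWithCorners ℝ E H} [I.Boundaryless]
  {M : Type*} [TopologicalSpace M] [ChartedSpace H M] [IsManifold I ∞ M]
  {ι : Type*} [Fintype ι] [DecidableEq ι]

theorem laplacian_eq {B : BilinField I M} {G : E → E →L[ℝ] E →L[ℝ] ℝ} {w : M → ℝ} {u : E → ℝ}
    {x : M} (hB : IsInner (formAt B x)) (hG : chartMetric I B x =ᶠ[𝓝 (extChartAt I x x)] G)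
    (hw : w ∘ (extChartAt I x).symm =ᶠ[𝓝 (extChartAt I x x)] u)
    (hu : ContDiffAt ℝ ∞ u (extChartAt I x x)) {e : ι → E} (he : Ortho (formAt B x) e)
    (hcard : Fintype.card ι = Module.finrank ℝ E) :
    laplacian I B w x = ∑ k, (fderiv ℝ (fderiv ℝ u) (extChartAt I x x) (e k) (e k)
      - fderiv ℝ u (extChartAt I x x) (chr G (extChartAt I x x) (e k) (e k))) := by
  rw [← metricTrace_eq_sum hB (T := fun v w => fderiv ℝ (fderiv ℝ u) (extChartAt I x x) v w
      - fderiv ℝ u (extChartAt I x x) (chr G (extChartAt I x x) v w))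
    (fun v => ⟨fun a b => by simp; ring, fun c a => by simp; ring⟩)
    (fun v => ⟨fun a b => by simp; ring, fun c a => by simp; ring⟩) he hcard]
  change metricTrace (formAt B x) (fun v z => fderiv ℝ (fun y => fderiv ℝ
    (w ∘ (extChartAt I x).symm) y z) (extChartAt I x x) v - fderiv ℝ
    (w ∘ (extChartAt I x).symm) (extChartAt I x x)
      (christoffel (chartMetric I B x) (extChartAt I x x) v z)) = _
  refine congrArg (fun T : E → E → ℝ => metricTrace (formAt B x) T)
    (funext fun v => funext fun z => ?_)
  have h1 : (fun y => fderiv ℝ (w ∘ (extChartAt I x).symm) y z) =ᶠ[𝓝 (extChartAt I x x)]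
      fun y => fderiv ℝ u y z := by
    filter_upwards [hw.eventuallyEq_nhds] with y hy
    rw [hy.fderiv_eq]
  rw [h1.fderiv_eq, hw.fderiv_eq, ← chr_congr hG, chr_apply,
    fderiv_apply₁ ((hu.fderiv_right (m := 1) two_le_infty).differentiableAt (by simp))]

end LaplacianCoordinates

section LocalEvolution

variable {E : Type*} [NormedAddCommGroup E] [NormedSpace ℝ E] [FiniteDimensional ℝ E]
  {W : Type*} [NormedAddCommGroup W] [NormedSpace ℝ W] [FiniteDimensional ℝ W]
  {ι : Type*} [Fintype ι] [DecidableEq ι]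
  {G : W → W →L[ℝ] W →L[ℝ] ℝ} {φ : ℝ → E → W} {S : Set ℝ} {U : Set E} {V : Set W}
  {Θ : W → W [⋀^ι]→ₗ[ℝ] ℝ}

/-- The right-hand side of the evolution equation of `jac`, without the Laplacian term. -/
def reactionTerm (G : W → W →L[ℝ] W →L[ℝ] ℝ) (Θ₀ : W [⋀^ι]→ₗ[ℝ] ℝ) (f : E → W) (z : E)
    (e : ι → E) (ν : ι → W) : ℝ :=
  Θ₀ (fun j => fderiv ℝ f z (e j)) *
      ∑ k, ∑ i, G (f z) (sff G f z (e k) (e i)) (sff G f z (e k) (e i))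
    - ∑ k, ∑ i, ∑ j with j ≠ i, Θ₀ (Function.update (Function.update
        (fun j => fderiv ℝ f z (e j)) i (sff G f z (e k) (e i))) j (sff G f z (e k) (e j)))
    - ∑ i, ∑ q, (∑ k, G (f z) (curv (chr G) (f z) (fderiv ℝ f z (e k))
        (fderiv ℝ f z (e i)) (fderiv ℝ f z (e k))) (ν q))
        * Θ₀ (Function.update (fun j => fderiv ℝ f z (e j)) i (ν q))

/-- The evolution of `jac` with the second derivatives along `geo` written as the Laplacian in
coordinates. The constant `σ` is a sign that depends on the orientations of `e` and `b`. -/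
theorem LocalFlow.evolution_jac (h : LocalFlow G φ S U V) (hΘ : ParallelForm (chr G) Θ V)
    {t : ℝ} (ht : t ∈ S) {z : E} (hz : z ∈ U) {f : E → W} (hf : φ t = f)
    {Θ₀ : W [⋀^ι]→ₗ[ℝ] ℝ} (hΘ₀ : Θ (f z) = Θ₀)
    (hcard : Fintype.card ι = Module.finrank ℝ E)
    (hW : 2 * Fintype.card ι = Module.finrank ℝ W)
    {e b : ι → E} {ν : ι → W} (hu : ContDiffAt ℝ ∞ (jac Θ G b f) z)
    (he : Ortho (pull G f z) e) (hb : LinearIndependent ℝ b)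
    (hν : Ortho (G (f z)) ν) (hn : ∀ x q, G (f z) (fderiv ℝ f z x) (ν q) = 0) :
    ∃ σ : ℝ, jac Θ G b f z = σ * Θ₀ (fun j => fderiv ℝ f z (e j)) ∧
      HasDerivWithinAt (fun s => jac Θ G b (φ s) z)
        (∑ k, (fderiv ℝ (fderiv ℝ (jac Θ G b f)) z (e k) (e k)
          - fderiv ℝ (jac Θ G b f) z (chr (pull G f) z (e k) (e k)))
          + σ * reactionTerm G Θ₀ f z e ν) S t := by
  subst hf
  subst hΘ₀
  obtain ⟨σ, d, hj, hd, hev⟩ := GraphFlow.evolution_jac hΘ (h.immInto ht) hz hcard hW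
    (h.deriv_fderiv ht hz 0).1 (h.velocity t ht z hz) (fun v => (h.deriv_fderiv ht hz v).2)
    he hb hν hn
  refine ⟨σ, hj, hev.congr_deriv ?_⟩
  rw [Finset.sum_congr rfl fun k _ => (hd k).unique (has2DerivAt_comp_geo hu)]
  rfl

end LocalEvolution

section Evolution

variable {n : ℕ}
  {M : Type*} [TopologicalSpace M] [ChartedSpace (EuclideanSpace ℝ (Fin (2 * n))) M]
  [IsManifold (𝓡 (2 * n)) ∞ M]
  {M' : Type*} [TopologicalSpace M'] [ChartedSpace (EuclideanSpace ℝ (Fin (2 * n))) M']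
  [IsManifold (𝓡 (2 * n)) ∞ M']
  {g : BilinField (𝓡 (2 * n)) M} {J : EndoField (𝓡 (2 * n)) M}
  {g' : BilinField (𝓡 (2 * n)) M'} {J' : EndoField (𝓡 (2 * n)) M'}

theorem IsKahler.parallelOn_kahlerField (hK : IsKahler (𝓡 (2 * n)) g J) (hg : IsMetric g)
    (x : M) : ParallelOn (chr (chartMetric (𝓡 (2 * n)) g x))
      (chartMetric (𝓡 (2 * n)) (kahlerField g J) x) (extChartAt (𝓡 (2 * n)) x).target :=
  (hK.kahlerOn hg x).parallel.congr (fun _ _ => rfl) fun _ hq => (kform_chart_eq hq).symm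

theorem IsKahler.parallelForm_volFst (hK : IsKahler (𝓡 (2 * n)) g J) (hg : IsMetric g)
    (hg' : IsMetric g') (p : M × M') :
    ParallelForm (chr (chartMetric ((𝓡 (2 * n)).prod (𝓡 (2 * n)))
        (prodMetric (𝓡 (2 * n)) (𝓡 (2 * n)) g g') p))
      (fun q => volFst n (chartMetric (𝓡 (2 * n)) (kahlerField g J) p.1 q.1))
      (extChartAt ((𝓡 (2 * n)).prod (𝓡 (2 * n))) p).target := by
  have h := (hK.parallelOn_kahlerField hg p.1).liftFst (hg.metricField p.1) (hg'.metricField p.2)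
  rw [← target_prod (I := 𝓡 (2 * n)) (I' := 𝓡 (2 * n))] at h
  exact (h.congr (fun q hq => chr_chartMetric_prod hq) fun _ _ => rfl).topForm

theorem contDiffOn_jac {E W : Type*} [NormedAddCommGroup E] [NormedSpace ℝ E]
    [FiniteDimensional ℝ E] [NormedAddCommGroup W] [NormedSpace ℝ W] [FiniteDimensional ℝ W]
    {G : W → W →L[ℝ] W →L[ℝ] ℝ} {f : E → W} {U : Set E} {V : Set W}
    {η : W → W →L[ℝ] W →L[ℝ] ℝ} (h : ImmInto G f U V) (hη : ContDiffOn ℝ ∞ η V)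
    {b : Fin (2 * n) → E} (hb : LinearIndependent ℝ b) (hcard : 2 * n = Module.finrank ℝ E) :
    ContDiffOn ℝ ∞ (fun z => jac (fun q => topForm n (η q)) G b f z) U := by
  have hf' : ContDiffOn ℝ ∞ (fderiv ℝ f) U := h.smooth.fderiv_of_isOpen h.openU (by simp)
  have h1 : ContDiffOn ℝ ∞ (fun z => topForm n (η (f z)) fun i => fderiv ℝ f z (b i)) U :=
    contDiffOn_topForm (hη.comp h.smooth h.mapsTo) fun i => hf'.clm_apply contDiffOn_const
  have h2 : ContDiffOn ℝ ∞ (fun z => (gram (pull G f z) b).det) U := by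
    simp only [Matrix.det_apply']
    refine ContDiffOn.sum fun σ _ => contDiffOn_const.mul (contDiffOn_prod fun i _ => ?_)
    exact (h.metricOn_pull.smooth.clm_apply contDiffOn_const).clm_apply contDiffOn_const
  have h3 : ∀ z ∈ U, 0 < (gram (pull G f z) b).det := fun z hz =>
    linearIndependent_gram_pos (h.metricOn_pull.inner z hz) hb (by simpa using hcard)
  exact h1.div (h2.sqrt fun z hz => (h3 z hz).ne') fun z hz => (Real.sqrt_pos.2 (h3 z hz)).ne'

/-- In charts, `*Ω` is up to a constant sign the function `jac`. -/
theorem exists_starOmega_eq_jac (hK : IsKahler (𝓡 (2 * n)) g J) (hg : IsMetric g)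
    (x : M) {U : Set (EuclideanSpace ℝ (Fin (2 * n)))} (hU : Convex ℝ U)
    (hUt : U ⊆ (extChartAt (𝓡 (2 * n)) x).target) :
    ∃ σ : ℝ, ∀ (F : M → M × M') (p : M × M'),
      ContMDiff (𝓡 (2 * n)) ((𝓡 (2 * n)).prod (𝓡 (2 * n))) ∞ F →
      ∀ z ∈ U, z ∈ writtenDom (𝓡 (2 * n)) ((𝓡 (2 * n)).prod (𝓡 (2 * n))) x p F →
      starOmega g J g' F ((extChartAt (𝓡 (2 * n)) x).symm z)
        = σ * jac (fun q => volFst n (chartMetric (𝓡 (2 * n)) (kahlerField g J) p.1 q.1))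
          (chartMetric ((𝓡 (2 * n)).prod (𝓡 (2 * n)))
            (prodMetric (𝓡 (2 * n)) (𝓡 (2 * n)) g g') p) (stdBasis n)
          (written (𝓡 (2 * n)) ((𝓡 (2 * n)).prod (𝓡 (2 * n))) x p F) z := by
  have hp := hK.parallelOn_kahlerField hg x
  obtain ⟨σ, hσ⟩ := hp.topForm.exists_sign hp.smoothΓ.continuousOn hUt hU (stdBasis n)
    ((contDiffOn_topForm hp.smooth fun i => contDiffOn_const).continuousOn.mono hUt)
  refine ⟨σ, fun F p hF z hz hz' => ?_⟩
  rw [starOmega_chart hF hz', hσ z hz]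

/-- `*Ω` is smooth: in a chart it is a constant sign times `jac`, also where it
vanishes. -/
theorem contMDiff_starOmega (hK : IsKahler (𝓡 (2 * n)) g J) (hg : IsMetric g)
    (hg' : IsMetric g') {F : M → M × M'}
    (hF : ContMDiff (𝓡 (2 * n)) ((𝓡 (2 * n)).prod (𝓡 (2 * n))) ∞ F)
    (hi : ∀ q, Function.Injective (mfderiv (𝓡 (2 * n)) ((𝓡 (2 * n)).prod (𝓡 (2 * n))) F q)) :
    ContMDiff (𝓡 (2 * n)) 𝓘(ℝ, ℝ) ∞ (starOmega g J g' F) := by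
  intro x
  have hI := immInto_written (hg.metricField.prod hg'.metricField) hF hi x (F x)
  obtain ⟨r, hr, hrU⟩ := Metric.isOpen_iff.1 hI.openU _ (mem_writtenDom_self x)
  obtain ⟨σ, hσ⟩ := exists_starOmega_eq_jac (g' := g') hK hg x (convex_ball _ r)
    (hrU.trans inter_subset_left)
  have hη := ((hK.parallelOn_kahlerField hg (F x).1).liftFst (hg.metricField (F x).1)
    (hg'.metricField (F x).2)).smooth
  rw [← target_prod (I := 𝓡 (2 * n)) (I' := 𝓡 (2 * n))] at hη
  have hs := (contDiffOn_jac hI hη (stdBasis n).linearIndependent (by simp)).contDiffAt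
    (hI.openU.mem_nhds (mem_writtenDom_self x))
  have h1 := ((contDiffAt_const (c := σ)).mul hs).contMDiffAt.comp x
    (contMDiffAt_chart (mem_extChartAt_source (I := 𝓡 (2 * n)) x))
  refine h1.congr_of_eventuallyEq ?_
  filter_upwards [extChartAt_source_mem_nhds (I := 𝓡 (2 * n)) x,
    (continuousAt_extChartAt (I := 𝓡 (2 * n)) x).eventually (Metric.ball_mem_nhds _ hr)]
    with y hy hyr
  have h2 := hσ F (F x) hF _ hyr (hrU hyr)
  rw [(extChartAt (𝓡 (2 * n)) x).left_inv hy] at h2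
  exact h2

/-- The evolution equation of `*Ω` in an orthonormal basis adapted to the tangent and the normal
space of the flow. -/
theorem evolution_starOmega (hK : IsKahler (𝓡 (2 * n)) g J) (hg : IsMetric g)
    (hg' : IsMetric g') {T : ℝ} {F : ℝ → M → M × M'}
    (hF : IsMeanCurvatureFlow (𝓡 (2 * n)) ((𝓡 (2 * n)).prod (𝓡 (2 * n)))
      (prodMetric (𝓡 (2 * n)) (𝓡 (2 * n)) g g') T F) {t : ℝ} (ht : t ∈ Ico 0 T) (x : M)
    {G : EuclideanSpace ℝ (Fin (2 * n)) × EuclideanSpace ℝ (Fin (2 * n)) →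
      EuclideanSpace ℝ (Fin (2 * n)) × EuclideanSpace ℝ (Fin (2 * n)) →L[ℝ]
      EuclideanSpace ℝ (Fin (2 * n)) × EuclideanSpace ℝ (Fin (2 * n)) →L[ℝ] ℝ}
    (hG : G = chartMetric ((𝓡 (2 * n)).prod (𝓡 (2 * n)))
      (prodMetric (𝓡 (2 * n)) (𝓡 (2 * n)) g g') (F t x))
    {f : EuclideanSpace ℝ (Fin (2 * n)) →
      EuclideanSpace ℝ (Fin (2 * n)) × EuclideanSpace ℝ (Fin (2 * n))}
    (hf : f = written (𝓡 (2 * n)) ((𝓡 (2 * n)).prod (𝓡 (2 * n))) x (F t x) (F t))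
    {z : EuclideanSpace ℝ (Fin (2 * n))} (hz : z = extChartAt (𝓡 (2 * n)) x x)
    {Θ : (EuclideanSpace ℝ (Fin (2 * n)) × EuclideanSpace ℝ (Fin (2 * n))) [⋀^Fin (2 * n)]→ₗ[ℝ] ℝ}
    (hΘ : Θ = volFst n (formAt (kahlerField g J) (F t x).1))
    {e : Fin (2 * n) → EuclideanSpace ℝ (Fin (2 * n))}
    {ν : Fin (2 * n) → EuclideanSpace ℝ (Fin (2 * n)) × EuclideanSpace ℝ (Fin (2 * n))}
    (he : Ortho (pull G f z) e) (hν : Ortho (G (f z)) ν)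
    (hn : ∀ v q, G (f z) (fderiv ℝ f z v) (ν q) = 0) :
    ∃ σ, starOmega g J g' (F t) x = σ * Θ (fun j => fderiv ℝ f z (e j)) ∧
      HasDerivWithinAt (fun s => starOmega g J g' (F s) x)
        (laplacianStarOmega g J g' (F t) x + σ * reactionTerm G Θ f z e ν) (Ico 0 T) t := by
  have hGf : MetricField (prodMetric (𝓡 (2 * n)) (𝓡 (2 * n)) g g') :=
    hg.metricField.prod hg'.metricField
  have hFt := hF.contMDiff ht
  obtain ⟨S, U, htS, hST, hSn, hyU, hUc, hdom, hL⟩ := hF.exists_localFlow hGf ht x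
  obtain ⟨σ, hσ'⟩ := exists_starOmega_eq_jac (g' := g') hK hg x hUc
    ((hdom t htS).trans inter_subset_left)
  have hσ := fun F₁ => hσ' F₁ (F t x)
  have hη := ((hK.parallelOn_kahlerField hg (F t x).1).liftFst (hg.metricField (F t x).1)
    (hg'.metricField (F t x).2)).smooth
  rw [← target_prod (I := 𝓡 (2 * n)) (I' := 𝓡 (2 * n))] at hη
  have hI := hL.immInto htS
  have hs := (contDiffOn_jac hI hη (stdBasis n).linearIndependent (by simp)).contDiffAt
    (hI.openU.mem_nhds hyU)
  have hp := hK.parallelForm_volFst hg hg' (F t x)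
  have hfz : f z = extChartAt ((𝓡 (2 * n)).prod (𝓡 (2 * n))) (F t x) (F t x) := by
    rw [hf, hz, written_self]
  have hΘz : volFst n (chartMetric (𝓡 (2 * n)) (kahlerField g J) (F t x).1 (f z).1) = Θ := by
    rw [hΘ, hfz, chart_prod, chartMetric_self]; rfl
  rw [← hz] at hyU hs
  rw [← hG] at hL hp hI hs hσ
  have hxz : (extChartAt (𝓡 (2 * n)) x).symm z = x := by rw [hz, extChartAt_to_inv]
  set Θ' : EuclideanSpace ℝ (Fin (2 * n)) × EuclideanSpace ℝ (Fin (2 * n)) →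
      (EuclideanSpace ℝ (Fin (2 * n)) × EuclideanSpace ℝ (Fin (2 * n))) [⋀^Fin (2 * n)]→ₗ[ℝ] ℝ :=
    fun q => volFst n (chartMetric (𝓡 (2 * n)) (kahlerField g J) (F t x).1 q.1) with hΘ'
  have hu : ContDiffAt ℝ ∞ (jac Θ' G (stdBasis n) f) z := by rw [hf]; exact hs
  obtain ⟨τ, hj, hev⟩ := hL.evolution_jac hp htS hyU hf.symm hΘz (by simp) (by simp; ring) hu he
    (stdBasis n).linearIndependent hν hn
  have hst : ∀ s ∈ S, starOmega g J g' (F s) x = σ * jac Θ' G (stdBasis n)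
      (written (𝓡 (2 * n)) ((𝓡 (2 * n)).prod (𝓡 (2 * n))) x (F t x) (F s)) z := by
    intro s hs
    have h := hσ (F s) (hF.contMDiff (hST hs)) z hyU (hdom s hs hyU)
    rwa [hxz] at h
  have hlap : laplacianStarOmega g J g' (F t) x = σ * ∑ k,
      (fderiv ℝ (fderiv ℝ (jac Θ' G (stdBasis n) f)) z (e k) (e k)
          - fderiv ℝ (jac Θ' G (stdBasis n) f) z (chr (pull G f) z (e k) (e k))) := by
    have hpe : pull G f z = formAt (induced (𝓡 (2 * n)) ((𝓡 (2 * n)).prod (𝓡 (2 * n)))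
        (prodMetric (𝓡 (2 * n)) (𝓡 (2 * n)) g g') (F t)) x := by
      rw [hG, hf, hz]; exact (induced_eq hFt x).symm
    have hw : starOmega g J g' (F t) ∘ (extChartAt (𝓡 (2 * n)) x).symm =ᶠ[𝓝 z]
        σ • jac Θ' G (stdBasis n) f := by
      filter_upwards [hL.openU.mem_nhds hyU] with y hy
      rw [hf]
      exact hσ (F t) hFt y hy (hdom t htS hy)
    have hme : chartMetric (𝓡 (2 * n)) (induced (𝓡 (2 * n)) ((𝓡 (2 * n)).prod (𝓡 (2 * n)))
        (prodMetric (𝓡 (2 * n)) (𝓡 (2 * n)) g g') (F t)) x =ᶠ[𝓝 z] pull G f := by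
      filter_upwards [hL.openU.mem_nhds hyU] with y hy
      rw [hG, hf]
      exact (pull_written hFt (hdom t htS hy)).symm
    have hin : IsInner (pull G f z) := by rw [hf]; exact hI.metricOn_pull.inner z hyU
    rw [hpe] at hin he
    subst hz
    rw [laplacianStarOmega, laplacian_eq hin hme hw (contDiffAt_const.smul hu) he (by simp),
      Finset.mul_sum]
    have h1 : fderiv ℝ (σ • jac Θ' G (stdBasis n) f) = σ • fderiv ℝ (jac Θ' G (stdBasis n) f) := by
      exact fderiv_const_smul_field (R := ℝ) (F := ℝ) σ
    have h2 : fderiv ℝ (σ • fderiv ℝ (jac Θ' G (stdBasis n) f))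
        = σ • fderiv ℝ (fderiv ℝ (jac Θ' G (stdBasis n) f)) := by
      exact fderiv_const_smul_field (R := ℝ) (F := EuclideanSpace ℝ (Fin (2 * n)) →L[ℝ] ℝ) σ
    rw [h1, h2]
    refine Finset.sum_congr rfl fun k _ => ?_
    simp only [Pi.smul_apply, smul_apply, smul_eq_mul]
    ring
  refine ⟨σ * τ, ?_, ?_⟩
  · rw [hst t htS, mul_assoc, ← hj, hf]
  · have h1 := ((hev.const_mul σ).congr hst (hst t htS)).mono_of_mem_nhdsWithin hSn
    refine h1.congr_deriv ?_
    rw [hlap]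
    ring

end Evolution

/-! ### The involution of the indices and the quadratic form -/

section Alternating

variable {E : Type*} [AddCommGroup E] [Module ℝ E] {ι : Type*} [Fintype ι] [DecidableEq ι]

theorem map_update_sum (Φ : E [⋀^ι]→ₗ[ℝ] ℝ) (b : ι → E) (i : ι) (X : ι → ℝ) :
    Φ (Function.update b i (∑ p, X p • b p)) = X i * Φ b := by
  let L := Φ.toMultilinearMap.toLinearMap b i
  have hL : ∀ y, Φ (Function.update b i y) = L y := fun y => rfl
  have h0 : ∀ p, p ≠ i → L (b p) = 0 := fun p hp => Φ.map_update_self b hp.symm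
  have h1 : L (b i) = Φ b := by rw [← hL, Function.update_eq_self]
  rw [hL, map_sum, Finset.sum_eq_single i (fun p _ hp => by simp [h0 p hp]) (by simp)]
  simp [h1]

/-- Replacing two arguments of an alternating form by linear combinations produces a `2 × 2`
minor. -/
theorem map_update_update_sum (Φ : E [⋀^ι]→ₗ[ℝ] ℝ) (b : ι → E) {i j : ι} (hij : j ≠ i)
    (X Y : ι → ℝ) :
    Φ (Function.update (Function.update b i (∑ p, X p • b p)) j (∑ q, Y q • b q))
      = (X i * Y j - X j * Y i) * Φ b := by
  set x := ∑ p, X p • b p with hx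
  set v := Function.update b i x with hv
  let L := Φ.toMultilinearMap.toLinearMap v j
  have hL : ∀ y, Φ (Function.update v j y) = L y := fun y => rfl
  have h0 : ∀ q, q ≠ i → q ≠ j → L (b q) = 0 := fun q hqi hqj => by
    have h := Φ.map_update_self v hqj.symm
    rwa [hv, Function.update_of_ne hqi] at h
  have h1 : L (b j) = X i * Φ b := by
    rw [← hL, hv, Function.update_comm hij.symm, Function.update_eq_self, hx, map_update_sum]
  have h2 : L (b i) = -(X j * Φ b) := by
    rw [← hL, ← map_update_sum Φ b j X, ← Φ.map_swap _ hij]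
    congr 1
    ext1 l
    rw [Function.comp_apply]
    rcases eq_or_ne l j with rfl | hlj
    · rw [Function.update_self, Equiv.swap_apply_left, Function.update_of_ne hij.symm]
    · rcases eq_or_ne l i with rfl | hli
      · rw [Function.update_of_ne hij.symm, hv, Function.update_self, Equiv.swap_apply_right,
          Function.update_self]
      · rw [Equiv.swap_apply_of_ne_of_ne hlj hli, Function.update_of_ne hlj, hv,
          Function.update_of_ne hli, Function.update_of_ne hlj]
  rw [hL, map_sum, Finset.sum_eq_add i j hij.symm
    (fun q _ hq => by simp [h0 q hq.1 hq.2]) (by simp) (by simp)]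
  simp only [map_smul, h1, h2, smul_eq_mul]
  ring

end Alternating

section Partner

variable {n : ℕ}

theorem partner_of_even {i : Fin (2 * n)} (h : Even (i : ℕ)) : (partner i : ℕ) = i + 1 := by
  simp [partner, h]

theorem partner_of_odd {i : Fin (2 * n)} (h : ¬ Even (i : ℕ)) : (partner i : ℕ) = i - 1 := by
  simp [partner, h]

theorem even_partner {i : Fin (2 * n)} : Even (partner i : ℕ) ↔ ¬ Even (i : ℕ) := by
  by_cases h : Even (i : ℕ)
  · rw [partner_of_even h]; simp [Nat.even_add_one, h]
  · rw [partner_of_odd h]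
    obtain ⟨k, hk⟩ := Nat.not_even_iff_odd.1 h
    simp only [h, not_false_eq_true, iff_true]
    exact ⟨k, by omega⟩

theorem partner_partner (i : Fin (2 * n)) : partner (partner i) = i := by
  ext
  by_cases h : Even (i : ℕ)
  · rw [partner_of_odd (by rw [even_partner]; simpa using h), partner_of_even h]; rfl
  · rw [partner_of_even (by rw [even_partner]; exact h), partner_of_odd h]
    obtain ⟨k, hk⟩ := Nat.not_even_iff_odd.1 h
    omega

theorem partner_injective : Function.Injective (partner : Fin (2 * n) → Fin (2 * n)) :=
  Function.Involutive.injective partner_partner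

theorem partner_ne (i : Fin (2 * n)) : partner i ≠ i := fun h => by
  have := even_partner (i := i)
  rw [h] at this
  tauto

theorem lt_partner_iff {i : Fin (2 * n)} : i < partner i ↔ Even (i : ℕ) := by
  rw [Fin.lt_def]
  by_cases h : Even (i : ℕ)
  · rw [partner_of_even h]; simp [h]
  · rw [partner_of_odd h]; simp [h]

/-- The involution as an equivalence. -/
def partnerEquiv (n : ℕ) : Fin (2 * n) ≃ Fin (2 * n) :=
  ⟨partner, partner, partner_partner, partner_partner⟩

theorem neg_one_pow_partner (i : Fin (2 * n)) :
    (-1 : ℝ) ^ (partner i : ℕ) = -(-1) ^ (i : ℕ) := by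
  by_cases h : Even (i : ℕ)
  · rw [partner_of_even h, pow_succ]; ring
  · have h2 : Even (partner i : ℕ) := even_partner.2 h
    rw [h2.neg_one_pow, (Nat.not_even_iff_odd.1 h).neg_one_pow]; ring

/-- A symmetric sum over pairs of distinct indices, split into partners and others. -/
theorem sum_ne_eq_two_mul_sum_lt (A : Fin (2 * n) → Fin (2 * n) → ℝ) (hA : ∀ i j, A i j = A j i) :
    ∑ i, ∑ j with j ≠ i, A i j
      = 2 * ∑ i : Fin (2 * n) with Even i.val, A i (partner i)
        + 2 * ∑ i, ∑ j with i < j ∧ j ≠ partner i, A i j := by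
  have e1 : ∀ i j : Fin (2 * n), (if j ≠ i then A i j else 0)
      = (if i < j then A i j else 0) + (if j < i then A j i else 0) := fun i j => by
    rcases lt_trichotomy i j with h | h | h
    · simp [h, h.ne', h.not_gt]
    · simp [h]
    · simp [h, h.ne, h.not_gt, hA i j]
  have e2 : ∀ i j : Fin (2 * n), (if i < j then A i j else 0)
      = (if j = partner i then (if Even (i : ℕ) then A i (partner i) else 0) else 0)
        + (if i < j ∧ j ≠ partner i then A i j else 0) := fun i j => by
    by_cases h : j = partner i
    · subst h
      simp [lt_partner_iff]
    · simp [h]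
  simp only [Finset.sum_filter, e1, Finset.sum_add_distrib]
  rw [Finset.sum_comm (f := fun i j => if j < i then A j i else 0)]
  simp only [e2, Finset.sum_add_distrib, Finset.sum_ite_eq', Finset.mem_univ, if_true]
  ring

/-- The identification of the terms of `Q(λ, h)` with sums of `2 × 2` minors. -/
theorem quadForm_eq {lam : Fin (2 * n) → ℝ} (hp : ∀ i, lam i * lam (partner i) = 1)
    {h : Fin (2 * n) → Fin (2 * n) → Fin (2 * n) → ℝ} (h1 : ∀ i j k, h i j k = h j i k)
    (h2 : ∀ i j k, h i j k = h i k j) :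
    ∑ k, ∑ i, ∑ p, h k i p ^ 2 - ∑ k, ∑ i : Fin (2 * n), ∑ j : Fin (2 * n) with j ≠ i,
      (-1) ^ ((i : ℕ) + (j : ℕ)) * lam i * lam j *
        (h k i (partner i) * h k j (partner j) - h k i (partner j) * h k j (partner i))
      = quadForm lam h := by
  have e : ∀ k, ∑ i : Fin (2 * n), ∑ j : Fin (2 * n) with j ≠ i,
      (-1) ^ ((i : ℕ) + (j : ℕ)) * lam i * lam j *
        (h k i (partner i) * h k j (partner j) - h k i (partner j) * h k j (partner i))
      = 2 * ∑ i : Fin (2 * n) with Even i.val,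
          (h i i k * h (partner i) (partner i) k - h i (partner i) k ^ 2)
        + 2 * ∑ i : Fin (2 * n), ∑ j : Fin (2 * n) with i < j ∧ j ≠ partner i,
          (-1) ^ ((i : ℕ) + (j : ℕ)) * lam i * lam j *
          (h (partner i) i k * h (partner j) j k - h (partner i) j k * h (partner j) i k) := by
    intro k
    have hs : ∀ a b, h k a b = h a b k := fun a b => by rw [h1, h2]
    rw [sum_ne_eq_two_mul_sum_lt _ fun i j => by
      rw [add_comm (i : ℕ), hs i (partner j), hs j (partner i)]; ring]
    congr 2
    · refine Finset.sum_congr rfl fun i _ => ?_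
      rw [partner_partner, pow_add, neg_one_pow_partner, hs, hs, hs, hs, h1 (partner i) i]
      have h3 : (-1 : ℝ) ^ (i : ℕ) * (-1) ^ (i : ℕ) = 1 := by rw [← mul_pow]; simp
      linear_combination (-(lam i * lam (partner i)) * (h i (partner i) k * h i (partner i) k
        - h i i k * h (partner i) (partner i) k)) * h3 - (h i (partner i) k * h i (partner i) k
        - h i i k * h (partner i) (partner i) k) * hp i
    · refine Finset.sum_congr rfl fun i _ => Finset.sum_congr rfl fun j _ => ?_
      rw [hs, hs, hs, hs, h1 (partner i) i, h1 (partner j) j, h1 (partner i) j, h1 (partner j) i]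
      ring
  rw [quadForm, Finset.sum_congr rfl fun k _ => e k, Finset.sum_add_distrib, ← Finset.mul_sum,
    ← Finset.mul_sum, sub_add_eq_sub_sub]

end Partner

section Reaction

variable {n : ℕ} {E : Type*} [NormedAddCommGroup E] [NormedSpace ℝ E] [FiniteDimensional ℝ E]
  {E' : Type*} [NormedAddCommGroup E'] [NormedSpace ℝ E'] [FiniteDimensional ℝ E']

theorem fst_update {ι : Type*} [DecidableEq ι] (s : ι → E × E') (i : ι) (x : E × E') :
    (fun l => (Function.update s i x l).1) = Function.update (fun l => (s l).1) i x.1 := by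
  ext1 l
  rcases eq_or_ne l i with rfl | h
  · simp
  · simp [h]

/-- The reaction term in a frame `s`, `ν` of the tangent and the normal space for which the first
components of `ν l` and `s l'` are proportional. -/
theorem reactionTerm_eq {D : Type*} [NormedAddCommGroup D] [NormedSpace ℝ D]
    [FiniteDimensional ℝ D] {G : E × E' → E × E' →L[ℝ] E × E' →L[ℝ] ℝ}
    {Θ₀ : (E × E') [⋀^Fin (2 * n)]→ₗ[ℝ] ℝ} {Φ : E [⋀^Fin (2 * n)]→ₗ[ℝ] ℝ}
    (hΘ : ∀ v, Θ₀ v = Φ fun i => (v i).1) {f : D → E × E'} {z : D} {e : Fin (2 * n) → D}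
    {ν : Fin (2 * n) → E × E'} {lam : Fin (2 * n) → ℝ}
    {h : Fin (2 * n) → Fin (2 * n) → Fin (2 * n) → ℝ}
    (hν : Ortho (G (f z)) ν)
    (hp : ∀ i, lam i * lam (partner i) = 1)
    (hπ : ∀ l, (ν l).1 = ((-1) ^ (l : ℕ) * lam (partner l)) • (fderiv ℝ f z (e (partner l))).1)
    (hS : ∀ k i, sff G f z (e k) (e i) = ∑ p, h k i p • ν p)
    (h1 : ∀ i j k, h i j k = h j i k) (h2 : ∀ i j k, h i j k = h i k j) :
    reactionTerm G Θ₀ f z e ν = Θ₀ (fun j => fderiv ℝ f z (e j)) *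
      (quadForm lam h + ∑ k, ∑ i : Fin (2 * n), (-1) ^ (i : ℕ) * lam i * G (f z) (curv (chr G) (f z)
        (fderiv ℝ f z (e k)) (fderiv ℝ f z (e i)) (fderiv ℝ f z (e k))) (ν (partner i))) := by
  set s : Fin (2 * n) → E × E' := fun j => fderiv ℝ f z (e j) with hs
  have hπ' : ∀ i, (ν (partner i)).1 = (-(-1) ^ (i : ℕ) * lam i) • (s i).1 := fun i => by
    rw [hπ, partner_partner, neg_one_pow_partner]
  have hS1 : ∀ k i, (sff G f z (e k) (e i)).1
      = ∑ p : Fin (2 * n), (h k i (partner p) * (-(-1) ^ (p : ℕ) * lam p)) • (s p).1 :=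
    fun k i => by
    rw [hS, ← (partnerEquiv n).sum_comp, Prod.fst_sum]
    refine Finset.sum_congr rfl fun p _ => ?_
    change h k i (partner p) • (ν (partner p)).1 = _
    rw [hπ', smul_smul]
  have e1 : ∀ k i, G (f z) (sff G f z (e k) (e i)) (sff G f z (e k) (e i))
      = ∑ p, h k i p ^ 2 := fun k i => by
    rw [hS]
    simp [map_sum, sum_apply, hν _ _, sq]
  have e2 : ∀ k i j, j ≠ i → Θ₀ (Function.update (Function.update s i (sff G f z (e k) (e i))) j
      (sff G f z (e k) (e j))) = Θ₀ s * ((-1) ^ ((i : ℕ) + (j : ℕ)) * lam i * lam j *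
        (h k i (partner i) * h k j (partner j) - h k i (partner j) * h k j (partner i))) := by
    intro k i j hij
    rw [hΘ, fst_update, fst_update, hS1, hS1,
      map_update_update_sum Φ (fun l => (s l).1) hij, hΘ, pow_add]
    ring
  have e3 : ∀ i q, Θ₀ (Function.update s i (ν q))
      = if q = partner i then -(-1) ^ (i : ℕ) * lam i * Θ₀ s else 0 := by
    intro i q
    rw [hΘ, fst_update]
    obtain ⟨l, rfl⟩ := (partnerEquiv n).surjective q
    change Φ (Function.update _ _ (ν (partner l)).1) = if partner l = _ then _ else _
    rw [hπ', AlternatingMap.map_update_smul]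
    rcases eq_or_ne l i with rfl | hl
    · rw [Function.update_eq_self (f := fun l => (s l).1), if_pos rfl, hΘ, smul_eq_mul]
    · rw [Φ.map_update_self (fun l => (s l).1) hl.symm, smul_zero,
        if_neg (partner_injective.ne hl)]
  rw [← quadForm_eq hp h1 h2, reactionTerm]
  have e4 : ∀ k (i : Fin (2 * n)), ∑ j with j ≠ i, Θ₀ (Function.update (Function.update s i
      (sff G f z (e k) (e i))) j (sff G f z (e k) (e j))) = Θ₀ s * ∑ j : Fin (2 * n) with j ≠ i,
        (-1) ^ ((i : ℕ) + (j : ℕ)) * lam i * lam j *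
        (h k i (partner i) * h k j (partner j) - h k i (partner j) * h k j (partner i)) := by
    intro k i
    rw [Finset.mul_sum]
    exact Finset.sum_congr rfl fun j hj => e2 k i j (Finset.mem_filter.1 hj).2
  simp only [← hs, e1, e3, e4, mul_ite, mul_zero, Finset.sum_ite_eq', Finset.mem_univ, if_true,
    ← Finset.mul_sum]
  have e5 : ∀ g : Fin (2 * n) → Fin (2 * n) → ℝ,
      ∑ i : Fin (2 * n), (∑ k, g k i) * (-(-1) ^ (i : ℕ) * lam i * Θ₀ s)
      = -(Θ₀ s * ∑ k, ∑ i : Fin (2 * n), (-1) ^ (i : ℕ) * lam i * g k i) := by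
    intro g
    rw [Finset.sum_comm, Finset.mul_sum, ← Finset.sum_neg_distrib]
    refine Finset.sum_congr rfl fun i _ => ?_
    rw [← Finset.mul_sum]
    ring
  rw [e5]
  ring

end Reaction

/-! ### Lagrangian immersions and adapted frames -/

section KahlerSff

variable {E : Type*} [NormedAddCommGroup E] [NormedSpace ℝ E] [FiniteDimensional ℝ E]
  {W : Type*} [NormedAddCommGroup W] [NormedSpace ℝ W] [FiniteDimensional ℝ W]
  {G : W → W →L[ℝ] W →L[ℝ] ℝ} {J : W → W →L[ℝ] W} {f : E → W} {U : Set E} {V : Set W}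

/-- For a Lagrangian immersion `(u, v, w) ↦ G(∇df(u, v), J df w)` is totally symmetric. -/
theorem ImmInto.sff_kahler_symm (h : ImmInto G f U V) (hJ : KahlerOn G J V) {z : E} (hz : z ∈ U)
    (hα : ∀ᶠ y in 𝓝 z, ∀ v w, kform G J (f y) (fderiv ℝ f y v) (fderiv ℝ f y w) = 0) (u v w : E) :
    G (f z) (sff G f z u v) (J (f z) (fderiv ℝ f z w))
      = G (f z) (sff G f z u w) (J (f z) (fderiv ℝ f z v)) := by
  have hV := h.mapsTo hz
  have h3 := fun u : E =>
    (h.mapInto.differentiableAt_fderiv hz).hasFDerivAt.clm_apply (hasFDerivAt_const u z)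
  have h2 := (hJ.parallel.differentiableAt hV).hasFDerivAt.comp z
    (h.mapInto.differentiableAt hz).hasFDerivAt
  have h4 : HasFDerivAt (fun y => kform G J (f y) (fderiv ℝ f y v) (fderiv ℝ f y w)) _ z :=
    (h2.clm_apply (h3 v)).clm_apply (h3 w)
  have h5 : HasFDerivAt (fun y => kform G J (f y) (fderiv ℝ f y v) (fderiv ℝ f y w))
      (0 : E →L[ℝ] ℝ) z :=
    (hasFDerivAt_const (0 : ℝ) z).congr_of_eventuallyEq (by
      filter_upwards [hα] with y hy using hy v w)
  have h6 := congrArg (fun L : E →L[ℝ] ℝ => L u) (h4.unique h5)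
  have h7 : kform G J (f z) (hess (chr G) f z u v) (fderiv ℝ f z w)
      + kform G J (f z) (fderiv ℝ f z v) (hess (chr G) f z u w) = 0 := by
    refine Eq.trans ?_ h6
    rw [hess_apply, hess_apply]
    simp only [Function.comp_apply, map_add, add_apply, ContinuousLinearMap.coe_comp,
      ContinuousLinearMap.flip_apply, ContinuousLinearMap.comp_zero, zero_add,
      hJ.parallel.parallel _ hV]
    ring
  have h8 := fun a b => hα.self_of_nhds a b
  have h9 : ∀ a b, hess (chr G) f z a b = sff G f z a b + fderiv ℝ f z (chr (pull G f) z a b) :=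
    fun a b => by rw [sff_apply]; abel
  rw [h9, h9, map_add, add_apply, map_add, h8, h8, add_zero, add_zero, kform_apply, kform_apply,
    hJ.skew hV, (h.metric.inner _ hV).symm (J (f z) (fderiv ℝ f z v))] at h7
  linarith

end KahlerSff

section Frames

variable {n : ℕ} {E : Type*} [NormedAddCommGroup E] [NormedSpace ℝ E] [FiniteDimensional ℝ E]
  {B B' : E →L[ℝ] E →L[ℝ] ℝ} {J J' L : E →L[ℝ] E} {a : Fin (2 * n) → E} {lam : Fin (2 * n) → ℝ}

theorem apply_complex_frame (hsq : ∀ v, J (J v) = -v)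
    (hc : ∀ i : Fin (2 * n), Even (i : ℕ) → J (a i) = a (partner i)) (i : Fin (2 * n)) :
    J (a i) = (-1 : ℝ) ^ (i : ℕ) • a (partner i) := by
  by_cases h : Even (i : ℕ)
  · rw [hc i h, h.neg_one_pow, one_smul]
  · have h1 := hc (partner i) (even_partner.2 h)
    rw [partner_partner] at h1
    rw [← h1, hsq, (Nat.not_even_iff_odd.1 h).neg_one_pow, neg_one_smul]

/-- The image of an adapted frame under `L` is orthonormal up to the factors `lam i`. -/
theorem ortho_image (ho : Ortho B a) (hpos : ∀ i, 0 < lam i)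
    (hs : ∀ i v, B' (L (a i)) (L v) = lam i ^ 2 * B (a i) v) :
    Ortho B' fun i => (lam i)⁻¹ • L (a i) := by
  intro i j
  simp only [map_smul, smul_apply, smul_eq_mul, hs, ho i j]
  rcases eq_or_ne i j with rfl | h
  · have := (hpos i).ne'
    simp only [if_true]
    field_simp
  · simp [h]

/-- The complex structure `J'` in the image frame `L a_i`. -/
theorem apply_complex_image (hB' : IsInner B') (hcard : 2 * n = Module.finrank ℝ E)
    (ho : Ortho B a) (hsq : ∀ v, J (J v) = -v)
    (hc : ∀ i : Fin (2 * n), Even (i : ℕ) → J (a i) = a (partner i)) (hpos : ∀ i, 0 < lam i)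
    (hs : ∀ i v, B' (L (a i)) (L v) = lam i ^ 2 * B (a i) v)
    (hp : ∀ i, lam i * lam (partner i) = 1)
    (hl : ∀ u v, B' (J' (L u)) (L v) = B (J u) v) (i : Fin (2 * n)) :
    J' (L (a i)) = ((-1 : ℝ) ^ (i : ℕ) * lam i ^ 2) • L (a (partner i)) := by
  have hoi := ortho_image ho hpos hs
  have hex := fun w => hoi.expand (by simpa using hcard) w
  refine hB'.ext fun w => ?_
  rw [hex w]
  simp only [map_sum, map_smul]
  refine Finset.sum_congr rfl fun j _ => ?_
  congr 2
  rw [hl, apply_complex_frame hsq hc, map_smul, smul_apply, smul_apply, hs, ho]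
  rcases eq_or_ne (partner i) j with rfl | h
  · simp only [smul_eq_mul, if_true]
    linear_combination (-(-1) ^ (i : ℕ) * (lam i * lam (partner i) + 1)) * hp i
  · simp [h]

theorem inv_sqrt_partner (hpos : ∀ i, 0 < lam i) (hp : ∀ i, lam i * lam (partner i) = 1)
    (i : Fin (2 * n)) : (Real.sqrt (1 + lam i ^ 2))⁻¹
      = lam (partner i) * (Real.sqrt (1 + lam (partner i) ^ 2))⁻¹ := by
  have h1 : 1 + lam (partner i) ^ 2 = lam (partner i) ^ 2 * (1 + lam i ^ 2) := by
    linear_combination (-(1 + lam i * lam (partner i))) * hp i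
  have h2 := (hpos (partner i)).ne'
  rw [h1, Real.sqrt_mul (sq_nonneg _), Real.sqrt_sq (hpos _).le, mul_inv, ← mul_assoc,
    mul_inv_cancel₀ h2, one_mul]

end Frames

section CurvatureProduct

variable {E : Type*} [NormedAddCommGroup E] [NormedSpace ℝ E] [FiniteDimensional ℝ E]
  {H : Type*} [TopologicalSpace H] {I : ModelWithCorners ℝ E H} [I.Boundaryless]
  {M : Type*} [TopologicalSpace M] [ChartedSpace H M] [IsManifold I ∞ M]
  {E' : Type*} [NormedAddCommGroup E'] [NormedSpace ℝ E'] [FiniteDimensional ℝ E']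
  {H' : Type*} [TopologicalSpace H'] {I' : ModelWithCorners ℝ E' H'} [I'.Boundaryless]
  {N : Type*} [TopologicalSpace N] [ChartedSpace H' N] [IsManifold I' ∞ N]
  {g : BilinField I M} {g' : BilinField I' N}

theorem curv_chart_prod (hg : MetricField g) (hg' : MetricField g') (p : M × N) (u v w : E × E') :
    curv (chr (chartMetric (I.prod I') (prodMetric I I' g g') p)) (extChartAt (I.prod I') p p) u v w
      = (curv (chr (chartMetric I g p.1)) (extChartAt I p.1 p.1) u.1 v.1 w.1,
        curv (chr (chartMetric I' g' p.2)) (extChartAt I' p.2 p.2) u.2 v.2 w.2) := by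
  have hq := mem_extChartAt_target (I := I.prod I') p
  have he : chr (chartMetric (I.prod I') (prodMetric I I' g g') p)
      =ᶠ[𝓝 (extChartAt (I.prod I') p p)]
      chr (prodG (chartMetric I g p.1) (chartMetric I' g' p.2)) := by
    filter_upwards [(isOpen_extChartAt_target p).mem_nhds hq] with z hz
    exact chr_chartMetric_prod hz
  have h1 : curv (chr (chartMetric (I.prod I') (prodMetric I I' g g') p))
      (extChartAt (I.prod I') p p) u v w
      = curv (chr (prodG (chartMetric I g p.1) (chartMetric I' g' p.2)))
        (extChartAt (I.prod I') p p) u v w := by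
    rw [curv, curv, he.fderiv_eq, he.eq_of_nhds]
  rw [target_prod] at hq
  rw [h1, curv_prod (hg p.1) (hg' p.2) hq, chart_prod]

end CurvatureProduct

/-! ### The graph map -/

section AdaptedEvolution

variable {n : ℕ}
  {M : Type*} [TopologicalSpace M] [ChartedSpace (EuclideanSpace ℝ (Fin (2 * n))) M]
  [IsManifold (𝓡 (2 * n)) ∞ M]
  {M' : Type*} [TopologicalSpace M'] [ChartedSpace (EuclideanSpace ℝ (Fin (2 * n))) M']
  [IsManifold (𝓡 (2 * n)) ∞ M']
  {g : BilinField (𝓡 (2 * n)) M} {J : EndoField (𝓡 (2 * n)) M}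
  {g' : BilinField (𝓡 (2 * n)) M'} {J' : EndoField (𝓡 (2 * n)) M'}
  {F : M → M × M'} {x : M}

/-- The model space of the manifolds. -/
abbrev Model (n : ℕ) : Type := EuclideanSpace ℝ (Fin (2 * n))

/-- `graphDeriv` as an endomorphism of the model space. -/
def graphMap (F : M → M × M') (x : M) : Model n →L[ℝ] Model n := graphDeriv F x

/-- `invProj` as an endomorphism of the model space. -/
def projInv (F : M → M × M') (x : M) : Model n →L[ℝ] Model n := invProj F x

/-- The tangent space of `Σ_t` is the graph of `L`. -/
theorem dmap_projInv (hF : ContMDiff (𝓡 (2 * n)) ((𝓡 (2 * n)).prod (𝓡 (2 * n))) ∞ F)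
    (hx : IsGraphAt (n := n) F x) (v : Model n) :
    dmap (𝓡 (2 * n)) ((𝓡 (2 * n)).prod (𝓡 (2 * n))) F x (projInv F x v)
      = (v, graphMap F x v) := by
  have hinv : (dmap (𝓡 (2 * n)) (𝓡 (2 * n)) (fun y => (F y).1) x).IsInvertible := by
    let Le : Model n ≃ₗ[ℝ] Model n := LinearEquiv.ofBijective
      (dmap (𝓡 (2 * n)) (𝓡 (2 * n)) (fun y => (F y).1) x).toLinearMap
      ⟨hx, LinearMap.surjective_of_injective hx⟩
    exact ⟨Le.toContinuousLinearEquiv, by ext1 v; rfl⟩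
  refine Prod.ext ?_ ?_
  · rw [← dmap_fst hF]
    exact hinv.self_apply_inverse v
  · rw [← dmap_snd hF]
    rfl

/-- The Lagrangian condition for the image of `F` says that its graph map is symplectic. -/
theorem graphMap_symplectic (hF : ContMDiff (𝓡 (2 * n)) ((𝓡 (2 * n)).prod (𝓡 (2 * n))) ∞ F)
    (hx : IsGraphAt (n := n) F x)
    (hlag : ∀ u v : Model n, induced (𝓡 (2 * n)) ((𝓡 (2 * n)).prod (𝓡 (2 * n))) (kahlerField
      (prodMetric (𝓡 (2 * n)) (𝓡 (2 * n)) g g') (prodJ (𝓡 (2 * n)) (𝓡 (2 * n)) J J')) F x u v = 0)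
    (u v : Model n) :
    formAt g' (F x).2 (endoAt J' (F x).2 (graphMap F x u)) (graphMap F x v)
      = formAt g (F x).1 (endoAt J (F x).1 u) v := by
  have h1 : formAt g (F x).1 (endoAt J (F x).1
        (dmap (𝓡 (2 * n)) ((𝓡 (2 * n)).prod (𝓡 (2 * n))) F x (projInv F x u)).1)
        (dmap (𝓡 (2 * n)) ((𝓡 (2 * n)).prod (𝓡 (2 * n))) F x (projInv F x v)).1
      + formAt g' (F x).2 (-endoAt J' (F x).2
        (dmap (𝓡 (2 * n)) ((𝓡 (2 * n)).prod (𝓡 (2 * n))) F x (projInv F x u)).2)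
        (dmap (𝓡 (2 * n)) ((𝓡 (2 * n)).prod (𝓡 (2 * n))) F x (projInv F x v)).2 = 0 :=
    hlag (projInv F x u) (projInv F x v)
  rw [dmap_projInv hF hx, dmap_projInv hF hx, map_neg, neg_apply] at h1
  linarith

theorem isInner_formAt (hg : IsMetric g) (p : M) : IsInner (formAt g p) :=
  ⟨fun u v => hg.symm p u v, fun v hv => hg.pos p v hv⟩

theorem curvTensor_eq_formAt (hg : IsMetric g) (p : M) (a b c d : Model n) :
    curvTensor (𝓡 (2 * n)) g p a b c d = formAt g p
      (curv (chr (chartMetric (𝓡 (2 * n)) g p)) (extChartAt (𝓡 (2 * n)) p p) a b d) c :=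
  congrArg (fun w : Model n => formAt g p w c) (hg.metricField.riemann_eq p a b d)

end AdaptedEvolution

section AdaptedCoordinates

variable {n : ℕ} {E : Type*} [NormedAddCommGroup E] [NormedSpace ℝ E] [FiniteDimensional ℝ E]
  {B B' : E →L[ℝ] E →L[ℝ] ℝ} {J J' L : E →L[ℝ] E} {a : Fin (2 * n) → E} {lam : Fin (2 * n) → ℝ}

/-- The lifts of an adapted frame to the graph of `L` are orthonormal. -/
theorem ortho_graph (ho : Ortho B a)
    (hs : ∀ i v, B' (L (a i)) (L v) = lam i ^ 2 * B (a i) v) (i j : Fin (2 * n)) :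
    B ((Real.sqrt (1 + lam i ^ 2))⁻¹ • a i) ((Real.sqrt (1 + lam j ^ 2))⁻¹ • a j)
      + B' ((Real.sqrt (1 + lam i ^ 2))⁻¹ • L (a i)) ((Real.sqrt (1 + lam j ^ 2))⁻¹ • L (a j))
      = if i = j then 1 else 0 := by
  simp only [map_smul, smul_apply, smul_eq_mul, hs, ho i j]
  rcases eq_or_ne i j with rfl | h
  · have h1 : (0 : ℝ) < 1 + lam i ^ 2 := by positivity
    have h2 := Real.sq_sqrt h1.le
    have h3 := (Real.sqrt_pos.2 h1).ne'
    simp only [if_true]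
    field_simp
    linarith
  · simp [h]

/-- The curvature of the product in the directions of the lifted frame, in terms of the curvatures
of the factors. -/
theorem curv_graph_term (Γ Γ' : E → E →L[ℝ] E →L[ℝ] E) (q q' : E)
    (hsq : ∀ v, J (J v) = -v) (hc : ∀ i : Fin (2 * n), Even (i : ℕ) → J (a i) = a (partner i))
    (hpos : ∀ i, 0 < lam i) (hp : ∀ i, lam i * lam (partner i) = 1)
    (hJ' : ∀ i : Fin (2 * n), J' (L (a i)) = ((-1 : ℝ) ^ (i : ℕ) * lam i ^ 2) • L (a (partner i)))
    (k i : Fin (2 * n)) {c : Fin (2 * n) → ℝ} (hcc : ∀ i, c i = (Real.sqrt (1 + lam i ^ 2))⁻¹) :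
    (-1) ^ (i : ℕ) * lam i *
      (B (curv Γ q (c k • a k) (c i • a i) (c k • a k)) (J (c (partner i) • a (partner i)))
        + B' (curv Γ' q' (c k • L (a k)) (c i • L (a i)) (c k • L (a k)))
          (-J' (c (partner i) • L (a (partner i)))))
      = lam i / ((1 + lam k ^ 2) * (lam i + lam (partner i))) *
        (B (curv Γ q (a i) (a k) (a k)) (a i) - lam k ^ 2 *
          B' (curv Γ' q' ((lam i)⁻¹ • L (a i)) ((lam k)⁻¹ • L (a k)) ((lam k)⁻¹ • L (a k)))
            ((lam i)⁻¹ • L (a i))) := by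
  have h1 : c (partner i) = lam i * c i := by
    rw [hcc, hcc, inv_sqrt_partner hpos hp, partner_partner]
  have hcs : ∀ j, c j ^ 2 = (1 + lam j ^ 2)⁻¹ := fun j => by
    rw [hcc, inv_pow, Real.sq_sqrt (by positivity)]
  have hm : ((-1 : ℝ) ^ (i : ℕ)) ^ 2 = 1 := by rw [← pow_mul, mul_comm, pow_mul]; simp
  simp only [← curvL_apply, map_smul, smul_apply, LinearMap.smul_apply, smul_eq_mul, map_neg,
    apply_complex_frame hsq hc (partner i), hJ' (partner i), partner_partner, neg_one_pow_partner,
    h1]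
  simp only [curvL_apply]
  rw [curv_antisymm Γ q (a i), curv_antisymm Γ' q' (L (a i))]
  simp only [map_neg, neg_apply]
  have hi := (hpos i).ne'
  have hk := (hpos k).ne'
  have hpi : lam (partner i) = (lam i)⁻¹ := eq_inv_of_mul_eq_one_right (hp i)
  rw [hpi]
  generalize B (curv Γ q (a k) (a i) (a k)) (a i) = X
  generalize B' (curv Γ' q' (L (a k)) (L (a i)) (L (a k))) (L (a i)) = Y
  have e1 : lam i / ((1 + lam k ^ 2) * (lam i + (lam i)⁻¹)) = lam i ^ 2 * c i ^ 2 * c k ^ 2 := by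
    rw [hcs, hcs]
    have := hpos i
    field_simp
    ring
  rw [e1]
  generalize (-1 : ℝ) ^ (i : ℕ) = m at hm
  field_simp
  linear_combination (-c k ^ 2 * c i ^ 2 * lam i ^ 2 * X + c k ^ 2 * c i ^ 2 * Y) * hm

end AdaptedCoordinates

section AdaptedCoordinates

variable {n : ℕ} {E : Type*} [NormedAddCommGroup E] [NormedSpace ℝ E] [FiniteDimensional ℝ E]
  {D : Type*} [NormedAddCommGroup D] [NormedSpace ℝ D] [FiniteDimensional ℝ D]
  {B B' : E →L[ℝ] E →L[ℝ] ℝ} {J J' L : E →L[ℝ] E} {a : Fin (2 * n) → E} {lam : Fin (2 * n) → ℝ}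
  {G : E × E → E × E →L[ℝ] E × E →L[ℝ] ℝ} {K : E × E → E × E →L[ℝ] E × E}
  {f : D → E × E} {U : Set D} {V : Set (E × E)} {z : D} {e : Fin (2 * n) → D}
  {Γ Γ' : E → E →L[ℝ] E →L[ℝ] E} {q q' : E}

/-- The reaction term of a Lagrangian immersion whose tangent space is the graph of `L`, in an
adapted frame; `K` is the complex structure of the ambient space, and `K ∘ df ∘ e` the frame of the
normal space. -/
theorem reactionTerm_adapted (him : ImmInto G f U V) (hK : KahlerOn G K V) (hz : z ∈ U)
    (hα : ∀ᶠ y in 𝓝 z, ∀ v w, kform G K (f y) (fderiv ℝ f y v) (fderiv ℝ f y w) = 0)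
    (hcard : 2 * n = Module.finrank ℝ E) (hB' : IsInner B')
    (hG : ∀ u v, G (f z) u v = B u.1 v.1 + B' u.2 v.2)
    (hKz : ∀ v, K (f z) v = (J v.1, -J' v.2))
    (hR : ∀ u v w, curv (chr G) (f z) u v w
      = (curv Γ q u.1 v.1 w.1, curv Γ' q' u.2 v.2 w.2))
    (he : ∀ i, fderiv ℝ f z (e i) = ((Real.sqrt (1 + lam i ^ 2))⁻¹ • a i,
      (Real.sqrt (1 + lam i ^ 2))⁻¹ • L (a i)))
    (hsq : ∀ v, J (J v) = -v) (hl : ∀ u v, B' (J' (L u)) (L v) = B (J u) v)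
    (ho : Ortho B a) (hc : ∀ i : Fin (2 * n), Even (i : ℕ) → J (a i) = a (partner i))
    (hpos : ∀ i, 0 < lam i) (hs : ∀ i v, B' (L (a i)) (L v) = lam i ^ 2 * B (a i) v)
    (hp : ∀ i, lam i * lam (partner i) = 1)
    {Θ₀ : (E × E) [⋀^Fin (2 * n)]→ₗ[ℝ] ℝ} {Φ : E [⋀^Fin (2 * n)]→ₗ[ℝ] ℝ}
    (hΘ : ∀ v, Θ₀ v = Φ fun i => (v i).1)
    {ν : Fin (2 * n) → E × E} (hν : ∀ l, ν l = K (f z) (fderiv ℝ f z (e l))) :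
    Ortho (pull G f z) e ∧ Ortho (G (f z)) ν ∧ (∀ v l, G (f z) (fderiv ℝ f z v) (ν l) = 0) ∧
    reactionTerm G Θ₀ f z e ν = Θ₀ (fun j => fderiv ℝ f z (e j)) *
      (quadForm lam (fun i j k => G (f z) (sff G f z (e i) (e j)) (ν k)) +
        ∑ k, ∑ i : Fin (2 * n) with i ≠ k, lam i / ((1 + lam k ^ 2) * (lam i + lam (partner i))) *
          (B (curv Γ q (a i) (a k) (a k)) (a i) - lam k ^ 2 *
            B' (curv Γ' q' ((lam i)⁻¹ • L (a i)) ((lam k)⁻¹ • L (a k)) ((lam k)⁻¹ • L (a k)))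
              ((lam i)⁻¹ • L (a i)))) := by
  have hV := him.mapsTo hz
  have hBG := him.metric.inner _ hV
  have hoe : Ortho (pull G f z) e := fun i j => by
    rw [pull_apply, hG, he, he]
    exact ortho_graph ho hs i j
  have hoν : Ortho (G (f z)) ν := fun i j => by
    rw [hν, hν, hK.compat _ hV]
    exact hoe i j
  have hn : ∀ v l, G (f z) (fderiv ℝ f z v) (ν l) = 0 := fun v l => by
    rw [hBG.symm, hν]
    exact hα.self_of_nhds _ _
  have hJ' := apply_complex_image hB' hcard ho hsq hc hpos hs hp hl
  refine ⟨hoe, hoν, hn, ?_⟩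
  have hse : Ortho (G (f z)) fun i => fderiv ℝ f z (e i) := fun i j => hoe i j
  have hall := hse.sum_elim hBG hoν fun i j => hn _ j
  have hS : ∀ k i, sff G f z (e k) (e i)
      = ∑ p, G (f z) (sff G f z (e k) (e i)) (ν p) • ν p := fun k i => by
    have h := hall.expand (by
      rw [Fintype.card_sum, Fintype.card_fin, Module.finrank_prod, ← hcard])
      (sff G f z (e k) (e i))
    rw [Fintype.sum_sum_type] at h
    simpa only [Sum.elim_inl, Sum.elim_inr, him.sff_normal hz, zero_smul,
      Finset.sum_const_zero, zero_add] using h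
  have hπ : ∀ l, (ν l).1
      = ((-1) ^ (l : ℕ) * lam (partner l)) • (fderiv ℝ f z (e (partner l))).1 := fun l => by
    rw [hν, hKz, he, he]
    change J _ = _ • _ • _
    rw [map_smul, apply_complex_frame hsq hc, inv_sqrt_partner hpos hp, smul_smul, smul_smul]
    congr 1
    ring
  rw [reactionTerm_eq hΘ hoν hp hπ hS
    (fun i j k => by rw [him.sff_symm hz])
    (fun i j k => by rw [hν, hν]; exact him.sff_kahler_symm hK hz hα _ _ _)]
  congr 2
  refine Finset.sum_congr rfl fun k _ => ?_
  rw [Finset.sum_filter]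
  refine Finset.sum_congr rfl fun i _ => ?_
  have h1 := curv_graph_term (B := B) (B' := B') Γ Γ' q q' hsq hc hpos hp hJ' k i (fun _ => rfl)
  split_ifs with hik
  · rw [← h1, hR, hν, hKz, hG, he, he, he]
  · obtain rfl : i = k := not_not.1 hik
    rw [hR]
    have h0 : ∀ (Γ : E → E →L[ℝ] E →L[ℝ] E) (q u w : E), curv Γ q u u w = 0 := fun Γ q u w => by
      rw [curv, sub_self, zero_add, sub_self]
    rw [h0, h0, hG]
    simp

end AdaptedCoordinates

/-! ### The evolution of `*Ω` in an adapted frame -/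

section AdaptedEvolution

variable {n : ℕ}
  {M : Type*} [TopologicalSpace M] [ChartedSpace (EuclideanSpace ℝ (Fin (2 * n))) M]
  [IsManifold (𝓡 (2 * n)) ∞ M]
  {M' : Type*} [TopologicalSpace M'] [ChartedSpace (EuclideanSpace ℝ (Fin (2 * n))) M']
  [IsManifold (𝓡 (2 * n)) ∞ M']
  {g : BilinField (𝓡 (2 * n)) M} {J : EndoField (𝓡 (2 * n)) M}
  {g' : BilinField (𝓡 (2 * n)) M'} {J' : EndoField (𝓡 (2 * n)) M'}

/-- The Lagrangian condition in the charts centred at `x` and `F x`. -/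
theorem kform_written_eq_zero {F : M → M × M'}
    (hF : ContMDiff (𝓡 (2 * n)) ((𝓡 (2 * n)).prod (𝓡 (2 * n))) ∞ F)
    (hlag : ∀ y (u v : Model n), induced (𝓡 (2 * n)) ((𝓡 (2 * n)).prod (𝓡 (2 * n))) (kahlerField
      (prodMetric (𝓡 (2 * n)) (𝓡 (2 * n)) g g') (prodJ (𝓡 (2 * n)) (𝓡 (2 * n)) J J')) F y u v = 0)
    {x : M} {z : Model n}
    (hz : z ∈ writtenDom (𝓡 (2 * n)) ((𝓡 (2 * n)).prod (𝓡 (2 * n))) x (F x) F) (v w : Model n) :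
    kform (chartMetric ((𝓡 (2 * n)).prod (𝓡 (2 * n)))
        (prodMetric (𝓡 (2 * n)) (𝓡 (2 * n)) g g') (F x))
      (chartEndo ((𝓡 (2 * n)).prod (𝓡 (2 * n))) (prodJ (𝓡 (2 * n)) (𝓡 (2 * n)) J J') (F x))
      (written (𝓡 (2 * n)) ((𝓡 (2 * n)).prod (𝓡 (2 * n))) x (F x) F z)
      (fderiv ℝ (written (𝓡 (2 * n)) ((𝓡 (2 * n)).prod (𝓡 (2 * n))) x (F x) F) z v)
      (fderiv ℝ (written (𝓡 (2 * n)) ((𝓡 (2 * n)).prod (𝓡 (2 * n))) x (F x) F) z w) = 0 := by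
  have h1 : written (𝓡 (2 * n)) ((𝓡 (2 * n)).prod (𝓡 (2 * n))) x (F x) F z
      ∈ (extChartAt ((𝓡 (2 * n)).prod (𝓡 (2 * n))) (F x)).target :=
    (extChartAt ((𝓡 (2 * n)).prod (𝓡 (2 * n))) (F x)).map_source hz.2
  rw [kform_chart_eq h1, ← pull_apply, pull_written hF hz, chartMetric_apply]
  exact hlag _ _ _

/-- The evolution equation of `*Ω` in an adapted frame. -/
theorem evolution_adapted (hK : IsKahler (𝓡 (2 * n)) g J) (hK' : IsKahler (𝓡 (2 * n)) g' J')
    (hg : IsMetric g) (hg' : IsMetric g') {T : ℝ} {F : ℝ → M → M × M'}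
    (hF : IsMeanCurvatureFlow (𝓡 (2 * n)) ((𝓡 (2 * n)).prod (𝓡 (2 * n)))
      (prodMetric (𝓡 (2 * n)) (𝓡 (2 * n)) g g') T F) {t : ℝ} (ht : t ∈ Ico 0 T)
    (hlag : ∀ y (u v : Model n), induced (𝓡 (2 * n)) ((𝓡 (2 * n)).prod (𝓡 (2 * n))) (kahlerField
      (prodMetric (𝓡 (2 * n)) (𝓡 (2 * n)) g g') (prodJ (𝓡 (2 * n)) (𝓡 (2 * n)) J J')) (F t) y u v
        = 0)
    {x : M} (hx : IsGraphAt (n := n) (F t) x)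
    {a : Fin (2 * n) → TangentSpace (𝓡 (2 * n)) (F t x).1} {lam : Fin (2 * n) → ℝ}
    (ha : IsAdaptedFrame g J g' (graphDeriv (F t) x) a lam) :
    HasDerivWithinAt (fun s => starOmega g J g' (F s) x)
      (laplacianStarOmega g J g' (F t) x + starOmega g J g' (F t) x *
        (quadForm lam (hCoeff g J g' J' (F t) x a lam)
          + curvTerm g g' (graphDeriv (F t) x) a lam)) (Ico 0 T) t := by
  have hFt := hF.contMDiff ht
  have hi := hF.immersion t ht
  have hMF := hg.metricField.prod hg'.metricField
  obtain ⟨G, hG⟩ : ∃ G, G = chartMetric ((𝓡 (2 * n)).prod (𝓡 (2 * n)))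
      (prodMetric (𝓡 (2 * n)) (𝓡 (2 * n)) g g') (F t x) := ⟨_, rfl⟩
  obtain ⟨K, hKd⟩ : ∃ K, K = chartEndo ((𝓡 (2 * n)).prod (𝓡 (2 * n)))
      (prodJ (𝓡 (2 * n)) (𝓡 (2 * n)) J J') (F t x) := ⟨_, rfl⟩
  obtain ⟨f, hf⟩ : ∃ f, f = written (𝓡 (2 * n)) ((𝓡 (2 * n)).prod (𝓡 (2 * n))) x (F t x) (F t) :=
    ⟨_, rfl⟩
  obtain ⟨z, hz⟩ : ∃ z, z = extChartAt (𝓡 (2 * n)) x x := ⟨_, rfl⟩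
  obtain ⟨Φ, hΦ⟩ : ∃ Φ, Φ = topForm n (formAt (kahlerField g J) (F t x).1) := ⟨_, rfl⟩
  obtain ⟨Θ, hΘ⟩ : ∃ Θ : (Model n × Model n) [⋀^Fin (2 * n)]→ₗ[ℝ] ℝ,
    Θ = volFst n (formAt (kahlerField g J) (F t x).1) := ⟨_, rfl⟩
  let e : Fin (2 * n) → Model n := tangentFrame (F t) x a lam
  let b : Fin (2 * n) → Model n := a
  have hfz : f z = extChartAt ((𝓡 (2 * n)).prod (𝓡 (2 * n))) (F t x) (F t x) := by
    rw [hf, hz]; exact written_self x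
  have hdf : fderiv ℝ f z = dmap (𝓡 (2 * n)) ((𝓡 (2 * n)).prod (𝓡 (2 * n))) (F t) x := by
    rw [hf, hz]; exact fderiv_written_self hFt x
  have hzU : z ∈ writtenDom (𝓡 (2 * n)) ((𝓡 (2 * n)).prod (𝓡 (2 * n))) x (F t x) (F t) := by
    rw [hz]; exact mem_writtenDom_self x
  have him : ImmInto G f (writtenDom (𝓡 (2 * n)) ((𝓡 (2 * n)).prod (𝓡 (2 * n))) x (F t x) (F t))
      (extChartAt ((𝓡 (2 * n)).prod (𝓡 (2 * n))) (F t x)).target := by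
    rw [hG, hf]; exact immInto_written hMF hFt hi x (F t x)
  have hKo : KahlerOn G K (extChartAt ((𝓡 (2 * n)).prod (𝓡 (2 * n))) (F t x)).target := by
    rw [hG, hKd]; exact kahlerOn_prod hg hg' hK hK' (F t x)
  have hα : ∀ᶠ y in 𝓝 z, ∀ v w, kform G K (f y) (fderiv ℝ f y v) (fderiv ℝ f y w) = 0 := by
    filter_upwards [him.openU.mem_nhds hzU] with y hy v w
    rw [hG, hKd, hf]
    exact kform_written_eq_zero hFt hlag hy v w
  have hGz : G (f z) = formAt (prodMetric (𝓡 (2 * n)) (𝓡 (2 * n)) g g') (F t x) := by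
    rw [hfz, hG]; exact chartMetric_self ((𝓡 (2 * n)).prod (𝓡 (2 * n))) _ _
  have hKz : K (f z) = endoAt (prodJ (𝓡 (2 * n)) (𝓡 (2 * n)) J J') (F t x) := by
    rw [hfz, hKd]; exact chartEndo_self ((𝓡 (2 * n)).prod (𝓡 (2 * n))) _ _
  have hR : ∀ u v w, curv (chr G) (f z) u v w
      = (curv (chr (chartMetric (𝓡 (2 * n)) g (F t x).1)) (extChartAt (𝓡 (2 * n)) _ (F t x).1)
          u.1 v.1 w.1,
        curv (chr (chartMetric (𝓡 (2 * n)) g' (F t x).2)) (extChartAt (𝓡 (2 * n)) _ (F t x).2)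
          u.2 v.2 w.2) := fun u v w => by
    rw [hfz, hG]; exact curv_chart_prod hg.metricField hg'.metricField (F t x) u v w
  have he : ∀ i, fderiv ℝ f z (e i) = ((Real.sqrt (1 + lam i ^ 2))⁻¹ • b i,
      (Real.sqrt (1 + lam i ^ 2))⁻¹ • graphMap (F t) x (b i)) := fun i => by
    rw [hdf]
    refine (map_smul (dmap (𝓡 (2 * n)) ((𝓡 (2 * n)).prod (𝓡 (2 * n))) (F t) x)
      (Real.sqrt (1 + lam i ^ 2))⁻¹ (projInv (F t) x (b i))).trans ?_
    rw [dmap_projInv hFt hx]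
    rfl
  obtain ⟨h1, h2, h3, h4⟩ := reactionTerm_adapted (B := formAt g (F t x).1)
    (B' := formAt g' (F t x).2) (J := endoAt J (F t x).1) (J' := endoAt J' (F t x).2)
    (L := graphMap (F t) x) (a := b) (lam := lam) (e := e) (Θ₀ := Θ) (Φ := Φ)
    (ν := fun l => K (f z) (fderiv ℝ f z (e l))) him hKo hzU hα (by simp)
    (isInner_formAt hg' _) (fun u v => by rw [hGz]; rfl) (fun v => by rw [hKz]; rfl) hR he
    (hK.sq _) (graphMap_symplectic hFt hx (hlag x)) ha.orthonormal ha.complex ha.pos ha.singular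
    ha.paired (fun v => by rw [hΘ, hΦ]; exact volFst_apply _ _) (fun l => rfl)
  obtain ⟨σ, h5, h6⟩ := evolution_starOmega hK hg hg' hF ht x hG hf hz hΘ h1 h2 h3
  rw [h4, ← mul_assoc, ← h5] at h6
  have h7 : (fun i j k => G (f z) (sff G f z (e i) (e j)) (K (f z) (fderiv ℝ f z (e k))))
      = hCoeff g J g' J' (F t) x a lam := by
    funext i j k
    rw [hGz, hKz, hdf, hG, hf, hz]
    exact congrArg (fun s => formAt (prodMetric (𝓡 (2 * n)) (𝓡 (2 * n)) g g') (F t x) s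
      (endoAt (prodJ (𝓡 (2 * n)) (𝓡 (2 * n)) J J') (F t x)
        (dmap (𝓡 (2 * n)) ((𝓡 (2 * n)).prod (𝓡 (2 * n))) (F t) x (e k))))
      (secondFund_eq hMF hFt hi x (e i) (e j)).symm
  rw [h7] at h6
  refine h6.congr_deriv ?_
  congr 3
  rw [curvTerm]
  refine Finset.sum_congr rfl fun k _ => Finset.sum_congr rfl fun i _ => ?_
  congr 2
  · exact (curvTensor_eq_formAt hg (F t x).1 (b i) (b k) (b i) (b k)).symm
  · exact congrArg (lam k ^ 2 * ·) (curvTensor_eq_formAt hg' (F t x).2 _ _ _ _).symm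

end AdaptedEvolution

/-! ### Existence of adapted frames -/

section AdaptedFrame

variable {E : Type*} [NormedAddCommGroup E] [NormedSpace ℝ E] [FiniteDimensional ℝ E]
  {B Q : E →L[ℝ] E →L[ℝ] ℝ} {ι : Type*} [Fintype ι] [DecidableEq ι]

/-- A symmetric form `Q` has an eigenvector with respect to `B` orthogonal to given ones. -/
theorem exists_eigenvector (hB : IsInner B) (hQ : ∀ u v, Q u v = Q v u) {e : ι → E}
    (he : Ortho B e) {μ : ι → ℝ} (hμ : ∀ i v, Q (e i) v = μ i * B (e i) v)
    (hcard : Fintype.card ι < Module.finrank ℝ E) :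
    ∃ w c, B w w = 1 ∧ (∀ i, B w (e i) = 0) ∧ ∀ v, Q w v = c * B w v := by
  obtain ⟨k, hk⟩ := Nat.exists_eq_add_of_lt hcard
  obtain ⟨ν, h1, h2⟩ := exists_ortho_extend hB e (k + 1) (by omega)
  have hA : (Matrix.of fun i j => Q (ν i) (ν j)).IsHermitian := by
    ext i j
    simp [hQ (ν i)]
  let v := hA.eigenvectorBasis 0
  have hv := hA.mulVec_eigenvectorBasis 0
  have hw : ∀ j, B (∑ i, v i • ν i) (ν j) = v j := fun j => h1.apply_sum _ j
  have hwe : ∀ i, B (∑ i, v i • ν i) (e i) = 0 := fun i => by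
    simp [map_sum, sum_apply, hB.symm _ (e i), h2]
  have hq : ∀ j, Q (∑ i, v i • ν i) (ν j) = hA.eigenvalues 0 * v j := fun j => by
    have h5 := congrFun hv j
    simp only [Matrix.mulVec, dotProduct, Matrix.of_apply, Pi.smul_apply, smul_eq_mul] at h5
    rw [← h5, map_sum, sum_apply]
    refine Finset.sum_congr rfl fun i _ => ?_
    rw [map_smul, smul_apply, smul_eq_mul, mul_comm, hQ]
  have hn : B (∑ i, v i • ν i) (∑ i, v i • ν i) = 1 := by
    rw [map_sum]
    simp only [map_smul, hw, smul_eq_mul]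
    have h3 := hA.eigenvectorBasis.orthonormal.1 0
    rw [EuclideanSpace.norm_eq, Real.sqrt_eq_one] at h3
    simpa [sq] using h3
  generalize (∑ i, v i • ν i) = w at hw hwe hq hn
  refine ⟨w, hA.eigenvalues 0, hn, hwe, fun u => ?_⟩
  rw [(he.sum_elim hB h1 h2).expand (by
    rw [Fintype.card_sum, Fintype.card_fin]; omega) u, Fintype.sum_sum_type]
  simp only [Sum.elim_inl, Sum.elim_inr, map_add, map_sum, map_smul, smul_eq_mul, hwe, hw, hq,
    hQ w (e _), hμ, hB.symm (e _) w, mul_add, Finset.mul_sum]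
  congr 1
  · exact Finset.sum_congr rfl fun i _ => by ring
  · exact Finset.sum_congr rfl fun i _ => by ring

variable {B' : E →L[ℝ] E →L[ℝ] ℝ} {J J' L : E →L[ℝ] E}

/-- If `L` is symplectic, `J` exchanges the singular vectors of `L` for the singular values `s` and
`s⁻¹`. -/
theorem singular_complex (hB' : IsInner B') (hsq : ∀ v, J (J v) = -v)
    (hco : ∀ u v, B (J u) (J v) = B u v) (hco' : ∀ u v, B' (J' u) (J' v) = B' u v)
    (hsq' : ∀ v, J' (J' v) = -v)
    (hL : Function.Surjective L) (hl : ∀ u v, B' (J' (L u)) (L v) = B (J u) v) {a : E} {s : ℝ}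
    (hs : s ≠ 0) (ha : ∀ v, B' (L a) (L v) = s ^ 2 * B a v) (v : E) :
    B' (L (J a)) (L v) = (s⁻¹) ^ 2 * B (J a) v := by
  have h1 : L (J a) = (s⁻¹) ^ 2 • J' (L a) := by
    refine hB'.ext fun w => ?_
    obtain ⟨u, hu⟩ := hL (-J' w)
    have hw : J' (L u) = w := by rw [hu, map_neg, hsq', neg_neg]
    rw [← hw, hB'.symm, hl, hco, map_smul, smul_apply, hco', ha, smul_eq_mul]
    have h2 : B u a = B a u := by
      rw [← hco u a, ← hl, hB'.symm]
      have h3 : B' (L (J a)) (J' (L u)) = -B' (J' (L (J a))) (L u) := by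
        rw [← hco' (L (J a)), hsq', map_neg]
      rw [h3, hl, hsq, map_neg, neg_apply, neg_neg]
    rw [h2]
    field_simp
  rw [h1, map_smul, smul_apply, hl, smul_eq_mul]

theorem symplectic_injective (hB : IsInner B) (hsq : ∀ v, J (J v) = -v)
    (hl : ∀ u v, B' (J' (L u)) (L v) = B (J u) v) : Function.Injective L := by
  refine (injective_iff_map_eq_zero L).2 fun u hu => ?_
  have h1 : J u = 0 := hB.eq_zero fun v => by rw [← hl, hu, map_zero, map_zero, zero_apply]
  rw [← neg_neg u, ← hsq u, h1, map_zero, neg_zero]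

/-- Half of a unitary basis of singular vectors, by induction: an eigenvector of the pulled-back
form orthogonal to the previous vectors and their images under `J` is split off together with its
image under `J`. -/
theorem exists_singular_vectors (hB : IsInner B) (hB' : IsInner B') (hsq : ∀ v, J (J v) = -v)
    (hco : ∀ u v, B (J u) (J v) = B u v) (hco' : ∀ u v, B' (J' u) (J' v) = B' u v)
    (hsq' : ∀ v, J' (J' v) = -v) (hl : ∀ u v, B' (J' (L u)) (L v) = B (J u) v) (k : ℕ)
    (hk : 2 * k ≤ Module.finrank ℝ E) :
    ∃ (c : Fin k → E) (s : Fin k → ℝ), Ortho B (Sum.elim c fun i => J (c i)) ∧ (∀ i, 0 < s i) ∧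
      ∀ i v, B' (L (c i)) (L v) = s i ^ 2 * B (c i) v := by
  have hinj := symplectic_injective hB hsq hl
  have hsur : Function.Surjective L :=
    LinearMap.surjective_of_injective (f := L.toLinearMap) hinj
  have hskew : ∀ u v, B (J u) v = -B u (J v) := fun u v => by
    rw [← hco u, hsq, map_neg, neg_neg]
  have hself : ∀ u, B u (J u) = 0 := fun u => by
    have := hskew u u
    rw [hB.symm] at this
    linarith
  induction k with
  | zero =>
    exact ⟨Fin.elim0, Fin.elim0, by rintro (i | i) <;> exact i.elim0, fun i => i.elim0,
      fun i => i.elim0⟩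
  | succ k ih =>
    obtain ⟨c, s, h1, h2, h3⟩ := ih (by omega)
    obtain ⟨w, μ, hw, hwe, hwv⟩ := exists_eigenvector (Q := B'.bilinearComp L L)
      (μ := Sum.elim (fun i => s i ^ 2) fun i => ((s i)⁻¹) ^ 2) hB
      (fun u v => hB'.symm _ _) h1 (by
        rintro (i | i) v
        · exact h3 i v
        · exact singular_complex hB' hsq hco hco' hsq' hsur hl (h2 i).ne' (h3 i) v)
      (by simp only [Fintype.card_sum, Fintype.card_fin]; omega)
    have hwc : ∀ i, B w (c i) = 0 := fun i => hwe (Sum.inl i)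
    have hwJ : ∀ i, B w (J (c i)) = 0 := fun i => hwe (Sum.inr i)
    have hμ : 0 < μ := by
      have h4 := hwv w
      rw [hw, mul_one] at h4
      rw [← h4]
      refine hB'.pos _ fun h0 => ?_
      have h5 : w = 0 := hinj (h0.trans (map_zero L).symm)
      simp [h5] at hw
    have hn : Ortho B (Fin.cons w c : Fin (k + 1) → E) := by
      refine Fin.cases (Fin.cases ?_ fun j => ?_) fun i => Fin.cases ?_ fun j => ?_
      · simp [hw]
      · simp [hwc, (Fin.succ_ne_zero j).symm]
      · simp [hB.symm (c i), hwc]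
      · simpa using h1 (Sum.inl i) (Sum.inl j)
    refine ⟨Fin.cons w c, Fin.cons (Real.sqrt μ) s, hn.sum_elim hB (fun i j => ?_) ?_, ?_, ?_⟩
    · rw [hco]; exact hn i j
    · refine Fin.cases (Fin.cases ?_ fun j => ?_) fun i => Fin.cases ?_ fun j => ?_
      · simp [hself]
      · simp [hwJ]
      · simp only [Fin.cons_succ, Fin.cons_zero]
        rw [hB.symm, hskew, hwJ, neg_zero]
      · simpa using h1 (Sum.inl i) (Sum.inr j)
    · exact Fin.cases (Real.sqrt_pos.2 hμ) h2
    · refine Fin.cases (fun v => ?_) h3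
      simp only [Fin.cons_zero]
      rw [Real.sq_sqrt hμ.le]
      exact hwv v

end AdaptedFrame

section AdaptedFrame

variable {n : ℕ} {E : Type*} [NormedAddCommGroup E] [NormedSpace ℝ E] [FiniteDimensional ℝ E]
  {B B' : E →L[ℝ] E →L[ℝ] ℝ} {J J' L : E →L[ℝ] E}

theorem partner_evenIdx (k : Fin n) : partner (evenIdx k) = oddIdx k := by
  ext
  rw [partner_of_even (by simp [evenIdx])]
  rfl

theorem partner_oddIdx (k : Fin n) : partner (oddIdx k) = evenIdx k := by
  rw [← partner_evenIdx, partner_partner]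

/-- A function on `Fin (2 * n)` with prescribed values at the even and at the odd indices. -/
def interleave {A : Type*} (c d : Fin n → A) (i : Fin (2 * n)) : A :=
  if Even (i : ℕ) then c ⟨i / 2, by omega⟩ else d ⟨i / 2, by omega⟩

theorem interleave_evenIdx {A : Type*} (c d : Fin n → A) (k : Fin n) :
    interleave c d (evenIdx k) = c k := by
  simp [interleave, evenIdx]

theorem interleave_oddIdx {A : Type*} (c d : Fin n → A) (k : Fin n) :
    interleave c d (oddIdx k) = d k := by
  have h : (2 * (k : ℕ) + 1) / 2 = k := by omega
  simp [interleave, oddIdx, h]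

theorem exists_adapted (hB : IsInner B) (hB' : IsInner B') (hsq : ∀ v, J (J v) = -v)
    (hco : ∀ u v, B (J u) (J v) = B u v) (hco' : ∀ u v, B' (J' u) (J' v) = B' u v)
    (hsq' : ∀ v, J' (J' v) = -v) (hl : ∀ u v, B' (J' (L u)) (L v) = B (J u) v)
    (hcard : 2 * n = Module.finrank ℝ E) :
    ∃ (a : Fin (2 * n) → E) (lam : Fin (2 * n) → ℝ), Ortho B a ∧
      (∀ i : Fin (2 * n), Even (i : ℕ) → J (a i) = a (partner i)) ∧ (∀ i, 0 < lam i) ∧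
      (∀ i v, B' (L (a i)) (L v) = lam i ^ 2 * B (a i) v) ∧ ∀ i, lam i * lam (partner i) = 1 := by
  obtain ⟨c, s, h1, h2, h3⟩ := exists_singular_vectors hB hB' hsq hco hco' hsq' hl n hcard.le
  have hinj := symplectic_injective hB hsq hl
  have hsur : Function.Surjective L :=
    LinearMap.surjective_of_injective (f := L.toLinearMap) hinj
  refine ⟨interleave c fun i => J (c i), interleave s fun i => (s i)⁻¹, fun i j => ?_,
    fun i hi => ?_, fun i => ?_, fun i v => ?_, fun i => ?_⟩
  · obtain ⟨k, rfl | rfl⟩ := evenIdx_or_oddIdx i <;>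
    obtain ⟨l, rfl | rfl⟩ := evenIdx_or_oddIdx j <;>
      simp only [interleave_evenIdx, interleave_oddIdx]
    · simpa [evenIdx_injective.eq_iff] using h1 (Sum.inl k) (Sum.inl l)
    · simpa [evenIdx_ne_oddIdx] using h1 (Sum.inl k) (Sum.inr l)
    · simpa [(evenIdx_ne_oddIdx _ _).symm] using h1 (Sum.inr k) (Sum.inl l)
    · simpa [oddIdx_injective.eq_iff] using h1 (Sum.inr k) (Sum.inr l)
  · obtain ⟨k, rfl | rfl⟩ := evenIdx_or_oddIdx i
    · rw [partner_evenIdx, interleave_evenIdx, interleave_oddIdx]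
    · simp [oddIdx] at hi
  · obtain ⟨k, rfl | rfl⟩ := evenIdx_or_oddIdx i
    · rw [interleave_evenIdx]; exact h2 k
    · rw [interleave_oddIdx]; exact inv_pos.2 (h2 k)
  · obtain ⟨k, rfl | rfl⟩ := evenIdx_or_oddIdx i
    · simp only [interleave_evenIdx]; exact h3 k v
    · simp only [interleave_oddIdx]
      exact singular_complex hB' hsq hco hco' hsq' hsur hl (h2 k).ne' (h3 k) v
  · obtain ⟨k, rfl | rfl⟩ := evenIdx_or_oddIdx i
    · rw [partner_evenIdx, interleave_evenIdx, interleave_oddIdx]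
      exact mul_inv_cancel₀ (h2 k).ne'
    · rw [partner_oddIdx, interleave_evenIdx, interleave_oddIdx]
      exact inv_mul_cancel₀ (h2 k).ne'

variable {M : Type*} [TopologicalSpace M] [ChartedSpace (EuclideanSpace ℝ (Fin (2 * n))) M]
  [IsManifold (𝓡 (2 * n)) ∞ M]
  {M' : Type*} [TopologicalSpace M'] [ChartedSpace (EuclideanSpace ℝ (Fin (2 * n))) M']
  [IsManifold (𝓡 (2 * n)) ∞ M']
  {g : BilinField (𝓡 (2 * n)) M} {J : EndoField (𝓡 (2 * n)) M}
  {g' : BilinField (𝓡 (2 * n)) M'} {J' : EndoField (𝓡 (2 * n)) M'}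

theorem exists_isAdaptedFrame (hK : IsKahler (𝓡 (2 * n)) g J) (hK' : IsKahler (𝓡 (2 * n)) g' J')
    (hg : IsMetric g) (hg' : IsMetric g') {F : M → M × M'} {x : M}
    (hF : ContMDiff (𝓡 (2 * n)) ((𝓡 (2 * n)).prod (𝓡 (2 * n))) ∞ F)
    (hx : IsGraphAt (n := n) F x)
    (hlag : ∀ u v : Model n, induced (𝓡 (2 * n)) ((𝓡 (2 * n)).prod (𝓡 (2 * n))) (kahlerField
      (prodMetric (𝓡 (2 * n)) (𝓡 (2 * n)) g g') (prodJ (𝓡 (2 * n)) (𝓡 (2 * n)) J J')) F x u v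
        = 0) :
    ∃ a lam, IsAdaptedFrame g J g' (graphDeriv F x) a lam := by
  obtain ⟨a, lam, h1, h2, h3, h4, h5⟩ := exists_adapted (n := n) (J := endoAt J (F x).1)
    (J' := endoAt J' (F x).2) (L := graphMap F x) (isInner_formAt hg (F x).1)
    (isInner_formAt hg' (F x).2) (hK.sq _) (hK.compat _) (hK'.compat _) (hK'.sq _)
    (graphMap_symplectic hF hx hlag) (by simp)
  exact ⟨a, lam, h1, h2, h3, h4, h5⟩

end AdaptedFrame

/-! ### The curvature of the Fubini–Study metric -/

section FubiniStudyCurvature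

open scoped InnerProductSpace

variable {W : Type*} [NormedAddCommGroup W] [InnerProductSpace ℂ W] [FiniteDimensional ℂ W]
  {G : W → W →L[ℝ] W →L[ℝ] ℝ} {U : Set W}

/-- The Fubini–Study metric of holomorphic sectional curvature `1` in affine coordinates. -/
def fubini (w u v : W) : ℝ :=
  4 * ((1 + (‖w‖ : ℂ) ^ 2) * ⟪v, u⟫_ℂ - ⟪v, w⟫_ℂ * ⟪w, u⟫_ℂ).re / (1 + ‖w‖ ^ 2) ^ 2

/-- The Christoffel symbols of `fubini`. -/
def fubiniChr (w u v : W) : W :=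
  (-(1 + ‖w‖ ^ 2)⁻¹ : ℝ) • (⟪w, u⟫_ℂ • v + ⟪w, v⟫_ℂ • u)

theorem fubini_eq (w u v : W) : fubini w u v
    = 4 * ((1 + ‖w‖ ^ 2) * (⟪v, u⟫_ℂ).re - (⟪v, w⟫_ℂ * ⟪w, u⟫_ℂ).re) / (1 + ‖w‖ ^ 2) ^ 2 := by
  rw [fubini, Complex.sub_re]
  congr 3
  norm_cast
  rw [Complex.re_ofReal_mul]

/-- The connection with symbols `fubiniChr` is compatible with the metric `fubini`. -/
theorem hasDerivAt_fubini (w x u v : W) :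
    HasDerivAt (fun t : ℝ => fubini (w + t • x) u v)
      (fubini w (fubiniChr w x u) v + fubini w (fubiniChr w x v) u) 0 := by
  have hα : (1 : ℝ) + ‖w‖ ^ 2 ≠ 0 := by positivity
  have hn : ∀ t : ℝ, ‖w + t • x‖ ^ 2 = ‖w‖ ^ 2 + 2 * (⟪w, x⟫_ℂ).re * t + ‖x‖ ^ 2 * t ^ 2 := by
    intro t
    rw [@norm_add_sq ℂ, inner_smul_right_eq_smul, norm_smul, mul_pow, Real.norm_eq_abs, sq_abs]
    simp
    ring
  have h1 : (fun t : ℝ => fubini (w + t • x) u v) = fun t : ℝ =>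
      4 * ((1 + (‖w‖ ^ 2 + 2 * (⟪w, x⟫_ℂ).re * t + ‖x‖ ^ 2 * t ^ 2)) * (⟪v, u⟫_ℂ).re
        - ((⟪v, w⟫_ℂ * ⟪w, u⟫_ℂ).re + (⟪v, w⟫_ℂ * ⟪x, u⟫_ℂ + ⟪v, x⟫_ℂ * ⟪w, u⟫_ℂ).re * t
          + (⟪v, x⟫_ℂ * ⟪x, u⟫_ℂ).re * t ^ 2))
        / (1 + (‖w‖ ^ 2 + 2 * (⟪w, x⟫_ℂ).re * t + ‖x‖ ^ 2 * t ^ 2)) ^ 2 := by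
    funext t
    rw [fubini_eq, ← hn]
    congr 3
    rw [inner_add_left, inner_add_right, inner_smul_right_eq_smul, inner_smul_left_eq_smul]
    simp only [Complex.mul_re, Complex.add_re, Complex.add_im, Complex.smul_re, Complex.smul_im,
      smul_eq_mul]
    ring
  have hA : HasDerivAt (fun t : ℝ => 1 + (‖w‖ ^ 2 + 2 * (⟪w, x⟫_ℂ).re * t + ‖x‖ ^ 2 * t ^ 2))
      (2 * (⟪w, x⟫_ℂ).re) 0 := by
    have h := ((((hasDerivAt_id (0 : ℝ)).const_mul (2 * (⟪w, x⟫_ℂ).re)).const_add (‖w‖ ^ 2)).add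
      (((hasDerivAt_id (0 : ℝ)).pow 2).const_mul (‖x‖ ^ 2))).const_add 1
    simpa using h
  have hB : HasDerivAt (fun t : ℝ => (⟪v, w⟫_ℂ * ⟪w, u⟫_ℂ).re
      + (⟪v, w⟫_ℂ * ⟪x, u⟫_ℂ + ⟪v, x⟫_ℂ * ⟪w, u⟫_ℂ).re * t + (⟪v, x⟫_ℂ * ⟪x, u⟫_ℂ).re * t ^ 2)
      (⟪v, w⟫_ℂ * ⟪x, u⟫_ℂ + ⟪v, x⟫_ℂ * ⟪w, u⟫_ℂ).re 0 := by
    have h := (((hasDerivAt_id (0 : ℝ)).const_mul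
      ((⟪v, w⟫_ℂ * ⟪x, u⟫_ℂ + ⟪v, x⟫_ℂ * ⟪w, u⟫_ℂ).re)).const_add ((⟪v, w⟫_ℂ * ⟪w, u⟫_ℂ).re)).add
      (((hasDerivAt_id (0 : ℝ)).pow 2).const_mul ((⟪v, x⟫_ℂ * ⟪x, u⟫_ℂ).re))
    exact h.congr_deriv (by simp)
  rw [h1]
  refine (((((hA.mul_const (⟪v, u⟫_ℂ).re).sub hB).const_mul 4).div (hA.pow 2) (by simpa using hα))
    ).congr_deriv ?_
  have e1 : ∀ y z : W, ⟪z, fubiniChr w x y⟫_ℂ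
      = (-(1 + ‖w‖ ^ 2)⁻¹ : ℝ) • (⟪w, x⟫_ℂ * ⟪z, y⟫_ℂ + ⟪w, y⟫_ℂ * ⟪z, x⟫_ℂ) := fun y z => by
    rw [fubiniChr, inner_smul_right_eq_smul, inner_add_right, inner_smul_right, inner_smul_right]
  simp only [fubini_eq, e1]
  rw [← inner_conj_symm v w, ← inner_conj_symm u w, ← inner_conj_symm u v, ← inner_conj_symm x u]
  generalize ⟪w, x⟫_ℂ = a, ⟪w, v⟫_ℂ = c, ⟪w, u⟫_ℂ = b, ⟪v, u⟫_ℂ = d, ⟪u, x⟫_ℂ = p, ⟪v, x⟫_ℂ = q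
  simp only [Complex.mul_re, Complex.mul_im, Complex.add_re, Complex.add_im, Complex.smul_re,
    Complex.smul_im, smul_eq_mul, Complex.conj_re, Complex.conj_im]
  generalize ‖w‖ ^ 2 = r at hα
  field_simp
  simp
  field_simp
  ring

theorem fubiniChr_symm (w u v : W) : fubiniChr w u v = fubiniChr w v u := by
  rw [fubiniChr, fubiniChr, add_comm (⟪w, u⟫_ℂ • v)]

/-- `fubiniChr` is the Levi-Civita connection, being symmetric and compatible with the metric. -/
theorem chr_fubini (hG : MetricOn G U) (h : ∀ w ∈ U, ∀ u v, G w u v = fubini w u v) {w : W}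
    (hw : w ∈ U) (u v : W) : chr G w u v = fubiniChr w u v := by
  refine (hG.inner w hw).ext fun y => ?_
  refine hG.chr_unique hw (C := fun u v y => G w (fubiniChr w u v) y)
    (fun u v y => by rw [fubiniChr_symm]) (fun x u v => ?_) u v y
  rw [h w hw, h w hw, ← fderiv_apply₂ (hG.differentiableAt hw)]
  have h1 : HasFDerivAt (fun z => G z u v) (fderiv ℝ (fun z => G z u v) w) (w + (0 : ℝ) • x) := by
    rw [zero_smul, add_zero]
    exact ((hG.differentiableAt hw).clm_apply (differentiableAt_const u)).clm_apply
      (differentiableAt_const v) |>.hasFDerivAt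
  have h2 : HasDerivAt (fun t : ℝ => w + t • x) x 0 := by
    simpa using ((hasDerivAt_id (0 : ℝ)).smul_const x).const_add w
  refine (h1.comp_hasDerivAt 0 h2).unique ((hasDerivAt_fubini w x u v).congr_of_eventuallyEq ?_)
  have h3 : Tendsto (fun t : ℝ => w + t • x) (𝓝 0) (𝓝 w) := by
    simpa using h2.continuousAt.tendsto
  filter_upwards [h3 (hG.isOpen.mem_nhds hw)] with t ht
  exact h _ ht u v

/-- The curvature at the origin of affine coordinates, where the quadratic terms in the Christoffel
symbols vanish. -/
theorem curv_fubini (hG : MetricOn G U) (h : ∀ w ∈ U, ∀ u v, G w u v = fubini w u v)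
    (h0 : (0 : W) ∈ U) (u v x : W) : curv (chr G) 0 u v x
      = ⟪v, u⟫_ℂ • x + ⟪v, x⟫_ℂ • u - (⟪u, v⟫_ℂ • x + ⟪u, x⟫_ℂ • v) := by
  have h1 : ∀ t a b : W, fderiv ℝ (chr G) 0 t a b = -(⟪t, a⟫_ℂ • b + ⟪t, b⟫_ℂ • a) := by
    intro t a b
    rw [← fderiv_apply₂ (hG.chr_differentiableAt h0)]
    have h1 : HasFDerivAt (fun z => chr G z a b) (fderiv ℝ (fun z => chr G z a b) 0)
        ((0 : ℝ) • t) := by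
      rw [zero_smul]
      exact ((hG.chr_differentiableAt h0).clm_apply (differentiableAt_const a)).clm_apply
        (differentiableAt_const b) |>.hasFDerivAt
    have h2 : HasDerivAt (fun s : ℝ => s • t) t 0 := by
      simpa using (hasDerivAt_id (0 : ℝ)).smul_const t
    have h3 : Tendsto (fun s : ℝ => s • t) (𝓝 0) (𝓝 0) := by
      simpa using h2.continuousAt.tendsto
    have h4 : HasDerivAt
        (fun s : ℝ => (-(1 + s ^ 2 * ‖t‖ ^ 2)⁻¹ * s) • (⟪t, a⟫_ℂ • b + ⟪t, b⟫_ℂ • a))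
        (-(⟪t, a⟫_ℂ • b + ⟪t, b⟫_ℂ • a)) 0 := by
      have h5 : HasDerivAt (fun s : ℝ => -(1 + s ^ 2 * ‖t‖ ^ 2)⁻¹ * s) (-1) 0 := by
        have h6 := (((((hasDerivAt_id (0 : ℝ)).pow 2).mul_const (‖t‖ ^ 2)).const_add 1).inv
          (by simp)).neg.mul (hasDerivAt_id (0 : ℝ))
        exact h6.congr_deriv (by simp)
      exact (h5.smul_const (⟪t, a⟫_ℂ • b + ⟪t, b⟫_ℂ • a)).congr_deriv (neg_one_smul ℝ _)
    refine (h1.comp_hasDerivAt 0 h2).unique (h4.congr_of_eventuallyEq ?_)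
    filter_upwards [h3 (hG.isOpen.mem_nhds h0)] with s hs
    rw [Function.comp_apply, chr_fubini hG h hs, fubiniChr, norm_smul, mul_pow, Real.norm_eq_abs,
      sq_abs, inner_smul_left_eq_smul, inner_smul_left_eq_smul, smul_assoc, smul_assoc, ← smul_add,
      smul_smul]
  have h2 : ∀ a b, chr G 0 a b = 0 := fun a b => by
    rw [chr_fubini hG h h0, fubiniChr]
    simp
  rw [curv, h1, h1, h2, h2]
  abel

/-- The curvature of the Fubini–Study metric at the centre of affine coordinates. -/
theorem sectional_fubini (hG : MetricOn G U) (h : ∀ w ∈ U, ∀ u v, G w u v = fubini w u v)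
    (h0 : (0 : W) ∈ U) (u v : W) : G 0 (curv (chr G) 0 u v v) u
      = (fubini 0 u u * fubini 0 v v - fubini 0 u v ^ 2
        + 3 * fubini 0 (Complex.I • u) v ^ 2) / 4 := by
  rw [h 0 h0, curv_fubini hG h h0]
  simp only [fubini_eq, inner_zero_left, mul_zero, inner_sub_right, inner_add_right,
    inner_smul_right, inner_self_eq_norm_sq_to_K]
  rw [← inner_conj_symm u v]
  generalize ⟪v, u⟫_ℂ = d
  norm_cast
  simp [Complex.mul_re]
  norm_cast
  simp
  ring

end FubiniStudyCurvature

section ModelSpace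

variable {W : Type*} [NormedAddCommGroup W] [NormedSpace ℝ W] [FiniteDimensional ℝ W]

theorem dsymm_model (x y : W) : dsymm 𝓘(ℝ, W) x y = ContinuousLinearMap.id ℝ W := by
  rw [dsymm, extChartAt_model_space_eq_id]
  exact mfderiv_id

theorem chartMetric_model (B : BilinField 𝓘(ℝ, W) W) (x y : W) :
    chartMetric 𝓘(ℝ, W) B x y = formAt B y := by
  ext u v
  rw [chartMetric_apply, dsymm_model]
  rfl

end ModelSpace

section FubiniStudy

variable {n : ℕ}
  {M : Type*} [TopologicalSpace M] [ChartedSpace (EuclideanSpace ℝ (Fin (2 * n))) M]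
  [IsManifold (𝓡 (2 * n)) ∞ M]
  {g : BilinField (𝓡 (2 * n)) M} {J : EndoField (𝓡 (2 * n)) M}
  {W : Type*} [NormedAddCommGroup W] [InnerProductSpace ℂ W] [FiniteDimensional ℂ W]
  {pr : EuclideanSpace ℂ (Fin (n + 1)) → M}
  {z : EuclideanSpace ℂ (Fin (n + 1))} {ι : W →ₗᵢ[ℂ] EuclideanSpace ℂ (Fin (n + 1))}

/-- The affine coordinates of complex projective space around `[z]`: the vector `w` orthogonal to
`z` is sent to `[z + w]`. -/
def affine (pr : EuclideanSpace ℂ (Fin (n + 1)) → M) (z : EuclideanSpace ℂ (Fin (n + 1)))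
    (ι : W →ₗᵢ[ℂ] EuclideanSpace ℂ (Fin (n + 1))) (w : W) : M := pr (z + ι w)

theorem affine_ne_zero (hz : ‖z‖ = 1) (hι : ∀ w, inner ℂ z (ι w) = 0) (w : W) : z + ι w ≠ 0 := by
  intro h
  have h1 : inner ℂ z (z + ι w) = 0 := by rw [h, inner_zero_right]
  rw [inner_add_right, hι, add_zero, inner_self_eq_norm_sq_to_K, hz] at h1
  simp at h1

theorem contDiff_affine : ContDiff ℝ ∞ fun w : W => z + ι w :=
  contDiff_const.add (ι.toContinuousLinearMap.restrictScalars ℝ).contDiff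

theorem contMDiff_affine
    (hpr : ContMDiffOn 𝓘(ℝ, EuclideanSpace ℂ (Fin (n + 1))) (𝓡 (2 * n)) ∞ pr {0}ᶜ)
    (hz : ‖z‖ = 1) (hι : ∀ w, inner ℂ z (ι w) = 0) :
    ContMDiff 𝓘(ℝ, W) (𝓡 (2 * n)) ∞ (affine pr z ι) := by
  intro w
  exact (hpr.contMDiffAt (isOpen_compl_singleton.mem_nhds (affine_ne_zero hz hι w))).comp w
    (contDiff_affine.contMDiff w)

theorem dmap_affine
    (hpr : ContMDiffOn 𝓘(ℝ, EuclideanSpace ℂ (Fin (n + 1))) (𝓡 (2 * n)) ∞ pr {0}ᶜ)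
    (hz : ‖z‖ = 1) (hι : ∀ w, inner ℂ z (ι w) = 0) (w v : W) :
    dmap 𝓘(ℝ, W) (𝓡 (2 * n)) (affine pr z ι) w v
      = dmap 𝓘(ℝ, EuclideanSpace ℂ (Fin (n + 1))) (𝓡 (2 * n)) pr (z + ι w) (ι v) := by
  have h1 := (hpr.contMDiffAt (isOpen_compl_singleton.mem_nhds
    (affine_ne_zero hz hι w))).mdifferentiableAt (by simp)
  have h2 : HasFDerivAt (fun w : W => z + ι w) (ι.toContinuousLinearMap.restrictScalars ℝ) w :=
    (ι.toContinuousLinearMap.restrictScalars ℝ).hasFDerivAt.const_add z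
  have h3 := h1.hasMFDerivAt.comp w h2.hasMFDerivAt
  exact congrArg (fun L : W →L[ℝ] Model n => L v) h3.mfderiv

/-- In affine coordinates the metric is given by `fubini`. -/
theorem pull_affine
    (hpr : ContMDiffOn 𝓘(ℝ, EuclideanSpace ℂ (Fin (n + 1))) (𝓡 (2 * n)) ∞ pr {0}ᶜ)
    (hg : ∀ y : EuclideanSpace ℂ (Fin (n + 1)), y ≠ 0 → ∀ u v,
      formAt g (pr y) (dmap 𝓘(ℝ, EuclideanSpace ℂ (Fin (n + 1))) (𝓡 (2 * n)) pr y u)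
          (dmap 𝓘(ℝ, EuclideanSpace ℂ (Fin (n + 1))) (𝓡 (2 * n)) pr y v)
        = 4 * ((‖y‖ : ℂ) ^ 2 * inner ℂ v u - inner ℂ v y * inner ℂ y u).re / ‖y‖ ^ 4)
    (hz : ‖z‖ = 1) (hι : ∀ w, inner ℂ z (ι w) = 0) (w u v : W) :
    formAt g (affine pr z ι w) (dmap 𝓘(ℝ, W) (𝓡 (2 * n)) (affine pr z ι) w u)
      (dmap 𝓘(ℝ, W) (𝓡 (2 * n)) (affine pr z ι) w v) = fubini w u v := by
  rw [dmap_affine hpr hz hι, dmap_affine hpr hz hι]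
  refine (hg _ (affine_ne_zero hz hι w) _ _).trans ?_
  have h1 : ∀ u, inner ℂ (ι u) z = 0 := fun u => by rw [← inner_conj_symm, hι, map_zero]
  have h2 : ‖z + ι w‖ ^ 2 = 1 + ‖w‖ ^ 2 := by
    rw [@norm_add_sq ℂ, hι, hz, ι.norm_map]
    simp
  have h3 : (‖z + ι w‖ : ℂ) ^ 2 = 1 + (‖w‖ : ℂ) ^ 2 := by exact_mod_cast h2
  have h4 : ‖z + ι w‖ ^ 4 = (1 + ‖w‖ ^ 2) ^ 2 := by rw [← h2]; ring
  rw [fubini, h3, h4, inner_add_left, inner_add_right, hι, h1, zero_add, zero_add,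
    ι.inner_map_map, ι.inner_map_map, ι.inner_map_map]

/-- The sectional curvatures of a Fubini–Study metric, from affine coordinates. -/
theorem curvTensor_affine (hm : IsMetric g)
    (hpr : ContMDiffOn 𝓘(ℝ, EuclideanSpace ℂ (Fin (n + 1))) (𝓡 (2 * n)) ∞ pr {0}ᶜ)
    (hg : ∀ y : EuclideanSpace ℂ (Fin (n + 1)), y ≠ 0 → ∀ u v,
      formAt g (pr y) (dmap 𝓘(ℝ, EuclideanSpace ℂ (Fin (n + 1))) (𝓡 (2 * n)) pr y u)
          (dmap 𝓘(ℝ, EuclideanSpace ℂ (Fin (n + 1))) (𝓡 (2 * n)) pr y v)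
        = 4 * ((‖y‖ : ℂ) ^ 2 * inner ℂ v u - inner ℂ v y * inner ℂ y u).re / ‖y‖ ^ 4)
    (hJ : ∀ y : EuclideanSpace ℂ (Fin (n + 1)), y ≠ 0 → ∀ u,
      dmap 𝓘(ℝ, EuclideanSpace ℂ (Fin (n + 1))) (𝓡 (2 * n)) pr y (Complex.I • u)
        = endoAt J (pr y) (dmap 𝓘(ℝ, EuclideanSpace ℂ (Fin (n + 1))) (𝓡 (2 * n)) pr y u))
    (hz : ‖z‖ = 1) (hι : ∀ w, inner ℂ z (ι w) = 0) (hcard : Module.finrank ℝ W = 2 * n)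
    (a b : Model n) :
    curvTensor (𝓡 (2 * n)) g (affine pr z ι 0) a b a b
      = (formAt g (affine pr z ι 0) a a * formAt g (affine pr z ι 0) b b
          - formAt g (affine pr z ι 0) a b ^ 2
          + 3 * formAt g (affine pr z ι 0) (endoAt J (affine pr z ι 0) a) b ^ 2) / 4 := by
  have hF := contMDiff_affine hpr hz hι
  have hp := pull_affine hpr hg hz hι
  have hinj : ∀ w, Function.Injective (dmap 𝓘(ℝ, W) (𝓡 (2 * n)) (affine pr z ι) w) := fun w => by
    refine (injective_iff_map_eq_zero _).2 fun u hu => ?_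
    by_contra h0
    have h1 := hp w u u
    rw [hu, map_zero, fubini_eq] at h1
    have h2 : (inner ℂ u w * inner ℂ w u : ℂ).re ≤ ‖w‖ ^ 2 * ‖u‖ ^ 2 := by
      refine (Complex.re_le_norm _).trans ?_
      rw [norm_mul]
      have h3 := norm_inner_le_norm (𝕜 := ℂ) u w
      have h4 := norm_inner_le_norm (𝕜 := ℂ) w u
      calc _ ≤ (‖u‖ * ‖w‖) * (‖w‖ * ‖u‖) := by gcongr
        _ = _ := by ring
    have h3 : (inner ℂ u u : ℂ).re = ‖u‖ ^ 2 := by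
      rw [inner_self_eq_norm_sq_to_K]; norm_cast
    have h4 : 0 < ‖u‖ ^ 2 := by positivity
    rw [h3] at h1
    have h5 : 0 < 4 * ((1 + ‖w‖ ^ 2) * ‖u‖ ^ 2 - (inner ℂ u w * inner ℂ w u : ℂ).re)
        / (1 + ‖w‖ ^ 2) ^ 2 := div_pos (by nlinarith) (by positivity)
    exact h5.ne h1
  have hcard' : Module.finrank ℝ W = Module.finrank ℝ (Model n) := by rw [hcard]; simp
  have hsur : ∀ w, Function.Surjective (dmap 𝓘(ℝ, W) (𝓡 (2 * n)) (affine pr z ι) w) := fun w =>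
    (LinearMap.injective_iff_surjective_of_finrank_eq_finrank (f := (dmap 𝓘(ℝ, W) (𝓡 (2 * n))
      (affine pr z ι) w).toLinearMap) hcard').1 (hinj w)
  have him := immInto_written hm.metricField hF hinj 0 (affine pr z ι 0)
  have h0 := mem_writtenDom_self (I := 𝓘(ℝ, W)) (I' := 𝓡 (2 * n)) (F := affine pr z ι) 0
  obtain ⟨θ, hθ⟩ : ∃ θ, θ = written 𝓘(ℝ, W) (𝓡 (2 * n)) 0 (affine pr z ι 0) (affine pr z ι) :=
    ⟨_, rfl⟩
  obtain ⟨G, hG⟩ : ∃ G, G = chartMetric (𝓡 (2 * n)) g (affine pr z ι 0) := ⟨_, rfl⟩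
  obtain ⟨U, hU⟩ : ∃ U, U = writtenDom 𝓘(ℝ, W) (𝓡 (2 * n)) 0 (affine pr z ι 0) (affine pr z ι) :=
    ⟨_, rfl⟩
  have hpull : ∀ w ∈ U, ∀ u v, pull G θ w u v = fubini w u v := fun w hw u v => by
    rw [hU] at hw
    rw [hG, hθ, pull_written hF hw, chartMetric_model]
    exact hp w u v
  have h0' : (0 : W) ∈ U := by rw [hU]; exact h0
  have hd : fderiv ℝ θ 0 = dmap 𝓘(ℝ, W) (𝓡 (2 * n)) (affine pr z ι) 0 := by
    rw [hθ]; exact fderiv_written_self hF 0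
  have hc : θ 0 = extChartAt (𝓡 (2 * n)) (affine pr z ι 0) (affine pr z ι 0) := by
    rw [hθ]; exact written_self 0
  rw [← hG, ← hθ, ← hU] at him
  have hGp : formAt g (affine pr z ι 0) = G (θ 0) := by
    rw [hG, hc, chartMetric_self]; rfl
  have hs : ∀ q ∈ U, Function.Surjective (fderiv ℝ θ q) := fun q hq =>
    (LinearMap.injective_iff_surjective_of_finrank_eq_finrank (f := (fderiv ℝ θ q).toLinearMap)
      hcard').1 (him.injective q hq)
  obtain ⟨u, rfl⟩ := hs 0 h0' a
  obtain ⟨v, rfl⟩ := hs 0 h0' b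
  have hJu : endoAt J (affine pr z ι 0) (fderiv ℝ θ 0 u) = fderiv ℝ θ 0 (Complex.I • u) := by
    rw [hd, dmap_affine hpr hz hι, dmap_affine hpr hz hι, ι.map_smul]
    exact (hJ _ (affine_ne_zero hz hι 0) _).symm
  rw [hJu, curvTensor_eq_formAt hm, ← hG, ← hc, curv_isometry him.metricOn_pull him
    (fun _ _ => rfl) hs h0', hGp]
  simp only [← pull_apply]
  rw [sectional_fubini him.metricOn_pull hpull h0']
  simp only [hpull 0 h0']

/-- The curvature of `ℂℙⁿ` with the Fubini–Study metric of holomorphic sectional curvature `1`. -/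
theorem IsFubiniStudy.curvTensor_eq (hm : IsMetric g) (h : IsFubiniStudy g J) (p : M)
    (a b : Model n) : curvTensor (𝓡 (2 * n)) g p a b a b
      = (formAt g p a a * formAt g p b b - formAt g p a b ^ 2
          + 3 * formAt g p (endoAt J p a) b ^ 2) / 4 := by
  obtain ⟨φ, pr, h1, h2, h3⟩ := h
  obtain ⟨ℓ, rfl⟩ := φ.surjective p
  obtain ⟨y, hy, rfl⟩ : ∃ (y : EuclideanSpace ℂ (Fin (n + 1))) (hy : y ≠ 0),
      Projectivization.mk ℂ y hy = ℓ := ⟨ℓ.rep, ℓ.rep_nonzero, ℓ.mk_rep⟩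
  have hy' : (‖y‖ : ℂ) ≠ 0 := by simpa using hy
  set z : EuclideanSpace ℂ (Fin (n + 1)) := (‖y‖ : ℂ)⁻¹ • y with hzd
  have hz : ‖z‖ = 1 := by
    rw [hzd, norm_smul, norm_inv, Complex.norm_real, norm_norm,
      inv_mul_cancel₀ (by simpa using hy)]
  have hz0 : z ≠ 0 := by
    intro h0; rw [h0, norm_zero] at hz; exact zero_ne_one hz
  let ι : ((ℂ ∙ z)ᗮ : Submodule ℂ (EuclideanSpace ℂ (Fin (n + 1)))) →ₗᵢ[ℂ]
    EuclideanSpace ℂ (Fin (n + 1)) := (ℂ ∙ z)ᗮ.subtypeₗᵢ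
  have hι : ∀ w, inner ℂ z (ι w) = 0 := fun w =>
    Submodule.mem_orthogonal_singleton_iff_inner_right.1 w.2
  have hcard : Module.finrank ℝ ((ℂ ∙ z)ᗮ : Submodule ℂ (EuclideanSpace ℂ (Fin (n + 1))))
      = 2 * n := by
    have : Fact (Module.finrank ℂ (EuclideanSpace ℂ (Fin (n + 1))) = n + 1) := ⟨by simp⟩
    rw [finrank_real_of_complex, Submodule.finrank_orthogonal_span_singleton (n := n) hz0]
  have hp : φ (Projectivization.mk ℂ y hy) = affine pr z ι 0 := by
    rw [affine, map_zero, add_zero, h1 z hz0]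
    congr 1
    rw [Projectivization.mk_eq_mk_iff']
    exact ⟨(‖y‖ : ℂ), by rw [hzd, smul_smul, mul_inv_cancel₀ hy', one_smul]⟩
  rw [hp]
  exact curvTensor_affine hm h2 (fun y hy u v => (h3 y hy u v).2) (fun y hy u => (h3 y hy u u).1)
    hz hι hcard a b

end FubiniStudy

/-! ### The curvature term for Fubini–Study metrics -/

section FubiniStudyTerm

variable {n : ℕ}

theorem even_evenIdx (k : Fin n) : Even (evenIdx k : ℕ) := by simp [evenIdx]

theorem not_even_oddIdx (k : Fin n) : ¬ Even (oddIdx k : ℕ) := by simp [oddIdx]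

/-- The curvature term for constant holomorphic sectional curvature `1`, where the sectional
curvature of the plane spanned by `a_i` and `a_k` is `1` for `k = i'` and `1 / 4` otherwise. -/
theorem sum_fubiniStudy {lam : Fin (2 * n) → ℝ} (hpos : ∀ i, 0 < lam i)
    (hp : ∀ i, lam i * lam (partner i) = 1) :
    ∑ k, ∑ i : Fin (2 * n) with i ≠ k, lam i / ((1 + lam k ^ 2) * (lam i + lam (partner i))) *
        ((1 + 3 * if partner i = k then (1 : ℝ) else 0) / 4
          - lam k ^ 2 * ((1 + 3 * if partner i = k then (1 : ℝ) else 0) / 4))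
      = ∑ k : Fin (2 * n) with Even k.val, (1 - lam k ^ 2) ^ 2 / (1 + lam k ^ 2) ^ 2 := by
  -- `m` changes sign under the involution of the indices and `w k + w k' = 1`, so that the constant
  -- multiples of `m k` drop out of the sum
  let m : Fin (2 * n) → ℝ := fun k => (1 - lam k ^ 2) / (1 + lam k ^ 2)
  let w : Fin (2 * n) → ℝ := fun i => lam i / (lam i + lam (partner i))
  have hpi : ∀ i, lam (partner i) = (lam i)⁻¹ := fun i => eq_inv_of_mul_eq_one_right (hp i)
  have hm : ∀ k, m (partner k) = -m k := fun k => by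
    have := hpos k
    simp only [m, hpi]
    field_simp
    ring
  have hw : ∀ k, w (partner k) = 1 - w k := fun k => by
    have := hpos k
    simp only [w, hpi]
    field_simp
    ring
  have hmw : ∀ k, m k = 1 - 2 * w k := fun k => by
    have := hpos k
    simp only [m, w, hpi]
    field_simp
    ring
  have h1 : ∀ k, ∑ i : Fin (2 * n) with i ≠ k,
      lam i / ((1 + lam k ^ 2) * (lam i + lam (partner i))) *
        ((1 + 3 * if partner i = k then (1 : ℝ) else 0) / 4
          - lam k ^ 2 * ((1 + 3 * if partner i = k then (1 : ℝ) else 0) / 4))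
      = m k * (∑ i, w i + 3) / 4 - m k * w k := fun k => by
    have h2 : ∀ i, (if i ≠ k then lam i / ((1 + lam k ^ 2) * (lam i + lam (partner i))) *
        ((1 + 3 * if partner i = k then (1 : ℝ) else 0) / 4
          - lam k ^ 2 * ((1 + 3 * if partner i = k then (1 : ℝ) else 0) / 4)) else 0)
        = m k / 4 * w i - (if i = k then m k / 4 * w k else 0)
          + (if i = partner k then 3 * m k / 4 * w (partner k) else 0) := by
      intro i
      have e1 : lam i / ((1 + lam k ^ 2) * (lam i + lam (partner i)))
          = w i * (1 + lam k ^ 2)⁻¹ := by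
        simp only [w]
        rw [mul_comm, ← div_div, div_eq_mul_inv (lam i / _)]
      have e2 : (partner i = k) = (i = partner k) := by
        rw [eq_iff_iff]
        exact ⟨fun h => by rw [← h, partner_partner], fun h => by rw [h, partner_partner]⟩
      rw [e1]
      simp only [e2, m]
      by_cases hik : i = k
      · subst hik
        simp [(partner_ne i).symm]
      · by_cases hik' : i = partner k
        · subst hik'
          simp only [partner_ne, ne_eq, not_false_eq_true, if_true, if_false]
          ring
        · simp only [hik, hik', ne_eq, not_false_eq_true, if_true, if_false]
          ring
    rw [Finset.sum_filter, Finset.sum_congr rfl fun i _ => h2 i, Finset.sum_add_distrib,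
      Finset.sum_sub_distrib, ← Finset.mul_sum, Finset.sum_ite_eq' Finset.univ k,
      Finset.sum_ite_eq' Finset.univ (partner k), hw]
    simp only [Finset.mem_univ, if_true]
    ring
  simp only [h1]
  generalize ∑ i, w i = S
  rw [Finset.sum_filter, sum_evenIdx_oddIdx,
    sum_evenIdx_oddIdx]
  refine Finset.sum_congr rfl fun k _ => ?_
  rw [if_pos (even_evenIdx k), if_neg (not_even_oddIdx k), ← partner_evenIdx, hm, hw,
    ← div_pow]
  change _ = m (evenIdx k) ^ 2 + 0
  rw [hmw]
  ring

variable {M : Type*} [TopologicalSpace M] [ChartedSpace (EuclideanSpace ℝ (Fin (2 * n))) M]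
  [IsManifold (𝓡 (2 * n)) ∞ M]
  {M' : Type*} [TopologicalSpace M'] [ChartedSpace (EuclideanSpace ℝ (Fin (2 * n))) M']
  [IsManifold (𝓡 (2 * n)) ∞ M']
  {g : BilinField (𝓡 (2 * n)) M} {J : EndoField (𝓡 (2 * n)) M}
  {g' : BilinField (𝓡 (2 * n)) M'} {J' : EndoField (𝓡 (2 * n)) M'}

/-- The sectional curvatures of a Fubini–Study metric in a unitary basis. -/
theorem IsFubiniStudy.curvTensor_frame (hm : IsMetric g) (h : IsFubiniStudy g J) {p : M}
    {a : Fin (2 * n) → Model n} (ho : Ortho (formAt g p) a)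
    (hJ : ∀ i : Fin (2 * n), endoAt J p (a i) = (-1 : ℝ) ^ (i : ℕ) • a (partner i))
    {i k : Fin (2 * n)} (hik : i ≠ k) :
    curvTensor (𝓡 (2 * n)) g p (a i) (a k) (a i) (a k)
      = (1 + 3 * if partner i = k then (1 : ℝ) else 0) / 4 := by
  rw [h.curvTensor_eq hm, hJ, map_smul, smul_apply, ho, ho, ho, ho, if_pos rfl, if_pos rfl,
    if_neg hik, smul_eq_mul, mul_pow, ← pow_mul, mul_comm (i : ℕ), pow_mul]
  split_ifs <;> norm_num

theorem curvTerm_fubiniStudy (hg : IsMetric g) (hg' : IsMetric g') (hK : IsKahler (𝓡 (2 * n)) g J)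
    (h : IsFubiniStudy g J) (h' : IsFubiniStudy g' J') {p : M} {q : M'}
    {L : Model n →L[ℝ] Model n} {a : Fin (2 * n) → Model n} {lam : Fin (2 * n) → ℝ}
    (hl : ∀ u v, formAt g' q (endoAt J' q (L u)) (L v) = formAt g p (endoAt J p u) v)
    (ha : IsAdaptedFrame g J g' (p := p) (q := q) L a lam) :
    curvTerm g g' (p := p) (q := q) L a lam
      = ∑ k : Fin (2 * n) with Even k.val, (1 - lam k ^ 2) ^ 2 / (1 + lam k ^ 2) ^ 2 := by
  have ho : Ortho (formAt g p) a := ha.orthonormal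
  have hJ := apply_complex_frame (J := endoAt J p) (a := a) (hK.sq p) ha.complex
  have ho' : Ortho (formAt g' q) fun i => (lam i)⁻¹ • L (a i) := ortho_image ho ha.pos ha.singular
  have hJ' : ∀ i : Fin (2 * n), endoAt J' q ((lam i)⁻¹ • L (a i))
      = (-1 : ℝ) ^ (i : ℕ) • ((lam (partner i))⁻¹ • L (a (partner i))) := fun i => by
    rw [map_smul, apply_complex_image (isInner_formAt hg' q) (by simp) ho (hK.sq p) ha.complex
      ha.pos ha.singular ha.paired hl, smul_smul, smul_smul,
      inv_eq_of_mul_eq_one_left (ha.paired i)]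
    have := (ha.pos i).ne'
    congr 1
    field_simp
  rw [← sum_fubiniStudy ha.pos ha.paired]
  refine Finset.sum_congr rfl fun k _ => Finset.sum_congr rfl fun i hi => ?_
  have hik := (Finset.mem_filter.1 hi).2
  rw [h.curvTensor_frame hg ho hJ hik]
  congr 3
  exact h'.curvTensor_frame hg' ho' hJ' hik

end FubiniStudyTerm

/-! ### The hypotheses of the theorem -/

section Hypotheses

variable {n : ℕ}
  {M : Type*} [TopologicalSpace M] [ChartedSpace (EuclideanSpace ℝ (Fin (2 * n))) M]
  [IsManifold (𝓡 (2 * n)) ∞ M]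
  {M' : Type*} [TopologicalSpace M'] [ChartedSpace (EuclideanSpace ℝ (Fin (2 * n))) M']
  [IsManifold (𝓡 (2 * n)) ∞ M']
  {g : BilinField (𝓡 (2 * n)) M} {J : EndoField (𝓡 (2 * n)) M}
  {g' : BilinField (𝓡 (2 * n)) M'} {J' : EndoField (𝓡 (2 * n)) M'}

theorem isMetric_inner (g : Metric n M) : IsMetric g.inner :=
  ⟨g.contMDiff, g.symm, g.pos⟩

theorem scal_einstein (hg : IsMetric g) {c : ℝ} {x : M}
    (hc : ∀ u v : TangentSpace (𝓡 (2 * n)) x, ricci (𝓡 (2 * n)) g x u v = c * g x u v) :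
    scal (𝓡 (2 * n)) g x = 2 * n * c := by
  obtain ⟨e, he⟩ := exists_ortho (k := 2 * n) (isInner_formAt hg x) (by simp)
  have h1 : scal (𝓡 (2 * n)) g x
      = metricTrace (formAt g x) (fun u v : Model n => c * formAt g x u v) :=
    congrArg (metricTrace (formAt g x)) (funext fun u => funext fun v => hc u v)
  rw [h1, metricTrace_eq_sum (isInner_formAt hg x)
    (fun v => ⟨fun a b => by simp [mul_add], fun a b => by simp; ring⟩)
    (fun u => ⟨fun a b => by simp [mul_add], fun a b => by simp; ring⟩) he (by simp)]
  simp [he _ _]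

/-- Two Einstein metrics with the same scalar curvature have the same Einstein constant. In
dimension `0` every constant is an Einstein constant. -/
theorem exists_common_einstein_constant (hg : IsMetric g) (hg' : IsMetric g')
    (hE : IsEinstein (𝓡 (2 * n)) g) (hE' : IsEinstein (𝓡 (2 * n)) g') {p : M} {q : M'}
    (hs : scal (𝓡 (2 * n)) g p = scal (𝓡 (2 * n)) g' q) :
    ∃ c : ℝ, (∀ (x : M) (u v : TangentSpace (𝓡 (2 * n)) x),
        ricci (𝓡 (2 * n)) g x u v = c * g x u v) ∧
      ∀ (x : M') (u v : TangentSpace (𝓡 (2 * n)) x),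
        ricci (𝓡 (2 * n)) g' x u v = c * g' x u v := by
  obtain ⟨c, hc⟩ := hE
  obtain ⟨c', hc'⟩ := hE'
  refine ⟨c, hc, fun x u v => ?_⟩
  rw [scal_einstein hg (hc p), scal_einstein hg' (hc' q)] at hs
  rw [hc']
  -- in dimension `0` the scalar curvature does not determine the constant
  rcases Nat.eq_zero_or_pos n with rfl | hn
  · have h0 : formAt g' x u v = 0 := by
      have h1 : ∀ w w' : Model 0, formAt g' x w w' = 0 := fun w w' => by
        rw [Subsingleton.elim (α := EuclideanSpace ℝ (Fin 0)) w 0, map_zero, zero_apply]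
      exact h1 u v
    change c' * formAt g' x u v = c * formAt g' x u v
    rw [h0, mul_zero, mul_zero]
  · have hn' : (2 * n : ℝ) ≠ 0 := by positivity
    rw [mul_left_cancel₀ hn' hs]

/-- The graph of a symplectomorphism is Lagrangian. -/
theorem induced_graph_eq_zero {f : M → M'} (hfs : ContMDiff (𝓡 (2 * n)) (𝓡 (2 * n)) ∞ f)
    (hf : ∀ (p : M) (u v : Model n), formAt g' (f p) (endoAt J' (f p)
      (dmap (𝓡 (2 * n)) (𝓡 (2 * n)) f p u)) (dmap (𝓡 (2 * n)) (𝓡 (2 * n)) f p v)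
        = formAt g p (endoAt J p u) v) (x : M) (u v : Model n) :
    induced (𝓡 (2 * n)) ((𝓡 (2 * n)).prod (𝓡 (2 * n))) (kahlerField
      (prodMetric (𝓡 (2 * n)) (𝓡 (2 * n)) g g') (prodJ (𝓡 (2 * n)) (𝓡 (2 * n)) J J'))
      (fun y => (y, f y)) x u v = 0 := by
  have hF : ContMDiff (𝓡 (2 * n)) ((𝓡 (2 * n)).prod (𝓡 (2 * n))) ∞ fun y => (y, f y) :=
    contMDiff_id.prodMk hfs
  have h1 : ∀ w : Model n,
      (dmap (𝓡 (2 * n)) ((𝓡 (2 * n)).prod (𝓡 (2 * n))) (fun y => (y, f y)) x w).1 = w := fun w => by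
    rw [← dmap_fst hF]
    exact congrArg (fun L : Model n →L[ℝ] Model n => L w) mfderiv_id
  have h2 : ∀ w : Model n,
      (dmap (𝓡 (2 * n)) ((𝓡 (2 * n)).prod (𝓡 (2 * n))) (fun y => (y, f y)) x w).2
        = dmap (𝓡 (2 * n)) (𝓡 (2 * n)) f x w := fun w => (dmap_snd hF x w).symm
  change formAt g x (endoAt J x
        (dmap (𝓡 (2 * n)) ((𝓡 (2 * n)).prod (𝓡 (2 * n))) (fun y => (y, f y)) x u).1)
        (dmap (𝓡 (2 * n)) ((𝓡 (2 * n)).prod (𝓡 (2 * n))) (fun y => (y, f y)) x v).1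
      + formAt g' (f x) (-endoAt J' (f x)
        (dmap (𝓡 (2 * n)) ((𝓡 (2 * n)).prod (𝓡 (2 * n))) (fun y => (y, f y)) x u).2)
        (dmap (𝓡 (2 * n)) ((𝓡 (2 * n)).prod (𝓡 (2 * n))) (fun y => (y, f y)) x v).2 = 0
  rw [h1, h1, h2, h2, map_neg, neg_apply, hf, add_neg_cancel]

end Hypotheses

end GraphFlow

end

theorem proposition3p1 (n : ℕ)
    {M : Type*} [TopologicalSpace M] [T2Space M] [CompactSpace M]
    [ChartedSpace (EuclideanSpace ℝ (Fin (2 * n))) M] [IsManifold (𝓡 (2 * n)) ∞ M]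
    {M' : Type*} [TopologicalSpace M'] [T2Space M']
    [ChartedSpace (EuclideanSpace ℝ (Fin (2 * n))) M'] [IsManifold (𝓡 (2 * n)) ∞ M']
    -- the two Kähler–Einstein manifolds
    (g : Metric n M) (J : EndoField (𝓡 (2 * n)) M)
    (g' : Metric n M') (J' : EndoField (𝓡 (2 * n)) M')
    (hK : IsKahler (𝓡 (2 * n)) g.inner J) (hK' : IsKahler (𝓡 (2 * n)) g'.inner J')
    (hE : IsEinstein (𝓡 (2 * n)) g.inner) (hE' : IsEinstein (𝓡 (2 * n)) g'.inner)
    (hscal : ∀ (p : M) (q : M'), scal (𝓡 (2 * n)) g.inner p = scal (𝓡 (2 * n)) g'.inner q)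
    -- the symplectomorphism
    (f : M ≃ₘ^∞⟮𝓡 (2 * n), 𝓡 (2 * n)⟯ M')
    (hf : ∀ (p : M) (u v : TangentSpace (𝓡 (2 * n)) p),
      g'.inner (f p) (J' (f p) (mfderiv (𝓡 (2 * n)) (𝓡 (2 * n)) f p u))
          (mfderiv (𝓡 (2 * n)) (𝓡 (2 * n)) f p v)
        = g.inner p (J p u) v)
    -- the mean curvature flow of its graph
    (T : ℝ) (F : ℝ → M → M × M')
    (hF : IsMeanCurvatureFlow (𝓡 (2 * n)) ((𝓡 (2 * n)).prod (𝓡 (2 * n)))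
      (prodMetric (𝓡 (2 * n)) (𝓡 (2 * n)) g.inner g'.inner) T F)
    (hF0 : ∀ x, F 0 x = (x, f x)) :
    ∀ t ∈ Ico 0 T,
      ContMDiff (𝓡 (2 * n)) 𝓘(ℝ, ℝ) ∞ (starOmega g.inner J g'.inner (F t)) ∧
      ∀ x, IsGraphAt (n := n) (F t) x →
        (∃ a lam, IsAdaptedFrame g.inner J g'.inner (graphDeriv (F t) x) a lam) ∧
        ∀ a lam, IsAdaptedFrame g.inner J g'.inner (graphDeriv (F t) x) a lam →
          HasDerivWithinAt (fun s => starOmega g.inner J g'.inner (F s) x)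
            (laplacianStarOmega g.inner J g'.inner (F t) x
              + starOmega g.inner J g'.inner (F t) x *
                (quadForm lam (hCoeff g.inner J g'.inner J' (F t) x a lam)
                  + curvTerm g.inner g'.inner (graphDeriv (F t) x) a lam))
            (Ico 0 T) t ∧
          (IsFubiniStudy g.inner J → IsFubiniStudy g'.inner J' →
            HasDerivWithinAt (fun s => starOmega g.inner J g'.inner (F s) x)
              (laplacianStarOmega g.inner J g'.inner (F t) x
                + starOmega g.inner J g'.inner (F t) x *
                  (quadForm lam (hCoeff g.inner J g'.inner J' (F t) x a lam)
                    + ∑ k : Fin (2 * n) with Even k.val,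
                        (1 - lam k ^ 2) ^ 2 / (1 + lam k ^ 2) ^ 2))
              (Ico 0 T) t) := by
  intro t ht
  have hg := isMetric_inner g
  have hg' := isMetric_inner g'
  have h0 : F 0 = fun x => (x, f x) := funext hF0
  have hlag : ∀ y (u v : Model n), induced (𝓡 (2 * n)) ((𝓡 (2 * n)).prod (𝓡 (2 * n))) (kahlerField
      (prodMetric (𝓡 (2 * n)) (𝓡 (2 * n)) g.inner g'.inner)
      (prodJ (𝓡 (2 * n)) (𝓡 (2 * n)) J J')) (F t) y u v = 0 := by
    intro y u v
    obtain ⟨c, hc, hc'⟩ := exists_common_einstein_constant hg hg' hE hE' (hscal y (f y))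
    refine hF.lagrangian (hg.metricField.prod hg'.metricField) (kahlerOn_prod hg hg' hK hK')
      (by rw [Module.finrank_prod]; ring)
      (fun p q hq => trace_curv_chart_prod hg.metricField hg'.metricField hc hc' p hq) ?_ ht y u v
    rw [h0]
    exact induced_graph_eq_zero f.contMDiff hf
  have hFt := hF.contMDiff ht
  refine ⟨contMDiff_starOmega hK hg hg' hFt (hF.immersion t ht), fun x hx =>
    ⟨exists_isAdaptedFrame hK hK' hg hg' hFt hx (hlag x), fun a lam ha => ?_⟩⟩
  have h1 := evolution_adapted hK hK' hg hg' hF ht hlag hx ha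
  refine ⟨h1, fun hS hS' => ?_⟩
  have h2 := curvTerm_fubiniStudy hg hg' hK hS hS' (graphMap_symplectic hFt hx (hlag x)) ha
  exact h2 ▸ h1
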